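/- Let $(M^{2n},\Omega)$ be a connected symplectic manifold without boundary. Write $\operatorname{sgrad}H$ for the vector field with $\Omega(\operatorname{sgrad}H,\cdot)=-dH$. A (smooth) Hamiltonian $F(x,t)=F_t(x)$ on $M\times[0,1]$ is normalized if every $F_t$ has zero mean with respect to $\Omega^n/n!$ (when $M$ is closed), or if all $F_t$ are supported in a common compact set (when $M$ is not compact). Let $\mathrm{Ham}(M,\Omega)$ be the group of diffeomorphisms that belong to flows of normalized Hamiltonians. Let $\{f_t\}_{t\in[0,1]}$, $f_0=\mathrm{id}$, be the flow of a normalized Hamiltonian $F$: $\frac{d}{dt}f_t x=\operatorname{sgrad}F_t(f_tx)$. A variation of $\{f_t\}$ is a smooth family of paths $\{f_{t,\epsilon}\}$ in $\mathrm{Ham}(M,\Omega)$, $t\in[0,1]$, $|\epsilon|<\epsilon_0$, with supports in a common compact set and with $f_{0,\epsilon}=f_0$, $f_{1,\epsilon}=f_1$, $f_{t,0}=f_t$. If $F(x,t,\epsilon)$ is the normalized Hamiltonian generating $\{f_{t,\epsilon}\}_t$, put $$\ell_+(\epsilon)=\int_0^1\max_xF(x,t,\epsilon)\,dt,\qquad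 \ell_-(\epsilon)=\int_0^1\min_xF(x,t,\epsilon)\,dt,\qquad \ell=\ell_+-\ell_-.$$ The path $\{f_t\}$ is a geodesic of the Hofer metric if $\max F_t-\min F_t$ does not depend on $t$ and, for every variation, $\epsilon=0$ is a critical point of $\ell$ in the following sense: there are $\delta,C>0$ and a convex function $u$ on $(-\delta,\delta)$ with minimum at $0$ such that $|\ell(\epsilon)-u(\epsilon)|\le C\epsilon^2$ for $|\epsilon|<\delta$. It is stable if, for every variation, $\ell$ has a local minimum at $\epsilon=0$. The geodesic is nondegenerate if for each $t$ the function $F_t$ has a unique maximum point and a unique minimum point, and both are nondegenerate in the sense of Morse. **Theorem.** Let $\{f_t\}_{t\in[0,1]}$, $f_0=\mathrm{id}$, be a nondegenerate geodesic with normalized Hamiltonian $F$. Then the maximum point $x_+$ and the minimum point $x_-$ of $F_t$ do not depend on $t$ and are fixed by all $f_t$. Consider the linearized flows $f_{t*}$ on $T_{x_+}M$ and $T_{x_-}M$; such a flow has a nontrivial $T$-periodic orbit if $f_{T*}\xi=\xi$ for some tangent vector $\xi\neq0$. 1. If neither linearized flow has a nontrivial $T$-periodic orbit with $T\in(0,1]$,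 then $\{f_t\}$ is stable. 2. If $\{f_t\}$ is stable, then neither linearized flow has a nontrivial $T$-periodic orbit with $T\in(0,1)$. 3. Let $C_\pm(t)$ be the operator on $T_{x_\pm}M$ with $\frac{d}{dt}f_{t*}=C_\pm(t)f_{t*}$; it is well defined and invertible for $t\in[0,1]$. For every variation $\{f_{t,\epsilon}\}$ of $\{f_t\}$, the maps $v_\pm(t)=\frac{d}{d\epsilon}\big|_{\epsilon=0}f_{t,\epsilon}x_\pm$ are smooth maps $[0,1]\to T_{x_\pm}M$ with $v_\pm(0)=v_\pm(1)=0$, the functions $\ell_\pm$ and $\ell$ are twice continuously differentiable near $\epsilon=0$, and $$\frac{d^2\ell_\pm}{d\epsilon^2}(0)=Q_\pm(v_\pm),\qquad \frac{d^2\ell}{d\epsilon^2}(0)=Q_+(v_+)-Q_-(v_-),$$ where $$Q_\pm(v)=-\int_0^1\Big(\Omega\big(C_\pm(t)^{-1}\dot v(t),\dot v(t)\big)+\Omega\big(\dot v(t),v(t)\big)\Big)\,dt .$$ -/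

import Mathlib

open Set MeasureTheory
open scoped Manifold ContDiff

noncomputable section

namespace Hofer

/-- The model space `ℝ²ⁿ`. -/
abbrev E (n : ℕ) : Type := EuclideanSpace ℝ (Fin (2 * n))

section Symplectic

variable {n : ℕ} {M : Type*} [TopologicalSpace M] [ChartedSpace (E n) M]

/-- A 2-form on `M` read in the preferred chart around `x₀`, i.e. pulled back by the inverse
of that chart. It is meaningful on the target of the chart. -/
def chartForm (β : ∀ x : M, TangentSpace (𝓡 (2 * n)) x [⋀^Fin 2]→L[ℝ] ℝ) (x₀ : M) (y : E n) :
    E n [⋀^Fin 2]→L[ℝ] ℝ :=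
  (β ((extChartAt (𝓡 (2 * n)) x₀).symm y)).compContinuousLinearMap
    (mfderiv 𝓘(ℝ, E n) (𝓡 (2 * n)) (extChartAt (𝓡 (2 * n)) x₀).symm y)

end Symplectic

/-- Symplectic forms on `M`: smooth closed nondegenerate 2-forms. -/
structure SymplecticForm (n : ℕ) (M : Type*) [TopologicalSpace M] [ChartedSpace (E n) M] where
  /-- the value of the form at each point -/
  form : ∀ x : M, TangentSpace (𝓡 (2 * n)) x [⋀^Fin 2]→L[ℝ] ℝ
  smooth : ∀ x₀ : M, ContDiffOn ℝ ∞ (chartForm form x₀) (extChartAt (𝓡 (2 * n)) x₀).target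
  closed : ∀ x₀ : M, ∀ y ∈ (extChartAt (𝓡 (2 * n)) x₀).target,
    extDeriv (chartForm form x₀) y = 0
  nondegenerate : ∀ (x : M) (u : TangentSpace (𝓡 (2 * n)) x),
    (∀ v : TangentSpace (𝓡 (2 * n)) x, form x ![u, v] = 0) → u = 0

section Defs

variable {n : ℕ} {M : Type*} [TopologicalSpace M] [ChartedSpace (E n) M]

/-- The density of the canonical volume form `Ωⁿ / n!` with respect to Lebesgue measure in the
preferred chart around `x₀`: the absolute value of the Pfaffian of the matrix `Ω(eᵢ, eⱼ)`,
that is the square root of its determinant. -/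
def liouvilleDensity (Ω : SymplecticForm n M) (x₀ : M) (y : E n) : ℝ :=
  Real.sqrt (Matrix.det (Matrix.of fun i j : Fin (2 * n) =>
    chartForm Ω.form x₀ y ![EuclideanSpace.single i (1 : ℝ), EuclideanSpace.single j (1 : ℝ)]))

/-- The canonical measure restricted to the domain of the preferred chart around `x₀`. -/
def chartLiouville [MeasurableSpace M] (Ω : SymplecticForm n M) (x₀ : M) : Measure M :=
  Measure.map (extChartAt (𝓡 (2 * n)) x₀).symm
    ((volume.restrict (extChartAt (𝓡 (2 * n)) x₀).target).withDensity
      fun y => ENNReal.ofReal (liouvilleDensity Ω x₀ y))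

/-- The measure of the canonical volume form `Ωⁿ / n!`. The measures on the chart domains agree
on overlaps, so their supremum is the measure glued from them. -/
def liouville [MeasurableSpace M] (Ω : SymplecticForm n M) : Measure M :=
  ⨆ x₀ : M, chartLiouville Ω x₀

/-- Diffeomorphisms of `M` of class `C^∞`. -/
abbrev Diffeo (n : ℕ) (M : Type*) [TopologicalSpace M] [ChartedSpace (E n) M] : Type _ :=
  Diffeomorph (𝓡 (2 * n)) (𝓡 (2 * n)) M M ∞

/-- `ξ = sgrad H` at the point `x`: `Ω(ξ, ·) = -dH`. -/
def IsSgradAt (Ω : SymplecticForm n M) (H : M → ℝ) (x : M)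
    (ξ : TangentSpace (𝓡 (2 * n)) x) : Prop :=
  ∀ η : TangentSpace (𝓡 (2 * n)) x,
    Ω.form x ![ξ, η] = -(mfderiv (𝓡 (2 * n)) 𝓘(ℝ, ℝ) H x η : ℝ)

/-- Normalized time-dependent Hamiltonians `F t x` on `M × [0, 1]`: smooth; of zero mean at each
time if `M` is compact, with a common compact support if `M` is not compact. -/
structure IsNormalized [MeasurableSpace M] (Ω : SymplecticForm n M) (F : ℝ → M → ℝ) : Prop where
  smooth : ContMDiffOn (𝓘(ℝ, ℝ).prod (𝓡 (2 * n))) 𝓘(ℝ, ℝ) ∞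
    (fun p : ℝ × M => F p.1 p.2) (Icc (0 : ℝ) 1 ×ˢ univ)
  mean_zero : CompactSpace M → ∀ t ∈ Icc (0 : ℝ) 1, ∫ x, F t x ∂(liouville Ω) = 0
  compact_support : ¬ CompactSpace M →
    ∃ K : Set M, IsCompact K ∧ ∀ t ∈ Icc (0 : ℝ) 1, ∀ x ∉ K, F t x = 0

/-- Paths `f_t`, `t ∈ [0, 1]`, of compactly supported diffeomorphisms (values of `f` at other
times play no role). -/
structure IsPath (f : ℝ → Diffeo n M) : Prop where
  smooth : ContMDiffOn (𝓘(ℝ, ℝ).prod (𝓡 (2 * n))) (𝓡 (2 * n)) ∞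
    (fun p : ℝ × M => f p.1 p.2) (Icc (0 : ℝ) 1 ×ˢ univ)
  compact_support : ∃ K : Set M, IsCompact K ∧ ∀ t ∈ Icc (0 : ℝ) 1, ∀ x ∉ K, f t x = x

/-- Hamilton's equation `d/dt (f_t x) = sgrad F_t (f_t x)` for `t ∈ [0, 1]`. -/
def Generates (Ω : SymplecticForm n M) (F : ℝ → M → ℝ) (f : ℝ → Diffeo n M) : Prop :=
  ∀ t ∈ Icc (0 : ℝ) 1, ∀ x : M, IsSgradAt Ω (F t) (f t x)
    (mfderivWithin 𝓘(ℝ, ℝ) (𝓡 (2 * n)) (fun s : ℝ => f s x) (Icc (0 : ℝ) 1) t (1 : ℝ))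

/-- `f_t`, `t ∈ [0, 1]`, `f_0 = id`, is the Hamiltonian flow of the normalized Hamiltonian `F`. -/
structure IsHamiltonianFlow [MeasurableSpace M] (Ω : SymplecticForm n M)
    (f : ℝ → Diffeo n M) (F : ℝ → M → ℝ) : Prop where
  path : IsPath f
  zero : ∀ x : M, f 0 x = x
  normalized : IsNormalized Ω F
  generates : Generates Ω F f

/-- The group `Ham(M, Ω)` of Hamiltonian diffeomorphisms, as a set. -/
def Ham [MeasurableSpace M] (Ω : SymplecticForm n M) : Set (Diffeo n M) :=
  {φ | ∃ f F, IsHamiltonianFlow Ω f F ∧ ∃ a ∈ Icc (0 : ℝ) 1, φ = f a}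

/-- Variations `φ ε t`, `|ε| < ε₀`, `t ∈ [0, 1]`, with fixed ends, of the path `f t`: smooth
families of paths in `Ham(M, Ω)` whose supports lie in a common compact set. -/
structure IsVariation [MeasurableSpace M] (Ω : SymplecticForm n M) (f : ℝ → Diffeo n M)
    (ε₀ : ℝ) (φ : ℝ → ℝ → Diffeo n M) : Prop where
  pos : 0 < ε₀
  smooth : ContMDiffOn (𝓘(ℝ, ℝ).prod (𝓘(ℝ, ℝ).prod (𝓡 (2 * n)))) (𝓡 (2 * n)) ∞
    (fun p : ℝ × ℝ × M => φ p.1 p.2.1 p.2.2) (Ioo (-ε₀) ε₀ ×ˢ Icc (0 : ℝ) 1 ×ˢ univ)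
  compact_support : ∃ K : Set M, IsCompact K ∧
    ∀ ε ∈ Ioo (-ε₀) ε₀, ∀ t ∈ Icc (0 : ℝ) 1, ∀ x ∉ K, φ ε t x = x
  mem_ham : ∀ ε ∈ Ioo (-ε₀) ε₀, ∀ t ∈ Icc (0 : ℝ) 1, φ ε t ∈ Ham Ω
  start : ∀ ε ∈ Ioo (-ε₀) ε₀, ∀ x : M, φ ε 0 x = f 0 x
  finish : ∀ ε ∈ Ioo (-ε₀) ε₀, ∀ x : M, φ ε 1 x = f 1 x
  base : ∀ t ∈ Icc (0 : ℝ) 1, ∀ x : M, φ 0 t x = f t x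

/-- For each `ε`, `Φ ε` is the normalized Hamiltonian generating the path `t ↦ φ ε t`.
It is determined by the path; no regularity in `ε` is assumed. -/
def IsHamiltonianOfVariation [MeasurableSpace M] (Ω : SymplecticForm n M)
    (ε₀ : ℝ) (φ : ℝ → ℝ → Diffeo n M) (Φ : ℝ → ℝ → M → ℝ) : Prop :=
  ∀ ε ∈ Ioo (-ε₀) ε₀, IsNormalized Ω (Φ ε) ∧ Generates Ω (Φ ε) (φ ε)

/-- Hofer's norm `‖H‖ = max H - min H`. -/
def osc (H : M → ℝ) : ℝ := (⨆ x, H x) - ⨅ x, H x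

/-- The length `ℓ(ε) = ∫₀¹ (max_x Φ(x,t,ε) - min_x Φ(x,t,ε)) dt`. -/
def length (Φ : ℝ → ℝ → M → ℝ) (ε : ℝ) : ℝ := ∫ t in (0 : ℝ)..1, osc (Φ ε t)

/-- `ℓ₊(ε) = ∫₀¹ max_x Φ(x,t,ε) dt`. -/
def lengthPlus (Φ : ℝ → ℝ → M → ℝ) (ε : ℝ) : ℝ := ∫ t in (0 : ℝ)..1, ⨆ x, Φ ε t x

/-- `ℓ₋(ε) = ∫₀¹ min_x Φ(x,t,ε) dt`. -/
def lengthMinus (Φ : ℝ → ℝ → M → ℝ) (ε : ℝ) : ℝ := ∫ t in (0 : ℝ)..1, ⨅ x, Φ ε t x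

/-- `ε = 0` is a critical point of a (possibly nonsmooth) function: near `0` the function is
within `O(ε²)` of a convex function that has a minimum at `0`. -/
def IsCriticalAtZero (l : ℝ → ℝ) : Prop :=
  ∃ (u : ℝ → ℝ) (δ C : ℝ), 0 < δ ∧ 0 < C ∧ ConvexOn ℝ (Ioo (-δ) δ) u ∧
    (∀ ε ∈ Ioo (-δ) δ, |l ε - u ε| ≤ C * ε ^ 2) ∧ ∀ ε ∈ Ioo (-δ) δ, u 0 ≤ u ε

/-- The path `f`, with Hamiltonian `F`, is a geodesic: it has constant speed and the length
function of every variation has a critical point at `0`. -/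
structure IsGeodesic [MeasurableSpace M] (Ω : SymplecticForm n M)
    (f : ℝ → Diffeo n M) (F : ℝ → M → ℝ) : Prop where
  speed : ∀ s ∈ Icc (0 : ℝ) 1, ∀ t ∈ Icc (0 : ℝ) 1, osc (F s) = osc (F t)
  critical : ∀ ε₀ φ Φ, IsVariation Ω f ε₀ φ → IsHamiltonianOfVariation Ω ε₀ φ Φ →
    IsCriticalAtZero (length Φ)

/-- The path is stable: the length function of every variation has a (local) minimum at `0`. -/
def IsStable [MeasurableSpace M] (Ω : SymplecticForm n M) (f : ℝ → Diffeo n M) : Prop :=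
  ∀ ε₀ φ Φ, IsVariation Ω f ε₀ φ → IsHamiltonianOfVariation Ω ε₀ φ Φ →
    IsLocalMin (length Φ) 0

/-- The Hessian of `H` at `x`, in the preferred chart around `x`, is nondegenerate
(used at critical points only). -/
def HessianNondegenerate (H : M → ℝ) (x : M) : Prop :=
  ∀ u : E n, (∀ v : E n,
    fderiv ℝ (fderiv ℝ (H ∘ (extChartAt (𝓡 (2 * n)) x).symm)) (extChartAt (𝓡 (2 * n)) x x) u v
      = 0) → u = 0

/-- `x` is the unique maximum point of `H`. -/
def IsUniqueMax (H : M → ℝ) (x : M) : Prop := ∀ y, y ≠ x → H y < H x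

/-- `x` is the unique minimum point of `H`. -/
def IsUniqueMin (H : M → ℝ) (x : M) : Prop := ∀ y, y ≠ x → H x < H y

/-- At each time the Hamiltonian has a unique maximum point and a unique minimum point, and
these are nondegenerate; the points may a priori depend on the time. -/
def HasNondegenerateExtrema (n : ℕ) {M : Type*} [TopologicalSpace M] [ChartedSpace (E n) M]
    (F : ℝ → M → ℝ) : Prop :=
  ∀ t ∈ Icc (0 : ℝ) 1,
    (∃ x, IsUniqueMax (F t) x ∧ HessianNondegenerate (n := n) (F t) x) ∧
    (∃ x, IsUniqueMin (F t) x ∧ HessianNondegenerate (n := n) (F t) x)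

/-- The linearized flow `f_{t*}` on `T_x M` at a point `x` fixed by all `f_t`. Mathlib's tangent
space at any point is the model space, through the preferred chart there, so for `f_t x = x`
source and target are the same tangent space. -/
def linFlow (f : ℝ → Diffeo n M) (x : M) (t : ℝ) : E n →L[ℝ] E n :=
  mfderiv (𝓡 (2 * n)) (𝓡 (2 * n)) (f t) x

/-- The linearized flow at `x` has a nontrivial `T`-periodic orbit. -/
def HasPeriodicOrbit (f : ℝ → Diffeo n M) (x : M) (T : ℝ) : Prop :=
  ∃ ξ : E n, ξ ≠ 0 ∧ linFlow f x T ξ = ξ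

/-- The operator `C(t)` of the linearized equation `d/dt f_{t*} = C(t) f_{t*}` on `T_x M`. -/
def linOp (f : ℝ → Diffeo n M) (x : M) (t : ℝ) : E n →L[ℝ] E n :=
  derivWithin (linFlow f x) (Icc (0 : ℝ) 1) t ∘L (linFlow f x t).inverse

/-- Smooth maps `v : [0, 1] → T_x M` with `v 0 = v 1 = 0`. -/
def IsLoopField (v : ℝ → E n) : Prop :=
  ContDiffOn ℝ ∞ v (Icc (0 : ℝ) 1) ∧ v 0 = 0 ∧ v 1 = 0

/-- `v(t) = d/dε |_{ε = 0} φ ε t x`, at a point `x` fixed by all `φ 0 t`. -/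
def varField (φ : ℝ → ℝ → Diffeo n M) (x : M) (t : ℝ) : E n :=
  (mfderiv 𝓘(ℝ, ℝ) (𝓡 (2 * n)) (fun ε : ℝ => φ ε t x) 0 (1 : ℝ) :
    TangentSpace (𝓡 (2 * n)) (φ 0 t x))

/-- The value of the symplectic form on two vectors of `T_x M`. -/
def pairing (Ω : SymplecticForm n M) (x : M) (u v : E n) : ℝ :=
  Ω.form x ![(u : TangentSpace (𝓡 (2 * n)) x), (v : TangentSpace (𝓡 (2 * n)) x)]

/-- The quadratic functional `Q(v) = -∫₀¹ (Ω(C⁻¹ v', v') + Ω(v', v)) dt`. -/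
def Q (Ω : SymplecticForm n M) (f : ℝ → Diffeo n M) (x : M) (v : ℝ → E n) : ℝ :=
  -∫ t in (0 : ℝ)..1,
    (pairing Ω x ((linOp f x t).inverse (derivWithin v (Icc (0 : ℝ) 1) t))
        (derivWithin v (Icc (0 : ℝ) 1) t)
      + pairing Ω x (derivWithin v (Icc (0 : ℝ) 1) t) (v t))

end Defs

end Hofer

end

namespace Hofer
open Filter Topology
open Metric (ball isOpen_ball mem_ball_self sphere ball_mem_nhds closedBall mem_ball ball_subset_closedBall
  ball_subset_ball mem_closedBall_self eventually_nhds_iff_ball)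

noncomputable section

variable {n : ℕ} {M : Type*} [TopologicalSpace M] [ChartedSpace (E n) M] {Ω : SymplecticForm n M}
  {φ : ℝ → ℝ → Diffeo n M} {Φ : ℝ → ℝ → M → ℝ} {f : ℝ → Diffeo n M} {F : ℝ → M → ℝ} {ε₀ ε t : ℝ}
  {x₀ p : M} {y : E n}

local notation "𝕀" => Icc (0 : ℝ) 1
local notation "𝓜" => 𝓡 (2 * n)
local notation "𝓔" => extChartAt 𝓜
local notation "𝓘₁" => 𝓘(ℝ, ℝ)
local notation "𝓣" => ModelWithCorners.prod 𝓘₁ 𝓜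
local notation "𝒞" => ContDiffOn ℝ ∞
local notation:max "𝔓" n:max => ℝ × ℝ × E n

local notation "𝓛" => E n →L[ℝ] E n
local notation "𝓑" => E n →L[ℝ] E n →L[ℝ] ℝ

theorem uIcc_unit : uIcc (0 : ℝ) 1 = 𝕀 := uIcc_of_le zero_le_one

theorem uniqueDiffOn_unit : UniqueDiffOn ℝ 𝕀 := uniqueDiffOn_Icc zero_lt_one

theorem integral_congr_unit {F : Type*} [NormedAddCommGroup F] [NormedSpace ℝ F] {f g : ℝ → F} (h :
  ∀ t ∈ 𝕀, f t = g t) : ∫ t in 0..1, f t = ∫ t in 0..1, g t := intervalIntegral.integral_congr fun t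
  ht => h t (uIcc_unit ▸ ht)

theorem intervalIntegrable_unit {F : Type*} [NormedAddCommGroup F] {f : ℝ → F} (h : ContinuousOn f
  𝕀) : IntervalIntegrable f volume 0 1 := ContinuousOn.intervalIntegrable (uIcc_unit ▸ h)

section ParametricIntegral

variable {N F : Type} [NormedAddCommGroup N] [NormedSpace ℝ N]
  [NormedAddCommGroup F] [NormedSpace ℝ F] [CompleteSpace F]

theorem uniqueDiffOn_prod_unit {S : Set N} (hU : UniqueDiffOn ℝ S) : UniqueDiffOn ℝ (S ×ˢ 𝕀) :=
  hU.prod uniqueDiffOn_unit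

/-- Differentiation under the integral sign over `[0, 1]`, within a convex set of parameters. -/
theorem hasFDerivWithinAt_integral_unit {S : Set N} (hS : Convex ℝ S) (hU : UniqueDiffOn ℝ S) {G : N
    × ℝ → F} (hG : ContDiffOn ℝ 1 G (S ×ˢ 𝕀)) {p : N} (hp : p ∈ S) : HasFDerivWithinAt (fun q => ∫ r
    in 0..1, G (q, r)) (∫ r in 0..1, (fderivWithin ℝ G (S ×ˢ 𝕀) (p, r)).comp
    (ContinuousLinearMap.inl ℝ N ℝ)) S p := by
  have hUS := uniqueDiffOn_prod_unit hU
  set D : N × ℝ → N →L[ℝ] F := fun z => (fderivWithin ℝ G (S ×ˢ 𝕀) z).comp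
        (ContinuousLinearMap.inl ℝ N ℝ) with hD
  have hDc : ContinuousOn D (S ×ˢ 𝕀) := by
    have := hG.continuousOn_fderivWithin hUS le_rfl
    exact this.clm_comp continuousOn_const
  have hder : ∀ q ∈ S, ∀ r ∈ 𝕀, HasFDerivWithinAt (fun q => G (q, r)) (D (q, r)) S q := by
    intro q hq r hr
    have h1 : HasFDerivWithinAt G (fderivWithin ℝ G (S ×ˢ 𝕀) (q, r)) (S ×ˢ 𝕀) (q, r) :=
      ((hG.differentiableOn one_ne_zero) (q, r) ⟨hq, hr⟩).hasFDerivWithinAt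
    exact HasFDerivWithinAt.comp (t := S ×ˢ 𝕀) q h1
      (hasFDerivAt_prodMk_left q r).hasFDerivWithinAt (fun x hx => ⟨hx, hr⟩)
  have hslice : ∀ q ∈ S, ContinuousOn (fun r => G (q, r)) 𝕀 := fun q hq =>
    hG.continuousOn.comp (by fun_prop) (fun r hr => ⟨hq, hr⟩)
  have hsliceD : ContinuousOn (fun r => D (p, r)) 𝕀 := hDc.comp (by fun_prop) (fun r hr => ⟨hp, hr⟩)
  have hint : ∀ q ∈ S, IntervalIntegrable (fun r => G (q, r)) volume 0 1 := fun q hq => by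
    apply ContinuousOn.intervalIntegrable; rw [uIcc_unit]; exact hslice q hq
  have hintD : IntervalIntegrable (fun r => D (p, r)) volume 0 1 := by
    apply ContinuousOn.intervalIntegrable; rw [uIcc_unit]; exact hsliceD
  rw [hasFDerivWithinAt_iff_isLittleO, Asymptotics.isLittleO_iff]
  intro c hc
  obtain ⟨v, hv, hvb⟩ := isCompact_Icc.mem_uniformity_of_prod (f := fun q r => D (q, r))
    (s := S) (q := p) (by simpa [Function.uncurry_def] using hDc) hp (Metric.dist_mem_uniformity hc)
  obtain ⟨ρ, hρ, hball⟩ := Metric.mem_nhdsWithin_iff.1 hv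
  filter_upwards [inter_mem_nhdsWithin S (ball_mem_nhds p hρ)] with q hq
  have hconv : Convex ℝ (S ∩ ball p ρ) := hS.inter (convex_ball _ _)
  have key : ∀ r ∈ 𝕀, ‖G (q, r) - G (p, r) - D (p, r) (q - p)‖ ≤ c * ‖q - p‖ := by
    intro r hr
    refine hconv.norm_image_sub_le_of_norm_hasFDerivWithin_le' (f := fun q => G (q, r))
      (f' := fun q => D (q, r)) (fun x hx => (hder x hx.1 r hr).mono inter_subset_left) ?_
      ⟨hp, mem_ball_self hρ⟩ hq
    intro x hx
    have := hvb x (hball ⟨hx.2, hx.1⟩) r hr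
    rw [← dist_eq_norm]; exact le_of_lt this
  have hI : (∫ r in 0..1, G (q, r)) - (∫ r in 0..1, G (p, r)) - (∫ r in 0..1, D (p, r)) (q - p) = ∫
      r in 0..1, (G (q, r) - G (p, r) - D (p, r) (q - p)) := by
    rw [intervalIntegral.integral_sub ((hint q hq.1).sub (hint p hp)), intervalIntegral.integral_sub
      (hint q hq.1) (hint p hp), ContinuousLinearMap.intervalIntegral_apply hintD]
    apply ContinuousOn.intervalIntegrable; rw [uIcc_unit]
    exact hsliceD.clm_apply continuousOn_const
  rw [hI]
  refine (intervalIntegral.norm_integral_le_of_norm_le_const (C := c * ‖q - p‖) ?_).trans (by simp)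
  intro r hr
  rw [uIoc_of_le zero_le_one] at hr
  exact key r ⟨hr.1.le, hr.2⟩

theorem contDiffOn_nat_integral_unit {S : Set N} (hS : Convex ℝ S) (hU : UniqueDiffOn ℝ S) (k : ℕ) :
    ∀ {F : Type} [NormedAddCommGroup F] [NormedSpace ℝ F] [CompleteSpace F] {G : N × ℝ → F}, 𝒞 G (S
    ×ˢ 𝕀) → ContDiffOn ℝ k (fun q => ∫ r in 0..1, G (q, r)) S := by
  induction k with
  | zero =>
    intro F _ _ _ G hG
    exact contDiffOn_zero.2 fun p hp =>
      (hasFDerivWithinAt_integral_unit hS hU (hG.of_le (by simp)) hp).continuousWithinAt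
  | succ k ih =>
    intro F _ _ _ G hG
    have hd := fun p hp => hasFDerivWithinAt_integral_unit hS hU (p := p)
      (hG.of_le (n := ∞) (m := 1) (by simp)) hp
    push_cast
    refine (contDiffOn_succ_iff_fderivWithin hU).2
      ⟨fun p hp => (hd p hp).differentiableWithinAt, by simp, ?_⟩
    refine ContDiffOn.congr (f := fun p => ∫ r in 0..1, (fderivWithin ℝ G (S ×ˢ 𝕀) (p, r)).comp
      (ContinuousLinearMap.inl ℝ N ℝ)) ?_ fun p hp => (hd p hp).fderivWithin (hU p hp)
    refine ih (F := N →L[ℝ] F) (G := fun z => (fderivWithin ℝ G (S ×ˢ 𝕀) z).comp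
      (ContinuousLinearMap.inl ℝ N ℝ)) ?_
    exact (hG.fderivWithin (uniqueDiffOn_prod_unit hU) (m := ∞) (by simp)).clm_comp contDiffOn_const

/-- Integrals over `[0, 1]` of smooth functions depend smoothly on parameters. -/
theorem contDiffOn_integral_unit {S : Set N} (hS : Convex ℝ S) (hU : UniqueDiffOn ℝ S) {G : N × ℝ →
  F} (hG : 𝒞 G (S ×ˢ 𝕀)) : 𝒞 (fun q => ∫ r in 0..1, G (q, r)) S := contDiffOn_infty.2 fun k =>
  contDiffOn_nat_integral_unit hS hU k hG

end ParametricIntegral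

section Implicit

variable {N E' G : Type} [NormedAddCommGroup N] [NormedSpace ℝ N]
  [NormedAddCommGroup E'] [NormedSpace ℝ E'] [NormedAddCommGroup G] [NormedSpace ℝ G]

theorem hasFDerivWithinAt_implicit {S : Set N} {B : Set E'} {A : N × E' → G} {y : N → E'} {q₀ : N}
    (hq₀ : q₀ ∈ S) {L : N × E' →L[ℝ] G} (hA : HasFDerivWithinAt A L (S ×ˢ B) (q₀, y q₀)) (hyB : ∀ q
    ∈ S, y q ∈ B) (hy0 : ∀ q ∈ S, A (q, y q) = 0) (hyc : ContinuousWithinAt y S q₀) (L₂ : E' ≃L[ℝ]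
    G) (hL₂ : ∀ w, L₂ w = L (0, w)) : HasFDerivWithinAt y (-(L₂.symm : G →L[ℝ] E').comp (L.comp
    (ContinuousLinearMap.inl ℝ N E'))) S q₀ := by
  set R : N →L[ℝ] E' := (L₂.symm : G →L[ℝ] E').comp (L.comp (ContinuousLinearMap.inl ℝ N E'))
  have hmap : Tendsto (fun q => (q, y q)) (𝓝[S] q₀) (𝓝[S ×ˢ B] (q₀, y q₀)) := by
    rw [nhdsWithin_prod_eq]
    exact tendsto_id.prodMk (tendsto_nhdsWithin_iff.2 ⟨hyc, eventually_nhdsWithin_of_forall hyB⟩)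
  have h1 := (hasFDerivWithinAt_iff_isLittleO.1 hA).comp_tendsto hmap
  have h2 : (fun q => y q - y q₀ + R (q - q₀)) =o[𝓝[S] q₀] fun q => (q - q₀, y q - y q₀) := by
    have h3 := ((L₂.symm : G →L[ℝ] E').isBigO_comp
      (fun q => A (q, y q) - A (q₀, y q₀) - L ((q, y q) - (q₀, y q₀))) (𝓝[S] q₀)).trans_isLittleO h1
    refine (h3.neg_left).congr' ?_ (Eventually.of_forall fun q => rfl)
    filter_upwards [self_mem_nhdsWithin] with q hq
    rw [hy0 q hq, hy0 q₀ hq₀]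
    have : L ((q, y q) - (q₀, y q₀)) = L (q - q₀, 0) + L₂ (y q - y q₀) := by
      rw [hL₂, ← map_add]; simp
    simp only [ContinuousLinearEquiv.coe_coe, this, sub_self, zero_sub, map_neg, map_add,
      ContinuousLinearEquiv.symm_apply_apply, neg_neg, R, ContinuousLinearMap.comp_apply,
      ContinuousLinearMap.inl_apply]
    rw [add_comm]
  have h4 : (fun q => y q - y q₀) =O[𝓝[S] q₀] fun q => q - q₀ := by
    have hR : (fun q => R (q - q₀)) =O[𝓝[S] q₀] fun q => q - q₀ := R.isBigO_comp _ _
    have h5 : ∀ᶠ q in 𝓝[S] q₀, ‖y q - y q₀ + R (q - q₀)‖ ≤ (1 / 2) * ‖(q - q₀, y q - y q₀)‖ :=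
      (Asymptotics.isLittleO_iff.1 h2) (by norm_num)
    refine Asymptotics.IsBigO.of_bound (2 * ‖R‖ + 1) ?_
    filter_upwards [h5] with q hq
    have h6 : ‖y q - y q₀‖ ≤ ‖y q - y q₀ + R (q - q₀)‖ + ‖R‖ * ‖q - q₀‖ := by
      have := norm_sub_le (y q - y q₀ + R (q - q₀)) (R (q - q₀))
      simp only [add_sub_cancel_right] at this
      exact this.trans (by gcongr; exact R.le_opNorm _)
    have h7 : ‖(q - q₀, y q - y q₀)‖ ≤ ‖q - q₀‖ + ‖y q - y q₀‖ := by
      rw [Prod.norm_def]; exact max_le (by simp) (by simp)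
    nlinarith [norm_nonneg (q - q₀), norm_nonneg (y q - y q₀), norm_nonneg R]
  rw [hasFDerivWithinAt_iff_isLittleO]
  have h8 : (fun q => (q - q₀, y q - y q₀)) =O[𝓝[S] q₀] fun q => q - q₀ :=
    (Asymptotics.isBigO_refl _ _).prod_left h4
  refine (h2.trans_isBigO h8).congr_left fun q => ?_
  simp [R]

variable [CompleteSpace E']

/-- Continuous solutions of a nondegenerate smooth equation are smooth, on domains that may have
a boundary. -/
theorem contDiffOn_implicit {S : Set N} (hS : UniqueDiffOn ℝ S) {B : Set E'} (hB : IsOpen B) {A : N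
    × E' → G} (hA : 𝒞 A (S ×ˢ B)) {y : N → E'} (hyB : ∀ q ∈ S, y q ∈ B) (hy0 : ∀ q ∈ S, A (q, y q) =
    0) (hyc : ContinuousOn y S) (hinv : ∀ q ∈ S, ∃ L₂ : E' ≃L[ℝ] G, ∀ w, L₂ w = fderivWithin ℝ A (S
    ×ˢ B) (q, y q) (0, w)) : 𝒞 y S := by
  have hU : UniqueDiffOn ℝ (S ×ˢ B) := hS.prod hB.uniqueDiffOn
  set P1 : N × E' → N →L[ℝ] G := fun z =>
    (fderivWithin ℝ A (S ×ˢ B) z).comp (ContinuousLinearMap.inl ℝ N E')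
  set P2 : N × E' → E' →L[ℝ] G := fun z =>
    (fderivWithin ℝ A (S ×ˢ B) z).comp (ContinuousLinearMap.inr ℝ N E')
  have hA' : 𝒞 (fderivWithin ℝ A (S ×ˢ B)) (S ×ˢ B) := hA.fderivWithin hU (by simp)
  have hP1 : 𝒞 P1 (S ×ˢ B) := hA'.clm_comp contDiffOn_const
  have hP2 : 𝒞 P2 (S ×ˢ B) := hA'.clm_comp contDiffOn_const
  have hd : ∀ q ∈ S, HasFDerivWithinAt y (-((P2 (q, y q)).inverse).comp (P1 (q, y q))) S q := by
    intro q hq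
    obtain ⟨L₂, hL₂⟩ := hinv q hq
    have h1 := hasFDerivWithinAt_implicit hq ((hA.differentiableOn (by simp)) (q, y q) ⟨hq, hyB q
      hq⟩).hasFDerivWithinAt hyB hy0 (hyc q hq) L₂ hL₂
    have h2 : P2 (q, y q) = (L₂ : E' →L[ℝ] G) := by ext w; simp [P2, hL₂]
    rw [h2, ContinuousLinearMap.inverse_equiv]
    exact h1
  have hk : ∀ k : ℕ, ContDiffOn ℝ k y S := by
    intro k
    induction k with
    | zero => exact contDiffOn_zero.2 hyc
    | succ k ih =>
      push_cast
      refine (contDiffOn_succ_iff_fderivWithin hS).2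
        ⟨fun q hq => (hd q hq).differentiableWithinAt, by simp, ?_⟩
      refine ContDiffOn.congr (f := fun q => -((P2 (q, y q)).inverse).comp (P1 (q, y q))) ?_
        fun q hq => (hd q hq).fderivWithin (hS q hq)
      have hpair : ContDiffOn ℝ k (fun q => (q, y q)) S := contDiffOn_id.prodMk ih
      have hmaps : MapsTo (fun q => (q, y q)) S (S ×ˢ B) := fun q hq => ⟨hq, hyB q hq⟩
      have hle : (k : WithTop ℕ∞) ≤ ∞ := by exact_mod_cast le_top
      have h1 : ContDiffOn ℝ k (fun q => P1 (q, y q)) S := (hP1.of_le hle).comp hpair hmaps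
      have h2 : ContDiffOn ℝ k (fun q => P2 (q, y q)) S := (hP2.of_le hle).comp hpair hmaps
      refine (ContDiffOn.clm_comp ?_ h1).neg
      intro q hq
      obtain ⟨L₂, hL₂⟩ := hinv q hq
      have h3 : P2 (q, y q) = (L₂ : E' →L[ℝ] G) := by ext w; simp [P2, hL₂]
      exact ContDiffAt.comp_contDiffWithinAt q (by rw [h3]; exact contDiffAt_map_inverse L₂) (h2 q hq)
  exact contDiffOn_infty.2 hk

end Implicit

section Flow

/-- The time interval `[-1, 1]`. -/
abbrev timeI : Type := Icc (-1 : ℝ) 1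

variable {V : Type} [NormedAddCommGroup V] [NormedSpace ℝ V]

/-- Pointwise application of a curve of operators to a curve of vectors. -/
def pointwiseApply (V W : Type) [NormedAddCommGroup V] [NormedSpace ℝ V] [NormedAddCommGroup W]
    [NormedSpace ℝ W] : C(timeI, V →L[ℝ] W) →L[ℝ] C(timeI, V) →L[ℝ] C(timeI, W) :=
  LinearMap.mkContinuous₂ (LinearMap.mk₂ ℝ
    (fun (A : C(timeI, V →L[ℝ] W)) (γ : C(timeI, V)) =>
      (⟨fun t => A t (γ t), A.continuous.clm_apply γ.continuous⟩ : C(timeI, W)))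
    (fun _ _ _ => by ext; simp) (fun _ _ _ => by ext; simp) (fun _ _ _ => by ext; simp)
    (fun _ _ _ => by ext; simp)) 1 (by
      intro A γ
      rw [one_mul, ContinuousMap.norm_le _ (by positivity)]
      intro t
      exact ((A t).le_opNorm _).trans (mul_le_mul (A.norm_coe_le_norm t) (γ.norm_coe_le_norm t)
        (norm_nonneg _) (norm_nonneg A)))

@[simp] theorem pointwiseApply_apply {W : Type} [NormedAddCommGroup W] [NormedSpace ℝ W] (A :
    C(timeI, V →L[ℝ] W)) (γ : C(timeI, V)) (t : timeI) : pointwiseApply V W A γ t = A t (γ t) := rfl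

theorem norm_pointwiseApply_le {W : Type} [NormedAddCommGroup W] [NormedSpace ℝ W]
    (A : C(timeI, V →L[ℝ] W)) : ‖pointwiseApply V W A‖ ≤ ‖A‖ := by
  refine ContinuousLinearMap.opNorm_le_bound _ (norm_nonneg A) fun γ => ?_
  rw [ContinuousMap.norm_le _ (by positivity)]
  intro t
  exact ((A t).le_opNorm _).trans (mul_le_mul (A.norm_coe_le_norm t) (γ.norm_coe_le_norm t)
    (norm_nonneg _) (norm_nonneg A))

/-- Composition with a continuous map, on curves. -/
def curveComp {W : Type} [TopologicalSpace W] (X : V → W) (hX : Continuous X)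
    (γ : C(timeI, V)) : C(timeI, W) := ⟨fun t => X (γ t), hX.comp γ.continuous⟩

theorem contDiff_pointwiseApply (V W : Type) [NormedAddCommGroup V] [NormedSpace ℝ V]
    [NormedAddCommGroup W] [NormedSpace ℝ W] {k : WithTop ℕ∞} :
    ContDiff ℝ k (fun A => pointwiseApply V W A) := by
  refine IsBoundedLinearMap.contDiff ⟨⟨map_add _, map_smul _⟩, 1, one_pos, fun A => ?_⟩
  rw [one_mul]
  exact norm_pointwiseApply_le A

theorem hasFDerivAt_curveComp [FiniteDimensional ℝ V] {W : Type} [NormedAddCommGroup W] [NormedSpace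
    ℝ W] {X : V → W} (hX : ContDiff ℝ 1 X) (hc : HasCompactSupport X) (γ : C(timeI, V)) :
    HasFDerivAt (curveComp X hX.continuous) (pointwiseApply V W (curveComp (fderiv ℝ X)
    (hX.continuous_fderiv one_ne_zero) γ)) γ := by
  have huc : UniformContinuous (fderiv ℝ X) := (hX.continuous_fderiv
    one_ne_zero).uniformContinuous_of_tendsto_cocompact (hc.fderiv ℝ).is_zero_at_infty
  rw [hasFDerivAt_iff_isLittleO, Asymptotics.isLittleO_iff]
  intro c hc
  obtain ⟨δ, hδ, hunif⟩ := Metric.uniformContinuous_iff.1 huc c hc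
  filter_upwards [ball_mem_nhds γ hδ] with η hη
  rw [ContinuousMap.norm_le _ (by positivity)]
  intro t
  have hb : ∀ x ∈ ball (γ t) δ, ‖fderiv ℝ X x - fderiv ℝ X (γ t)‖ ≤ c := fun x hx => by
    rw [← dist_eq_norm]; exact (hunif hx).le
  have hmem : η t ∈ ball (γ t) δ := lt_of_le_of_lt (ContinuousMap.dist_apply_le_dist t) hη
  have := (convex_ball (γ t) δ).norm_image_sub_le_of_norm_fderiv_le'
    (fun x _ => (hX.differentiable one_ne_zero) x) hb (mem_ball_self hδ) hmem
  refine this.trans ?_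
  gcongr
  exact (η - γ).norm_coe_le_norm t

theorem contDiff_curveComp [FiniteDimensional ℝ V] (k : ℕ) : ∀ {W : Type} [NormedAddCommGroup W]
    [NormedSpace ℝ W] {X : V → W} (hX : ContDiff ℝ ∞ X) (_ : HasCompactSupport X),
    ContDiff ℝ k (curveComp X hX.continuous) := by
  induction k with
  | zero =>
    intro W _ _ X hX hc
    exact contDiff_zero.2 (continuous_iff_continuousAt.2 fun γ =>
      (hasFDerivAt_curveComp (hX.of_le (by simp)) hc γ).continuousAt)
  | succ k ih =>
    intro W _ _ X hX hc
    have h := ih (hX.fderiv_right (m := ∞) (by simp)) (hc.fderiv ℝ)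
    have h2 : ContDiff ℝ k fun γ => pointwiseApply V W (curveComp (fderiv ℝ X) (hX.continuous_fderiv
      (by simp)) γ) := (contDiff_pointwiseApply V W).comp h
    exact (contDiff_succ_iff_hasFDerivAt (n := k)).2 ⟨_, h2,
      fun γ => hasFDerivAt_curveComp (hX.of_le (by simp)) hc γ⟩

/-- The primitive vanishing at time `0`. -/
def primitive (V : Type) [NormedAddCommGroup V] [NormedSpace ℝ V] :
    C(timeI, V) →L[ℝ] C(timeI, V) :=
  LinearMap.mkContinuous
    { toFun := fun γ => ⟨fun t => ∫ s in 0..t, IccExtend (by norm_num) γ s, by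
        have h : Continuous (IccExtend (by norm_num : (-1 : ℝ) ≤ 1) γ) := γ.continuous.Icc_extend'
        exact (intervalIntegral.continuous_primitive
          (fun a b => h.intervalIntegrable a b) 0).comp continuous_subtype_val⟩
      map_add' := fun γ η => by
        have h (γ : C(timeI, V)) : Continuous (IccExtend (by norm_num : (-1 : ℝ) ≤ 1) γ) :=
          γ.continuous.Icc_extend'
        ext t
        exact intervalIntegral.integral_add ((h γ).intervalIntegrable _ _)
          ((h η).intervalIntegrable _ _)
      map_smul' := fun c γ => by
        ext t
        exact intervalIntegral.integral_smul c _ } 1 (by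
    intro γ
    rw [one_mul, ContinuousMap.norm_le _ (norm_nonneg _)]
    intro t
    refine (intervalIntegral.norm_integral_le_of_norm_le_const (C := ‖γ‖) fun s _ =>
      γ.norm_coe_le_norm _).trans ?_
    have : |(t : ℝ) - 0| ≤ 1 := by rw [sub_zero, abs_le]; exact t.2
    nlinarith [norm_nonneg γ])

theorem primitive_apply (γ : C(timeI, V)) (t : timeI) :
    primitive V γ t = ∫ s in 0..t, IccExtend (by norm_num : (-1 : ℝ) ≤ 1) γ s := rfl

theorem norm_primitive_le : ‖primitive V‖ ≤ 1 := LinearMap.mkContinuous_norm_le _ zero_le_one _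

/-- Vector fields with small derivative have a smooth flow for times in `[-1, 1]`. -/
theorem exists_flow_of_small [FiniteDimensional ℝ V] [CompleteSpace V] {X : V → V} (hX : ContDiff ℝ
    ∞ X) (hc : HasCompactSupport X) (hsmall : ∀ y, ‖fderiv ℝ X y‖ ≤ 1 / 2) : ∃ Γ : V → ℝ → V, (∀ t ∈
    Icc (-1 : ℝ) 1, ContDiff ℝ ∞ fun y => Γ y t) ∧ (∀ y, Γ y 0 = y) ∧ (∀ y, ContinuousOn (Γ y) (Icc
    (-1 : ℝ) 1)) ∧ ∀ y, ∀ t ∈ Ioo (-1 : ℝ) 1, HasDerivAt (Γ y) (X (Γ y t)) t := by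
  classical
  set T : C(timeI, V) → C(timeI, V) := curveComp X hX.continuous with hT
  set D : C(timeI, V) → C(timeI, V) →L[ℝ] C(timeI, V) := fun γ => (primitive V).comp
    (pointwiseApply V V (curveComp (fderiv ℝ X) (hX.continuous_fderiv (by simp)) γ)) with hD
  have hDle : ∀ γ, ‖D γ‖ ≤ 1 / 2 := fun γ => by
    refine (ContinuousLinearMap.opNorm_comp_le _ _).trans ?_
    have h1 : ‖pointwiseApply V V (curveComp (fderiv ℝ X) (hX.continuous_fderiv (by simp)) γ)‖
        ≤ 1 / 2 := (norm_pointwiseApply_le _).trans (by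
      rw [ContinuousMap.norm_le _ (by norm_num)]
      exact fun t => hsmall _)
    nlinarith [norm_primitive_le (V := V), norm_nonneg (primitive V), norm_nonneg
      (pointwiseApply V V (curveComp (fderiv ℝ X) (hX.continuous_fderiv (by simp)) γ))]
  set G : C(timeI, V) → C(timeI, V) := fun γ => γ - primitive V (T γ) with hG
  have hGd : ∀ γ, HasFDerivAt G (ContinuousLinearMap.id ℝ _ - D γ) γ := fun γ => (hasFDerivAt_id
    γ).sub (((primitive V).hasFDerivAt).comp γ (hasFDerivAt_curveComp (hX.of_le (by simp)) hc γ))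
  have hGsmooth : ContDiff ℝ ∞ G := contDiff_infty.2 fun k =>
    contDiff_id.sub ((primitive V).contDiff.comp (contDiff_curveComp k hX hc))
  have happrox : ApproximatesLinearOn G ((ContinuousLinearEquiv.refl ℝ C(timeI, V) : C(timeI, V)
      ≃L[ℝ] C(timeI, V)) : C(timeI, V) →L[ℝ] C(timeI, V)) univ (1 / 2 : NNReal) := by
    intro γ _ η _
    have := convex_univ.norm_image_sub_le_of_norm_hasFDerivWithin_le' (f := G) (f' := fun γ =>
      ContinuousLinearMap.id ℝ _ - D γ) (φ := ContinuousLinearMap.id ℝ _) (C := 1 / 2) (fun x _ =>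
      (hGd x).hasFDerivWithinAt) (fun x _ => by simpa using hDle x) (mem_univ η) (mem_univ γ)
    simpa using this
  have hlt : Subsingleton C(timeI, V) ∨ (1 / 2 : NNReal) <
      ‖((ContinuousLinearEquiv.refl ℝ C(timeI, V)).symm : C(timeI, V) →L[ℝ] C(timeI, V))‖₊⁻¹ := by
    rcases subsingleton_or_nontrivial C(timeI, V) with h | h
    · exact Or.inl h
    · right
      have h1 : ‖((ContinuousLinearEquiv.refl ℝ C(timeI, V)).symm :
          C(timeI, V) →L[ℝ] C(timeI, V))‖₊ = 1 := by
        simp [ContinuousLinearMap.nnnorm_id (𝕜 := ℝ) (E := C(timeI, V))]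
      rw [h1, inv_one, ← NNReal.coe_lt_coe]; norm_num
  set Φ := happrox.toHomeomorph G hlt with hΦ
  have hΦG : ∀ γ, Φ γ = G γ := fun γ => rfl
  have hlt1 : ∀ γ, ‖D γ‖ < 1 := fun γ => (hDle γ).trans_lt (by norm_num)
  have hΦs : ContDiff ℝ ∞ Φ.symm := by
    refine Φ.contDiff_symm (f₀' := fun γ =>
      ContinuousLinearEquiv.ofUnit (Units.oneSub (D γ) (hlt1 γ))) (fun γ => ?_) hGsmooth
    have h1 : ((ContinuousLinearEquiv.ofUnit (Units.oneSub (D γ) (hlt1 γ)) : C(timeI, V) ≃L[ℝ]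
        C(timeI, V)) : C(timeI, V) →L[ℝ] C(timeI, V)) = ContinuousLinearMap.id ℝ _ - D γ := rfl
    rw [h1]
    exact hGd γ
  refine ⟨fun y t => IccExtend (by norm_num : (-1 : ℝ) ≤ 1) (Φ.symm (ContinuousMap.const _ y)) t,
    ?_, ?_, ?_, ?_⟩
  · intro t ht
    have h1 : ContDiff ℝ ∞ fun y : V => Φ.symm (ContinuousMap.const timeI y) := by
      refine hΦs.comp ?_
      exact (LinearMap.mkContinuous (σ := RingHom.id ℝ)
        { toFun := fun y : V => ContinuousMap.const timeI y
          map_add' := fun _ _ => rfl, map_smul' := fun _ _ => rfl } 1 (fun y => by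
            exact (one_mul ‖y‖).symm ▸ (ContinuousMap.norm_le _ (norm_nonneg _)).2 fun _ => le_rfl)).contDiff
    have h2 := (ContinuousMap.evalCLM ℝ (⟨t, ht⟩ : timeI) : C(timeI, V) →L[ℝ] V).contDiff.comp h1
    convert h2 using 1
    ext y
    exact IccExtend_of_mem _ _ ht
  all_goals intro y
  all_goals
    set γ := Φ.symm (ContinuousMap.const timeI y) with hγ
    have hcont : Continuous (IccExtend (by norm_num : (-1 : ℝ) ≤ 1) γ) := γ.continuous.Icc_extend'
    have heq : G γ = ContinuousMap.const timeI y := by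
      rw [← hΦG, hγ, Φ.apply_symm_apply]
    have hint : ∀ t ∈ Icc (-1 : ℝ) 1, IccExtend (by norm_num : (-1 : ℝ) ≤ 1) γ t
        = y + ∫ s in 0..t, X (IccExtend (by norm_num : (-1 : ℝ) ≤ 1) γ s) := by
      intro t ht
      have h1 := DFunLike.congr_fun heq (⟨t, ht⟩ : timeI)
      rw [hG] at h1
      simp only [ContinuousMap.sub_apply, ContinuousMap.const_apply, primitive_apply] at h1
      rw [IccExtend_of_mem _ _ ht, ← sub_eq_iff_eq_add]
      exact h1
  · exact (hint 0 (by norm_num)).trans (by simp)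
  · exact hcont.continuousOn
  · intro t ht
    have h1 : HasDerivAt (fun t => y + ∫ s in 0..t, X (IccExtend (by norm_num : (-1 : ℝ) ≤ 1) γ s))
        (X (IccExtend (by norm_num : (-1 : ℝ) ≤ 1) γ t)) t := by
      have h2 : Continuous fun s => X (IccExtend (by norm_num : (-1 : ℝ) ≤ 1) γ s) :=
        hX.continuous.comp hcont
      exact (h2.integral_hasStrictDerivAt 0 t).hasDerivAt.const_add y
    exact h1.congr_of_eventuallyEq (by
      filter_upwards [Icc_mem_nhds ht.1 ht.2] with s hs using hint s hs)

theorem flow_unique {X : V → V} {K : NNReal} (hX : LipschitzWith K X) {a b : ℝ} (h0 : (0 : ℝ) ∈ Ioo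
  a b) {f g : ℝ → V} (hf : ∀ t ∈ Ioo a b, HasDerivAt f (X (f t)) t) (hg : ∀ t ∈ Ioo a b, HasDerivAt
  g (X (g t)) t) (hfc : ContinuousOn f (Icc a b)) (hgc : ContinuousOn g (Icc a b)) (h : f 0 = g 0) :
  EqOn f g (Icc a b) := ODE_solution_unique_of_mem_Icc (v := fun _ => X) (s := fun _ => univ) (K :=
  K) (fun _ _ => hX.lipschitzOnWith) h0 hfc hf (fun _ _ => mem_univ _) hgc hg (fun _ _ => mem_univ
  _) h

/-- A compactly supported smooth vector field has, after scaling, a flow that is smooth jointly in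
time and space for times in `(-1, 1)`. -/
theorem exists_smooth_flow [FiniteDimensional ℝ V] [CompleteSpace V] {X : V → V} (hX : ContDiff ℝ ∞
    X) (hc : HasCompactSupport X) : ∃ (c : ℝ) (θ : ℝ → V → V), 0 < c ∧ ContDiff ℝ ∞ (fun z : ℝ × V
    => θ z.1 z.2) ∧ (∀ y, θ 0 y = y) ∧ (∀ s ∈ Ioo (-1 : ℝ) 1, ∀ y, HasDerivAt (fun s => θ s y) (c •
    X (θ s y)) s) ∧ (∀ s ∈ Ioo (-1 : ℝ) 1, ∀ y, θ (-s) (θ s y) = y) ∧ ∀ s ∈ Ioo (-1 : ℝ) 1, ∀ y, X y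
    = 0 → θ s y = y := by
  let χ : ContDiffBump (0 : ℝ) := ⟨1, 2, by norm_num, by norm_num⟩
  set Y : ℝ × V → ℝ × V := fun z => (0, (χ z.1 * z.1) • X z.2) with hY
  have hYs : ContDiff ℝ ∞ Y := contDiff_const.prodMk
    (((χ.contDiff.comp contDiff_fst).mul contDiff_fst).smul (hX.comp contDiff_snd))
  have hYc : HasCompactSupport Y := by
    refine HasCompactSupport.of_support_subset_isCompact (χ.hasCompactSupport.prod hc) ?_
    intro z hz
    by_contra hcon
    apply hz
    simp only [mem_prod, not_and_or] at hcon
    rcases hcon with h | h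
    · simp [hY, image_eq_zero_of_notMem_tsupport h]
    · simp [hY, image_eq_zero_of_notMem_tsupport h]
  obtain ⟨C, hC⟩ := (hYc.fderiv ℝ).exists_bound_of_continuous (hYs.continuous_fderiv (by simp))
  obtain ⟨C', hC'⟩ := (hc.fderiv ℝ).exists_bound_of_continuous (hX.continuous_fderiv (by simp))
  set c : ℝ := 1 / (2 * (|C| + 1)) with hcdef
  have hcpos : 0 < c := by positivity
  have hYcs : ContDiff ℝ ∞ (fun z => c • Y z) := hYs.const_smul c
  obtain ⟨Γ, hΓs, hΓ0, hΓc, hΓd⟩ := exists_flow_of_small hYcs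
    (hYc.mono (fun z hz h => hz (by simp [h]))) (fun z => by
      have : fderiv ℝ (fun z => c • Y z) z = c • fderiv ℝ Y z :=
        fderiv_const_smul (hYs.differentiable (by simp) z) c
      rw [this, norm_smul, Real.norm_of_nonneg hcpos.le, hcdef]
      have h1 : ‖fderiv ℝ Y z‖ ≤ |C| + 1 := (hC z).trans ((le_abs_self C).trans (by linarith))
      rw [div_mul_eq_mul_div, one_mul, div_le_div_iff₀ (by positivity) (by norm_num)]
      linarith)
  have hLip : LipschitzWith (c * C').toNNReal (fun y => c • X y) := by
    refine lipschitzWith_of_nnnorm_fderiv_le (𝕜 := ℝ)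
      ((hX.const_smul c).differentiable (n := ∞) (by simp)) fun y => ?_
    rw [← NNReal.coe_le_coe, coe_nnnorm, Real.coe_toNNReal']
    have : fderiv ℝ (fun z => c • X z) y = c • fderiv ℝ X y :=
        fderiv_const_smul (hX.differentiable (by simp) y) c
    refine le_max_of_le_left ?_
    rw [this, norm_smul, Real.norm_of_nonneg hcpos.le]
    gcongr; exact hC' y
  have hfst : ∀ z, ∀ t ∈ Icc (-1 : ℝ) 1, (Γ z t).1 = z.1 := by
    intro z t ht
    have h := (flow_unique (X := fun _ : ℝ => (0 : ℝ)) (K := 0) (LipschitzWith.const 0) (a := -1) (b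
      := 1) (by norm_num) (f := fun t => (Γ z t).1) (g := fun _ => z.1) (fun s hs => by
        have h1 := (ContinuousLinearMap.fst ℝ ℝ V).hasFDerivAt.comp_hasDerivAt s (hΓd z s hs)
        simpa [hY, Function.comp_def] using h1)
      (fun s _ => hasDerivAt_const _ _) (continuous_fst.comp_continuousOn (hΓc z))
      continuousOn_const (by simp [hΓ0])) ht
    exact h
  have hsnd : ∀ z : ℝ × V, z.1 ∈ Icc (-1 : ℝ) 1 → ∀ t ∈ Ioo (-1 : ℝ) 1,
      HasDerivAt (fun t => (Γ z t).2) ((c * z.1) • X (Γ z t).2) t := by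
    intro z hz t ht
    have h1 := (ContinuousLinearMap.snd ℝ ℝ V).hasFDerivAt.comp_hasDerivAt t (hΓd z t ht)
    have h2 : χ z.1 = 1 := χ.one_of_mem_closedBall (by
      rw [mem_closedBall_zero_iff, Real.norm_eq_abs, abs_le]; exact hz)
    simpa [hY, Function.comp_def, hfst z t (Ioo_subset_Icc_self ht), h2, smul_smul, mul_comm] using h1
  have hscale : ∀ s ∈ Icc (-1 : ℝ) 1, ∀ y, (Γ (s, y) 1).2 = (Γ (1, y) s).2 := by
    intro s hs y
    have hmap : ∀ t ∈ Icc (-1 : ℝ) 1, t * s ∈ Icc (-1 : ℝ) 1 := fun t ht => by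
      rw [mem_Icc, ← abs_le] at *; rw [abs_mul]; exact mul_le_one₀ ht (abs_nonneg _) hs
    have hmap' : ∀ t ∈ Ioo (-1 : ℝ) 1, t * s ∈ Ioo (-1 : ℝ) 1 := fun t ht => by
      rw [mem_Ioo, ← abs_lt] at *; rw [mem_Icc, ← abs_le] at hs
      rw [abs_mul]; exact (mul_le_of_le_one_right (abs_nonneg _) hs).trans_lt ht
    have hLs : LipschitzWith (‖s‖₊ * (c * C').toNNReal) (fun y => (c * s) • X y) := by
      have := (lipschitzWith_smul (β := V) s).comp hLip
      simpa [Function.comp_def, smul_smul, mul_comm] using this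
    have h := flow_unique hLs (a := -1) (b := 1) (by norm_num) (f := fun t => (Γ (s, y) t).2) (g :=
      fun t => (Γ (1, y) (t * s)).2) (fun t ht => hsnd (s, y) hs t ht) (fun t ht => by
        have h1 := hsnd (1, y) (by norm_num) (t * s) (hmap' t ht)
        have h2 := HasDerivAt.scomp t h1 ((hasDerivAt_id t).mul_const s)
        simpa [Function.comp_def, smul_smul, mul_comm] using h2)
      (continuous_snd.comp_continuousOn (hΓc _))
      (continuous_snd.comp_continuousOn ((hΓc _).comp (by fun_prop) hmap)) (by simp [hΓ0])
    simpa using h (show (1 : ℝ) ∈ Icc (-1 : ℝ) 1 by norm_num)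
  have hder : ∀ s ∈ Ioo (-1 : ℝ) 1, ∀ y,
      HasDerivAt (fun s => (Γ (s, y) 1).2) (c • X (Γ (s, y) 1).2) s := by
    intro s hs y
    have h1 := hsnd (1, y) (by norm_num) s hs
    rw [hscale s (Ioo_subset_Icc_self hs)]
    rw [mul_one] at h1
    refine h1.congr_of_eventuallyEq ?_
    filter_upwards [Icc_mem_nhds hs.1 hs.2] with r hr using hscale r hr y
  have hcon : ∀ y, ContinuousOn (fun s => (Γ (s, y) 1).2) (Icc (-1 : ℝ) 1) := fun y =>
    ((contDiff_snd.comp (hΓs 1 (by norm_num))).continuous.comp (by fun_prop)).continuousOn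
  have h00 : ∀ y, (Γ (0, y) 1).2 = y := fun y => by
    rw [hscale 0 (by norm_num), hΓ0]
  refine ⟨c, fun s y => (Γ (s, y) 1).2, hcpos, contDiff_snd.comp (hΓs 1 (by norm_num)), h00,
    hder, ?_, ?_⟩
  · intro s hs y
    by_cases hs0 : s = 0
    · simp [hs0, h00]
    have hpos : 0 < |s| := abs_pos.2 hs0
    have hlt : |s| < 1 := abs_lt.2 hs
    have hin : ∀ t ∈ Ioo (-1 : ℝ) 1, t * |s| ∈ Ioo (-1 : ℝ) 1 := fun t ht => by
      rw [mem_Ioo, ← abs_lt] at *; rw [abs_mul, abs_abs]; nlinarith [abs_nonneg t]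
    have hkey : ∀ r, |r| < |s| → |r - s| < 1 → (r - s) ∈ Ioo (-1 : ℝ) 1 := fun r _ h => abs_lt.1 h
    rcases lt_or_gt_of_ne hs0 with hneg | hpos'
    · have h := flow_unique hLip (a := -1 - s) (b := 1) (by constructor <;> linarith [hs.1])
        (f := fun r => (Γ (r, (Γ (s, y) 1).2) 1).2) (g := fun r => (Γ (s + r, y) 1).2)
        (fun r hr => hder r ⟨by linarith [hr.1], hr.2⟩ _)
        (fun r hr => (hder (s + r) ⟨by linarith [hr.1], by linarith [hr.2]⟩ _).comp_const_add s r)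
        ((hcon _).mono (Icc_subset_Icc (by linarith) le_rfl))
        ((hcon y).comp (by fun_prop) (fun r hr => ⟨by linarith [hr.1], by linarith [hr.2]⟩))
        (by simp [h00]) (x := -s) ⟨by linarith [hs.1], by linarith [hs.1]⟩
      simpa [h00] using h
    · have h := flow_unique hLip (a := -1) (b := 1 - s) (by constructor <;> linarith [hs.2])
        (f := fun r => (Γ (r, (Γ (s, y) 1).2) 1).2) (g := fun r => (Γ (s + r, y) 1).2)
        (fun r hr => hder r ⟨hr.1, by linarith [hr.2]⟩ _)
        (fun r hr => (hder (s + r) ⟨by linarith [hr.1], by linarith [hr.2]⟩ _).comp_const_add s r)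
        ((hcon _).mono (Icc_subset_Icc le_rfl (by linarith)))
        ((hcon y).comp (by fun_prop) (fun r hr => ⟨by linarith [hr.1], by linarith [hr.2]⟩))
        (by simp [h00]) (x := -s) ⟨by linarith [hs.2], by linarith [hs.2]⟩
      simpa [h00] using h
  · intro s hs y hy
    have h := flow_unique hLip (a := -1) (b := 1) (by norm_num) (f := fun r => (Γ (r, y) 1).2) (g :=
      fun _ => y) (fun r hr => hder r hr y) (fun r _ => by simpa [hy] using hasDerivAt_const r y)
      (hcon y) continuousOn_const (h00 y) (Ioo_subset_Icc_self hs)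
    exact h

end Flow

section Bilinear

variable {V : Type} [NormedAddCommGroup V] [NormedSpace ℝ V]

theorem update_pair_zero (u w x : V) : Function.update ![u, w] 0 x = ![x, w] := by
  funext i; fin_cases i <;> simp

theorem update_pair_one (u w x : V) : Function.update ![u, w] 1 x = ![u, x] := by
  funext i; fin_cases i <;> simp

/-- Alternating 2-forms as bilinear maps. -/
def toBilin (V : Type) [NormedAddCommGroup V] [NormedSpace ℝ V]
    (β : V [⋀^Fin 2]→L[ℝ] ℝ) : V →L[ℝ] V →L[ℝ] ℝ :=
  LinearMap.mkContinuous₂ (LinearMap.mk₂ ℝ (fun u w : V => β ![u, w])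
    (fun u u' w => by
      have := β.map_update_add ![u, w] 0 u u'
      rwa [update_pair_zero, update_pair_zero, update_pair_zero] at this)
    (fun c u w => by
      have := β.map_update_smul ![u, w] 0 c u
      rwa [update_pair_zero, update_pair_zero] at this)
    (fun u w w' => by
      have := β.map_update_add ![u, w] 1 w w'
      rwa [update_pair_one, update_pair_one, update_pair_one] at this)
    (fun c u w => by
      have := β.map_update_smul ![u, w] 1 c w
      rwa [update_pair_one, update_pair_one] at this)) ‖β‖ (fun u w => by
        have := β.le_opNorm ![u, w]
        simpa [Fin.prod_univ_two, mul_assoc] using this)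

@[simp] theorem toBilin_apply (β : V [⋀^Fin 2]→L[ℝ] ℝ) (u w : V) :
    toBilin V β u w = β ![u, w] := rfl

theorem norm_toBilin_le (β : V [⋀^Fin 2]→L[ℝ] ℝ) : ‖toBilin V β‖ ≤ 1 * ‖β‖ := by
  rw [one_mul]
  exact LinearMap.mkContinuous₂_norm_le _ (norm_nonneg _) _

theorem contDiff_toBilin {k : WithTop ℕ∞} : ContDiff ℝ k (toBilin V) := IsBoundedLinearMap.contDiff
  ⟨⟨fun _ _ => by ext; simp, fun _ _ => by ext; simp⟩, 1, one_pos, norm_toBilin_le⟩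

theorem contDiff_flip {V W : Type} [NormedAddCommGroup V] [NormedSpace ℝ V] [NormedAddCommGroup W]
  [NormedSpace ℝ W] {k : WithTop ℕ∞} : ContDiff ℝ k (fun B : V →L[ℝ] W →L[ℝ] ℝ => B.flip) :=
  IsBoundedLinearMap.contDiff ⟨⟨fun _ _ => by ext; simp, fun _ _ => by ext; simp⟩, 1, one_pos, fun B
  => by rw [one_mul, ContinuousLinearMap.opNorm_flip]⟩

theorem alternating_swap (β : V [⋀^Fin 2]→L[ℝ] ℝ) (u w : V) : β ![u, w] = -β ![w, u] := by
  have := β.toAlternatingMap.map_swap ![w, u] (i := 0) (j := 1) (by simp)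
  have h : (![w, u] ∘ (Equiv.swap (0 : Fin 2) 1)) = ![u, w] := by
    funext i; fin_cases i <;> simp
  rw [h] at this
  exact this

theorem alternating_self (β : V [⋀^Fin 2]→L[ℝ] ℝ) (u : V) : β ![u, u] = 0 :=
  β.map_eq_zero_of_eq ![u, u] (i := 0) (j := 1) (by simp) (by simp)

theorem extDerivWithin_eq_zero_iff_cyclic {β : V → V [⋀^Fin 2]→L[ℝ] ℝ} {S : Set V} {p : V} (hβ :
    DifferentiableWithinAt ℝ β S p) (hS : UniqueDiffWithinAt ℝ S p) (h : extDerivWithin β S p = 0)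
    (a b c : V) : fderivWithin ℝ (fun q => toBilin V (β q)) S p a b c - fderivWithin ℝ (fun q =>
    toBilin V (β q)) S p b a c + fderivWithin ℝ (fun q => toBilin V (β q)) S p c a b = 0 := by
  have hd : DifferentiableWithinAt ℝ (fun q => toBilin V (β q)) S p :=
    (contDiff_toBilin.differentiable (n := 1) one_ne_zero _).comp_differentiableWithinAt p hβ
  have h1 : ∀ a b c, fderivWithin ℝ (fun q => toBilin V (β q)) S p a b c
      = fderivWithin ℝ β S p a ![b, c] := fun a b c => by
    have e1 := (((hd.hasFDerivWithinAt.clm_apply (hasFDerivWithinAt_const b p S)).clm_apply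
      (hasFDerivWithinAt_const c p S)).fderivWithin hS)
    have e2 := (hβ.hasFDerivWithinAt.continuousAlternatingMap_apply
      fun i => hasFDerivWithinAt_const (![b, c] i) p S).fderivWithin hS
    have e3 := DFunLike.congr_fun e1 a
    have e4 := DFunLike.congr_fun e2 a
    have e5 : (fun q => β q fun i => ![b, c] i) = fun q => toBilin V (β q) b c := rfl
    rw [e5, e3] at e4
    simpa using e4
  have h2 := congrArg (fun f => f ![a, b, c]) h
  simp only [extDerivWithin, ContinuousAlternatingMap.alternatizeUncurryFin_apply,
    ContinuousAlternatingMap.coe_zero, Pi.zero_apply] at h2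
  rw [Fin.sum_univ_three] at h2
  have e0 : Fin.removeNth (0 : Fin 3) ![a, b, c] = ![b, c] := by
    ext i; fin_cases i <;> simp [Fin.removeNth]
  have e1 : Fin.removeNth (1 : Fin 3) ![a, b, c] = ![a, c] := by
    ext i; fin_cases i <;> simp [Fin.removeNth, Fin.succAbove]
  have e2 : Fin.removeNth (2 : Fin 3) ![a, b, c] = ![a, b] := by
    ext i; fin_cases i <;> simp [Fin.removeNth, Fin.succAbove]
  rw [e0, e1, e2] at h2
  simp at h2
  simp only [h1, toBilin_apply]
  linarith

end Bilinear

section Pull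

variable [IsManifold (𝓡 (2 * n)) ∞ M]
variable {N : Type} [NormedAddCommGroup N] [NormedSpace ℝ N]

/-- The pullback of a symplectic form by a map into the manifold, as a field of bilinear forms. -/
def pull (Ω : SymplecticForm n M) (σ : N → M) (S : Set N) (p : N) :
    N →L[ℝ] N →L[ℝ] ℝ :=
  toBilin N ((Ω.form (σ p)).compContinuousLinearMap
    (mfderivWithin 𝓘(ℝ, N) 𝓜 σ S p))

theorem pull_apply (Ω : SymplecticForm n M) (σ : N → M) (S : Set N) (p u w : N) : pull Ω σ S p u w =
    Ω.form (σ p) ![mfderivWithin 𝓘(ℝ, N) 𝓜 σ S p u, mfderivWithin 𝓘(ℝ, N) 𝓜 σ S p w] := by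
  exact congrArg (Ω.form (σ p)) (by funext i; fin_cases i <;> rfl)

theorem mdifferentiableAt_extChartAt_symm (hy : y ∈ (𝓔 x₀).target) : MDifferentiableAt 𝓘(ℝ, E n) 𝓜
  (𝓔 x₀).symm y := ((contMDiffOn_extChartAt_symm (n := ∞) x₀).contMDiffAt ((isOpen_extChartAt_target
  x₀).mem_nhds hy)).mdifferentiableAt (by simp)

theorem contMDiffAt_extChartAt_of_mem {x₀ x : M} (hx : x ∈ (𝓔 x₀).source) : ContMDiffAt 𝓜 𝓘(ℝ, E n)
  ∞ (𝓔 x₀) x := contMDiffAt_extChartAt' (by rwa [extChartAt_source] at hx)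

theorem mfderivWithin_eq_chart {σ : N → M} {S : Set N} {p : N} (hσ : MDifferentiableWithinAt 𝓘(ℝ, N)
    𝓜 σ S p) (hS : UniqueDiffWithinAt ℝ S p) (hx : σ p ∈ (𝓔 x₀).source) (hp : p ∈ S) :
    (mfderivWithin 𝓘(ℝ, N) 𝓜 σ S p : N →L[ℝ] E n) = (mfderiv 𝓘(ℝ, E n) 𝓜 (𝓔 x₀).symm (𝓔 x₀ (σ p)) :
    𝓛).comp (fderivWithin ℝ (fun q => 𝓔 x₀ (σ q)) S p) := by
  have hd : MDifferentiableWithinAt 𝓘(ℝ, N) 𝓘(ℝ, E n) (fun q => 𝓔 x₀ (σ q)) S p :=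
    ((contMDiffAt_extChartAt_of_mem hx).mdifferentiableAt (by simp)).comp_mdifferentiableWithinAt p
    hσ
  have hcomp := mfderiv_comp_mfderivWithin (I := 𝓘(ℝ, N)) (I' := 𝓘(ℝ, E n)) (I'' := 𝓜) (M' := E n)
    (M'' := M) p (f := fun q => 𝓔 x₀ (σ q)) (g := (𝓔 x₀).symm) (mdifferentiableAt_extChartAt_symm
    ((𝓔 x₀).map_source hx)) hd hS.uniqueMDiffWithinAt
  rw [mfderivWithin_eq_fderivWithin] at hcomp
  refine Eq.trans ?_ hcomp
  have hev : ∀ᶠ q in 𝓝[S] p, σ q ∈ (𝓔 x₀).source := hσ.continuousWithinAt.preimage_mem_nhdsWithin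
    ((isOpen_extChartAt_source (I := 𝓜) x₀).mem_nhds hx)
  have heq : ((𝓔 x₀).symm ∘ fun q => 𝓔 x₀ (σ q)) =ᶠ[𝓝[S] p] σ := by
    filter_upwards [hev] with q hq
    exact (𝓔 x₀).left_inv hq
  exact (Filter.EventuallyEq.mfderivWithin_eq_of_mem (I := 𝓘(ℝ, N)) (I' := 𝓜) (M' := M) heq hp).symm

theorem form_congr_point (Ω : SymplecticForm n M) {x x' : M} (h : x = x') (u w : E n) : Ω.form x
    ![(u : TangentSpace 𝓜 x), (w : TangentSpace 𝓜 x)] = Ω.form x' ![(u : TangentSpace 𝓜 x'), (w :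
    TangentSpace 𝓜 x')] := by
  subst h; rfl

theorem chartForm_apply (Ω : SymplecticForm n M) (x₀ : M) (y u w : E n) : chartForm Ω.form x₀ y ![u,
    w] = Ω.form ((𝓔 x₀).symm y) ![mfderiv 𝓘(ℝ, E n) 𝓜 (𝓔 x₀).symm y u, mfderiv 𝓘(ℝ, E n) 𝓜 (𝓔
    x₀).symm y w] := by
  exact congrArg (Ω.form ((𝓔 x₀).symm y)) (by funext i; fin_cases i <;> rfl)

/-- The pullback computed in a chart of the target. -/
theorem pull_eq_chart (Ω : SymplecticForm n M) {σ : N → M} {S : Set N} {p : N} (hσ :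
    MDifferentiableWithinAt 𝓘(ℝ, N) 𝓜 σ S p) (hS : UniqueDiffWithinAt ℝ S p) (hx : σ p ∈ (𝓔
    x₀).source) (hp : p ∈ S) : pull Ω σ S p = toBilin N ((chartForm Ω.form x₀ (𝓔 x₀ (σ
    p))).compContinuousLinearMap (fderivWithin ℝ (fun q => 𝓔 x₀ (σ q)) S p)) := by
  ext u w
  have h := mfderivWithin_eq_chart hσ hS hx hp
  rw [pull_apply, toBilin_apply, ContinuousAlternatingMap.compContinuousLinearMap_apply]
  have h1 : (⇑(fderivWithin ℝ (fun q => 𝓔 x₀ (σ q)) S p) ∘ ![u, w]) = ![fderivWithin ℝ (fun q => 𝓔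
    x₀ (σ q)) S p u, fderivWithin ℝ (fun q => 𝓔 x₀ (σ q)) S p w] := by
    ext i; fin_cases i <;> rfl
  rw [h1, chartForm_apply]
  have h2 := DFunLike.congr_fun h u
  have h3 := DFunLike.congr_fun h w
  refine Eq.trans ?_ (form_congr_point Ω ((𝓔 x₀).left_inv hx).symm _ _)
  refine congrArg (Ω.form (σ p)) ?_
  funext i; fin_cases i
  · exact h2
  · exact h3

theorem pull_eventuallyEq_chart (Ω : SymplecticForm n M) {σ : N → M} {S : Set N} (hσ : ContMDiffOn
    𝓘(ℝ, N) 𝓜 ∞ σ S) (hS : UniqueDiffOn ℝ S) {O : Set N} (hmaps : ∀ q ∈ S ∩ O, σ q ∈ (𝓔 x₀).source)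
    (hO : IsOpen O) : ∀ q ∈ S ∩ O, pull Ω σ S q = toBilin N ((chartForm Ω.form x₀ (𝓔 x₀ (σ
    q))).compContinuousLinearMap (fderivWithin ℝ (fun q => 𝓔 x₀ (σ q)) (S ∩ O) q)) := by
  intro q hq
  rw [pull_eq_chart Ω ((hσ q hq.1).mdifferentiableWithinAt (by simp)) (hS q hq.1)
    (hmaps q hq) hq.1, fderivWithin_inter (hO.mem_nhds hq.2)]

theorem exists_open_mapsTo_source {σ : N → M} {S : Set N} (hσ : ContMDiffOn 𝓘(ℝ, N) 𝓜 ∞ σ S) {p : N}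
    (hp : p ∈ S) : ∃ O, IsOpen O ∧ p ∈ O ∧ ∀ q ∈ S ∩ O, σ q ∈ (𝓔 (σ p)).source := by
  have := (hσ p hp).continuousWithinAt.preimage_mem_nhdsWithin
    ((isOpen_extChartAt_source (I := 𝓜) (σ p)).mem_nhds (mem_extChartAt_source (σ p)))
  obtain ⟨O, hO, hpO, hsub⟩ := mem_nhdsWithin.1 this
  exact ⟨O, hO, hpO, fun q hq => hsub ⟨hq.2, hq.1⟩⟩

theorem contDiffOn_chart_comp {σ : N → M} {S O : Set N} (hσ : ContMDiffOn 𝓘(ℝ, N) 𝓜 ∞ σ S) (hmaps :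
  ∀ q ∈ S ∩ O, σ q ∈ (𝓔 x₀).source) : 𝒞 (fun q => 𝓔 x₀ (σ q)) (S ∩ O) := fun q hq =>
  ((contMDiffAt_extChartAt_of_mem (hmaps q hq)).comp_contMDiffWithinAt q ((hσ q hq.1).mono
  inter_subset_left)).contDiffWithinAt

/-- The pullback of a symplectic form is smooth. -/
theorem contDiffOn_pull (Ω : SymplecticForm n M) {σ : N → M} {S : Set N} (hσ : ContMDiffOn 𝓘(ℝ, N) 𝓜
    ∞ σ S) (hS : UniqueDiffOn ℝ S) : 𝒞 (pull Ω σ S) S := by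
  intro p hp
  obtain ⟨O, hO, hpO, hmaps⟩ := exists_open_mapsTo_source hσ hp
  have hf := contDiffOn_chart_comp hσ hmaps
  have hSO : UniqueDiffOn ℝ (S ∩ O) := hS.inter hO
  set f := fun q => 𝓔 (σ p) (σ q)
  have hD : 𝒞 (fderivWithin ℝ f (S ∩ O)) (S ∩ O) := hf.fderivWithin hSO (by simp)
  have hω : 𝒞 (fun q => toBilin (E n) (chartForm Ω.form (σ p) (f q))) (S ∩ O) :=
    contDiff_toBilin.comp_contDiffOn ((Ω.smooth (σ p)).comp hf fun q hq => (𝓔 (σ p)).map_source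
    (hmaps q hq))
  have h1 : 𝒞 (fun q => ((toBilin (E n) (chartForm Ω.form (σ p) (f q))).comp
      (fderivWithin ℝ f (S ∩ O) q)).flip.comp (fderivWithin ℝ f (S ∩ O) q)) (S ∩ O) := by
    refine ContDiffOn.clm_comp ?_ hD
    exact contDiff_flip.comp_contDiffOn (hω.clm_comp hD)
  have h2 := contDiff_flip.comp_contDiffOn h1
  have h3 : 𝒞 (pull Ω σ S) (S ∩ O) := by
    refine h2.congr fun q hq => ?_
    rw [pull_eventuallyEq_chart Ω hσ hS hmaps hO q hq]
    ext u w
    rw [toBilin_apply, ContinuousAlternatingMap.compContinuousLinearMap_apply]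
    simp only [Function.comp_apply, ContinuousLinearMap.flip_apply, ContinuousLinearMap.comp_apply, toBilin_apply]
    congr 1
    ext i; fin_cases i <;> rfl
  exact (contDiffWithinAt_inter (hO.mem_nhds hpO)).1 (h3 p ⟨hp, hpO⟩)

/-- The pullback of a symplectic form is closed. -/
theorem pull_closed (Ω : SymplecticForm n M) {σ : N → M} {S : Set N} (hσ : ContMDiffOn 𝓘(ℝ, N) 𝓜 ∞ σ
    S) (hS : UniqueDiffOn ℝ S) (hcl : S ⊆ closure (interior S)) {p : N} (hp : p ∈ S) (a b c : N) :
    fderivWithin ℝ (pull Ω σ S) S p a b c - fderivWithin ℝ (pull Ω σ S) S p b a c + fderivWithin ℝ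
    (pull Ω σ S) S p c a b = 0 := by
  obtain ⟨O, hO, hpO, hmaps⟩ := exists_open_mapsTo_source hσ hp
  have hf := contDiffOn_chart_comp hσ hmaps
  have hSO : UniqueDiffOn ℝ (S ∩ O) := hS.inter hO
  set f := fun q => 𝓔 (σ p) (σ q)
  have hmem : f p ∈ (𝓔 (σ p)).target := (𝓔 (σ p)).map_source (hmaps p ⟨hp, hpO⟩)
  have hopen := isOpen_extChartAt_target (I := 𝓜) (σ p)
  have hωd : DifferentiableWithinAt ℝ (chartForm Ω.form (σ p))
      (𝓔 (σ p)).target (f p) := (Ω.smooth (σ p)).differentiableOn (by simp) _ hmem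
  have hpc : p ∈ closure (interior (S ∩ O)) := by
    rw [interior_inter, hO.interior_eq]
    exact hO.closure_inter ⟨hcl hp, hpO⟩
  have hext := extDerivWithin_pullback hωd (hf p ⟨hp, hpO⟩)
    (minSmoothness_of_isRCLikeNormedField.trans_le (mod_cast le_top : ((2 : ℕ∞) : WithTop ℕ∞) ≤ ∞))
    hSO hpc ⟨hp, hpO⟩ (fun q hq => (𝓔 (σ p)).map_source (hmaps q hq))
  have hz : extDerivWithin (chartForm Ω.form (σ p)) (𝓔 (σ p)).target (f p) = 0 := by
    have h0 := Ω.closed (σ p) (f p) hmem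
    rw [extDeriv] at h0
    rw [extDerivWithin, fderivWithin_of_isOpen hopen hmem]
    exact h0
  rw [hz] at hext
  have hext' : extDerivWithin (fun x => (chartForm Ω.form (σ p) (f x)).compContinuousLinearMap
      (fderivWithin ℝ f (S ∩ O) x)) (S ∩ O) p = 0 := by
    rw [hext]; rfl
  have hdiff : DifferentiableWithinAt ℝ (fun x => (chartForm Ω.form (σ p) (f x)).compContinuousLinearMap
      (fderivWithin ℝ f (S ∩ O) x)) (S ∩ O) p := by
    refine DifferentiableWithinAt.continuousAlternatingMapCompContinuousLinearMap ?_ ?_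
    · exact hωd.comp p ((hf p ⟨hp, hpO⟩).differentiableWithinAt (by simp))
        (fun q hq => (𝓔 (σ p)).map_source (hmaps q hq))
    · exact (hf.fderivWithin hSO (m := ∞) (by simp)).differentiableOn (by simp) p ⟨hp, hpO⟩
  have key := extDerivWithin_eq_zero_iff_cyclic hdiff (hSO p ⟨hp, hpO⟩) hext' a b c
  have hcongr : fderivWithin ℝ (fun q => toBilin N ((chartForm Ω.form (σ p) (f q)).compContinuousLinearMap
      (fderivWithin ℝ f (S ∩ O) q))) (S ∩ O) p = fderivWithin ℝ (pull Ω σ S) S p := by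
    rw [← fderivWithin_inter (f := pull Ω σ S) (s := S) (hO.mem_nhds hpO)]
    exact fderivWithin_congr (fun q hq => (pull_eventuallyEq_chart Ω hσ hS hmaps hO q hq).symm)
      (pull_eventuallyEq_chart Ω hσ hS hmaps hO p ⟨hp, hpO⟩).symm
  rw [hcongr] at key
  exact key

end Pull

section PullComp

variable [IsManifold (𝓡 (2 * n)) ∞ M]
variable {N N' : Type} [NormedAddCommGroup N] [NormedSpace ℝ N]
  [NormedAddCommGroup N'] [NormedSpace ℝ N']

theorem mfderivWithin_comp_linear {σ : N → M} {S : Set N} {T : Set N'} {j : N' → N} {z : N'} {j' :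
    N' →L[ℝ] N} (hσ : MDifferentiableWithinAt 𝓘(ℝ, N) 𝓜 σ S (j z)) (hj : HasFDerivWithinAt j j' T z)
    (hmaps : MapsTo j T S) (hT : UniqueDiffWithinAt ℝ T z) (v : N') : (mfderivWithin 𝓘(ℝ, N') 𝓜 (fun
    z => σ (j z)) T z v : E n) = (mfderivWithin 𝓘(ℝ, N) 𝓜 σ S (j z) (j' v) : E n) := by
  have h := mfderivWithin_comp (I := 𝓘(ℝ, N')) (I' := 𝓘(ℝ, N)) (I'' := 𝓜) (M' := N)
    (M'' := M) z (g := σ) (f := j) (u := S) hσ hj.differentiableWithinAt.mdifferentiableWithinAt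
    hmaps hT.uniqueMDiffWithinAt
  rw [mfderivWithin_eq_fderivWithin, hj.fderivWithin hT] at h
  exact DFunLike.congr_fun h v

theorem hasFDerivWithinAt_pull_comp (Ω : SymplecticForm n M) {σ : N → M} {S : Set N} (hσ :
  ContMDiffOn 𝓘(ℝ, N) 𝓜 ∞ σ S) (hS : UniqueDiffOn ℝ S) {T : Set N'} {j : N' → N} {z : N'} {j' : N'
  →L[ℝ] N} (hz : j z ∈ S) (hj : HasFDerivWithinAt j j' T z) (hmaps : MapsTo j T S) :
  HasFDerivWithinAt (fun z => pull Ω σ S (j z)) ((fderivWithin ℝ (pull Ω σ S) S (j z)).comp j') T z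
  := HasFDerivWithinAt.comp z ((contDiffOn_pull Ω hσ hS).differentiableOn (by simp) _
  hz).hasFDerivWithinAt hj hmaps

end PullComp

section Family

/-- A family of diffeomorphisms in the coordinates of a chart of the source. -/
def famMap (φ : ℝ → ℝ → Diffeo n M) (x₀ : M) (q : 𝔓 n) : M :=
  φ q.1 q.2.1 ((𝓔 x₀).symm q.2.2)

/-- The parameter domain of a family in the coordinates of a chart of the source. -/
def famDom (n : ℕ) {M : Type*} [TopologicalSpace M] [ChartedSpace (E n) M] (ε₀ : ℝ) (x₀ : M) :
    Set (𝔓 n) :=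
  Ioo (-ε₀) ε₀ ×ˢ 𝕀 ×ˢ (extChartAt (𝓡 (2 * n)) x₀).target

/-- A family of Hamiltonian paths starting at the identity. -/
structure IsFamily (Ω : SymplecticForm n M) (ε₀ : ℝ) (φ : ℝ → ℝ → Diffeo n M)
    (Φ : ℝ → ℝ → M → ℝ) : Prop where
  pos : 0 < ε₀
  smooth : ContMDiffOn (𝓘(ℝ, ℝ).prod 𝓣) 𝓜 ∞
    (fun p : ℝ × ℝ × M => φ p.1 p.2.1 p.2.2) (Ioo (-ε₀) ε₀ ×ˢ 𝕀 ×ˢ univ)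
  ham : ∀ ε ∈ Ioo (-ε₀) ε₀, ContMDiffOn 𝓣 𝓘₁ ∞ (fun p : ℝ × M => Φ ε p.1 p.2) (𝕀 ×ˢ univ)
  gen : ∀ ε ∈ Ioo (-ε₀) ε₀, Generates Ω (Φ ε) (φ ε)
  start : ∀ ε ∈ Ioo (-ε₀) ε₀, ∀ x : M, φ ε 0 x = x

/-- The direction of time in the parameter space. -/
def dirT (n : ℕ) : 𝔓 n := (0, 1, 0)

/-- The direction of the deformation parameter in the parameter space. -/
def dirE (n : ℕ) : 𝔓 n := (1, 0, 0)

/-- The spatial directions in the parameter space. -/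
def dirX (n : ℕ) : E n →L[ℝ] 𝔓 n :=
  (ContinuousLinearMap.inr ℝ ℝ (ℝ × E n)).comp (ContinuousLinearMap.inr ℝ ℝ (E n))

@[simp] theorem dirX_apply (u : E n) : dirX n u = (0, 0, u) := rfl

theorem uniqueDiffOn_famDom (ε₀ : ℝ) (x₀ : M) : UniqueDiffOn ℝ (famDom n ε₀ x₀) :=
  isOpen_Ioo.uniqueDiffOn.prod (uniqueDiffOn_unit.prod (isOpen_extChartAt_target x₀).uniqueDiffOn)

theorem famDom_subset_closure_interior (ε₀ : ℝ) (x₀ : M) :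
    famDom n ε₀ x₀ ⊆ closure (interior (famDom n ε₀ x₀)) := by
  rw [famDom, interior_prod_eq, interior_prod_eq, closure_prod_eq, closure_prod_eq,
    isOpen_Ioo.interior_eq, (isOpen_extChartAt_target (I := 𝓜) x₀).interior_eq,
    interior_Icc, closure_Ioo zero_ne_one]
  exact prod_mono subset_closure (prod_mono subset_rfl subset_closure)

theorem hasFDerivAt_sliceX (ε t : ℝ) (y : E n) :
    HasFDerivAt (fun y : E n => ((ε, t, y) : 𝔓 n)) (dirX n) y := by
  have h := ((dirX n).hasFDerivAt (x := y)).const_add ((ε, t, 0) : 𝔓 n)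
  simpa using h

theorem hasFDerivAt_sliceT (ε t : ℝ) (y : E n) : HasFDerivAt (fun t : ℝ => ((ε, t, y) : 𝔓 n))
    (ContinuousLinearMap.toSpanSingleton ℝ (dirT n)) t := by
  have h := ((ContinuousLinearMap.toSpanSingleton ℝ (dirT n)).hasFDerivAt (x := t)).const_add
    ((ε, 0, y) : 𝔓 n)
  simpa [dirT] using h

theorem hasFDerivAt_sliceE (ε t : ℝ) (y : E n) : HasFDerivAt (fun ε : ℝ => ((ε, t, y) : 𝔓 n))
    (ContinuousLinearMap.toSpanSingleton ℝ (dirE n)) ε := by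
  have h := ((ContinuousLinearMap.toSpanSingleton ℝ (dirE n)).hasFDerivAt (x := ε)).const_add
    ((0, t, y) : 𝔓 n)
  simpa [dirE] using h

variable [IsManifold (𝓡 (2 * n)) ∞ M]

theorem contMDiffOn_famMap (hs : ContMDiffOn (𝓘(ℝ, ℝ).prod 𝓣) 𝓜 ∞ (fun p : ℝ × ℝ × M => φ p.1 p.2.1
    p.2.2) (Ioo (-ε₀) ε₀ ×ˢ 𝕀 ×ˢ univ)) (x₀ : M) : ContMDiffOn 𝓘(ℝ, 𝔓 n) 𝓜 ∞ (famMap φ x₀) (famDom n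
    ε₀ x₀) := by
  have h1 : ContMDiffOn 𝓘(ℝ, 𝔓 n) (𝓘(ℝ, ℝ).prod 𝓣) ∞ (fun q : 𝔓 n => (q.1, q.2.1, (𝓔 x₀).symm
      q.2.2)) (famDom n ε₀ x₀) := by
    refine contDiff_fst.contMDiff.contMDiffOn.prodMk
      ((contDiff_fst.comp contDiff_snd).contMDiff.contMDiffOn.prodMk ?_)
    exact (contMDiffOn_extChartAt_symm x₀).comp
      (contDiff_snd.comp contDiff_snd).contMDiff.contMDiffOn (fun q hq => hq.2.2)
  exact hs.comp h1 fun q hq => ⟨hq.1, hq.2.1, mem_univ _⟩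

/-- The symplectic form pulled back to the parameter space of a family. -/
def famForm (Ω : SymplecticForm n M) (ε₀ : ℝ) (φ : ℝ → ℝ → Diffeo n M) (x₀ : M) :
    𝔓 n → (𝔓 n) →L[ℝ] (𝔓 n) →L[ℝ] ℝ :=
  pull Ω (famMap φ x₀) (famDom n ε₀ x₀)

namespace IsFamily

variable (h : IsFamily Ω ε₀ φ Φ)
include h

theorem contMDiff_ham (hε : ε ∈ Ioo (-ε₀) ε₀) (ht : t ∈ 𝕀) : ContMDiff 𝓜 𝓘₁ ∞ (Φ ε t) := by
  rw [← contMDiffOn_univ]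
  exact (h.ham ε hε).comp (contMDiffOn_const.prodMk contMDiffOn_id) fun x _ => ⟨ht, mem_univ _⟩

theorem mdiff {q : 𝔓 n} (hq : q ∈ famDom n ε₀ x₀) : MDifferentiableWithinAt 𝓘(ℝ, 𝔓 n) 𝓜 (famMap φ
  x₀) (famDom n ε₀ x₀) q := (contMDiffOn_famMap h.smooth x₀ q hq).mdifferentiableWithinAt (by simp)

theorem mfderivWithin_dirT (hq : (ε, t, y) ∈ famDom n ε₀ x₀) : (mfderivWithin 𝓘(ℝ, 𝔓 n) 𝓜 (famMap φ
    x₀) (famDom n ε₀ x₀) (ε, t, y) (dirT n) : E n) = (mfderivWithin 𝓘₁ 𝓜 (fun s : ℝ => φ ε s ((𝓔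
    x₀).symm y)) 𝕀 t (1 : ℝ) : E n) := by
  have := mfderivWithin_comp_linear (T := 𝕀) (j := fun s : ℝ => (ε, s, y)) (z := t)
    (h.mdiff hq) (hasFDerivAt_sliceT ε t y).hasFDerivWithinAt (fun s hs => ⟨hq.1, hs, hq.2.2⟩)
    (uniqueDiffOn_unit t hq.2.1) 1
  rw [ContinuousLinearMap.toSpanSingleton_apply, one_smul] at this
  exact this.symm

theorem mfderivWithin_dirE (hq : (ε, t, y) ∈ famDom n ε₀ x₀) : (mfderivWithin 𝓘(ℝ, 𝔓 n) 𝓜 (famMap φ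
    x₀) (famDom n ε₀ x₀) (ε, t, y) (dirE n) : E n) = (mfderiv 𝓘₁ 𝓜 (fun ε : ℝ => φ ε t ((𝓔 x₀).symm
    y)) ε (1 : ℝ) : E n) := by
  have := mfderivWithin_comp_linear (T := Ioo (-ε₀) ε₀) (j := fun s : ℝ => (s, t, y)) (z := ε)
    (h.mdiff hq) (hasFDerivAt_sliceE ε t y).hasFDerivWithinAt (fun s hs => ⟨hs, hq.2.1, hq.2.2⟩)
    (isOpen_Ioo.uniqueDiffOn ε hq.1) 1
  rw [ContinuousLinearMap.toSpanSingleton_apply, one_smul,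
    mfderivWithin_of_isOpen isOpen_Ioo hq.1] at this
  exact this.symm

theorem mfderivWithin_dirX (hq : (ε, t, y) ∈ famDom n ε₀ x₀) (u : E n) : (mfderivWithin 𝓘(ℝ, 𝔓 n) 𝓜
    (famMap φ x₀) (famDom n ε₀ x₀) (ε, t, y) (dirX n u) : E n) = (mfderiv 𝓘(ℝ, E n) 𝓜 (fun y : E n
    => φ ε t ((𝓔 x₀).symm y)) y u : E n) := by
  have := mfderivWithin_comp_linear (T := (𝓔 x₀).target) (j := fun y => (ε, t, y)) (z := y) (h.mdiff
    hq) (hasFDerivAt_sliceX ε t y).hasFDerivWithinAt (fun s hs => ⟨hq.1, hq.2.1, hs⟩)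
    ((isOpen_extChartAt_target x₀).uniqueDiffOn y hq.2.2) u
  rw [mfderivWithin_of_isOpen (isOpen_extChartAt_target x₀) hq.2.2] at this
  exact this.symm

/-- The differential of the Hamiltonian along the family. -/
theorem hasFDerivAt_ham (hq : (ε, t, y) ∈ famDom n ε₀ x₀) : HasFDerivAt (fun y => Φ ε t (famMap φ x₀
    (ε, t, y))) (-(famForm Ω ε₀ φ x₀ (ε, t, y) (dirT n)).comp (dirX n)) y := by
  have hσ : MDifferentiableAt 𝓘(ℝ, E n) 𝓜 (fun y => famMap φ x₀ (ε, t, y)) y := by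
    have h1 : MDifferentiableWithinAt 𝓘(ℝ, E n) 𝓜 (fun y => famMap φ x₀ (ε, t, y)) (𝓔 x₀).target y
      := MDifferentiableWithinAt.comp (f := fun y : E n => ((ε, t, y) : 𝔓 n)) (I' := 𝓘(ℝ, 𝔓 n)) (u
      := famDom n ε₀ x₀) y (h.mdiff hq) (hasFDerivAt_sliceX ε t
      y).differentiableAt.mdifferentiableAt.mdifferentiableWithinAt fun z hz => ⟨hq.1, hq.2.1, hz⟩
    exact h1.mdifferentiableAt ((isOpen_extChartAt_target x₀).mem_nhds hq.2.2)
  have hΦ : MDifferentiableAt 𝓜 𝓘₁ (Φ ε t) (famMap φ x₀ (ε, t, y)) :=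
    (h.contMDiff_ham hq.1 hq.2.1).mdifferentiableAt (by simp)
  have hcomp := hΦ.hasMFDerivAt.comp y hσ.hasMFDerivAt
  have hf := hcomp.hasFDerivAt
  refine hf.congr_fderiv ?_
  ext u
  have hg := h.gen ε hq.1 t hq.2.1 ((𝓔 x₀).symm y) (mfderivWithin 𝓘(ℝ, 𝔓 n) 𝓜 (famMap φ x₀) (famDom
    n ε₀ x₀) (ε, t, y) (dirX n u))
  have hX := h.mfderivWithin_dirX hq u
  have hT := h.mfderivWithin_dirT hq
  have hp : famForm Ω ε₀ φ x₀ (ε, t, y) (dirT n) (dirX n u) = Ω.form (φ ε t ((𝓔 x₀).symm y))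
      ![(mfderivWithin 𝓘₁ 𝓜 (fun s : ℝ => φ ε s ((𝓔 x₀).symm y)) 𝕀 t (1 : ℝ)), mfderivWithin 𝓘(ℝ, 𝔓
      n) 𝓜 (famMap φ x₀) (famDom n ε₀ x₀) (ε, t, y) (dirX n u)] := by
    rw [famForm, pull_apply]
    refine congrArg (Ω.form (famMap φ x₀ (ε, t, y))) ?_
    funext i; fin_cases i
    · exact hT
    · rfl
  have e1 : (-(famForm Ω ε₀ φ x₀ (ε, t, y) (dirT n)).comp (dirX n)) u
      = -(famForm Ω ε₀ φ x₀ (ε, t, y) (dirT n) (dirX n u)) := rfl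
  refine Eq.trans ?_ (e1.trans (congrArg Neg.neg (hp.trans hg))).symm
  refine Eq.trans ?_ (neg_neg _).symm
  exact (congrArg (mfderiv 𝓜 𝓘₁ (Φ ε t) (famMap φ x₀ (ε, t, y))) hX).symm

theorem contDiffOn_form (x₀ : M) : 𝒞 (famForm Ω ε₀ φ x₀) (famDom n ε₀ x₀) := contDiffOn_pull Ω
  (contMDiffOn_famMap h.smooth x₀) (uniqueDiffOn_famDom ε₀ x₀)

theorem form_closed {q : 𝔓 n} (hq : q ∈ famDom n ε₀ x₀) (a b c : 𝔓 n) : fderivWithin ℝ (famForm Ω ε₀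
  φ x₀) (famDom n ε₀ x₀) q a b c - fderivWithin ℝ (famForm Ω ε₀ φ x₀) (famDom n ε₀ x₀) q b a c +
  fderivWithin ℝ (famForm Ω ε₀ φ x₀) (famDom n ε₀ x₀) q c a b = 0 := pull_closed Ω
  (contMDiffOn_famMap h.smooth x₀) (uniqueDiffOn_famDom ε₀ x₀) (famDom_subset_closure_interior ε₀
  x₀) hq a b c

theorem hasFDerivWithinAt_form {q : 𝔓 n} (hq : q ∈ famDom n ε₀ x₀) : HasFDerivWithinAt (famForm Ω ε₀
  φ x₀) (fderivWithin ℝ (famForm Ω ε₀ φ x₀) (famDom n ε₀ x₀) q) (famDom n ε₀ x₀) q :=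
  ((h.contDiffOn_form x₀).differentiableOn (by simp) q hq).hasFDerivWithinAt

theorem hasFDerivAt_form_sliceX (hq : (ε, t, y) ∈ famDom n ε₀ x₀) (a b : 𝔓 n) : HasFDerivAt (fun y
    => famForm Ω ε₀ φ x₀ (ε, t, y) a b) ((((fderivWithin ℝ (famForm Ω ε₀ φ x₀) (famDom n ε₀ x₀) (ε,
    t, y)).comp (dirX n)).flip a).flip b) y := by
  have h1 : HasFDerivWithinAt (fun y => famForm Ω ε₀ φ x₀ (ε, t, y)) ((fderivWithin ℝ (famForm Ω ε₀
    φ x₀) (famDom n ε₀ x₀) (ε, t, y)).comp (dirX n)) (𝓔 x₀).target y := hasFDerivWithinAt_pull_comp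
    Ω (contMDiffOn_famMap h.smooth x₀) (uniqueDiffOn_famDom ε₀ x₀) hq (hasFDerivAt_sliceX ε t
    y).hasFDerivWithinAt fun z hz => ⟨hq.1, hq.2.1, hz⟩
  have h2 := h1.hasFDerivAt ((isOpen_extChartAt_target x₀).mem_nhds hq.2.2)
  have h3 := (h2.clm_apply (hasFDerivAt_const a y)).clm_apply (hasFDerivAt_const b y)
  refine h3.congr_fderiv ?_
  ext u
  simp

theorem hasDerivWithinAt_form_sliceT (hq : (ε, t, y) ∈ famDom n ε₀ x₀) (a b : 𝔓 n) :
    HasDerivWithinAt (fun t => famForm Ω ε₀ φ x₀ (ε, t, y) a b) (fderivWithin ℝ (famForm Ω ε₀ φ x₀)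
    (famDom n ε₀ x₀) (ε, t, y) (dirT n) a b) 𝕀 t := by
  have h1 : HasFDerivWithinAt (fun t => famForm Ω ε₀ φ x₀ (ε, t, y)) ((fderivWithin ℝ (famForm Ω ε₀
    φ x₀) (famDom n ε₀ x₀) (ε, t, y)).comp (ContinuousLinearMap.toSpanSingleton ℝ (dirT n))) 𝕀 t :=
    hasFDerivWithinAt_pull_comp Ω (contMDiffOn_famMap h.smooth x₀) (uniqueDiffOn_famDom ε₀ x₀) hq
    (hasFDerivAt_sliceT ε t y).hasFDerivWithinAt fun z hz => ⟨hq.1, hz, hq.2.2⟩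
  have h3 := ((h1.clm_apply (hasFDerivWithinAt_const a t _)).clm_apply
    (hasFDerivWithinAt_const b t _)).hasDerivWithinAt
  refine h3.congr_deriv ?_
  simp

/-- The flows preserve the symplectic form, infinitesimally. -/
theorem fderivWithin_form_dirT (hq : (ε, t, y) ∈ famDom n ε₀ x₀) (u w : E n) : fderivWithin ℝ
    (famForm Ω ε₀ φ x₀) (famDom n ε₀ x₀) (ε, t, y) (dirT n) (dirX n u) (dirX n w) = 0 := by
  have hcl := h.form_closed hq (dirT n) (dirX n u) (dirX n w)
  have hnear : ∀ᶠ z in 𝓝 y, HasFDerivAt (fun y => Φ ε t (famMap φ x₀ (ε, t, y)))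
      (-(famForm Ω ε₀ φ x₀ (ε, t, z) (dirT n)).comp (dirX n)) z := by
    filter_upwards [(isOpen_extChartAt_target x₀).mem_nhds hq.2.2] with z hz
    exact h.hasFDerivAt_ham ⟨hq.1, hq.2.1, hz⟩
  have h1 : HasFDerivWithinAt (fun y => famForm Ω ε₀ φ x₀ (ε, t, y)) ((fderivWithin ℝ (famForm Ω ε₀
    φ x₀) (famDom n ε₀ x₀) (ε, t, y)).comp (dirX n)) (𝓔 x₀).target y := hasFDerivWithinAt_pull_comp
    Ω (contMDiffOn_famMap h.smooth x₀) (uniqueDiffOn_famDom ε₀ x₀) hq (hasFDerivAt_sliceX ε t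
    y).hasFDerivWithinAt fun z hz => ⟨hq.1, hq.2.1, hz⟩
  have h2 := h1.hasFDerivAt ((isOpen_extChartAt_target x₀).mem_nhds hq.2.2)
  have h3 := (((h2.clm_apply (hasFDerivAt_const (dirT n) y)).clm_comp
    (hasFDerivAt_const (dirX n) y)).neg)
  have h4 := h3.congr_fderiv (g' := -(((ContinuousLinearMap.compL ℝ (E n) (𝔓 n) ℝ).flip (dirX
    n)).comp (((fderivWithin ℝ (famForm Ω ε₀ φ x₀) (famDom n ε₀ x₀) (ε, t, y)).comp (dirX n)).flip
    (dirT n)))) (by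
    rw [ContinuousLinearMap.comp_zero, ContinuousLinearMap.comp_zero, zero_add, zero_add])
  have hs : -(fderivWithin ℝ (famForm Ω ε₀ φ x₀) (famDom n ε₀ x₀) (ε, t, y) (dirX n u) (dirT n)
      (dirX n w)) = -(fderivWithin ℝ (famForm Ω ε₀ φ x₀) (famDom n ε₀ x₀) (ε, t, y) (dirX n w)
      (dirT n) (dirX n u)) := second_derivative_symmetric_of_eventually hnear h4 u w
  linear_combination hcl - hs

/-- The flows preserve the symplectic form. -/
theorem form_dirX (hq : (ε, t, y) ∈ famDom n ε₀ x₀) (u w : E n) : famForm Ω ε₀ φ x₀ (ε, t, y) (dirX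
    n u) (dirX n w) = chartForm Ω.form x₀ y ![u, w] := by
  have hmem : ∀ s ∈ 𝕀, (ε, s, y) ∈ famDom n ε₀ x₀ := fun s hs => ⟨hq.1, hs, hq.2.2⟩
  have hconst := constant_of_derivWithin_zero (a := 0) (b := 1) (f := fun s => famForm Ω ε₀ φ x₀ (ε,
    s, y) (dirX n u) (dirX n w)) (fun s hs => (h.hasDerivWithinAt_form_sliceT (hmem s hs) _
    _).differentiableWithinAt) (fun s hs => by
      rw [(h.hasDerivWithinAt_form_sliceT (hmem s (Ico_subset_Icc_self hs)) _ _).derivWithin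
        (uniqueDiffOn_unit s (Ico_subset_Icc_self hs))]
      exact h.fderivWithin_form_dirT (hmem s (Ico_subset_Icc_self hs)) u w) t hq.2.1
  have h0 : (0 : ℝ) ∈ 𝕀 := by simp
  refine hconst.trans ?_
  have hX' := h.mfderivWithin_dirX (hmem 0 h0)
  have hid : (fun y : E n => φ ε 0 ((𝓔 x₀).symm y)) = (𝓔 x₀).symm := by
    funext z; exact h.start ε hq.1 _
  have hX : ∀ u : E n, (mfderivWithin 𝓘(ℝ, 𝔓 n) 𝓜 (famMap φ x₀) (famDom n ε₀ x₀) (ε, 0, y) (dirX n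
      u) : E n) = (mfderiv 𝓘(ℝ, E n) 𝓜 (𝓔 x₀).symm y u : E n) := by
    intro u
    have := hX' u
    rw [hid] at this
    exact this
  rw [famForm, pull_apply, chartForm_apply]
  have hpt : famMap φ x₀ (ε, 0, y) = (𝓔 x₀).symm y := h.start ε hq.1 _
  refine Eq.trans ?_ (form_congr_point Ω hpt _ _)
  refine congrArg (Ω.form (famMap φ x₀ (ε, 0, y))) ?_
  funext i; fin_cases i
  · exact hX u
  · exact hX w

end IsFamily

end Family

section Slices

variable {N : Type} [NormedAddCommGroup N] [NormedSpace ℝ N]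

theorem exists_hasFDerivAt_integral_unit {U : Set N} (hU : IsOpen U) {G : N × ℝ → ℝ} (hG :
    ContDiffOn ℝ 1 G (U ×ˢ 𝕀)) {p : N} (hp : p ∈ U) {G' : ℝ → N →L[ℝ] ℝ} (hG' : ∀ t ∈ 𝕀, HasFDerivAt
    (fun q => G (q, t)) (G' t) p) : ∃ L : N →L[ℝ] ℝ, HasFDerivAt (fun q => ∫ t in 0..1, G (q, t)) L
    p ∧ ∀ w, L w = ∫ t in 0..1, G' t w := by
  obtain ⟨r, hr, hball⟩ := Metric.isOpen_iff.1 hU p hp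
  have hB : ContDiffOn ℝ 1 G (ball p r ×ˢ 𝕀) := hG.mono (prod_mono hball subset_rfl)
  have hud : UniqueDiffOn ℝ (ball p r ×ˢ 𝕀) :=
    Metric.isOpen_ball.uniqueDiffOn.prod uniqueDiffOn_unit
  have hpB : p ∈ ball p r := mem_ball_self hr
  have h := hasFDerivWithinAt_integral_unit (convex_ball p r) Metric.isOpen_ball.uniqueDiffOn hB hpB
  refine ⟨_, h.hasFDerivAt (Metric.isOpen_ball.mem_nhds hpB), fun w => ?_⟩
  have hcont : ContinuousOn (fun t : ℝ => (fderivWithin ℝ G (ball p r ×ˢ 𝕀)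
      (p, t)).comp (ContinuousLinearMap.inl ℝ N ℝ)) (Icc 0 1) := by
    have h1 := hB.continuousOn_fderivWithin hud le_rfl
    have h2 : ContinuousOn (fun t : ℝ => fderivWithin ℝ G (ball p r ×ˢ 𝕀) (p, t)) (Icc 0 1) :=
      h1.comp (by fun_prop : ContinuousOn (fun t : ℝ => (p, t)) (Icc 0 1)) fun t ht => ⟨hpB, ht⟩
    exact h2.clm_comp continuousOn_const
  rw [ContinuousLinearMap.intervalIntegral_apply (by
    apply ContinuousOn.intervalIntegrable; rwa [uIcc_unit])]
  refine integral_congr_unit fun t ht => ?_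
  have h3 : HasFDerivWithinAt (fun q => G (q, t)) ((fderivWithin ℝ G (ball p r ×ˢ 𝕀) (p, t)).comp
    (ContinuousLinearMap.inl ℝ N ℝ)) (ball p r) p := HasFDerivWithinAt.comp p ((hB.differentiableOn
    one_ne_zero (p, t) ⟨hpB, ht⟩).hasFDerivWithinAt) (hasFDerivAt_prodMk_left p t).hasFDerivWithinAt
    fun q hq => ⟨hq, ht⟩
  exact congrArg (fun L : N →L[ℝ] ℝ => L w)
    ((h3.hasFDerivAt (Metric.isOpen_ball.mem_nhds hpB)).unique (hG' t ht))

theorem hasDerivAt_integral_unit {U : Set ℝ} (hU : IsOpen U) {G : ℝ × ℝ → ℝ} (hG : ContDiffOn ℝ 1 G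
    (U ×ˢ 𝕀)) {p : ℝ} (hp : p ∈ U) {G' : ℝ → ℝ} (hG' : ∀ t ∈ 𝕀, HasDerivAt (fun q => G (q, t)) (G'
    t) p) : HasDerivAt (fun q => ∫ t in 0..1, G (q, t)) (∫ t in 0..1, G' t) p := by
  obtain ⟨L, hL, hL'⟩ := exists_hasFDerivAt_integral_unit hU hG hp
    (G' := fun t => ContinuousLinearMap.toSpanSingleton ℝ (G' t)) fun t ht => (hG' t ht).hasFDerivAt
  refine hL.hasDerivAt.congr_deriv ?_
  simp [hL']

end Slices

section Family

/-- The Hamiltonian along the family, relative to its value at a given point. -/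
def relHam (φ : ℝ → ℝ → Diffeo n M) (Φ : ℝ → ℝ → M → ℝ) (p : M) (ε t : ℝ) (x : M) : ℝ :=
  Φ ε t (φ ε t x) - Φ ε t (φ ε t p)

/-- The value of the form on the two velocities of the family. -/
def areaDensity (Ω : SymplecticForm n M) (φ : ℝ → ℝ → Diffeo n M) (ε t : ℝ) (x : M) : ℝ :=
  Ω.form (φ ε t x)
    ![mfderivWithin 𝓘₁ 𝓜 (fun s : ℝ => φ ε s x) 𝕀 t (1 : ℝ),
      mfderiv 𝓘₁ 𝓜 (fun ε : ℝ => φ ε t x) ε (1 : ℝ)]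

theorem hasFDerivAt_comp_sliceX {g : 𝔓 n → ℝ} {L : 𝔓 n →L[ℝ] ℝ} (hg : HasFDerivWithinAt g L (famDom
  n ε₀ x₀) (ε, t, y)) (hq : (ε, t, y) ∈ famDom n ε₀ x₀) : HasFDerivAt (fun y => g (ε, t, y)) (L.comp
  (dirX n)) y := (HasFDerivWithinAt.comp (f := fun y => (ε, t, y)) y hg (hasFDerivAt_sliceX ε t
  y).hasFDerivWithinAt fun _ hz => ⟨hq.1, hq.2.1, hz⟩).hasFDerivAt ((isOpen_extChartAt_target
  x₀).mem_nhds hq.2.2)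

theorem hasDerivAt_comp_sliceE {g : 𝔓 n → ℝ} {L : 𝔓 n →L[ℝ] ℝ} (hg : HasFDerivWithinAt g L (famDom n
    ε₀ x₀) (ε, t, y)) (hq : (ε, t, y) ∈ famDom n ε₀ x₀) : HasDerivAt (fun ε => g (ε, t, y)) (L (dirE
    n)) ε := by
  have h := (HasFDerivWithinAt.comp (f := fun ε => (ε, t, y)) ε hg
    (hasFDerivAt_sliceE ε t y).hasFDerivWithinAt (t := famDom n ε₀ x₀) (s := Ioo (-ε₀) ε₀)
    fun _ hz => ⟨hz, hq.2.1, hq.2.2⟩).hasFDerivAt (isOpen_Ioo.mem_nhds hq.1)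
  exact h.hasDerivAt.congr_deriv (by simp)

theorem famMap_extChartAt (φ : ℝ → ℝ → Diffeo n M) {x₀ x : M} (hx : x ∈ (𝓔 x₀).source) (ε t : ℝ) :
    famMap φ x₀ (ε, t, 𝓔 x₀ x) = φ ε t x := by
  rw [famMap]
  exact congrArg (φ ε t) ((𝓔 x₀).left_inv hx)

namespace IsFamily

variable [IsManifold (𝓡 (2 * n)) ∞ M] (h : IsFamily Ω ε₀ φ Φ)
include h

theorem form_dirT_dirE (hq : (ε, t, y) ∈ famDom n ε₀ x₀) : famForm Ω ε₀ φ x₀ (ε, t, y) (dirT n)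
    (dirE n) = areaDensity Ω φ ε t ((𝓔 x₀).symm y) := by
  rw [famForm, pull_apply]
  refine congrArg (Ω.form (famMap φ x₀ (ε, t, y))) ?_
  funext i; fin_cases i
  · exact h.mfderivWithin_dirT hq
  · exact h.mfderivWithin_dirE hq

theorem form_dirE_eq_zero (hq : (ε, t, y) ∈ famDom n ε₀ x₀) (hc : ∀ ε ∈ Ioo (-ε₀) ε₀, ∀ x, φ ε t x =
    φ 0 t x) (a : 𝔓 n) : famForm Ω ε₀ φ x₀ (ε, t, y) (dirE n) a = 0 := by
  have h1 : (mfderivWithin 𝓘(ℝ, 𝔓 n) 𝓜 (famMap φ x₀) (famDom n ε₀ x₀) (ε, t, y)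
        (dirE n) : E n) = 0 := by
    refine (h.mfderivWithin_dirE hq).trans ?_
    have h2 : (fun ε : ℝ => φ ε t ((𝓔 x₀).symm y)) =ᶠ[𝓝 ε] fun _ => φ 0 t ((𝓔 x₀).symm y) := by
      filter_upwards [isOpen_Ioo.mem_nhds hq.1] with ε hε
      exact hc ε hε _
    have h3 := h2.mfderiv_eq (I := 𝓘₁) (I' := 𝓜)
    rw [mfderiv_const] at h3
    exact congrArg (fun L : ℝ →L[ℝ] E n => L 1) h3
  rw [famForm, pull_apply]
  exact (Ω.form (famMap φ x₀ (ε, t, y))).map_coord_zero 0 h1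

theorem hasFDerivAt_relHam (p : M) (hq : (ε, t, y) ∈ famDom n ε₀ x₀) : HasFDerivAt (fun y => relHam
  φ Φ p ε t ((𝓔 x₀).symm y)) (-(famForm Ω ε₀ φ x₀ (ε, t, y) (dirT n)).comp (dirX n)) y :=
  (h.hasFDerivAt_ham hq).sub_const _

/-- Local integral representation of the Hamiltonian along the family. -/
theorem ham_sub_eq_integral (hε : ε ∈ Ioo (-ε₀) ε₀) (ht : t ∈ 𝕀) {y₀ : E n} {r : ℝ} (hr : ball y₀ r
    ⊆ (𝓔 x₀).target) (hy : y ∈ ball y₀ r) : Φ ε t (famMap φ x₀ (ε, t, y)) - Φ ε t (famMap φ x₀ (ε,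
    t, y₀)) = ∫ s in 0..1, -famForm Ω ε₀ φ x₀ (ε, t, y₀ + s • (y - y₀)) (dirT n) (dirX n (y - y₀))
    := by
  have hseg : ∀ s ∈ 𝕀, y₀ + s • (y - y₀) ∈ ball y₀ r := by
    intro s hs
    have hpos : 0 < r := Metric.pos_of_mem_ball hy
    exact (convex_ball y₀ r).add_smul_sub_mem (mem_ball_self hpos) hy hs
  have hd : ∀ s ∈ uIcc (0 : ℝ) 1, HasDerivAt (fun s => Φ ε t (famMap φ x₀ (ε, t, y₀ + s • (y -
      y₀)))) (-famForm Ω ε₀ φ x₀ (ε, t, y₀ + s • (y - y₀)) (dirT n) (dirX n (y - y₀))) s := by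
    intro s hs
    rw [uIcc_unit] at hs
    have h1 := h.hasFDerivAt_ham (x₀ := x₀) ⟨hε, ht, hr (hseg s hs)⟩
    have h2 : HasDerivAt (fun s : ℝ => y₀ + s • (y - y₀)) (y - y₀) s := by
      simpa using ((hasDerivAt_id s).smul_const (y - y₀)).const_add y₀
    exact h1.comp_hasDerivAt s h2
  rw [intervalIntegral.integral_eq_sub_of_hasDerivAt hd]
  · simp
  · apply intervalIntegrable_unit
    have h1 : ContinuousOn (fun s : ℝ => famForm Ω ε₀ φ x₀ (ε, t, y₀ + s • (y - y₀))) (Icc 0 1) :=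
      (h.contDiffOn_form x₀).continuousOn.comp (by fun_prop) fun s hs => ⟨hε, ht, hr (hseg s hs)⟩
    exact ((h1.clm_apply continuousOn_const).clm_apply continuousOn_const).neg

theorem contDiffOn_ham_sub {y₀ : E n} {r : ℝ} (hr : ball y₀ r ⊆ (𝓔 x₀).target) : 𝒞 (fun q : 𝔓 n => Φ
    q.1 q.2.1 (famMap φ x₀ (q.1, q.2.1, q.2.2)) - Φ q.1 q.2.1 (famMap φ x₀ (q.1, q.2.1, y₀))) (Ioo
    (-ε₀) ε₀ ×ˢ 𝕀 ×ˢ ball y₀ r) := by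
  set S : Set (𝔓 n) := Ioo (-ε₀) ε₀ ×ˢ 𝕀 ×ˢ ball y₀ r
  have hconv : Convex ℝ S := (convex_Ioo _ _).prod ((convex_Icc _ _).prod (convex_ball _ _))
  have hud : UniqueDiffOn ℝ S := isOpen_Ioo.uniqueDiffOn.prod
    (uniqueDiffOn_unit.prod Metric.isOpen_ball.uniqueDiffOn)
  have hj : ContDiff ℝ ∞ (fun z : (𝔓 n) × ℝ =>
      ((z.1.1, z.1.2.1, y₀ + z.2 • (z.1.2.2 - y₀)) : 𝔓 n)) := by fun_prop
  have hmaps : MapsTo (fun z : (𝔓 n) × ℝ => ((z.1.1, z.1.2.1, y₀ + z.2 • (z.1.2.2 - y₀)) : 𝔓 n)) (S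
      ×ˢ 𝕀) (famDom n ε₀ x₀) := by
    rintro ⟨⟨ε, t, y⟩, s⟩ ⟨⟨hε, ht, hy⟩, hs⟩
    exact ⟨hε, ht, hr ((convex_ball y₀ r).add_smul_sub_mem
      (mem_ball_self (Metric.pos_of_mem_ball hy)) hy hs)⟩
  have hG : 𝒞 (fun z : (𝔓 n) × ℝ => -famForm Ω ε₀ φ x₀ (z.1.1, z.1.2.1, y₀ + z.2 • (z.1.2.2 - y₀))
      (dirT n) (dirX n (z.1.2.2 - y₀))) (S ×ˢ 𝕀) := by
    have h1 := (h.contDiffOn_form x₀).comp hj.contDiffOn hmaps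
    have h2 : ContDiff ℝ ∞ (fun z : (𝔓 n) × ℝ => dirX n (z.1.2.2 - y₀)) :=
      (dirX n).contDiff.comp (by fun_prop)
    exact ((h1.clm_apply contDiffOn_const).clm_apply h2.contDiffOn).neg
  refine (contDiffOn_integral_unit hconv hud hG).congr ?_
  rintro ⟨ε, t, y⟩ ⟨hε, ht, hy⟩
  exact h.ham_sub_eq_integral hε ht hr hy

variable [ConnectedSpace M]

theorem contDiffOn_relHam_point (p x : M) :
    𝒞 (fun q : ℝ × ℝ => relHam φ Φ p q.1 q.2 x) (Ioo (-ε₀) ε₀ ×ˢ 𝕀) := by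
  let A : Set M := {x | 𝒞 (fun q : ℝ × ℝ => relHam φ Φ p q.1 q.2 x) (Ioo (-ε₀) ε₀ ×ˢ 𝕀)}
  have hloc : ∀ x : M, ∀ᶠ z in 𝓝 x, (z ∈ A ↔ x ∈ A) := by
    intro x
    have hxt := mem_extChartAt_target (I := 𝓜) x
    obtain ⟨r, hr, hball⟩ := Metric.isOpen_iff.1 (isOpen_extChartAt_target (I := 𝓜) x) _ hxt
    have hev := (continuousAt_extChartAt (I := 𝓜) x) (ball_mem_nhds _ hr)
    filter_upwards [hev, extChartAt_source_mem_nhds (I := 𝓜) x] with z hz hzs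
    have h1 := (h.contDiffOn_ham_sub hball).comp (s := Ioo (-ε₀) ε₀ ×ˢ 𝕀) (g := fun q : 𝔓 n => Φ q.1
      q.2.1 (famMap φ x (q.1, q.2.1, q.2.2)) - Φ q.1 q.2.1 (famMap φ x (q.1, q.2.1, 𝓔 x x))) (f :=
      fun q : ℝ × ℝ => ((q.1, q.2, 𝓔 x z) : 𝔓 n)) (by fun_prop) (fun q hq => ⟨hq.1, hq.2, hz⟩)
    have h2 : 𝒞 (fun q : ℝ × ℝ => relHam φ Φ p q.1 q.2 z - relHam φ Φ p q.1 q.2 x)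
        (Ioo (-ε₀) ε₀ ×ˢ 𝕀) := by
      refine h1.congr fun q _ => ?_
      simp only [Function.comp_def, famMap_extChartAt φ hzs,
        famMap_extChartAt φ (mem_extChartAt_source (I := 𝓜) x), relHam]
      ring
    constructor
    · intro hzA
      exact (ContDiffOn.sub hzA h2).congr fun q _ => by simp
    · intro hxA
      exact (ContDiffOn.add hxA h2).congr fun q _ => by simp
  have hclopen : IsClopen A := by
    refine ⟨⟨isOpen_iff_mem_nhds.2 fun x hx => ?_⟩, isOpen_iff_mem_nhds.2 fun x hx => ?_⟩
    · filter_upwards [hloc x] with z hz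
      exact fun hzA => hx (hz.1 hzA)
    · filter_upwards [hloc x] with z hz
      exact hz.2 hx
  have hp : p ∈ A := by
    refine contDiffOn_const (c := (0 : ℝ)) |>.congr fun q _ => ?_
    simp [relHam]
  exact (hclopen.eq_univ ⟨p, hp⟩ ▸ mem_univ x : x ∈ A)

theorem contDiffOn_relHam (p x₀ : M) : 𝒞 (fun q : 𝔓 n => relHam φ Φ p q.1 q.2.1 ((𝓔 x₀).symm q.2.2))
    (famDom n ε₀ x₀) := by
  rintro ⟨ε, t, y⟩ ⟨hε, ht, hy⟩
  obtain ⟨r, hr, hball⟩ := Metric.isOpen_iff.1 (isOpen_extChartAt_target (I := 𝓜) x₀) _ hy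
  have h1 := h.contDiffOn_ham_sub hball
  have h2 := (h.contDiffOn_relHam_point p ((𝓔 x₀).symm y)).comp (s := Ioo (-ε₀) ε₀ ×ˢ 𝕀 ×ˢ ball y r)
    (f := fun q : 𝔓 n => (q.1, q.2.1)) (by fun_prop) fun q hq => ⟨hq.1, hq.2.1⟩
  have h3 := (h1.add h2).congr (f₁ := fun q : 𝔓 n =>
      relHam φ Φ p q.1 q.2.1 ((𝓔 x₀).symm q.2.2)) (fun q _ => by
    simp [relHam, famMap])
  have h4 := h3 (ε, t, y) ⟨hε, ht, mem_ball_self hr⟩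
  refine h4.mono_of_mem_nhdsWithin ?_
  have : (univ ×ˢ univ ×ˢ ball y r : Set (𝔓 n)) ∈ 𝓝 (ε, t, y) :=
    prod_mem_nhds univ_mem (prod_mem_nhds univ_mem (ball_mem_nhds _ hr))
  filter_upwards [self_mem_nhdsWithin, mem_nhdsWithin_of_mem_nhds this] with q hq hq'
  exact ⟨hq.1, hq.2.1, hq'.2.2⟩

/-- The derivative of the relative Hamiltonian in the deformation parameter, plus the area
density, in a chart. -/
theorem hasDerivAt_relHam (p : M) (hq : (ε, t, y) ∈ famDom n ε₀ x₀) : HasDerivAt (fun ε => relHam φ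
    Φ p ε t ((𝓔 x₀).symm y)) (fderivWithin ℝ (fun q : 𝔓 n => relHam φ Φ p q.1 q.2.1 ((𝓔 x₀).symm
    q.2.2)) (famDom n ε₀ x₀) (ε, t, y) (dirE n)) ε := by
  have h1 := ((h.contDiffOn_relHam p x₀).differentiableOn (by simp) _ hq).hasFDerivWithinAt
  exact hasDerivAt_comp_sliceE h1 hq

theorem relHam_fderivWithin_dirX (p : M) {q : 𝔓 n} (hq : q ∈ famDom n ε₀ x₀) (w : E n) :
    fderivWithin ℝ (fun q : 𝔓 n => relHam φ Φ p q.1 q.2.1 ((𝓔 x₀).symm q.2.2)) (famDom n ε₀ x₀) q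
    (dirX n w) = -famForm Ω ε₀ φ x₀ q (dirT n) (dirX n w) := by
  obtain ⟨ε, t, y⟩ := q
  have h1 := ((h.contDiffOn_relHam p x₀).differentiableOn (by simp) _ hq).hasFDerivWithinAt
  have h2 := hasFDerivAt_comp_sliceX h1 hq
  exact congrArg (fun L : E n →L[ℝ] ℝ => L w) (h2.unique (h.hasFDerivAt_relHam p hq))

/-- Mixed second derivatives of the relative Hamiltonian. -/
theorem relHam_second_derivative (p : M) {q : 𝔓 n} (hq : q ∈ famDom n ε₀ x₀) (a : 𝔓 n) (w : E n) :
    fderivWithin ℝ (fderivWithin ℝ (fun q : 𝔓 n => relHam φ Φ p q.1 q.2.1 ((𝓔 x₀).symm q.2.2))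
    (famDom n ε₀ x₀)) (famDom n ε₀ x₀) q (dirX n w) a = -fderivWithin ℝ (famForm Ω ε₀ φ x₀) (famDom
    n ε₀ x₀) q a (dirT n) (dirX n w) := by
  have hud := uniqueDiffOn_famDom (n := n) ε₀ x₀
  have hH := h.contDiffOn_relHam p x₀
  rw [(hH q hq).isSymmSndFDerivWithinAt (by
    rw [minSmoothness_of_isRCLikeNormedField]
    exact (mod_cast le_top : ((2 : ℕ∞) : WithTop ℕ∞) ≤ ∞)) hud
    (famDom_subset_closure_interior ε₀ x₀ hq) hq (dirX n w) a]
  have hdiff : DifferentiableWithinAt ℝ (fderivWithin ℝ (fun q : 𝔓 n => relHam φ Φ p q.1 q.2.1 ((𝓔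
    x₀).symm q.2.2)) (famDom n ε₀ x₀)) (famDom n ε₀ x₀) q := (hH.fderivWithin hud (m := ∞) (by
    simp)).differentiableOn (by simp) q hq
  have h1 := hdiff.hasFDerivWithinAt.clm_apply (hasFDerivWithinAt_const (dirX n w) q _)
  have h2 := (((h.hasFDerivWithinAt_form hq).clm_apply
    (hasFDerivWithinAt_const (dirT n) q _)).clm_apply (hasFDerivWithinAt_const (dirX n w) q _)).neg
  have h3 := h2.congr (fun z hz => h.relHam_fderivWithin_dirX p hz w)
    (h.relHam_fderivWithin_dirX p hq w)
  have h4 := congrArg (fun L : 𝔓 n →L[ℝ] ℝ => L a) ((hud q hq).eq h1 h3)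
  simpa using h4

theorem relHam_add_area_derivative (p : M) (hq : (ε, t, y) ∈ famDom n ε₀ x₀) : HasFDerivAt (fun y =>
    fderivWithin ℝ (fun q : 𝔓 n => relHam φ Φ p q.1 q.2.1 ((𝓔 x₀).symm q.2.2)) (famDom n ε₀ x₀) (ε,
    t, y) (dirE n) + famForm Ω ε₀ φ x₀ (ε, t, y) (dirT n) (dirE n)) (-(fderivWithin ℝ (famForm Ω ε₀
    φ x₀) (famDom n ε₀ x₀) (ε, t, y) (dirT n) (dirE n)).comp (dirX n)) y := by
  have hud := uniqueDiffOn_famDom (n := n) ε₀ x₀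
  have hdiff : DifferentiableWithinAt ℝ (fderivWithin ℝ (fun q : 𝔓 n => relHam φ Φ p q.1 q.2.1 ((𝓔
    x₀).symm q.2.2)) (famDom n ε₀ x₀)) (famDom n ε₀ x₀) (ε, t, y) := ((h.contDiffOn_relHam p
    x₀).fderivWithin hud (m := ∞) (by simp)).differentiableOn (by simp) _ hq
  have h1 := hdiff.hasFDerivWithinAt.clm_apply (hasFDerivWithinAt_const (dirE n) (ε, t, y) _)
  have h2 := hasFDerivAt_comp_sliceX h1 hq
  refine (h2.add (h.hasFDerivAt_form_sliceX hq (dirT n) (dirE n))).congr_fderiv ?_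
  ext w
  have hs := h.relHam_second_derivative p hq (dirE n) w
  have hc := h.form_closed hq (dirT n) (dirE n) (dirX n w)
  simp only [ContinuousLinearMap.comp_zero, zero_add, add_apply,
    ContinuousLinearMap.comp_apply, ContinuousLinearMap.flip_apply, neg_apply]
  linear_combination hs + hc

theorem contDiffOn_relHam_add_area (p x₀ : M) : 𝒞 (fun q => fderivWithin ℝ (fun q : 𝔓 n => relHam φ
  Φ p q.1 q.2.1 ((𝓔 x₀).symm q.2.2)) (famDom n ε₀ x₀) q (dirE n) + famForm Ω ε₀ φ x₀ q (dirT n)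
  (dirE n)) (famDom n ε₀ x₀) := (((h.contDiffOn_relHam p x₀).fderivWithin (uniqueDiffOn_famDom ε₀
  x₀) (m := ∞) (by simp)).clm_apply contDiffOn_const).add (((h.contDiffOn_form x₀).clm_apply
  contDiffOn_const).clm_apply contDiffOn_const)

theorem relHam_add_area_eq (p : M) {x : M} (hε : ε ∈ Ioo (-ε₀) ε₀) (ht : t ∈ 𝕀) (hx : x ∈ (𝓔
    x₀).source) : deriv (fun ε => relHam φ Φ p ε t x) ε + areaDensity Ω φ ε t x = fderivWithin ℝ
    (fun q : 𝔓 n => relHam φ Φ p q.1 q.2.1 ((𝓔 x₀).symm q.2.2)) (famDom n ε₀ x₀) (ε, t, 𝓔 x₀ x)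
    (dirE n) + famForm Ω ε₀ φ x₀ (ε, t, 𝓔 x₀ x) (dirT n) (dirE n) := by
  have hq : (ε, t, 𝓔 x₀ x) ∈ famDom n ε₀ x₀ := ⟨hε, ht, (𝓔 x₀).map_source hx⟩
  have h1 := (h.hasDerivAt_relHam p hq).deriv
  have h2 := h.form_dirT_dirE hq
  rw [(𝓔 x₀).left_inv hx] at h1 h2
  rw [h1, h2]

theorem continuousOn_slice {g : 𝔓 n → ℝ} (hg : 𝒞 g (famDom n ε₀ x₀)) (hε : ε ∈ Ioo (-ε₀) ε₀) (hy : y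
  ∈ (𝓔 x₀).target) : ContinuousOn (fun t => g (ε, t, y)) 𝕀 := hg.continuousOn.comp (by fun_prop) fun
  _ ht => ⟨hε, ht, hy⟩

theorem contDiffOn_areaDensity_point (x : M) : 𝒞 (fun q : ℝ × ℝ => areaDensity Ω φ q.1 q.2 x) (Ioo
    (-ε₀) ε₀ ×ˢ 𝕀) := by
  have hx := mem_extChartAt_target (I := 𝓜) x
  have h1 := (((h.contDiffOn_form x).clm_apply (contDiffOn_const (c := dirT n))).clm_apply
    (contDiffOn_const (c := dirE n))).comp (s := Ioo (-ε₀) ε₀ ×ˢ 𝕀) (f := fun q : ℝ × ℝ => (q.1,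
    q.2, 𝓔 x x)) (by fun_prop) fun q hq => ⟨hq.1, hq.2, hx⟩
  refine h1.congr fun q hq => ?_
  have h2 := h.form_dirT_dirE (x₀ := x) (ε := q.1) (t := q.2) ⟨hq.1, hq.2, hx⟩
  rw [extChartAt_to_inv] at h2
  exact h2.symm

/-- The integral over time of the relative Hamiltonian. -/
theorem hasDerivAt_integral_relHam (hfin : ∀ ε ∈ Ioo (-ε₀) ε₀, ∀ x, φ ε 1 x = φ 0 1 x) (p x : M) (hε
    : ε ∈ Ioo (-ε₀) ε₀) : HasDerivAt (fun ε => ∫ t in 0..1, relHam φ Φ p ε t x) ((∫ t in 0..1,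
    areaDensity Ω φ ε t p) - ∫ t in 0..1, areaDensity Ω φ ε t x) ε := by
  let Z : M → ℝ := fun x => ∫ t in 0..1,
    (deriv (fun ε => relHam φ Φ p ε t x) ε + areaDensity Ω φ ε t x)
  have hloc : IsLocallyConstant Z := by
    rw [IsLocallyConstant.iff_eventually_eq]
    intro x₀
    have hxt := mem_extChartAt_target (I := 𝓜) x₀
    obtain ⟨r, hr, hball⟩ := Metric.isOpen_iff.1 (isOpen_extChartAt_target (I := 𝓜) x₀) _ hxt
    set y₀ := 𝓔 x₀ x₀
    let g : 𝔓 n → ℝ := fun q => fderivWithin ℝ (fun q : 𝔓 n => relHam φ Φ p q.1 q.2.1 ((𝓔 x₀).symm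
        q.2.2)) (famDom n ε₀ x₀) q (dirE n) + famForm Ω ε₀ φ x₀ q (dirT n) (dirE n)
    have hg : 𝒞 g (famDom n ε₀ x₀) := h.contDiffOn_relHam_add_area p x₀
    let W : E n → ℝ := fun y => ∫ t in 0..1, g (ε, t, y)
    have hW : ∀ y ∈ ball y₀ r, HasFDerivAt W (0 : E n →L[ℝ] ℝ) y := by
      intro y hy
      obtain ⟨L, hL, hLw⟩ := exists_hasFDerivAt_integral_unit (isOpen_extChartAt_target (I := 𝓜) x₀)
        (G := fun z : E n × ℝ => g (ε, z.2, z.1)) (p := y) ((hg.comp (by fun_prop) fun z hz => ⟨hε,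
        hz.2, hz.1⟩ : 𝒞 (fun z : E n × ℝ => g (ε, z.2, z.1)) _).of_le (by simp)) (hball hy) fun t ht
        => h.relHam_add_area_derivative p (x₀ := x₀) ⟨hε, ht, hball hy⟩
      have : L = 0 := by
        ext w
        rw [hLw]
        have hd : ∀ t ∈ 𝕀, HasDerivWithinAt (fun t => -famForm Ω ε₀ φ x₀ (ε, t, y) (dirE n) (dirX n
          w)) (-fderivWithin ℝ (famForm Ω ε₀ φ x₀) (famDom n ε₀ x₀) (ε, t, y) (dirT n) (dirE n)
          (dirX n w)) 𝕀 t := fun t ht => (h.hasDerivWithinAt_form_sliceT ⟨hε, ht, hball hy⟩ _ _).neg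
        have hcd : 𝒞 (fun q => fderivWithin ℝ (famForm Ω ε₀ φ x₀) (famDom n ε₀ x₀) q (dirT n) (dirE
          n) (dirX n w)) (famDom n ε₀ x₀) := ((((h.contDiffOn_form x₀).fderivWithin
          (uniqueDiffOn_famDom ε₀ x₀) (m := ∞) (by simp)).clm_apply contDiffOn_const).clm_apply
          contDiffOn_const).clm_apply contDiffOn_const
        have hFTC := intervalIntegral.integral_eq_sub_of_hasDerivAt_of_le (a := (0 : ℝ)) (b := 1)
          zero_le_one (fun t ht => (hd t ht).continuousWithinAt) (fun t ht => (hd t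
          (Ioo_subset_Icc_self ht)).hasDerivAt (Icc_mem_nhds ht.1 ht.2)) (by
            exact intervalIntegrable_unit <| (h.continuousOn_slice hcd hε (hball hy)).neg)
        rw [h.form_dirE_eq_zero ⟨hε, by simp, hball hy⟩ hfin,
          h.form_dirE_eq_zero ⟨hε, by simp, hball hy⟩ (fun ε hε x => by
            rw [h.start ε hε, h.start 0 ⟨by linarith [h.pos], h.pos⟩])] at hFTC
        simpa using hFTC
      rwa [this] at hL
    have hconst : ∀ y ∈ ball y₀ r, W y = W y₀ := fun y hy => (convex_ball y₀
      r).is_const_of_fderivWithin_eq_zero (𝕜 := ℝ) (fun z hz => (hW z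
      hz).differentiableAt.differentiableWithinAt) (fun z hz => by
          rw [fderivWithin_of_isOpen isOpen_ball hz, (hW z hz).fderiv]) hy
        (mem_ball_self hr)
    have hZW : ∀ z ∈ (𝓔 x₀).source, Z z = W (𝓔 x₀ z) :=
      fun z hz => integral_congr_unit fun t ht => by
        exact h.relHam_add_area_eq p hε ht hz
    have hev := (continuousAt_extChartAt (I := 𝓜) x₀) (ball_mem_nhds _ hr)
    filter_upwards [hev, extChartAt_source_mem_nhds (I := 𝓜) x₀] with z hz hzs
    rw [hZW z hzs, hZW x₀ (mem_extChartAt_source x₀)]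
    exact hconst _ hz
  have hZ := hloc.apply_eq_of_preconnectedSpace x p
  have hR := h.contDiffOn_relHam_point p x
  have hdR : ∀ t ∈ 𝕀, HasDerivAt (fun ε => relHam φ Φ p ε t x)
      (deriv (fun ε => relHam φ Φ p ε t x) ε) ε := by
    intro t ht
    have := h.hasDerivAt_relHam p (x₀ := x) (ε := ε) (t := t)
      ⟨hε, ht, mem_extChartAt_target (I := 𝓜) x⟩
    rw [extChartAt_to_inv] at this
    exact this.differentiableAt.hasDerivAt
  have hD := hasDerivAt_integral_unit isOpen_Ioo (hR.of_le (by simp)) hε hdR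
  refine hD.congr_deriv ?_
  have hint : ∀ x, IntervalIntegrable (fun t => areaDensity Ω φ ε t x) volume 0 1 := by
    intro x
    exact intervalIntegrable_unit <| (h.contDiffOn_areaDensity_point x).continuousOn.comp (f := fun t : ℝ => (ε, t))
      (by fun_prop) fun t ht => ⟨hε, ht⟩
  have hint' : IntervalIntegrable (fun t => deriv (fun ε => relHam φ Φ p ε t x) ε) volume 0 1 := by
    apply intervalIntegrable_unit
    have h1 := h.continuousOn_slice (x₀ := x) (((h.contDiffOn_relHam p x).fderivWithin
      (uniqueDiffOn_famDom ε₀ x) (m := ∞) (by simp)).clm_apply (contDiffOn_const (c := dirE n))) hε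
      (mem_extChartAt_target (I := 𝓜) x)
    refine h1.congr fun t ht => ?_
    have := (h.hasDerivAt_relHam p (x₀ := x) (ε := ε) (t := t)
      ⟨hε, ht, mem_extChartAt_target (I := 𝓜) x⟩).deriv
    rw [extChartAt_to_inv] at this
    exact this
  have hZx : Z x = (∫ t in 0..1, deriv (fun ε => relHam φ Φ p ε t x) ε) + ∫ t in 0..1, areaDensity Ω
    φ ε t x := intervalIntegral.integral_add hint' (hint x)
  have hZp : Z p = ∫ t in 0..1, areaDensity Ω φ ε t p := by
    refine integral_congr_unit fun t _ => ?_
    simp [relHam]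
  rw [hZx, hZp] at hZ
  linarith

end IsFamily

end Family

section Determinant

theorem det_pos_of_skew {m : ℕ} {A : Matrix (Fin m) (Fin m) ℝ} (hskew : ∀ v : Fin m → ℝ, v ⬝ᵥ
    A.mulVec v = 0) (hA : ∀ v : Fin m → ℝ, A.mulVec v = 0 → v = 0) : 0 < A.det := by
  let B : ℝ → Matrix (Fin m) (Fin m) ℝ := fun s => A + s • (1 : Matrix (Fin m) (Fin m) ℝ) - s • A
  have hcont : Continuous fun s => (B s).det := by
    refine Continuous.matrix_det ?_
    fun_prop
  have hne : ∀ s ∈ 𝕀, (B s).det ≠ 0 := by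
    intro s hs h0
    obtain ⟨v, hv, hBv⟩ := Matrix.exists_mulVec_eq_zero_iff.2 h0
    have h1 : (B s).mulVec v = A.mulVec v + s • v - s • A.mulVec v := by
      simp only [B, Matrix.sub_mulVec, Matrix.add_mulVec, Matrix.smul_mulVec, Matrix.one_mulVec]
    have h2 : v ⬝ᵥ (B s).mulVec v = s * (v ⬝ᵥ v) := by
      rw [h1, dotProduct_sub, dotProduct_add, dotProduct_smul, dotProduct_smul, hskew]
      simp
    rw [hBv, dotProduct_zero] at h2
    rcases mul_eq_zero.1 h2.symm with h3 | h3
    · subst h3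
      exact hv (hA v (by simpa using h1.symm.trans hBv))
    · exact hv (dotProduct_self_eq_zero.1 h3)
  have hB0 : B 0 = A := by simp [B]
  have hB1 : B 1 = 1 := by simp [B]
  by_contra hneg
  have hmem : (0 : ℝ) ∈ Icc (B 0).det (B 1).det := by
    rw [hB0, hB1, Matrix.det_one]
    exact ⟨not_lt.1 hneg, zero_le_one⟩
  obtain ⟨s, hs, hs0⟩ := intermediate_value_Icc zero_le_one hcont.continuousOn hmem
  exact hne s hs hs0

end Determinant

section Liouville

/-- The matrix of an alternating form in the standard basis. -/
def formMatrix (β : E n [⋀^Fin 2]→L[ℝ] ℝ) : Matrix (Fin (2 * n)) (Fin (2 * n)) ℝ :=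
  Matrix.of fun i j => β ![EuclideanSpace.single i (1 : ℝ), EuclideanSpace.single j (1 : ℝ)]

theorem euclidean_eq_sum (u : E n) : u = ∑ i, u i • EuclideanSpace.single i (1 : ℝ) := by
  have := (EuclideanSpace.basisFun (Fin (2 * n)) ℝ).sum_repr u
  simpa using this.symm

theorem alternating_eq_sum (β : E n [⋀^Fin 2]→L[ℝ] ℝ) (u w : E n) :
    β ![u, w] = ∑ i, ∑ j, u i * formMatrix β i j * w j := by
  have h1 : β ![u, w] = toBilin (E n) β u w := (toBilin_apply β u w).symm
  rw [h1]
  conv_lhs => rw [euclidean_eq_sum u, euclidean_eq_sum w]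
  simp only [map_sum, map_smul, sum_apply, smul_apply, smul_eq_mul, toBilin_apply, formMatrix,
    Matrix.of_apply, Finset.mul_sum]
  rw [Finset.sum_comm]
  refine Finset.sum_congr rfl fun i _ => Finset.sum_congr rfl fun j _ => by ring

theorem formMatrix_comp (β : E n [⋀^Fin 2]→L[ℝ] ℝ) (D : 𝓛) : ∃ P : Matrix (Fin (2 * n)) (Fin (2 *
    n)) ℝ, P.det = D.det ∧ (Matrix.of fun i j : Fin (2 * n) => β ![D (EuclideanSpace.single i (1 :
    ℝ)), D (EuclideanSpace.single j (1 : ℝ))]) = P.transpose * formMatrix β * P := by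
  refine ⟨LinearMap.toMatrix (EuclideanSpace.basisFun (Fin (2 * n)) ℝ).toBasis
    (EuclideanSpace.basisFun (Fin (2 * n)) ℝ).toBasis D, LinearMap.det_toMatrix _ _, ?_⟩
  ext i j
  rw [Matrix.of_apply, alternating_eq_sum, Matrix.mul_assoc, Matrix.mul_apply]
  refine Finset.sum_congr rfl fun k _ => ?_
  rw [Matrix.mul_apply, Finset.mul_sum]
  refine Finset.sum_congr rfl fun l _ => ?_
  simp [LinearMap.toMatrix_apply, mul_assoc]

theorem liouvilleDensity_eq (Ω : SymplecticForm n M) (x₀ : M) (y : E n) :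
    liouvilleDensity Ω x₀ y = Real.sqrt (formMatrix (chartForm Ω.form x₀ y)).det := rfl

theorem liouvilleDensity_of_comp (Ω : SymplecticForm n M) {x₀ x₁ : M} {y z : E n} {D : 𝓛} (h : ∀ u
    w, chartForm Ω.form x₀ y ![u, w] = chartForm Ω.form x₁ z ![D u, D w]) : liouvilleDensity Ω x₀ y
    = |D.det| * liouvilleDensity Ω x₁ z := by
  obtain ⟨P, hP, hP'⟩ := formMatrix_comp (chartForm Ω.form x₁ z) D
  have h1 : formMatrix (chartForm Ω.form x₀ y)
      = P.transpose * formMatrix (chartForm Ω.form x₁ z) * P := by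
    rw [← hP', formMatrix]
    ext i j
    exact h _ _
  rw [liouvilleDensity_eq, liouvilleDensity_eq, h1, Matrix.det_mul, Matrix.det_mul,
    Matrix.det_transpose, hP, mul_comm, ← mul_assoc, Real.sqrt_mul (mul_self_nonneg _),
    Real.sqrt_mul_self_eq_abs]

theorem continuousOn_liouvilleDensity (Ω : SymplecticForm n M) (x₀ : M) :
    ContinuousOn (liouvilleDensity Ω x₀) (𝓔 x₀).target := by
  refine Real.continuous_sqrt.comp_continuousOn ?_
  have h1 : ContinuousOn (fun y => Matrix.of fun i j : Fin (2 * n) => chartForm Ω.form x₀ y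
      ![EuclideanSpace.single i (1 : ℝ), EuclideanSpace.single j (1 : ℝ)]) (𝓔 x₀).target := by
    refine continuousOn_pi.2 fun i => continuousOn_pi.2 fun j => ?_
    have h2 : ContinuousOn (fun y => toBilin (E n) (chartForm Ω.form x₀ y)) (𝓔 x₀).target :=
      (contDiff_toBilin (k := 0)).continuous.comp_continuousOn (Ω.smooth x₀).continuousOn
    have h3 := (h2.clm_apply (continuousOn_const (c := EuclideanSpace.single i (1 : ℝ)))).clm_apply
      (continuousOn_const (c := EuclideanSpace.single j (1 : ℝ)))
    simpa using h3
  exact (continuous_id.matrix_det (n := Fin (2 * n)) (R := ℝ)).comp_continuousOn h1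

variable [IsManifold (𝓡 (2 * n)) ∞ M]

theorem mfderiv_symm_injective (hy : y ∈ (𝓔 x₀).target) :
    Function.Bijective (mfderiv 𝓘(ℝ, E n) 𝓜 (𝓔 x₀).symm y) := by
  have h1 := isInvertible_mfderivWithin_extChartAt_symm (I := 𝓜) (x := x₀) hy
  rw [ModelWithCorners.range_eq_univ, mfderivWithin_univ] at h1
  obtain ⟨L, hL⟩ := h1
  rw [← hL]
  exact L.bijective

theorem chartForm_nondegenerate (Ω : SymplecticForm n M) (hy : y ∈ (𝓔 x₀).target) {u : E n} (hu : ∀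
    w : E n, chartForm Ω.form x₀ y ![u, w] = 0) : u = 0 := by
  have hb := mfderiv_symm_injective hy
  have h1 := Ω.nondegenerate _ (mfderiv 𝓘(ℝ, E n) 𝓜 (𝓔 x₀).symm y u) (fun v => by
      obtain ⟨w, rfl⟩ := hb.2 v
      exact (chartForm_apply Ω x₀ y u w).symm.trans (hu w))
  exact hb.1 (h1.trans (map_zero _).symm)

theorem liouvilleDensity_pos (Ω : SymplecticForm n M)
    (hy : y ∈ (𝓔 x₀).target) : 0 < liouvilleDensity Ω x₀ y := by
  rw [liouvilleDensity_eq]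
  refine Real.sqrt_pos.2 (det_pos_of_skew (fun v => ?_) fun v hv => ?_)
  · have h1 := alternating_self (chartForm Ω.form x₀ y) (WithLp.toLp 2 v)
    rw [alternating_eq_sum] at h1
    rw [← h1, dotProduct]
    refine Finset.sum_congr rfl fun i _ => ?_
    rw [Matrix.mulVec, dotProduct, Finset.mul_sum]
    refine Finset.sum_congr rfl fun j _ => by simp [mul_assoc]
  · have h1 : (WithLp.toLp 2 v : E n) = 0 := by
      refine chartForm_nondegenerate Ω hy fun w => ?_
      rw [alternating_swap, alternating_eq_sum, neg_eq_zero]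
      refine Finset.sum_eq_zero fun i _ => ?_
      have h2 := congrFun hv i
      rw [Matrix.mulVec, dotProduct, Pi.zero_apply] at h2
      simp only [mul_assoc]
      rw [← Finset.mul_sum]
      exact mul_eq_zero_of_right _ h2
    exact congrArg WithLp.ofLp h1

/-- Maps that preserve the symplectic form. -/
def IsSymplectic (Ω : SymplecticForm n M) (ψ : M → M) : Prop :=
  ∀ x₀ : M, ∀ y ∈ (𝓔 x₀).target, ∀ u w : E n,
    pull Ω (fun y => ψ ((𝓔 x₀).symm y)) (𝓔 x₀).target y
      u w = chartForm Ω.form x₀ y ![u, w]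

theorem isSymplectic_id (Ω : SymplecticForm n M) : IsSymplectic Ω id := by
  intro x₀ y hy u w
  rw [pull_apply, chartForm_apply]
  refine congrArg (Ω.form ((𝓔 x₀).symm y)) ?_
  have h1 := mfderivWithin_of_isOpen (I := 𝓘(ℝ, E n)) (I' := 𝓜)
    (f := fun y => (𝓔 x₀).symm y) (isOpen_extChartAt_target x₀) hy
  funext i; fin_cases i
  · exact congrArg (fun L : 𝓛 => L u) h1
  · exact congrArg (fun L : 𝓛 => L w) h1

theorem IsFamily.isSymplectic (h : IsFamily Ω ε₀ φ Φ)
    (hε : ε ∈ Ioo (-ε₀) ε₀) (ht : t ∈ 𝕀) : IsSymplectic Ω (φ ε t) := by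
  intro x₀ y hy u w
  have hq : (ε, t, y) ∈ famDom n ε₀ x₀ := ⟨hε, ht, hy⟩
  rw [← h.form_dirX hq u w, famForm, pull_apply, pull_apply]
  have h1 := mfderivWithin_of_isOpen (I := 𝓘(ℝ, E n)) (I' := 𝓜)
    (f := fun y => φ ε t ((𝓔 x₀).symm y)) (isOpen_extChartAt_target x₀) hy
  refine congrArg (Ω.form (φ ε t ((𝓔 x₀).symm y))) ?_
  funext i; fin_cases i
  · exact (congrArg (fun L : 𝓛 => L u) h1).trans (h.mfderivWithin_dirX hq u).symm
  · exact (congrArg (fun L : 𝓛 => L w) h1).trans (h.mfderivWithin_dirX hq w).symm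

variable [MeasurableSpace M] [BorelSpace M]

theorem measurableSet_chart_image {A : Set M} (hA : MeasurableSet A) :
    MeasurableSet ((𝓔 x₀).symm ⁻¹' A ∩ (𝓔 x₀).target) := by
  have ht := (isOpen_extChartAt_target (I := 𝓜) x₀).measurableSet
  have hc := (continuousOn_iff_continuous_domRestrict.1
    (continuousOn_extChartAt_symm (I := 𝓜) x₀)).measurable hA
  have h2 := MeasurableSet.subtype_image ht hc
  convert h2 using 1
  ext y
  simp [and_comm]

theorem chartLiouville_apply (Ω : SymplecticForm n M) (x₀ : M) {A : Set M} (hA : MeasurableSet A) :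
    chartLiouville Ω x₀ A = ∫⁻ y in (𝓔 x₀).symm ⁻¹' A ∩ (𝓔 x₀).target, ENNReal.ofReal
    (liouvilleDensity Ω x₀ y) := by
  have ht := (isOpen_extChartAt_target (I := 𝓜) x₀).measurableSet
  have hm : AEMeasurable (𝓔 x₀).symm ((volume.restrict (𝓔 x₀).target).withDensity fun y =>
    ENNReal.ofReal (liouvilleDensity Ω x₀ y)) := ((continuousOn_extChartAt_symm (I := 𝓜)
    x₀).aemeasurable ht).mono_ac (withDensity_absolutelyContinuous _ _)
  rw [chartLiouville, Measure.map_apply_of_aemeasurable hm hA, withDensity_apply',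
    Measure.restrict_restrict' ht]

/-- Change of variables under a symplectic diffeomorphism. -/
theorem chartLiouville_image (Ω : SymplecticForm n M) {ψ : Diffeo n M} (hψ : IsSymplectic Ω ψ) {x₀
    x₁ : M} {A : Set M} (hA : MeasurableSet A) (hA0 : A ⊆ (𝓔 x₀).source) (hA1 : ψ '' A ⊆ (𝓔
    x₁).source) : chartLiouville Ω x₁ (ψ '' A) = chartLiouville Ω x₀ A := by
  have hψA : MeasurableSet (ψ '' A) := (ψ.toHomeomorph.measurableEmbedding.measurableSet_image).2 hA
  set e₀ := 𝓔 x₀ with he₀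
  set e₁ := 𝓔 x₁ with he₁
  set τ : E n → E n := fun y => e₁ (ψ (e₀.symm y)) with hτ
  set S := e₀.symm ⁻¹' A ∩ e₀.target with hS
  have hτS : e₁.symm ⁻¹' (ψ '' A) ∩ e₁.target = τ '' S := by
    ext z
    constructor
    · rintro ⟨⟨x, hx, hxz⟩, hz⟩
      refine ⟨e₀ x, ⟨by rwa [mem_preimage, e₀.left_inv (hA0 hx)], e₀.map_source (hA0 hx)⟩, ?_⟩
      simp only [hτ]
      rw [e₀.left_inv (hA0 hx), hxz, e₁.right_inv hz]
    · rintro ⟨y, ⟨hy, hyt⟩, rfl⟩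
      have h1 : ψ (e₀.symm y) ∈ ψ '' A := mem_image_of_mem _ hy
      refine ⟨?_, e₁.map_source (hA1 h1)⟩
      rw [mem_preimage]
      simp only [hτ]
      rwa [e₁.left_inv (hA1 h1)]
  have hinj : InjOn τ S := by
    rintro y ⟨hy, hyt⟩ z ⟨hz, hzt⟩ hyz
    have h1 := e₁.injOn (hA1 (mem_image_of_mem ψ hy)) (hA1 (mem_image_of_mem ψ hz)) hyz
    exact e₀.symm.injOn hyt hzt (ψ.injective h1)
  have hmd : ∀ y ∈ e₀.target, MDifferentiableWithinAt 𝓘(ℝ, E n) 𝓜 (fun y => ψ (e₀.symm y)) e₀.target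
    y := fun y hy => ((ψ.contMDiff.mdifferentiable (by simp) (e₀.symm y)).comp y
    (mdifferentiableAt_extChartAt_symm hy)).mdifferentiableWithinAt
  have hd : ∀ y ∈ S, HasFDerivWithinAt τ (fderivWithin ℝ τ e₀.target y) S y := by
    rintro y ⟨hy, hyt⟩
    have h1 : MDifferentiableWithinAt 𝓘(ℝ, E n) 𝓘(ℝ, E n) τ e₀.target y :=
      ((contMDiffAt_extChartAt_of_mem (hA1 (mem_image_of_mem ψ hy))).mdifferentiableAt (by
      simp)).comp_mdifferentiableWithinAt y (hmd y hyt)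
    exact (h1.differentiableWithinAt.hasFDerivWithinAt).mono inter_subset_right
  rw [chartLiouville_apply Ω x₁ hψA, chartLiouville_apply Ω x₀ hA, ← he₀, ← he₁, hτS,
    lintegral_image_eq_lintegral_abs_det_fderiv_mul volume (measurableSet_chart_image hA) hd hinj]
  refine setLIntegral_congr_fun (measurableSet_chart_image hA) ?_
  rintro y ⟨hy, hyt⟩
  have hp := pull_eq_chart Ω (hmd y hyt) ((isOpen_extChartAt_target x₀).uniqueDiffOn y hyt)
    (hA1 (mem_image_of_mem ψ hy)) hyt
  have hden := liouvilleDensity_of_comp Ω (x₀ := x₀) (x₁ := x₁) (y := y) (z := τ y)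
    (D := fderivWithin ℝ τ e₀.target y) (fun u w => by
      rw [← hψ x₀ y hyt u w, hp, toBilin_apply,
        ContinuousAlternatingMap.compContinuousLinearMap_apply]
      exact congrArg (chartForm Ω.form x₁ (τ y)) (by funext i; fin_cases i <;> rfl))
  simp only
  rw [hden, ENNReal.ofReal_mul (abs_nonneg _)]

theorem chartLiouville_compl_source (Ω : SymplecticForm n M) (x₀ : M) :
    chartLiouville Ω x₀ (𝓔 x₀).sourceᶜ = 0 := by
  rw [chartLiouville_apply Ω x₀ (isOpen_extChartAt_source x₀).measurableSet.compl]
  have : (𝓔 x₀).symm ⁻¹' (𝓔 x₀).sourceᶜ ∩ (𝓔 x₀).target = ∅ := by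
    rw [eq_empty_iff_forall_notMem]
    rintro y ⟨h1, h2⟩
    exact h1 ((𝓔 x₀).map_target h2)
  rw [this, Measure.restrict_empty, lintegral_zero_measure]

theorem liouville_apply (Ω : SymplecticForm n M) {A : Set M} (hA : MeasurableSet A) (hA0 : A ⊆ (𝓔
    x₀).source) : liouville Ω A = chartLiouville Ω x₀ A := by
  have hs := (isOpen_extChartAt_source (I := 𝓜) x₀).measurableSet
  refine le_antisymm ?_ (le_iSup (fun x => chartLiouville Ω x) x₀ A)
  have hle : liouville Ω ≤ chartLiouville Ω x₀ + (⊤ : Measure M).restrict (𝓔 x₀).sourceᶜ := by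
    refine iSup_le fun x => Measure.le_iff.2 fun B hB => ?_
    have hsx := (isOpen_extChartAt_source (I := 𝓜) x).measurableSet
    rw [← measure_inter_add_sdiff B hs, Measure.add_apply]
    refine add_le_add ?_ ?_
    · calc chartLiouville Ω x (B ∩ (𝓔 x₀).source) = chartLiouville Ω x ((B ∩ (𝓔 x₀).source) ∩ (𝓔
          x).source) := by
            exact (measure_inter_conull (chartLiouville_compl_source Ω x)).symm
        _ = chartLiouville Ω x₀ ((B ∩ (𝓔 x₀).source) ∩ (𝓔 x).source) := by
            have h1 := chartLiouville_image Ω (ψ := Diffeomorph.refl 𝓜 M ∞)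
              (isSymplectic_id Ω) (x₀ := x₀) (x₁ := x) ((hB.inter hs).inter hsx)
              (fun z hz => hz.1.2) (by rintro _ ⟨z, hz, rfl⟩; exact hz.2)
            rw [Diffeomorph.coe_refl, image_id] at h1
            exact h1
        _ ≤ chartLiouville Ω x₀ B := measure_mono fun z hz => hz.1.1
    · rw [Measure.restrict_apply hB, ← sdiff_eq]
      exact (le_top : chartLiouville Ω x ≤ ⊤) _
  have h1 := hle A
  rwa [Measure.add_apply, Measure.restrict_apply hA, ← sdiff_eq, sdiff_eq_empty.2 hA0,
    measure_empty, add_zero] at h1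

theorem measurePreserving_liouville [SecondCountableTopology M] (Ω : SymplecticForm n M) {ψ : Diffeo
    n M} (hψ : IsSymplectic Ω ψ) : MeasurePreserving ψ (liouville Ω) (liouville Ω) := by
  have hemb : MeasurableEmbedding (ψ : M → M) := ψ.toHomeomorph.measurableEmbedding
  let U : M → Set M := fun x => (𝓔 x).source ∩ ψ ⁻¹' (𝓔 (ψ x)).source
  have hUo : ∀ x, IsOpen (U x) := fun x => (isOpen_extChartAt_source x).inter
    ((isOpen_extChartAt_source (ψ x)).preimage ψ.continuous)
  have hU : ∀ x, U x ∈ 𝓝 x := fun x => (hUo x).mem_nhds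
    ⟨mem_extChartAt_source x, mem_extChartAt_source (ψ x)⟩
  obtain ⟨s, hs, hcover⟩ := TopologicalSpace.countable_cover_nhds hU
  have := hs.to_subtype
  have hcomap : (liouville Ω).comap ψ = liouville Ω := by
    have h1 : ((liouville Ω).comap ψ).restrict (⋃ x : s, U x)
        = (liouville Ω).restrict (⋃ x : s, U x) := by
      rw [Measure.restrict_iUnion_congr]
      rintro ⟨x, hx⟩
      refine Measure.ext fun A hA => ?_
      rw [Measure.restrict_apply hA, Measure.restrict_apply hA]
      have hAU : MeasurableSet (A ∩ U x) := hA.inter (hUo x).measurableSet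
      have hsub : ψ '' (A ∩ U x) ⊆ (𝓔 (ψ x)).source := by
        rintro _ ⟨z, hz, rfl⟩; exact hz.2.2
      have h2 : ((liouville Ω).comap ψ) (A ∩ U x) = liouville Ω (ψ '' (A ∩ U x)) :=
        hemb.comap_apply _ _
      rw [h2, liouville_apply Ω (hemb.measurableSet_image.2 hAU) hsub, liouville_apply Ω hAU (fun z
        hz => hz.2.1), chartLiouville_image Ω hψ hAU (fun z hz => hz.2.1) hsub]
    have h3 : (⋃ x : s, U x) = univ := by rw [← hcover, biUnion_eq_iUnion]
    rwa [h3, Measure.restrict_univ, Measure.restrict_univ] at h1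
  refine ⟨ψ.continuous.measurable, ?_⟩
  conv_lhs => rw [← hcomap]
  have h4 := hemb.map_comap (liouville Ω)
  have h5 : range ψ = univ := ψ.surjective.range_eq
  refine h4.trans ?_
  rw [h5, Measure.restrict_univ]

theorem isLocallyFiniteMeasure_liouville (Ω : SymplecticForm n M) :
    IsLocallyFiniteMeasure (liouville Ω) := by
  refine ⟨fun x => ?_⟩
  set e := 𝓔 x with he
  have hxt : e x ∈ e.target := mem_extChartAt_target x
  have hopen : IsOpen e.target := isOpen_extChartAt_target x
  have hc : ContinuousAt (liouvilleDensity Ω x) (e x) :=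
    (continuousOn_liouvilleDensity Ω x).continuousAt (hopen.mem_nhds hxt)
  have hev : ∀ᶠ y in 𝓝 (e x), liouvilleDensity Ω x y < liouvilleDensity Ω x (e x) + 1 :=
    hc.eventually_lt continuousAt_const (by linarith)
  obtain ⟨r, hr, hball⟩ := Metric.eventually_nhds_iff_ball.1 hev
  let A : Set M := e.source ∩ e ⁻¹' ball (e x) r
  have hA : IsOpen A := (continuousOn_extChartAt (I := 𝓜) x).isOpen_inter_preimage
    (isOpen_extChartAt_source x) isOpen_ball
  refine ⟨A, hA.mem_nhds ⟨mem_extChartAt_source x, mem_ball_self hr⟩, ?_⟩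
  rw [liouville_apply Ω hA.measurableSet inter_subset_left,
    chartLiouville_apply Ω x hA.measurableSet]
  have hsub : e.symm ⁻¹' A ∩ e.target ⊆ ball (e x) r := by
    rintro y ⟨⟨_, h1⟩, h2⟩
    rwa [mem_preimage, e.right_inv h2] at h1
  calc ∫⁻ y in e.symm ⁻¹' A ∩ e.target, ENNReal.ofReal (liouvilleDensity Ω x y)
      ≤ ∫⁻ y in e.symm ⁻¹' A ∩ e.target, ENNReal.ofReal (liouvilleDensity Ω x (e x) + 1) :=
        setLIntegral_mono' (measurableSet_chart_image hA.measurableSet) fun y hy =>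
          ENNReal.ofReal_le_ofReal (hball y (hsub hy)).le
    _ = ENNReal.ofReal (liouvilleDensity Ω x (e x) + 1) * volume (e.symm ⁻¹' A ∩ e.target) :=
        setLIntegral_const _ _
    _ ≤ ENNReal.ofReal (liouvilleDensity Ω x (e x) + 1) * volume (ball (e x) r) := by
        gcongr
    _ < ⊤ := ENNReal.mul_lt_top ENNReal.ofReal_lt_top measure_ball_lt_top

theorem isFiniteMeasure_liouville [CompactSpace M] (Ω : SymplecticForm n M) :
    IsFiniteMeasure (liouville Ω) := by
  have := isLocallyFiniteMeasure_liouville Ω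
  infer_instance

theorem liouville_univ_ne_zero [Nonempty M] (Ω : SymplecticForm n M) : liouville Ω univ ≠ 0 := by
  obtain ⟨x⟩ := ‹Nonempty M›
  intro h0
  have hs := (isOpen_extChartAt_source (I := 𝓜) x)
  have h1 : liouville Ω (𝓔 x).source = 0 := measure_mono_null (subset_univ _) h0
  rw [liouville_apply Ω hs.measurableSet subset_rfl,
    chartLiouville_apply Ω x hs.measurableSet] at h1
  have hpre : (𝓔 x).symm ⁻¹' (𝓔 x).source ∩ (𝓔 x).target = (𝓔 x).target := inter_eq_right.2 fun y hy
    => (𝓔 x).map_target hy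
  rw [hpre] at h1
  have ht := isOpen_extChartAt_target (I := 𝓜) x
  have hm : AEMeasurable (fun y => ENNReal.ofReal (liouvilleDensity Ω x y)) (volume.restrict (𝓔
    x).target) := (((continuousOn_liouvilleDensity Ω x).aemeasurable
    ht.measurableSet)).ennreal_ofReal
  rw [lintegral_eq_zero_iff' hm] at h1
  have h2 : ∀ᵐ y ∂(volume.restrict (𝓔 x).target), False := by
    filter_upwards [h1, ae_restrict_mem ht.measurableSet] with y hy hyt
    have := liouvilleDensity_pos Ω hyt
    simp only [Pi.zero_apply, ENNReal.ofReal_eq_zero] at hy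
    linarith
  rw [eventually_false_iff_eq_bot, ae_eq_bot, Measure.restrict_eq_zero] at h2
  exact (ht.measure_pos volume ⟨_, mem_extChartAt_target x⟩).ne' h2

end Liouville

section Continuity

theorem hasDerivAt_integral_of_continuous {M : Type*} [TopologicalSpace M] [CompactSpace M]
    [SecondCountableTopology M] [T2Space M] [MeasurableSpace M] [BorelSpace M] {μ : Measure M}
    [IsFiniteMeasure μ] {U : Set ℝ} (hU : IsOpen U) {g g' : ℝ → M → ℝ} (hg : ContinuousOn (fun p : ℝ
    × M => g p.1 p.2) (U ×ˢ univ)) (hg' : ContinuousOn (fun p : ℝ × M => g' p.1 p.2) (U ×ˢ univ))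
    (hd : ∀ ε ∈ U, ∀ x, HasDerivAt (fun ε => g ε x) (g' ε x) ε) {ε : ℝ} (hε : ε ∈ U) : HasDerivAt
    (fun ε => ∫ x, g ε x ∂μ) (∫ x, g' ε x ∂μ) ε := by
  obtain ⟨r, hr, hball⟩ := Metric.nhds_basis_closedBall.mem_iff.1 (hU.mem_nhds hε)
  have hK : IsCompact (closedBall ε r ×ˢ (univ : Set M)) :=
    (isCompact_closedBall ε r).prod isCompact_univ
  obtain ⟨C, hC⟩ := hK.exists_bound_of_continuousOn (hg'.mono (prod_mono hball subset_rfl))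
  have hcont : ∀ {k : ℝ → M → ℝ}, ContinuousOn (fun p : ℝ × M => k p.1 p.2) (U ×ˢ univ) → ∀ δ ∈ U,
    Continuous (k δ) := fun hk δ hδ => hk.comp_continuous (f := fun x => (δ, x)) (by fun_prop) fun x
    => ⟨hδ, mem_univ _⟩
  refine (hasDerivAt_integral_of_dominated_loc_of_deriv_le (bound := fun _ => C)
    (Metric.closedBall_mem_nhds ε hr) ?_ ?_ ?_ ?_ ?_ ?_).2
  · filter_upwards [hU.mem_nhds hε] with δ hδ
    exact (hcont hg δ hδ).aestronglyMeasurable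
  · exact (hcont hg ε hε).integrable_of_hasCompactSupport (HasCompactSupport.of_compactSpace _)
  · exact (hcont hg' ε hε).aestronglyMeasurable
  · exact Eventually.of_forall fun x δ hδ => hC (δ, x) ⟨hδ, mem_univ _⟩
  · exact integrable_const C
  · exact Eventually.of_forall fun x δ hδ => hd δ (hball hδ) x

theorem integral_swap_of_continuousOn {M : Type*} [TopologicalSpace M] [CompactSpace M]
    [SecondCountableTopology M] [MeasurableSpace M] [BorelSpace M] {μ : Measure M} [IsFiniteMeasure
    μ] {g : ℝ → M → ℝ} (hg : ContinuousOn (fun p : ℝ × M => g p.1 p.2) (𝕀 ×ˢ univ)) : ∫ x, (∫ t in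
    0..1, g t x) ∂μ = ∫ t in 0..1, (∫ x, g t x ∂μ) := by
  have h1 : Integrable (Function.uncurry g) ((volume.restrict 𝕀).prod μ) := by
    have hr : (volume.restrict 𝕀).prod μ = ((volume : Measure ℝ).prod μ).restrict (𝕀 ×ˢ univ) := by
      rw [← Measure.prod_restrict, Measure.restrict_univ]
    have hm : MeasurableSet (𝕀 ×ˢ (univ : Set M)) := measurableSet_Icc.prod MeasurableSet.univ
    obtain ⟨C, hC⟩ := (isCompact_Icc.prod isCompact_univ).exists_bound_of_continuousOn hg
    refine Integrable.of_bound ?_ C ?_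
    · rw [hr]
      exact hg.aestronglyMeasurable hm
    · rw [hr]
      filter_upwards [ae_restrict_mem hm] with p hp
      exact hC p hp
  simp only [intervalIntegral.integral_of_le zero_le_one, ← integral_Icc_eq_integral_Ioc]
  exact (integral_integral_swap h1).symm

theorem continuousOn_of_charts {g : ℝ × ℝ × M → ℝ} (hg : ∀ x₀ : M, ContinuousOn (fun q : 𝔓 n => g
    (q.1, q.2.1, (𝓔 x₀).symm q.2.2)) (famDom n ε₀ x₀)) : ContinuousOn g (Ioo (-ε₀) ε₀ ×ˢ 𝕀 ×ˢ univ)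
    := by
  rintro ⟨ε, t, x⟩ ⟨hε, ht, _⟩
  have hx := mem_extChartAt_target (I := 𝓜) x
  have hsrc : (univ ×ˢ univ ×ˢ (𝓔 x).source : Set (ℝ × ℝ × M)) ∈ 𝓝 (ε, t, x) := prod_mem_nhds
      univ_mem (prod_mem_nhds univ_mem (extChartAt_source_mem_nhds x))
  have hj : ContinuousWithinAt (fun q : ℝ × ℝ × M => ((q.1, q.2.1, 𝓔 x q.2.2) : 𝔓 n)) (Ioo (-ε₀) ε₀
      ×ˢ 𝕀 ×ˢ (𝓔 x).source) (ε, t, x) := by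
    have h1 : ContinuousAt (fun q : ℝ × ℝ × M => 𝓔 x q.2.2) (ε, t, x) := ContinuousAt.comp (f := fun
      q : ℝ × ℝ × M => q.2.2) (continuousAt_extChartAt x) (by fun_prop)
    exact (continuousAt_fst.prodMk ((by fun_prop : ContinuousAt (fun q : ℝ × ℝ × M => q.2.1)
      (ε, t, x)).prodMk h1)).continuousWithinAt
  have h2 := ContinuousWithinAt.comp (hg x _ ⟨hε, ht, hx⟩) hj
    fun q hq => ⟨hq.1, hq.2.1, (𝓔 x).map_source hq.2.2⟩
  have h3 : ContinuousWithinAt g (Ioo (-ε₀) ε₀ ×ˢ 𝕀 ×ˢ (𝓔 x).source) (ε, t, x) := by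
    refine h2.congr (fun q hq => ?_) ?_
    · simp only [Function.comp_apply]
      rw [(𝓔 x).left_inv hq.2.2]
    · simp only [Function.comp_apply]
      rw [(𝓔 x).left_inv (mem_extChartAt_source x)]
  refine h3.mono_of_mem_nhdsWithin ?_
  filter_upwards [self_mem_nhdsWithin, mem_nhdsWithin_of_mem_nhds hsrc] with q hq hq'
  exact ⟨hq.1, hq.2.1, hq'.2.2⟩

end Continuity

theorem continuousOn_integral_unit {X : Type*} [TopologicalSpace X] [FirstCountableTopology X] {S :
    Set X} {G : X → ℝ → ℝ} (hG : ContinuousOn (fun z : X × ℝ => G z.1 z.2) (S ×ˢ 𝕀)) : ContinuousOn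
    (fun x => ∫ t in 0..1, G x t) S := by
  rw [continuousOn_iff_continuous_domRestrict]
  have h1 : Continuous (fun z : S × ℝ => G z.1 (projIcc (0 : ℝ) 1 zero_le_one z.2)) :=
    hG.comp_continuous (f := fun z : S × ℝ => ((z.1 : X), (projIcc (0 : ℝ) 1 zero_le_one z.2 : ℝ)))
    ((continuous_subtype_val.comp continuous_fst).prodMk (continuous_subtype_val.comp
    ((continuous_projIcc (h := (zero_le_one : (0 : ℝ) ≤ 1))).comp continuous_snd))) fun z => ⟨z.1.2,
    (projIcc (0 : ℝ) 1 zero_le_one z.2).2⟩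
  have h2 := intervalIntegral.continuous_parametric_intervalIntegral_of_continuous' (μ := volume)
    (f := fun (x : S) t => G x (projIcc (0 : ℝ) 1 zero_le_one t)) h1 0 1
  refine h2.congr fun x => integral_congr_unit fun t ht => ?_
  simp only [projIcc_of_mem zero_le_one ht]

section Family

variable [IsManifold (𝓡 (2 * n)) ∞ M]

namespace IsFamily

variable (h : IsFamily Ω ε₀ φ Φ)
include h

theorem continuousOn_areaDensity : ContinuousOn (fun q : ℝ × ℝ × M => areaDensity Ω φ q.1 q.2.1
    q.2.2) (Ioo (-ε₀) ε₀ ×ˢ 𝕀 ×ˢ univ) := by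
  refine continuousOn_of_charts (n := n) fun x₀ => ?_
  refine ((((h.contDiffOn_form x₀).clm_apply (contDiffOn_const (c := dirT n))).clm_apply
    (contDiffOn_const (c := dirE n))).continuousOn).congr fun q hq => ?_
  exact (h.form_dirT_dirE hq).symm

theorem continuousOn_relHam [ConnectedSpace M] (p : M) : ContinuousOn (fun q : ℝ × ℝ × M => relHam φ
  Φ p q.1 q.2.1 q.2.2) (Ioo (-ε₀) ε₀ ×ˢ 𝕀 ×ˢ univ) := continuousOn_of_charts (n := n) fun x₀ =>
  (h.contDiffOn_relHam p x₀).continuousOn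

theorem continuousOn_area_integral [FirstCountableTopology M] : ContinuousOn (fun q : ℝ × M => ∫ t
  in 0..1, areaDensity Ω φ q.1 t q.2) (Ioo (-ε₀) ε₀ ×ˢ univ) := continuousOn_integral_unit (G := fun
  (q : ℝ × M) t => areaDensity Ω φ q.1 t q.2) (h.continuousOn_areaDensity.comp (f := fun z : (ℝ × M)
  × ℝ => (z.1.1, z.2, z.1.2)) (by fun_prop) fun z hz => ⟨hz.1.1, hz.2, mem_univ _⟩)

theorem continuousOn_relHam_integral [ConnectedSpace M] [FirstCountableTopology M] (p : M) :
  ContinuousOn (fun q : ℝ × M => ∫ t in 0..1, relHam φ Φ p q.1 t q.2) (Ioo (-ε₀) ε₀ ×ˢ univ) :=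
  continuousOn_integral_unit (G := fun (q : ℝ × M) t => relHam φ Φ p q.1 t q.2)
  ((h.continuousOn_relHam p).comp (f := fun z : (ℝ × M) × ℝ => (z.1.1, z.2, z.1.2)) (by fun_prop)
  fun z hz => ⟨hz.1.1, hz.2, mem_univ _⟩)

theorem contDiffOn_comp {H : M → ℝ} (hH : ContMDiff 𝓜 𝓘₁ ∞ H) (x₀ : M) : 𝒞 (fun q => H (famMap φ x₀
  q)) (famDom n ε₀ x₀) := contMDiffOn_iff_contDiffOn.1 (hH.comp_contMDiffOn (contMDiffOn_famMap
  h.smooth x₀))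

theorem hasDerivAt_comp {H : M → ℝ} (hH : ContMDiff 𝓜 𝓘₁ ∞ H) {x₀ x : M} (hx : x ∈ (𝓔 x₀).source)
    (hε : ε ∈ Ioo (-ε₀) ε₀) (ht : t ∈ 𝕀) : HasDerivAt (fun ε => H (φ ε t x)) (fderivWithin ℝ (fun q
    => H (famMap φ x₀ q)) (famDom n ε₀ x₀) (ε, t, 𝓔 x₀ x) (dirE n)) ε := by
  have hq : (ε, t, 𝓔 x₀ x) ∈ famDom n ε₀ x₀ := ⟨hε, ht, (𝓔 x₀).map_source hx⟩
  have h1 := hasDerivAt_comp_sliceE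
    ((h.contDiffOn_comp hH x₀).differentiableOn (by simp) _ hq).hasFDerivWithinAt hq
  simpa only [famMap_extChartAt φ hx] using h1

theorem deriv_ham_comp (hε : ε ∈ Ioo (-ε₀) ε₀) (ht : t ∈ 𝕀) (x : M) :
    HasDerivAt (fun δ => Φ ε t (φ δ t x)) (-areaDensity Ω φ ε t x) ε := by
  have hsm : MDifferentiableAt 𝓘₁ 𝓜 (fun δ : ℝ => φ δ t x) ε := by
    have h1 : ContMDiffOn 𝓘₁ 𝓜 ∞ (fun δ : ℝ => φ δ t x) (Ioo (-ε₀) ε₀) := h.smooth.comp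
      (contMDiffOn_id.prodMk (contMDiffOn_const.prodMk contMDiffOn_const)) fun δ hδ => ⟨hδ, ht,
      mem_univ _⟩
    exact (h1.contMDiffAt (isOpen_Ioo.mem_nhds hε)).mdifferentiableAt (by simp)
  have hΦ : MDifferentiableAt 𝓜 𝓘₁ (Φ ε t) (φ ε t x) :=
    (h.contMDiff_ham hε ht).mdifferentiableAt (by simp)
  have hg := h.gen ε hε t ht x (mfderiv 𝓘₁ 𝓜 (fun ε : ℝ => φ ε t x) ε (1 : ℝ))
  obtain ⟨L, hL, hL1⟩ : ∃ L : ℝ →L[ℝ] ℝ, HasFDerivAt (fun δ => Φ ε t (φ δ t x)) L ε ∧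
      L 1 = -areaDensity Ω φ ε t x := by
    refine ⟨_, (hΦ.hasMFDerivAt.comp ε hsm.hasMFDerivAt).hasFDerivAt, ?_⟩
    rw [areaDensity, hg]
    exact (neg_neg _).symm
  exact hL.hasDerivAt.congr_deriv hL1

variable [ConnectedSpace M] [T2Space M] [SecondCountableTopology M] [MeasurableSpace M]
  [BorelSpace M]

theorem integral_areaDensity_eq_zero [CompactSpace M] (hn : ∀ ε ∈ Ioo (-ε₀) ε₀, IsNormalized Ω (Φ
    ε)) (hε : ε ∈ Ioo (-ε₀) ε₀) (ht : t ∈ 𝕀) : ∫ x, areaDensity Ω φ ε t x ∂(liouville Ω) = 0 := by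
  have := isFiniteMeasure_liouville Ω
  have hH := h.contMDiff_ham hε ht
  have hcont : ContinuousOn (fun p : ℝ × M => Φ ε t (φ p.1 t p.2)) (Ioo (-ε₀) ε₀ ×ˢ univ) :=
    hH.continuous.comp_continuousOn (h.smooth.continuousOn.comp (f := fun p : ℝ × M => (p.1, t,
    p.2)) (by fun_prop) fun p hp => ⟨hp.1, ht, mem_univ _⟩)
  have hcont' : ContinuousOn (fun p : ℝ × M => deriv (fun δ => Φ ε t (φ δ t p.2)) p.1)
      (Ioo (-ε₀) ε₀ ×ˢ univ) := by
    have h1 : ContinuousOn (fun q : ℝ × ℝ × M => deriv (fun δ => Φ ε t (φ δ q.2.1 q.2.2)) q.1)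
        (Ioo (-ε₀) ε₀ ×ˢ 𝕀 ×ˢ univ) := by
      refine continuousOn_of_charts (n := n) fun x₀ => ?_
      have h2 := (((h.contDiffOn_comp hH x₀).fderivWithin (uniqueDiffOn_famDom ε₀ x₀) (m := ∞)
        (by simp)).clm_apply (contDiffOn_const (c := dirE n))).continuousOn
      refine h2.congr fun q hq => ?_
      have h3 := (h.hasDerivAt_comp hH ((𝓔 x₀).map_target hq.2.2) hq.1 hq.2.1).deriv
      rw [(𝓔 x₀).right_inv hq.2.2] at h3
      exact h3
    exact h1.comp (f := fun p : ℝ × M => (p.1, t, p.2)) (by fun_prop)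
      fun p hp => ⟨hp.1, ht, mem_univ _⟩
  have hd := hasDerivAt_integral_of_continuous (μ := liouville Ω) isOpen_Ioo hcont hcont' (fun δ hδ
    x => (h.hasDerivAt_comp hH (mem_extChartAt_source x) hδ ht).differentiableAt.hasDerivAt) hε
  have hzero : (fun δ => ∫ x, Φ ε t (φ δ t x) ∂(liouville Ω)) =ᶠ[𝓝 ε] fun _ => 0 := by
    filter_upwards [isOpen_Ioo.mem_nhds hε] with δ hδ
    rw [(measurePreserving_liouville Ω (h.isSymplectic hδ ht)).integral_comp
      (φ δ t).toHomeomorph.measurableEmbedding]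
    exact (hn ε hε).mean_zero inferInstance t ht
  have h1 := hd.unique ((hasDerivAt_const ε (0 : ℝ)).congr_of_eventuallyEq hzero)
  rw [← neg_eq_zero, ← integral_neg, ← h1]
  exact integral_congr_ae (Eventually.of_forall fun x => (h.deriv_ham_comp hε ht x).deriv.symm)

theorem hasDerivAt_integral_ham_compact [CompactSpace M] (hfin : ∀ ε ∈ Ioo (-ε₀) ε₀, ∀ x, φ ε 1 x =
    φ 0 1 x) (hn : ∀ ε ∈ Ioo (-ε₀) ε₀, IsNormalized Ω (Φ ε)) (p : M) (hε : ε ∈ Ioo (-ε₀) ε₀) :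
    HasDerivAt (fun ε => ∫ t in 0..1, Φ ε t (φ ε t p)) (-∫ t in 0..1, areaDensity Ω φ ε t p) ε := by
  have := isFiniteMeasure_liouville Ω
  set c : ℝ := (liouville Ω).real univ with hc
  have hc0 : c ≠ 0 := by
    rw [hc, Measure.real, ENNReal.toReal_ne_zero]
    exact ⟨liouville_univ_ne_zero Ω, measure_ne_top _ _⟩
  have hA : ∀ δ ∈ Ioo (-ε₀) ε₀, ∫ x, (∫ t in 0..1, relHam φ Φ p δ t x) ∂(liouville Ω)
      = -c * ∫ t in 0..1, Φ δ t (φ δ t p) := by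
    intro δ hδ
    rw [integral_swap_of_continuousOn (g := fun t x => relHam φ Φ p δ t x) ((h.continuousOn_relHam
      p).comp (f := fun z : ℝ × M => (δ, z.1, z.2)) (by fun_prop) fun z hz => ⟨hδ, hz.1, mem_univ
      _⟩), ← intervalIntegral.integral_const_mul]
    refine integral_congr_unit fun t ht => ?_
    have hcont : Continuous fun x => Φ δ t (φ δ t x) :=
      (h.contMDiff_ham hδ ht).continuous.comp (φ δ t).continuous
    simp only [relHam]
    rw [integral_sub (hcont.integrable_of_hasCompactSupport (HasCompactSupport.of_compactSpace _))
      (integrable_const _), (measurePreserving_liouville Ω (h.isSymplectic hδ ht)).integral_comp (φ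
      δ t).toHomeomorph.measurableEmbedding, (hn δ hδ).mean_zero inferInstance t ht, integral_const]
    simp [hc]
  have hd := hasDerivAt_integral_of_continuous (μ := liouville Ω) (U := Ioo (-ε₀) ε₀) isOpen_Ioo (g
    := fun δ x => ∫ t in 0..1, relHam φ Φ p δ t x) (g' := fun δ x => (∫ t in 0..1, areaDensity Ω φ δ
    t p) - ∫ t in 0..1, areaDensity Ω φ δ t x) (h.continuousOn_relHam_integral p)
    ((h.continuousOn_area_integral.comp (f := fun z : ℝ × M => (z.1, p)) (by fun_prop) fun z hz =>
    ⟨hz.1, mem_univ _⟩).sub h.continuousOn_area_integral) (fun δ hδ x =>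
    h.hasDerivAt_integral_relHam hfin p x hδ) hε
  have hcontB : Continuous fun x => ∫ t in 0..1, areaDensity Ω φ ε t x :=
    h.continuousOn_area_integral.comp_continuous (f := fun x : M => (ε, x)) (by fun_prop) fun x =>
    ⟨hε, mem_univ _⟩
  have hB : ∫ x, (∫ t in 0..1, areaDensity Ω φ ε t x) ∂(liouville Ω) = 0 := by
    rw [integral_swap_of_continuousOn (g := fun t x => areaDensity Ω φ ε t x)
      (h.continuousOn_areaDensity.comp (f := fun z : ℝ × M => (ε, z.1, z.2)) (by fun_prop) fun z hz
      => ⟨hε, hz.1, mem_univ _⟩)]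
    rw [integral_congr_unit (g := fun _ => 0) fun t ht => ?_]
    · simp
    · exact h.integral_areaDensity_eq_zero hn hε ht
  rw [integral_sub (integrable_const _) (hcontB.integrable_of_hasCompactSupport
    (HasCompactSupport.of_compactSpace _)), hB, sub_zero, integral_const, smul_eq_mul, ← hc] at hd
  have hd2 := hd.const_mul (-c⁻¹)
  have heq : (fun ε => ∫ t in 0..1, Φ ε t (φ ε t p)) =ᶠ[𝓝 ε]
      fun δ => -c⁻¹ * ∫ x, (∫ t in 0..1, relHam φ Φ p δ t x) ∂(liouville Ω) := by
    filter_upwards [isOpen_Ioo.mem_nhds hε] with δ hδ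
    rw [hA δ hδ]
    field_simp
  refine (hd2.congr_of_eventuallyEq heq).congr_deriv ?_
  field_simp

theorem hasDerivAt_integral_ham_noncompact (hM : ¬ CompactSpace M) (hfin : ∀ ε ∈ Ioo (-ε₀) ε₀, ∀ x,
    φ ε 1 x = φ 0 1 x) (hK : ∃ K : Set M, IsCompact K ∧ ∀ ε ∈ Ioo (-ε₀) ε₀, ∀ t ∈ 𝕀, ∀ x ∉ K, φ ε t
    x = x) (hn : ∀ ε ∈ Ioo (-ε₀) ε₀, IsNormalized Ω (Φ ε)) (p : M) (hε : ε ∈ Ioo (-ε₀) ε₀) :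
    HasDerivAt (fun ε => ∫ t in 0..1, Φ ε t (φ ε t p)) (-∫ t in 0..1, areaDensity Ω φ ε t p) ε := by
  obtain ⟨K, hKc, hK⟩ := hK
  have hne : ∀ C : Set M, IsCompact C → ∃ x, x ∉ C := by
    intro C hC
    by_contra hcon
    push Not at hcon
    exact hM ⟨by rwa [eq_univ_of_forall hcon] at hC⟩
  have harea : ∀ x ∉ K, ∀ δ ∈ Ioo (-ε₀) ε₀, ∀ t ∈ 𝕀, areaDensity Ω φ δ t x = 0 := by
    intro x hx δ hδ t ht
    have h2 : (fun ε : ℝ => φ ε t x) =ᶠ[𝓝 δ] fun _ => x := by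
      filter_upwards [isOpen_Ioo.mem_nhds hδ] with ε hε
      exact hK ε hε t ht x hx
    have h3 := h2.mfderiv_eq (I := 𝓘₁) (I' := 𝓜)
    rw [mfderiv_const] at h3
    have h4 : (mfderiv 𝓘₁ 𝓜 (fun ε : ℝ => φ ε t x) δ (1 : ℝ) : E n) = 0 :=
      congrArg (fun L : ℝ →L[ℝ] E n => L 1) h3
    rw [areaDensity]
    exact (Ω.form (φ δ t x)).map_coord_zero 1 h4
  have hR : ∀ x ∉ K, ∀ δ ∈ Ioo (-ε₀) ε₀, HasDerivAt (fun ε => ∫ t in 0..1, relHam φ Φ p ε t x) (∫ t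
      in 0..1, areaDensity Ω φ δ t p) δ := by
    intro x hx δ hδ
    refine (h.hasDerivAt_integral_relHam hfin p x hδ).congr_deriv ?_
    rw [intervalIntegral.integral_congr (g := fun _ => 0)
      (f := fun t => areaDensity Ω φ δ t x) fun t ht => ?_]
    · simp
    · rw [uIcc_unit] at ht
      exact harea x hx δ hδ t ht
  obtain ⟨x₁, hx₁⟩ := hne K hKc
  have hdiff : ∀ x ∉ K, ∀ δ ∈ Ioo (-ε₀) ε₀, (∫ t in 0..1, relHam φ Φ p δ t x) - (∫ t in 0..1, relHam
      φ Φ p ε t x) = (∫ t in 0..1, relHam φ Φ p δ t x₁) - ∫ t in 0..1, relHam φ Φ p ε t x₁ := by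
    intro x hx δ hδ
    have h1 := (convex_Ioo (-ε₀) ε₀).is_const_of_fderivWithin_eq_zero (𝕜 := ℝ) (f := fun ε => (∫ t
      in 0..1, relHam φ Φ p ε t x) - ∫ t in 0..1, relHam φ Φ p ε t x₁) (fun z hz => ((hR x hx z
      hz).sub (hR x₁ hx₁ z hz)).differentiableAt.differentiableWithinAt) (fun z hz => by
        rw [fderivWithin_of_isOpen isOpen_Ioo hz]
        have := ((hR x hx z hz).sub (hR x₁ hx₁ z hz)).hasFDerivAt.fderiv
        rw [sub_self] at this
        refine Eq.trans this ?_
        ext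
        simp) hδ hε
    linarith
  have hsupp : ∀ δ ∈ Ioo (-ε₀) ε₀, ∃ C : Set M, IsCompact C ∧ ∀ x ∉ C, x ∉ K →
      ∫ t in 0..1, relHam φ Φ p δ t x = -∫ t in 0..1, Φ δ t (φ δ t p) := by
    intro δ hδ
    obtain ⟨C, hC, hC'⟩ := (hn δ hδ).compact_support hM
    refine ⟨C, hC, fun x hx hxK => ?_⟩
    rw [← intervalIntegral.integral_neg]
    refine integral_congr_unit fun t ht => ?_
    simp only [relHam]
    rw [hK δ hδ t ht x hxK, hC' t ht x hx, zero_sub]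
  have heq : (fun δ => ∫ t in 0..1, Φ δ t (φ δ t p)) =ᶠ[𝓝 ε] fun δ => (∫ t in 0..1, Φ ε t (φ ε t p))
      - ((∫ t in 0..1, relHam φ Φ p δ t x₁) - ∫ t in 0..1, relHam φ Φ p ε t x₁) := by
    filter_upwards [isOpen_Ioo.mem_nhds hε] with δ hδ
    obtain ⟨C, hC, hCx⟩ := hsupp δ hδ
    obtain ⟨C', hC', hCx'⟩ := hsupp ε hε
    obtain ⟨x, hx⟩ := hne (K ∪ (C ∪ C')) (hKc.union (hC.union hC'))
    simp only [mem_union, not_or] at hx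
    have h1 := hdiff x hx.1 δ hδ
    rw [hCx x hx.2.1 hx.1, hCx' x hx.2.2 hx.1] at h1
    linarith
  have h1 := ((hR x₁ hx₁ ε hε).sub_const
    (∫ t in 0..1, relHam φ Φ p ε t x₁)).const_sub (∫ t in 0..1, Φ ε t (φ ε t p))
  exact h1.congr_of_eventuallyEq heq

/-- The derivative of the mean value of the Hamiltonian along a trajectory. -/
theorem hasDerivAt_integral_ham (hfin : ∀ ε ∈ Ioo (-ε₀) ε₀, ∀ x, φ ε 1 x = φ 0 1 x) (hK : ∃ K : Set
    M, IsCompact K ∧ ∀ ε ∈ Ioo (-ε₀) ε₀, ∀ t ∈ 𝕀, ∀ x ∉ K, φ ε t x = x) (hn : ∀ ε ∈ Ioo (-ε₀) ε₀,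
    IsNormalized Ω (Φ ε)) (p : M) (hε : ε ∈ Ioo (-ε₀) ε₀) : HasDerivAt (fun ε => ∫ t in 0..1, Φ ε t
    (φ ε t p)) (-∫ t in 0..1, areaDensity Ω φ ε t p) ε := by
  by_cases hM : CompactSpace M
  · exact h.hasDerivAt_integral_ham_compact hfin hn p hε
  · exact h.hasDerivAt_integral_ham_noncompact hM hfin hK hn p hε

end IsFamily

end Family

theorem eventually_lt_of_isCompact {X Y : Type*} [TopologicalSpace X] [TopologicalSpace Y] {P : Set
    X} {K : Set Y} (hK : IsCompact K) {x₀ : X} (hP : P ∈ 𝓝 x₀) {g : X × Y → ℝ} (hg : ContinuousOn g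
    (P ×ˢ K)) {a : ℝ} (h : ∀ k ∈ K, g (x₀, k) < a) : ∀ᶠ x in 𝓝 x₀, ∀ k ∈ K, g (x, k) < a := by
  have h1 : ∀ᶠ x in 𝓝 x₀, ∀ k ∈ K, x ∈ P → k ∈ K → g (x, k) < a := by
    refine hK.eventually_forall_of_forall_eventually fun k hk => ?_
    have h2 := (hg (x₀, k) ⟨mem_of_mem_nhds hP, hk⟩).eventually_lt
      (continuousWithinAt_const (b := a)) (h k hk)
    filter_upwards [eventually_nhdsWithin_iff.1 h2] with z hz hzP hzK
    exact hz ⟨hzP, hzK⟩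
  filter_upwards [h1, hP] with x hx hxP k hk
  exact hx k hk hxP hk

theorem exists_eventually_lt_neg {X Y : Type*} [TopologicalSpace X] [TopologicalSpace Y] {P : Set X}
    {K : Set Y} (hK : IsCompact K) {x₀ : X} (hP : P ∈ 𝓝 x₀) {g : X × Y → ℝ} (hg : ContinuousOn g (P
    ×ˢ K)) (h : ∀ k ∈ K, g (x₀, k) < 0) : ∃ c > 0, ∀ᶠ x in 𝓝 x₀, ∀ k ∈ K, g (x, k) < -c := by
  rcases K.eq_empty_or_nonempty with rfl | hne
  · exact ⟨1, one_pos, Eventually.of_forall fun x k hk => absurd hk (notMem_empty k)⟩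
  · have hc : ContinuousOn (fun k => g (x₀, k)) K :=
      hg.comp (f := fun k => (x₀, k)) (by fun_prop) fun k hk => ⟨mem_of_mem_nhds hP, hk⟩
    obtain ⟨k₀, hk₀, hmax⟩ := hK.exists_isMaxOn hne hc
    refine ⟨-g (x₀, k₀) / 2, by linarith [h k₀ hk₀], ?_⟩
    refine eventually_lt_of_isCompact hK hP hg fun k hk => ?_
    have h1 : g (x₀, k) ≤ g (x₀, k₀) := hmax hk
    linarith [h k₀ hk₀]

section Second

variable {N F : Type} [NormedAddCommGroup N] [NormedSpace ℝ N] [NormedAddCommGroup F]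
  [NormedSpace ℝ F]

theorem hasFDerivWithinAt_fderivWithin_apply {G : N → F} {D : Set N} (hG : 𝒞 G D) (hD : UniqueDiffOn
    ℝ D) {q : N} (hq : q ∈ D) (a : N) : HasFDerivWithinAt (fun q => fderivWithin ℝ G D q a)
    ((fderivWithin ℝ (fderivWithin ℝ G D) D q).flip a) D q := by
  have h1 : DifferentiableWithinAt ℝ (fderivWithin ℝ G D) D q :=
    (hG.fderivWithin hD (m := ∞) (by simp)).differentiableOn (by simp) q hq
  have h2 := h1.hasFDerivWithinAt.clm_apply (hasFDerivWithinAt_const a q _)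
  refine h2.congr_fderiv ?_
  ext b
  simp

theorem fderivWithin_fderivWithin_symm {G : N → F} {D : Set N} (hG : 𝒞 G D) (hD : UniqueDiffOn ℝ D)
  (hcl : D ⊆ closure (interior D)) {q : N} (hq : q ∈ D) (a b : N) : fderivWithin ℝ (fderivWithin ℝ G
  D) D q a b = fderivWithin ℝ (fderivWithin ℝ G D) D q b a := (hG q hq).isSymmSndFDerivWithinAt (by
    rw [minSmoothness_of_isRCLikeNormedField]
    exact (mod_cast le_top : ((2 : ℕ∞) : WithTop ℕ∞) ≤ ∞)) hD (hcl hq) hq a b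

end Second

section LocalDomain

variable {F : Type} [NormedAddCommGroup F] [NormedSpace ℝ F]

/-- Parameter domains over a ball. -/
def locDom (δ ρ : ℝ) (z : E n) : Set (𝔓 n) :=
  Ioo (-δ) δ ×ˢ 𝕀 ×ˢ ball z ρ

notation:max "𝐝[" a "," b "," c "]" g:max => fderivWithin ℝ g (locDom a b c)

theorem uniqueDiffOn_locDom (δ ρ : ℝ) (z : E n) : UniqueDiffOn ℝ (locDom δ ρ z) :=
  isOpen_Ioo.uniqueDiffOn.prod (uniqueDiffOn_unit.prod Metric.isOpen_ball.uniqueDiffOn)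

theorem locDom_subset_closure_interior (δ ρ : ℝ) (z : E n) :
    locDom δ ρ z ⊆ closure (interior (locDom δ ρ z)) := by
  rw [locDom, interior_prod_eq, interior_prod_eq, closure_prod_eq, closure_prod_eq,
    isOpen_Ioo.interior_eq, Metric.isOpen_ball.interior_eq, interior_Icc, closure_Ioo zero_ne_one]
  exact prod_mono subset_closure (prod_mono subset_rfl subset_closure)

theorem locDom_mono {δ δ' ρ ρ' : ℝ} {z : E n} (h : δ ≤ δ') (h' : ρ ≤ ρ') : locDom δ ρ z ⊆ locDom δ'
  ρ' z := prod_mono (Ioo_subset_Ioo (by linarith) h) (prod_mono subset_rfl (ball_subset_ball h'))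

variable {δ ρ : ℝ} {z : E n} {g : 𝔓 n → F} {L : 𝔓 n →L[ℝ] F}

theorem hasFDerivAt_sliceX_of_locDom (hg : HasFDerivWithinAt g L (locDom δ ρ z) (ε, t, y)) (hq : (ε,
  t, y) ∈ locDom δ ρ z) : HasFDerivAt (fun y => g (ε, t, y)) (L.comp (dirX n)) y :=
  (HasFDerivWithinAt.comp (f := fun y => (ε, t, y)) y hg (hasFDerivAt_sliceX ε t
  y).hasFDerivWithinAt fun _ hz => ⟨hq.1, hq.2.1, hz⟩).hasFDerivAt (Metric.isOpen_ball.mem_nhds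
  hq.2.2)

theorem hasDerivAt_sliceE_of_locDom (hg : HasFDerivWithinAt g L (locDom δ ρ z) (ε, t, y)) (hq : (ε,
    t, y) ∈ locDom δ ρ z) : HasDerivAt (fun ε => g (ε, t, y)) (L (dirE n)) ε := by
  have h := (HasFDerivWithinAt.comp (f := fun ε => (ε, t, y)) ε hg
    (hasFDerivAt_sliceE ε t y).hasFDerivWithinAt (t := locDom δ ρ z) (s := Ioo (-δ) δ)
    fun _ hz => ⟨hz, hq.2.1, hq.2.2⟩).hasFDerivAt (isOpen_Ioo.mem_nhds hq.1)
  exact h.hasDerivAt.congr_deriv (by simp)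

theorem hasDerivWithinAt_sliceT_of_locDom (hg : HasFDerivWithinAt g L (locDom δ ρ z) (ε, t, y)) (hq
    : (ε, t, y) ∈ locDom δ ρ z) : HasDerivWithinAt (fun t => g (ε, t, y)) (L (dirT n)) 𝕀 t := by
  have h := HasFDerivWithinAt.comp (f := fun t => (ε, t, y)) t hg (hasFDerivAt_sliceT ε t
    y).hasFDerivWithinAt (t := locDom δ ρ z) (s := 𝕀) fun _ hz => ⟨hq.1, hz, hq.2.2⟩
  exact h.hasDerivWithinAt.congr_deriv (by simp)

end LocalDomain

theorem isInvertible_of_injective {A : 𝓛} (hA : ∀ u, A u = 0 → u = 0) : A.IsInvertible := by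
  have hinj : Function.Injective (A : E n →ₗ[ℝ] E n) := (injective_iff_map_eq_zero _).2 hA
  refine ⟨(LinearEquiv.ofInjectiveEndo (A : E n →ₗ[ℝ] E n) hinj).toContinuousLinearEquiv, ?_⟩
  ext1 u
  rfl

/-- A family of maps fixing a point at parameter zero, with its Hamiltonians, in a chart around
that point, which is a nondegenerate maximum of the Hamiltonians at parameter zero. -/
structure LocalFamily (δ ρ : ℝ) (z : E n) (G : 𝔓 n → E n) (H : 𝔓 n → ℝ)
    (ϖ : E n → 𝓑) (U : Set (E n)) : Prop where
  pos : 0 < δ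
  radius : 0 < ρ
  isOpen : IsOpen U
  smooth : 𝒞 G (locDom δ ρ z)
  ham : 𝒞 H (locDom δ ρ z)
  form : 𝒞 ϖ U
  maps : MapsTo G (locDom δ ρ z) U
  ham_center : ∀ ε ∈ Ioo (-δ) δ, ∀ t ∈ 𝕀, H (ε, t, z) = 0
  ham_deriv : ∀ q ∈ locDom δ ρ z, ∀ w : E n, 𝐝[δ, ρ, z] H q (dirX n w) = -ϖ (G q) (𝐝[δ, ρ, z] G q
    (dirT n)) (𝐝[δ, ρ, z] G q (dirX n w))
  base : ∀ t ∈ 𝕀, G (0, t, z) = z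
  start : ∀ ε ∈ Ioo (-δ) δ, G (ε, 0, z) = z
  finish : ∀ ε ∈ Ioo (-δ) δ, G (ε, 1, z) = z
  skew : ∀ y u w, ϖ y u w = -ϖ y w u
  closed : ∀ y ∈ U, ∀ a b c, fderiv ℝ ϖ y a b c - fderiv ℝ ϖ y b a c + fderiv ℝ ϖ y c a b = 0
  nondegenerate : ∀ u, (∀ w, ϖ z u w = 0) → u = 0
  max : ∀ t ∈ 𝕀, ∀ y ∈ ball z ρ, y ≠ z → H (0, t, y) < 0
  injective : ∀ t ∈ 𝕀, ∀ u : E n, 𝐝[δ, ρ, z] G (0, t, z) (dirX n u) = 0 → u = 0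
  hessian : ∀ t ∈ 𝕀, ∀ u : E n, (∀ w : E n, 𝐝[δ, ρ, z] (𝐝[δ, ρ, z] H) (0, t, z) (dirX n u) (dirX n
    w) = 0) → u = 0

/-- The linearization of a local family at its center. -/
def locLin (δ ρ : ℝ) (z : E n) (G : 𝔓 n → E n) (t : ℝ) :
    𝓛 :=
  (𝐝[δ, ρ, z] G (0, t, z)).comp (dirX n)

/-- The variation field of a local family at its center. -/
def locVar (δ ρ : ℝ) (z : E n) (G : 𝔓 n → E n) (t : ℝ) : E n :=
  𝐝[δ, ρ, z] G (0, t, z) (dirE n)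

namespace LocalFamily

variable {δ ρ : ℝ} {z : E n} {G : 𝔓 n → E n} {H : 𝔓 n → ℝ}
  {ϖ : E n → E n →L[ℝ] E n →L[ℝ] ℝ} {U : Set (E n)} (h : LocalFamily δ ρ z G H ϖ U)
include h

theorem mem_center (hε : ε ∈ Ioo (-δ) δ) (ht : t ∈ 𝕀) :
    (ε, t, z) ∈ locDom δ ρ z := ⟨hε, ht, mem_ball_self h.radius⟩

theorem zero_mem : (0 : ℝ) ∈ Ioo (-δ) δ := ⟨by linarith [h.pos], h.pos⟩

theorem mem_base (ht : t ∈ 𝕀) : (0, t, z) ∈ locDom δ ρ z := h.mem_center h.zero_mem ht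

theorem fderivWithin_dirT_base (ht : t ∈ 𝕀) : 𝐝[δ, ρ, z] G (0, t, z) (dirT n) = 0 := by
  have h1 := hasDerivWithinAt_sliceT_of_locDom
    ((h.smooth.differentiableOn (by simp) _ (h.mem_base ht)).hasFDerivWithinAt) (h.mem_base ht)
  have h2 : HasDerivWithinAt (fun t => G (0, t, z)) 0 𝕀 t :=
    (hasDerivWithinAt_const t _ z).congr (fun s hs => h.base s hs) (h.base t ht)
  exact (uniqueDiffOn_unit t ht).eq_deriv _ h1 h2

theorem hasDerivWithinAt_apply_T (ht : t ∈ 𝕀) (a : 𝔓 n) : HasDerivWithinAt (fun t => 𝐝[δ, ρ, z] G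
  (0, t, z) a) (𝐝[δ, ρ, z] (𝐝[δ, ρ, z] G) (0, t, z) (dirT n) a) 𝕀 t :=
  hasDerivWithinAt_sliceT_of_locDom (g := fun q => 𝐝[δ, ρ, z] G q a)
  (hasFDerivWithinAt_fderivWithin_apply h.smooth (uniqueDiffOn_locDom δ ρ z) (h.mem_base ht) a)
  (h.mem_base ht)

theorem contDiffOn_fderivWithin_T : 𝒞 (fun t => 𝐝[δ, ρ, z] G (0, t, z)) 𝕀 := (h.smooth.fderivWithin
  (uniqueDiffOn_locDom δ ρ z) (m := ∞) (by simp)).comp (f := fun t : ℝ => ((0, t, z) : 𝔓 n)) (by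
  fun_prop) fun _ ht => h.mem_base ht

theorem contDiffOn_locLin : 𝒞 (locLin δ ρ z G) 𝕀 :=
  h.contDiffOn_fderivWithin_T.clm_comp contDiffOn_const

theorem contDiffOn_locVar : 𝒞 (locVar δ ρ z G) 𝕀 :=
  h.contDiffOn_fderivWithin_T.clm_apply contDiffOn_const

theorem derivWithin_locLin (ht : t ∈ 𝕀) (u : E n) : derivWithin (locLin δ ρ z G) 𝕀 t u = 𝐝[δ, ρ, z]
    (𝐝[δ, ρ, z] G) (0, t, z) (dirT n) (dirX n u) := by
  have hu := uniqueDiffOn_unit t ht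
  have h1 := (h.contDiffOn_locLin.differentiableOn (by simp) t ht).hasDerivWithinAt
  have h2 := h1.clm_apply (hasDerivWithinAt_const t 𝕀 u)
  have h3 := hu.eq_deriv _ h2 (h.hasDerivWithinAt_apply_T ht (dirX n u))
  simpa using h3

theorem derivWithin_locVar (ht : t ∈ 𝕀) : derivWithin (locVar δ ρ z G) 𝕀 t = 𝐝[δ, ρ, z] (𝐝[δ, ρ, z]
  G) (0, t, z) (dirT n) (dirE n) := (h.hasDerivWithinAt_apply_T ht (dirE n)).derivWithin
  (uniqueDiffOn_unit t ht)

theorem locVar_zero : locVar δ ρ z G 0 = 0 := by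
  have h0 : (0 : ℝ) ∈ 𝕀 := by simp
  have h1 := hasDerivAt_sliceE_of_locDom
    ((h.smooth.differentiableOn (by simp) _ (h.mem_base h0)).hasFDerivWithinAt) (h.mem_base h0)
  refine h1.unique ((hasDerivAt_const 0 z).congr_of_eventuallyEq ?_)
  filter_upwards [isOpen_Ioo.mem_nhds h.zero_mem] with ε hε
  exact h.start ε hε

theorem locVar_one : locVar δ ρ z G 1 = 0 := by
  have h0 : (1 : ℝ) ∈ 𝕀 := by simp
  have h1 := hasDerivAt_sliceE_of_locDom
    ((h.smooth.differentiableOn (by simp) _ (h.mem_base h0)).hasFDerivWithinAt) (h.mem_base h0)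
  refine h1.unique ((hasDerivAt_const 0 z).congr_of_eventuallyEq ?_)
  filter_upwards [isOpen_Ioo.mem_nhds h.zero_mem] with ε hε
  exact h.finish ε hε

theorem isInvertible_locLin (ht : t ∈ 𝕀) : (locLin δ ρ z G t).IsInvertible :=
  isInvertible_of_injective fun u hu => h.injective t ht u hu

/-- The second derivatives of the Hamiltonian at the center. -/
theorem ham_second (ht : t ∈ 𝕀) (a : 𝔓 n) (w : E n) : 𝐝[δ, ρ, z] (𝐝[δ, ρ, z] H) (0, t, z) a (dirX n
    w) = -ϖ z (𝐝[δ, ρ, z] (𝐝[δ, ρ, z] G) (0, t, z) (dirT n) a) (locLin δ ρ z G t w) := by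
  have hud := uniqueDiffOn_locDom δ ρ z
  have hq := h.mem_base ht
  have h1 := hasFDerivWithinAt_fderivWithin_apply h.ham hud hq (dirX n w)
  have hϖ : DifferentiableWithinAt ℝ (fun q => ϖ (G q)) (locDom δ ρ z) (0, t, z) :=
    (h.form.comp h.smooth h.maps).differentiableOn (by simp) _ hq
  have h2 := ((hϖ.hasFDerivWithinAt.clm_apply (hasFDerivWithinAt_fderivWithin_apply h.smooth hud hq
    (dirT n))).clm_apply (hasFDerivWithinAt_fderivWithin_apply h.smooth hud hq (dirX n w))).neg
  have h3 := h2.congr (fun q hq => h.ham_deriv q hq w) (h.ham_deriv _ hq w)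
  have h4 := congrArg (fun L : 𝔓 n →L[ℝ] ℝ => L a) ((hud _ hq).eq h1 h3)
  simp only [ContinuousLinearMap.flip_apply, neg_apply, add_apply,
    ContinuousLinearMap.comp_apply] at h4
  rw [h4, h.fderivWithin_dirT_base ht, h.base t ht, map_zero, map_zero, zero_apply, zero_add,
    zero_apply, add_zero, fderivWithin_fderivWithin_symm h.smooth hud (locDom_subset_closure_interior δ ρ z) hq]
  rfl

theorem isInvertible_derivWithin_locLin (ht : t ∈ 𝕀) : (derivWithin (locLin δ ρ z G) 𝕀
  t).IsInvertible := isInvertible_of_injective fun u hu => h.hessian t ht u fun w => by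
      rw [h.ham_second ht, ← h.derivWithin_locLin ht, hu, map_zero, zero_apply, neg_zero]

theorem ham_second_XX (ht : t ∈ 𝕀) (u w : E n) : 𝐝[δ, ρ, z] (𝐝[δ, ρ, z] H) (0, t, z) (dirX n u)
    (dirX n w) = -ϖ z (derivWithin (locLin δ ρ z G) 𝕀 t u) (locLin δ ρ z G t w) := by
  rw [h.ham_second ht, h.derivWithin_locLin ht]

theorem ham_second_EX (ht : t ∈ 𝕀) (w : E n) : 𝐝[δ, ρ, z] (𝐝[δ, ρ, z] H) (0, t, z) (dirE n) (dirX n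
    w) = -ϖ z (derivWithin (locVar δ ρ z G) 𝕀 t) (locLin δ ρ z G t w) := by
  rw [h.ham_second ht, h.derivWithin_locVar ht]

theorem ham_dirE_center (hε : ε ∈ Ioo (-δ) δ) (ht : t ∈ 𝕀) :
    𝐝[δ, ρ, z] H (ε, t, z) (dirE n) = 0 := by
  have hq := h.mem_center hε ht
  have h1 := hasDerivAt_sliceE_of_locDom
    ((h.ham.differentiableOn (by simp) _ hq).hasFDerivWithinAt) hq
  refine h1.unique ((hasDerivAt_const ε (0 : ℝ)).congr_of_eventuallyEq ?_)
  filter_upwards [isOpen_Ioo.mem_nhds hε] with ε hε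
  exact h.ham_center ε hε t ht

theorem ham_second_EE (ht : t ∈ 𝕀) : 𝐝[δ, ρ, z] (𝐝[δ, ρ, z] H) (0, t, z) (dirE n) (dirE n) = 0 := by
  have hq := h.mem_base ht
  have h1 := hasDerivAt_sliceE_of_locDom (g := fun q => 𝐝[δ, ρ, z] H q (dirE n))
    (hasFDerivWithinAt_fderivWithin_apply h.ham (uniqueDiffOn_locDom δ ρ z) hq (dirE n)) hq
  refine h1.unique ((hasDerivAt_const 0 (0 : ℝ)).congr_of_eventuallyEq ?_)
  filter_upwards [isOpen_Ioo.mem_nhds h.zero_mem] with ε hε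
  exact h.ham_dirE_center hε ht

theorem hasFDerivAt_ham_X (hq : (ε, t, y) ∈ locDom δ ρ z) : HasFDerivAt (fun y => H (ε, t, y))
  ((𝐝[δ, ρ, z] H (ε, t, y)).comp (dirX n)) y := hasFDerivAt_sliceX_of_locDom
  ((h.ham.differentiableOn (by simp) _ hq).hasFDerivWithinAt) hq

theorem hasFDerivAt_ham_apply_X (hq : (ε, t, y) ∈ locDom δ ρ z) (a : 𝔓 n) : HasFDerivAt (fun y =>
  𝐝[δ, ρ, z] H (ε, t, y) a) (((𝐝[δ, ρ, z] (𝐝[δ, ρ, z] H) (ε, t, y)).flip a).comp (dirX n)) y :=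
  hasFDerivAt_sliceX_of_locDom (g := fun q => 𝐝[δ, ρ, z] H q a)
  (hasFDerivWithinAt_fderivWithin_apply h.ham (uniqueDiffOn_locDom δ ρ z) hq a) hq

theorem hasDerivAt_line {y u : E n} {s : ℝ} (hq : (ε, t, y + s • u) ∈ locDom δ ρ z) : HasDerivAt
    (fun s : ℝ => H (ε, t, y + s • u)) (𝐝[δ, ρ, z] H (ε, t, y + s • u) (dirX n u)) s := by
  have h2 : HasDerivAt (fun s : ℝ => y + s • u) u s := by
    simpa using ((hasDerivAt_id s).smul_const u).const_add y
  exact HasFDerivAt.comp_hasDerivAt (l := fun y => H (ε, t, y)) (f := fun s : ℝ => y + s • u) s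
    (h.hasFDerivAt_ham_X hq) h2

theorem hasDerivAt_line_apply {y u : E n} {s : ℝ} (hq : (ε, t, y + s • u) ∈ locDom δ ρ z) (a : 𝔓 n)
    : HasDerivAt (fun s : ℝ => 𝐝[δ, ρ, z] H (ε, t, y + s • u) a) (𝐝[δ, ρ, z] (𝐝[δ, ρ, z] H) (ε, t, y
    + s • u) (dirX n u) a) s := by
  have h2 : HasDerivAt (fun s : ℝ => y + s • u) u s := by
    simpa using ((hasDerivAt_id s).smul_const u).const_add y
  exact (h.hasFDerivAt_ham_apply_X hq a).comp_hasDerivAt s h2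

theorem ham_second_symm {q : 𝔓 n} (hq : q ∈ locDom δ ρ z) (a b : 𝔓 n) : 𝐝[δ, ρ, z] (𝐝[δ, ρ, z] H) q
  a b = 𝐝[δ, ρ, z] (𝐝[δ, ρ, z] H) q b a := fderivWithin_fderivWithin_symm h.ham (uniqueDiffOn_locDom
  δ ρ z) (locDom_subset_closure_interior δ ρ z) hq a b

theorem ham_second_nonpos (ht : t ∈ 𝕀) (u : E n) : 𝐝[δ, ρ, z] (𝐝[δ, ρ, z] H) (0, t, z) (dirX n u)
    (dirX n u) ≤ 0 := by
  by_contra hpos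
  push Not at hpos
  have hu : u ≠ 0 := by
    rintro rfl
    rw [(dirX n).map_zero, map_zero] at hpos
    exact lt_irrefl _ hpos
  let g : ℝ → ℝ := fun s => H (0, t, z + s • u)
  have hev : ∀ᶠ s : ℝ in 𝓝 0, z + s • u ∈ ball z ρ := by
    have hc : ContinuousAt (fun s : ℝ => z + s • u) 0 := by fun_prop
    exact hc (Metric.isOpen_ball.mem_nhds (by simp [h.radius]))
  have hmem : ∀ᶠ s : ℝ in 𝓝 0, (0, t, z + s • u) ∈ locDom δ ρ z := by
    filter_upwards [hev] with s hs
    exact ⟨h.zero_mem, ht, hs⟩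
  have hd : ∀ᶠ s : ℝ in 𝓝 0, deriv g s = 𝐝[δ, ρ, z] H (0, t, z + s • u) (dirX n u) := by
    filter_upwards [hmem] with s hs
    exact (h.hasDerivAt_line hs).deriv
  have hdd : deriv (deriv g) 0 = 𝐝[δ, ρ, z] (𝐝[δ, ρ, z] H) (0, t, z) (dirX n u) (dirX n u) := by
    rw [EventuallyEq.deriv_eq hd]
    have := (h.hasDerivAt_line_apply hmem.self_of_nhds (dirX n u)).deriv
    simpa using this
  have hg0 : deriv g 0 = 0 := by
    have hmax : IsLocalMax g 0 := by
      filter_upwards [hev] with s hs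
      by_cases h0 : s • u = 0
      · simp [g, h0]
      · have h1 := h.max t ht (z + s • u) hs (by simpa using h0)
        have h2 := h.ham_center 0 h.zero_mem t ht
        simp only [g, zero_smul, add_zero]
        linarith
    exact hmax.deriv_eq_zero
  have hmin := isLocalMin_of_deriv_deriv_pos (f := g) (x₀ := 0) (by rw [hdd]; exact hpos) hg0
    (h.hasDerivAt_line hmem.self_of_nhds).continuousAt
  have h3 : ∀ᶠ s : ℝ in 𝓝[≠] 0, False := by
    have := hmin.filter_mono (nhdsWithin_le_nhds (s := {0}ᶜ))
    filter_upwards [hmin.filter_mono nhdsWithin_le_nhds, hev.filter_mono nhdsWithin_le_nhds,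
      self_mem_nhdsWithin] with s hs1 hs2 hs3
    have h1 := h.max t ht (z + s • u) hs2 (by
      simpa using ⟨hs3, hu⟩)
    have h2 := h.ham_center 0 h.zero_mem t ht
    simp only [g, zero_smul, add_zero] at hs1
    linarith
  exact NeBot.ne (inferInstance : (𝓝[≠] (0 : ℝ)).NeBot) (eventually_false_iff_eq_bot.1 h3)

theorem ham_second_neg (ht : t ∈ 𝕀) {u : E n} (hu : u ≠ 0) : 𝐝[δ, ρ, z] (𝐝[δ, ρ, z] H) (0, t, z)
    (dirX n u) (dirX n u) < 0 := by
  refine lt_of_le_of_ne (h.ham_second_nonpos ht u) fun h0 => hu ?_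
  have hK : ∀ w, 𝐝[δ, ρ, z] (𝐝[δ, ρ, z] H) (0, t, z) (dirX n u) (dirX n w) = 0 := by
    intro w
    set B := 𝐝[δ, ρ, z] (𝐝[δ, ρ, z] H) (0, t, z)
    have hsym : B (dirX n w) (dirX n u) = B (dirX n u) (dirX n w) :=
      h.ham_second_symm (h.mem_base ht) _ _
    have hs : ∀ s : ℝ, 2 * s * B (dirX n u) (dirX n w) + s ^ 2 * B (dirX n w) (dirX n w) ≤ 0 := by
      intro s
      have h1 := h.ham_second_nonpos ht (u + s • w)
      have h2 : B (dirX n (u + s • w)) (dirX n (u + s • w)) = B (dirX n u) (dirX n u)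
          + 2 * s * B (dirX n u) (dirX n w) + s ^ 2 * B (dirX n w) (dirX n w) := by
        simp only [map_add, map_smul, add_apply, smul_apply, smul_eq_mul]
        linear_combination s * hsym
      rw [h2, h0] at h1
      linarith
    by_contra hne
    set b := B (dirX n u) (dirX n w)
    set d := B (dirX n w) (dirX n w)
    have hd : d ≤ 0 := h.ham_second_nonpos ht w
    have h1 := hs (b / (1 - d))
    have h2 : 0 < 1 - d := by linarith
    have h3 : 2 * (b / (1 - d)) * b + (b / (1 - d)) ^ 2 * d = b ^ 2 * (2 - d) / (1 - d) ^ 2 := by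
      field_simp
      ring
    rw [h3] at h1
    have h4 : 0 < b ^ 2 * (2 - d) / (1 - d) ^ 2 := by
      have : 0 < b ^ 2 := by positivity
      have : 0 < 2 - d := by linarith
      positivity
    linarith
  exact h.hessian t ht u hK

theorem exists_ham_second_le : ∃ δ₁ ρ₁ c : ℝ, 0 < δ₁ ∧ δ₁ ≤ δ ∧ 0 < ρ₁ ∧ ρ₁ ≤ ρ ∧ 0 < c ∧ ∀ q ∈
    locDom δ₁ ρ₁ z, ∀ u : E n, 𝐝[δ, ρ, z] (𝐝[δ, ρ, z] H) q (dirX n u) (dirX n u) ≤ -c * ‖u‖ ^ 2 :=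
    by
  let g : (ℝ × E n) × (ℝ × E n) → ℝ := fun k => 𝐝[δ, ρ, z] (𝐝[δ, ρ, z] H) (k.1.1, k.2.1, k.1.2)
    (dirX n k.2.2) (dirX n k.2.2)
  have hP : Ioo (-δ) δ ×ˢ ball z ρ ∈ 𝓝 ((0 : ℝ), z) :=
    prod_mem_nhds (isOpen_Ioo.mem_nhds h.zero_mem) (ball_mem_nhds z h.radius)
  have hg : ContinuousOn g ((Ioo (-δ) δ ×ˢ ball z ρ) ×ˢ (𝕀 ×ˢ sphere (0 : E n) 1)) := by
    have h1 : ContinuousOn (𝐝[δ, ρ, z] (𝐝[δ, ρ, z] H)) (locDom δ ρ z) := ((h.ham.fderivWithin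
        (uniqueDiffOn_locDom δ ρ z) (m := ∞) (by simp)).fderivWithin (uniqueDiffOn_locDom δ ρ z) (m
        := ∞) (by simp)).continuousOn
    have h2 := h1.comp (f := fun k : (ℝ × E n) × (ℝ × E n) => ((k.1.1, k.2.1, k.1.2) : 𝔓 n))
      (s := (Ioo (-δ) δ ×ˢ ball z ρ) ×ˢ (𝕀 ×ˢ sphere (0 : E n) 1))
      (by fun_prop) fun k hk => ⟨hk.1.1, hk.2.1, hk.1.2⟩
    have h3 : Continuous (fun k : (ℝ × E n) × (ℝ × E n) => dirX n k.2.2) :=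
      (dirX n).continuous.comp (by fun_prop)
    exact (h2.clm_apply h3.continuousOn).clm_apply h3.continuousOn
  obtain ⟨c, hc, hev⟩ := exists_eventually_lt_neg (isCompact_Icc.prod (isCompact_sphere (0 : E n) 1))
    hP hg (fun k hk => h.ham_second_neg hk.1 (by
      have := hk.2
      rintro h0
      rw [h0] at this
      simp at this))
  obtain ⟨r, hr, hball⟩ := Metric.eventually_nhds_iff_ball.1 hev
  refine ⟨min r δ, min r ρ, c, lt_min hr h.pos, min_le_right _ _, lt_min hr h.radius,
    min_le_right _ _, hc, ?_⟩
  rintro ⟨ε, t, y⟩ ⟨hε, ht, hy⟩ u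
  have hmem : ((ε, y) : ℝ × E n) ∈ ball ((0 : ℝ), z) r := by
    rw [mem_ball, Prod.dist_eq, max_lt_iff]
    refine ⟨?_, lt_of_lt_of_le hy (min_le_left _ _)⟩
    rw [Real.dist_eq, sub_zero]
    exact lt_of_lt_of_le (abs_lt.2 hε) (min_le_left _ _)
  by_cases hu : u = 0
  · subst hu
    rw [(dirX n).map_zero, map_zero]
    simp
  · have hn : 0 < ‖u‖ := norm_pos_iff.2 hu
    have h1 := hball _ hmem (t, ‖u‖⁻¹ • u) ⟨ht, by simp [norm_smul, hn.ne']⟩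
    simp only [g, map_smul, smul_apply, smul_eq_mul] at h1
    have h2 : ‖u‖ ^ 2 * (‖u‖⁻¹ * (‖u‖⁻¹ * fderivWithin ℝ (𝐝[δ, ρ, z] H)
        (locDom δ ρ z) (ε, t, y) (dirX n u) (dirX n u))) = 𝐝[δ, ρ, z] (fderivWithin ℝ H
        (locDom δ ρ z)) (ε, t, y) (dirX n u) (dirX n u) := by
      field_simp
    rw [← h2]
    nlinarith [sq_nonneg ‖u‖]

/-- The maximum point of the Hamiltonian depends smoothly on the parameters. -/
theorem exists_maximizer : ∃ (δ₂ ρ₂ : ℝ) (m : ℝ × ℝ → E n), 0 < δ₂ ∧ δ₂ ≤ δ ∧ 0 < ρ₂ ∧ ρ₂ < ρ ∧ 𝒞 m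
    (Ioo (-δ₂) δ₂ ×ˢ 𝕀) ∧ (∀ q ∈ Ioo (-δ₂) δ₂ ×ˢ 𝕀, m q ∈ ball z ρ₂ ∧ (∀ w : E n, 𝐝[δ, ρ, z] H (q.1,
    q.2, m q) (dirX n w) = 0) ∧ ∀ y ∈ closedBall z ρ₂, H (q.1, q.2, y) ≤ H (q.1, q.2, m q)) ∧ ∀ t ∈
    𝕀, m (0, t) = z := by
  obtain ⟨δ₁, ρ₁, c, hδ₁, hδ₁', hρ₁, hρ₁', hc, hneg⟩ := h.exists_ham_second_le
  have hρ₂ : 0 < ρ₁ / 2 := by linarith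
  set ρ₂ := ρ₁ / 2 with hρ₂d
  have hcb : closedBall z ρ₂ ⊆ ball z ρ₁ := Metric.closedBall_subset_ball (by rw [hρ₂d]; linarith)
  have hbb : ball z ρ₁ ⊆ ball z ρ := ball_subset_ball hρ₁'
  -- on the sphere the Hamiltonian stays negative
  have hsph : ∀ᶠ ε : ℝ in 𝓝 0, ∀ k ∈ 𝕀 ×ˢ sphere z ρ₂, H (ε, k.1, k.2) < 0 := by
    refine eventually_lt_of_isCompact (isCompact_Icc.prod (isCompact_sphere z ρ₂))
      (isOpen_Ioo.mem_nhds h.zero_mem) (g := fun p : 𝔓 n => H (p.1, p.2.1, p.2.2)) ?_ ?_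
    · exact h.ham.continuousOn.mono (prod_mono subset_rfl (prod_mono subset_rfl
        (Metric.sphere_subset_closedBall.trans (hcb.trans hbb))))
    · rintro ⟨t, y⟩ ⟨ht, hy⟩
      refine h.max t ht y (hbb (hcb (Metric.sphere_subset_closedBall hy))) ?_
      rintro rfl
      simp at hy
      linarith
  obtain ⟨r, hr, hball⟩ := Metric.eventually_nhds_iff_ball.1 hsph
  set δ₂ := min r δ₁ with hδ₂d
  have hδ₂ : 0 < δ₂ := lt_min hr hδ₁
  have hδ₂' : δ₂ ≤ δ₁ := min_le_right _ _
  have hIoo : ∀ ε ∈ Ioo (-δ₂) δ₂, ε ∈ Ioo (-δ) δ := fun ε hε =>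
    ⟨by linarith [hε.1], by linarith [hε.2]⟩
  have hIoo₁ : ∀ ε ∈ Ioo (-δ₂) δ₂, ε ∈ Ioo (-δ₁) δ₁ := fun ε hε =>
    ⟨by linarith [hε.1], by linarith [hε.2]⟩
  have hex : ∀ q : ℝ × ℝ, ∃ y : E n, q ∈ Ioo (-δ₂) δ₂ ×ˢ 𝕀 → y ∈ closedBall z ρ₂ ∧ ∀ y' ∈ closedBall
      z ρ₂, H (q.1, q.2, y') ≤ H (q.1, q.2, y) := by
    intro q
    by_cases hq : q ∈ Ioo (-δ₂) δ₂ ×ˢ 𝕀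
    · have hcont : ContinuousOn (fun y => H (q.1, q.2, y)) (closedBall z ρ₂) :=
        h.ham.continuousOn.comp (f := fun y => (q.1, q.2, y)) (by fun_prop) fun y hy => ⟨hIoo _
        hq.1, hq.2, hbb (hcb hy)⟩
      obtain ⟨y, hy, hmax⟩ := (isCompact_closedBall z ρ₂).exists_isMaxOn
        ⟨z, mem_closedBall_self hρ₂.le⟩ hcont
      exact ⟨y, fun _ => ⟨hy, fun y' hy' => hmax hy'⟩⟩
    · exact ⟨z, fun h0 => absurd h0 hq⟩
  choose m hm using hex
  have hmpos : ∀ q ∈ Ioo (-δ₂) δ₂ ×ˢ 𝕀, 0 ≤ H (q.1, q.2, m q) := fun q hq => by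
    have h1 := (hm q hq).2 z (mem_closedBall_self hρ₂.le)
    rwa [h.ham_center _ (hIoo _ hq.1) _ hq.2] at h1
  have hmball : ∀ q ∈ Ioo (-δ₂) δ₂ ×ˢ 𝕀, m q ∈ ball z ρ₂ := by
    intro q hq
    by_contra hcon
    have h1 : m q ∈ sphere z ρ₂ := le_antisymm (hm q hq).1 (not_lt.1 hcon)
    have h2 := hball q.1 (by
      rw [mem_ball, Real.dist_eq, sub_zero]
      exact lt_of_lt_of_le (abs_lt.2 hq.1) (min_le_left _ _)) (q.2, m q) ⟨hq.2, h1⟩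
    linarith [hmpos q hq]
  have hmdom : ∀ q ∈ Ioo (-δ₂) δ₂ ×ˢ 𝕀, (q.1, q.2, m q) ∈ locDom δ₁ ρ₁ z :=
    fun q hq => ⟨hIoo₁ _ hq.1, hq.2, hcb (ball_subset_closedBall (hmball q hq))⟩
  have hdom : locDom δ₁ ρ₁ z ⊆ locDom δ ρ z := locDom_mono hδ₁' hρ₁'
  have hcrit : ∀ q ∈ Ioo (-δ₂) δ₂ ×ˢ 𝕀, ∀ w : E n, 𝐝[δ, ρ, z] H (q.1, q.2, m q) (dirX n w) = 0 := by
    intro q hq w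
    have h1 : IsLocalMax (fun y => H (q.1, q.2, y)) (m q) := by
      filter_upwards [Metric.isOpen_ball.mem_nhds (hmball q hq)] with y hy
      exact (hm q hq).2 y (ball_subset_closedBall hy)
    have h2 := h1.hasFDerivAt_eq_zero (h.hasFDerivAt_ham_X (hdom (hmdom q hq)))
    exact congrArg (fun L : E n →L[ℝ] ℝ => L w) h2
  have hmono : ∀ ε ∈ Ioo (-δ₂) δ₂, ∀ t ∈ 𝕀, ∀ y ∈ ball z ρ₁, ∀ y' ∈ ball z ρ₁, 𝐝[δ, ρ, z] H (ε, t,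
      y') (dirX n (y' - y)) - 𝐝[δ, ρ, z] H (ε, t, y) (dirX n (y' - y)) ≤ -c * ‖y' - y‖ ^ 2 := by
    intro ε hε t ht y hy y' hy'
    have hseg : ∀ s ∈ 𝕀, (ε, t, y + s • (y' - y)) ∈ locDom δ₁ ρ₁ z := fun s hs =>
      ⟨hIoo₁ _ hε, ht, (convex_ball z ρ₁).add_smul_sub_mem hy hy' hs⟩
    have hd : ∀ s ∈ 𝕀, HasDerivAt (fun s : ℝ => 𝐝[δ, ρ, z] H (ε, t, y + s • (y' - y)) (dirX n (y' -
      y))) (𝐝[δ, ρ, z] (𝐝[δ, ρ, z] H) (ε, t, y + s • (y' - y)) (dirX n (y' - y)) (dirX n (y' - y)))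
      s := fun s hs => h.hasDerivAt_line_apply (hdom (hseg s hs)) _
    obtain ⟨s, hs, hs'⟩ := exists_hasDerivAt_eq_slope _ _ zero_lt_one (fun s hs => (hd s
      hs).continuousAt.continuousWithinAt) (fun s hs => hd s (Ioo_subset_Icc_self hs))
    have h1 := hneg _ (hseg s (Ioo_subset_Icc_self hs)) (y' - y)
    rw [hs'] at h1
    simpa using h1
  have hcontm : ContinuousOn m (Ioo (-δ₂) δ₂ ×ˢ 𝕀) := by
    intro q hq
    have hA : ContinuousWithinAt (fun q' : ℝ × ℝ => 𝐝[δ, ρ, z] H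
        (q'.1, q'.2, m q)) (Ioo (-δ₂) δ₂ ×ˢ 𝕀) q := by
      have h1 : ContinuousOn (𝐝[δ, ρ, z] H) (locDom δ ρ z) :=
        h.ham.continuousOn_fderivWithin (uniqueDiffOn_locDom δ ρ z) (by simp)
      have h2 := h1.comp (f := fun q' : ℝ × ℝ => ((q'.1, q'.2, m q) : 𝔓 n)) (s := Ioo (-δ₂) δ₂ ×ˢ 𝕀)
        (by fun_prop) fun q' hq' => ⟨hIoo _ hq'.1, hq'.2, hbb (hmdom q hq).2.2⟩
      exact h2 q hq
    have hA2 : ContinuousWithinAt (fun q' : ℝ × ℝ => c⁻¹ * ‖(𝐝[δ, ρ, z] H (q'.1, q'.2, m q)).comp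
      (dirX n)‖) (Ioo (-δ₂) δ₂ ×ˢ 𝕀) q := ((hA.clm_comp continuousWithinAt_const).norm).const_mul _
    have h0 : (𝐝[δ, ρ, z] H (q.1, q.2, m q)).comp (dirX n) = 0 := by
      ext w
      exact hcrit q hq w
    have hlim : Tendsto (fun q' : ℝ × ℝ => c⁻¹ * ‖(𝐝[δ, ρ, z] H
        (q'.1, q'.2, m q)).comp (dirX n)‖) (𝓝[Ioo (-δ₂) δ₂ ×ˢ 𝕀] q) (𝓝 0) := by
      have := hA2.tendsto
      rwa [h0, norm_zero, mul_zero] at this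
    rw [ContinuousWithinAt, tendsto_iff_dist_tendsto_zero]
    refine squeeze_zero' (Eventually.of_forall fun _ => dist_nonneg) ?_ hlim
    filter_upwards [self_mem_nhdsWithin] with q' hq'
    have h1 := hmono q'.1 hq'.1 q'.2 hq'.2 (m q) (hmdom q hq).2.2 (m q') (hmdom q' hq').2.2
    rw [hcrit q' hq', zero_sub] at h1
    have h2 : 𝐝[δ, ρ, z] H (q'.1, q'.2, m q) (dirX n (m q' - m q)) ≤ ‖(𝐝[δ, ρ, z] H (q'.1, q'.2, m
      q)).comp (dirX n)‖ * ‖m q' - m q‖ := (le_abs_self _).trans (((𝐝[δ, ρ, z] H (q'.1, q'.2, m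
      q)).comp (dirX n)).le_opNorm _)
    rw [dist_eq_norm]
    set A := ‖(𝐝[δ, ρ, z] H (q'.1, q'.2, m q)).comp (dirX n)‖
    have h3 : c * ‖m q' - m q‖ ^ 2 ≤ A * ‖m q' - m q‖ := by linarith
    rcases (norm_nonneg (m q' - m q)).eq_or_lt with h4 | h4
    · rw [← h4]; positivity
    · rw [inv_mul_eq_div, le_div_iff₀ hc]
      nlinarith
  refine ⟨δ₂, ρ₂, m, hδ₂, hδ₂'.trans hδ₁', hρ₂, by rw [hρ₂d]; linarith, ?_,
    fun q hq => ⟨hmball q hq, hcrit q hq, (hm q hq).2⟩, ?_⟩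
  · -- smoothness by the implicit function theorem
    set S := Ioo (-δ₂) δ₂ ×ˢ 𝕀 with hS
    have hSu : UniqueDiffOn ℝ S := isOpen_Ioo.uniqueDiffOn.prod uniqueDiffOn_unit
    have hSBu : UniqueDiffOn ℝ (S ×ˢ ball z ρ₁) := hSu.prod Metric.isOpen_ball.uniqueDiffOn
    let j : ((ℝ × ℝ) × E n) ≃L[ℝ] (𝔓 n) := ContinuousLinearEquiv.prodAssoc ℝ ℝ ℝ (E n)
    have hj : MapsTo j (S ×ˢ ball z ρ₁) (locDom δ ρ z) := fun k hk =>
      ⟨hIoo _ hk.1.1, hk.1.2, hbb hk.2⟩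
    have hA : 𝒞 (fun k : (ℝ × ℝ) × E n => (𝐝[δ, ρ, z] H (j k)).comp (dirX n)) (S ×ˢ ball z ρ₁) :=
      ((h.ham.fderivWithin (uniqueDiffOn_locDom δ ρ z) (m := ∞) (by simp)).comp
      j.contDiff.contDiffOn hj).clm_comp contDiffOn_const
    refine contDiffOn_implicit hSu isOpen_ball hA
      (fun q hq => (hmdom q hq).2.2) (fun q hq => by ext w; exact hcrit q hq w) hcontm ?_
    intro q hq
    have hqm : (q, m q) ∈ S ×ˢ ball z ρ₁ := ⟨hq, (hmdom q hq).2.2⟩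
    set A' := fderivWithin ℝ (fun k : (ℝ × ℝ) × E n =>
        (𝐝[δ, ρ, z] H (j k)).comp (dirX n)) (S ×ˢ ball z ρ₁) (q, m q)
    have hval : ∀ (v : (ℝ × ℝ) × E n) (u : E n), A' v u = fderivWithin ℝ
        (𝐝[δ, ρ, z] H) (locDom δ ρ z) (j (q, m q)) (j v) (dirX n u) := by
      intro v u
      have h1 := ((hA.differentiableOn (by simp) _ hqm).hasFDerivWithinAt).clm_apply
        (hasFDerivWithinAt_const u (q, m q) _)
      have h2 := (hasFDerivWithinAt_fderivWithin_apply h.ham (uniqueDiffOn_locDom δ ρ z) (hj hqm)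
        (dirX n u)).comp (q, m q) j.hasFDerivAt.hasFDerivWithinAt hj
      have h3 := congrArg (fun L : (ℝ × ℝ) × E n →L[ℝ] ℝ => L v) ((hSBu _ hqm).eq h1 h2)
      simpa using h3
    let T : E n →ₗ[ℝ] (E n →L[ℝ] ℝ) :=
      (A'.comp (ContinuousLinearMap.inr ℝ (ℝ × ℝ) (E n)) : E n →L[ℝ] (E n →L[ℝ] ℝ))
    have hT : Function.Injective T := by
      refine (injective_iff_map_eq_zero _).2 fun u hu => ?_
      have h1 : A' (0, u) u = 0 := congrArg (fun L : E n →L[ℝ] ℝ => L u) hu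
      rw [hval] at h1
      have h2 := hneg _ (hmdom q hq) u
      have h3 : 𝐝[δ, ρ, z] (𝐝[δ, ρ, z] H) (q.1, q.2, m q) (dirX n u) (dirX n u) = 0 := h1
      rw [h3] at h2
      have h4 : ‖u‖ ^ 2 ≤ 0 := by nlinarith [sq_nonneg ‖u‖]
      have h5 : ‖u‖ = 0 := by
        have := sq_nonneg ‖u‖
        exact pow_eq_zero_iff two_ne_zero |>.1 (le_antisymm h4 this)
      exact norm_eq_zero.1 h5
    have hfr : Module.finrank ℝ (E n) = Module.finrank ℝ (E n →L[ℝ] ℝ) := by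
      rw [← (LinearMap.toContinuousLinearMap : (E n →ₗ[ℝ] ℝ) ≃ₗ[ℝ] (E n →L[ℝ] ℝ)).finrank_eq]
      exact (Subspace.dual_finrank_eq (K := ℝ) (V := E n)).symm
    exact ⟨(T.linearEquivOfInjective hT hfr).toContinuousLinearEquiv, fun w => rfl⟩
  · intro t ht
    by_contra hne
    have hq : ((0 : ℝ), t) ∈ Ioo (-δ₂) δ₂ ×ˢ 𝕀 := ⟨⟨by linarith, hδ₂⟩, ht⟩
    have h1 := h.max t ht (m (0, t)) (hbb (hmdom _ hq).2.2) hne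
    have h2 := hmpos _ hq
    simp only at h2
    linarith

end LocalFamily

/-- The operator of the linearized equation. -/
def flowOp (S : ℝ → 𝓛) (t : ℝ) : 𝓛 :=
  derivWithin S 𝕀 t ∘L (S t).inverse

theorem flowOp_comp {S : ℝ → 𝓛} (hS : (S t).IsInvertible) :
    flowOp S t ∘L S t = derivWithin S 𝕀 t := by
  obtain ⟨L, hL⟩ := hS
  rw [flowOp, ← hL, ContinuousLinearMap.inverse_equiv]
  ext1 u
  simp

theorem isInvertible_flowOp {S : ℝ → 𝓛} (hS : (S t).IsInvertible)
    (hS' : (derivWithin S 𝕀 t).IsInvertible) : (flowOp S t).IsInvertible := by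
  obtain ⟨L, hL⟩ := hS
  obtain ⟨L', hL'⟩ := hS'
  refine ⟨L.symm.trans L', ?_⟩
  rw [flowOp, ← hL, ContinuousLinearMap.inverse_equiv, ← hL']
  rfl

theorem flowOp_inverse_apply {S : ℝ → 𝓛} (hS : (S t).IsInvertible) (hS' : (derivWithin S 𝕀
    t).IsInvertible) (u : E n) : (flowOp S t).inverse (derivWithin S 𝕀 t u) = S t u := by
  obtain ⟨L, hL⟩ := hS
  obtain ⟨L', hL'⟩ := hS'
  have h1 : flowOp S t = (L.symm.trans L' : E n ≃L[ℝ] E n) := by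
    rw [flowOp, ← hL, ContinuousLinearMap.inverse_equiv, ← hL']
    rfl
  rw [h1, ContinuousLinearMap.inverse_equiv, ← hL, ← hL']
  simp

/-- The quadratic functional of the second variation. -/
def quadForm (β : 𝓑) (S : ℝ → 𝓛)
    (v : ℝ → E n) : ℝ :=
  -∫ t in 0..1, (β ((flowOp S t).inverse (derivWithin v 𝕀 t))
    (derivWithin v 𝕀 t) + β (derivWithin v 𝕀 t) (v t))

theorem contDiffOn_inverse {A : ℝ → 𝓛} {s : Set ℝ} (hA : 𝒞 A s)
    (hi : ∀ t ∈ s, (A t).IsInvertible) : 𝒞 (fun t => (A t).inverse) s := by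
  intro t ht
  obtain ⟨L, hL⟩ := hi t ht
  have h1 : ContDiffAt ℝ ∞ ContinuousLinearMap.inverse (A t) := by
    rw [← hL]; exact contDiffAt_map_inverse L
  exact h1.comp_contDiffWithinAt t (hA t ht)

theorem contDiffOn_derivWithin_unit {F : Type} [NormedAddCommGroup F] [NormedSpace ℝ F] {f : ℝ → F}
  (hf : 𝒞 f 𝕀) : 𝒞 (derivWithin f 𝕀) 𝕀 := hf.derivWithin uniqueDiffOn_unit (by simp)

namespace LocalFamily

variable {δ ρ : ℝ} {z : E n} {G : 𝔓 n → E n} {H : 𝔓 n → ℝ}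
  {ϖ : E n → E n →L[ℝ] E n →L[ℝ] ℝ} {U : Set (E n)} (h : LocalFamily δ ρ z G H ϖ U)
include h

/-- The form on the two velocities at the center. -/
def area {δ ρ : ℝ} {z : E n} {G : 𝔓 n → E n} {H : 𝔓 n → ℝ}
    {ϖ : E n → 𝓑} {U : Set (E n)} (_h : LocalFamily δ ρ z G H ϖ U)
    (ε t : ℝ) : ℝ :=
  ϖ (G (ε, t, z)) (𝐝[δ, ρ, z] G (ε, t, z) (dirT n))
    (𝐝[δ, ρ, z] G (ε, t, z) (dirE n))

theorem contDiffOn_area : 𝒞 (fun q : ℝ × ℝ => h.area q.1 q.2) (Ioo (-δ) δ ×ˢ 𝕀) := by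
  have hj : 𝒞 (fun q : ℝ × ℝ => ((q.1, q.2, z) : 𝔓 n)) (Ioo (-δ) δ ×ˢ 𝕀) := by fun_prop
  have hm : MapsTo (fun q : ℝ × ℝ => ((q.1, q.2, z) : 𝔓 n))
    (Ioo (-δ) δ ×ˢ 𝕀) (locDom δ ρ z) := fun q hq => h.mem_center hq.1 hq.2
  have h1 := (h.smooth.fderivWithin (uniqueDiffOn_locDom δ ρ z) (m := ∞) (by simp)).comp hj hm
  exact (((h.form.comp h.smooth h.maps).comp hj hm).clm_apply
    (h1.clm_apply contDiffOn_const)).clm_apply (h1.clm_apply contDiffOn_const)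

theorem hasDerivAt_area (ht : t ∈ 𝕀) : HasDerivAt (fun ε => h.area ε t) (ϖ z (derivWithin (locVar δ
    ρ z G) 𝕀 t) (locVar δ ρ z G t)) 0 := by
  have hud := uniqueDiffOn_locDom δ ρ z
  have hq := h.mem_base ht
  have hϖ : DifferentiableWithinAt ℝ (fun q => ϖ (G q)) (locDom δ ρ z) (0, t, z) :=
    (h.form.comp h.smooth h.maps).differentiableOn (by simp) _ hq
  have h2 := (hϖ.hasFDerivWithinAt.clm_apply (hasFDerivWithinAt_fderivWithin_apply h.smooth hud hq
    (dirT n))).clm_apply (hasFDerivWithinAt_fderivWithin_apply h.smooth hud hq (dirE n))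
  have h3 := hasDerivAt_sliceE_of_locDom h2 hq
  refine h3.congr_deriv ?_
  simp only [ContinuousLinearMap.flip_apply, add_apply, ContinuousLinearMap.comp_apply]
  rw [h.fderivWithin_dirT_base ht, h.base t ht, map_zero, map_zero, zero_apply, zero_add,
    zero_apply, add_zero, fderivWithin_fderivWithin_symm h.smooth hud
    (locDom_subset_closure_interior δ ρ z) hq, ← h.derivWithin_locVar ht]
  rfl

section Maximizer

variable {δ₂ ρ₂ : ℝ} {m : ℝ × ℝ → E n} (hδ₂ : 0 < δ₂) (hδ : δ₂ ≤ δ) (hρ : ρ₂ < ρ) (hm : 𝒞 m (Ioo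
  (-δ₂) δ₂ ×ˢ 𝕀)) (hmb : ∀ q ∈ Ioo (-δ₂) δ₂ ×ˢ 𝕀, m q ∈ ball z ρ₂) (hmc : ∀ q ∈ Ioo (-δ₂) δ₂ ×ˢ 𝕀, ∀
  w : E n, 𝐝[δ, ρ, z] H (q.1, q.2, m q) (dirX n w) = 0) (hm0 : ∀ t ∈ 𝕀, m (0, t) = z)
include hδ hρ hm hmb

omit hm in
theorem mapsTo_maximizer : MapsTo (fun q : ℝ × ℝ => ((q.1, q.2, m q) : 𝔓 n)) (Ioo (-δ₂) δ₂ ×ˢ 𝕀)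
  (locDom δ ρ z) := fun q hq => ⟨⟨by linarith [hq.1.1], by linarith [hq.1.2]⟩, hq.2,
  ball_subset_ball hρ.le (hmb q hq)⟩

theorem contDiffOn_max : 𝒞 (fun q : ℝ × ℝ => H (q.1, q.2, m q)) (Ioo (-δ₂) δ₂ ×ˢ 𝕀) := h.ham.comp
  (contDiffOn_fst.prodMk (contDiffOn_snd.prodMk hm)) (h.mapsTo_maximizer hδ hρ hmb)

theorem contDiffOn_max_deriv : 𝒞 (fun q : ℝ × ℝ => 𝐝[δ, ρ, z] H (q.1, q.2, m q) (dirE n)) (Ioo (-δ₂)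
  δ₂ ×ˢ 𝕀) := ((h.ham.fderivWithin (uniqueDiffOn_locDom δ ρ z) (m := ∞) (by simp)).comp
  (contDiffOn_fst.prodMk (contDiffOn_snd.prodMk hm)) (h.mapsTo_maximizer hδ hρ hmb)).clm_apply
  contDiffOn_const

theorem exists_hasDerivAt_maximizer (hε : ε ∈ Ioo (-δ₂) δ₂) (ht : t ∈ 𝕀) : ∃ η : E n, ∀ (g : 𝔓 n →
    ℝ) (L : 𝔓 n →L[ℝ] ℝ), HasFDerivWithinAt g L (locDom δ ρ z) (ε, t, m (ε, t)) → HasDerivAt (fun ε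
    => g (ε, t, m (ε, t))) (L (dirE n) + L (dirX n η)) ε := by
  have h1 : 𝒞 (fun ε => m (ε, t)) (Ioo (-δ₂) δ₂) :=
    hm.comp (f := fun ε : ℝ => (ε, t)) (by fun_prop) fun ε hε => ⟨hε, ht⟩
  have h2 := ((h1.differentiableOn (by simp)).differentiableAt (isOpen_Ioo.mem_nhds hε)).hasDerivAt
  refine ⟨deriv (fun ε => m (ε, t)) ε, fun g L hg => ?_⟩
  have h3 : HasDerivAt (fun ε => ((ε, t, m (ε, t)) : 𝔓 n)) (1, 0, deriv (fun ε => m (ε, t)) ε) ε :=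
    (hasDerivAt_id ε).prodMk ((hasDerivAt_const ε t).prodMk h2)
  have h4 := (HasFDerivWithinAt.comp_hasDerivWithinAt (f := fun ε => ((ε, t, m (ε, t)) : 𝔓 n)) (s :=
    Ioo (-δ₂) δ₂) ε hg h3.hasDerivWithinAt fun ε' hε' => h.mapsTo_maximizer hδ hρ hmb (x := (ε', t))
    ⟨hε', ht⟩).hasDerivAt (isOpen_Ioo.mem_nhds hε)
  refine h4.congr_deriv ?_
  rw [← map_add]
  simp [dirE]

include hmc

theorem hasDerivAt_max (hε : ε ∈ Ioo (-δ₂) δ₂) (ht : t ∈ 𝕀) : HasDerivAt (fun ε => H (ε, t, m (ε,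
    t))) (𝐝[δ, ρ, z] H (ε, t, m (ε, t)) (dirE n)) ε := by
  obtain ⟨η, hη⟩ := h.exists_hasDerivAt_maximizer hδ hρ hm hmb hε ht
  have hq := h.mapsTo_maximizer hδ hρ hmb (x := (ε, t)) ⟨hε, ht⟩
  refine (hη H _ (h.ham.differentiableOn (by simp) _ hq).hasFDerivWithinAt).congr_deriv ?_
  rw [hmc (ε, t) ⟨hε, ht⟩, add_zero]

include hδ₂ hm0

theorem hasDerivAt_max_deriv (ht : t ∈ 𝕀) : HasDerivAt (fun ε => 𝐝[δ, ρ, z] H (ε, t, m (ε, t)) (dirE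
    n)) (-ϖ z ((flowOp (locLin δ ρ z G) t).inverse (derivWithin (locVar δ ρ z G) 𝕀 t)) (derivWithin
    (locVar δ ρ z G) 𝕀 t)) 0 := by
  have hε : (0 : ℝ) ∈ Ioo (-δ₂) δ₂ := ⟨by linarith, hδ₂⟩
  have hud := uniqueDiffOn_locDom δ ρ z
  obtain ⟨η, hη⟩ := h.exists_hasDerivAt_maximizer hδ hρ hm hmb hε ht
  have hq := h.mem_base ht
  rw [hm0 t ht] at hη
  have h1 := fun a => hη _ _ (hasFDerivWithinAt_fderivWithin_apply h.ham hud hq a)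
  simp only [ContinuousLinearMap.flip_apply] at h1
  set v' := derivWithin (locVar δ ρ z G) 𝕀 t
  set S' := derivWithin (locLin δ ρ z G) 𝕀 t with hS'
  have hS := h.isInvertible_locLin ht
  have hv : S' η = -v' := by
    rw [eq_neg_iff_add_eq_zero]
    refine h.nondegenerate _ fun w => ?_
    obtain ⟨L, hL⟩ := hS
    have h2 := h1 (dirX n (L.symm w))
    have h3 : (fun ε => 𝐝[δ, ρ, z] H (ε, t, m (ε, t)) (dirX n (L.symm w))) =ᶠ[𝓝 0] fun _ => 0 := by
      filter_upwards [isOpen_Ioo.mem_nhds hε] with ε hε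
      exact hmc (ε, t) ⟨hε, ht⟩ _
    have h4 := h2.unique ((hasDerivAt_const 0 (0 : ℝ)).congr_of_eventuallyEq h3)
    rw [h.ham_second_EX ht, h.ham_second_XX ht, ← hL] at h4
    simp only [ContinuousLinearEquiv.coe_coe, ContinuousLinearEquiv.apply_symm_apply] at h4
    rw [map_add, add_apply]
    linarith
  have hinv : (flowOp (locLin δ ρ z G) t).inverse v' = -locLin δ ρ z G t η := by
    have h2 := flowOp_inverse_apply hS (h.isInvertible_derivWithin_locLin ht) η
    rw [← hS', hv, map_neg] at h2
    rw [← h2, neg_neg]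
  refine (h1 (dirE n)).congr_deriv ?_
  rw [h.ham_second_EE ht, zero_add, h.ham_second_symm hq, h.ham_second_EX ht, hinv, map_neg,
    neg_apply, neg_neg, h.skew z _ v', ← h.skew z]

/-- The second variation of the length functional. -/
theorem second_variation {hb l : ℝ → ℝ} (hhb : ∀ ε ∈ Ioo (-δ) δ, HasDerivAt hb (-∫ t in 0..1, h.area
    ε t) ε) (hl : ∀ ε ∈ Ioo (-δ₂) δ₂, l ε = (∫ t in 0..1, H (ε, t, m (ε, t))) + hb ε) : ContDiffAt ℝ
    ∞ l 0 ∧ deriv l 0 = 0 ∧ HasDerivAt (deriv l) (quadForm (ϖ z) (locLin δ ρ z G) (locVar δ ρ z G))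
    0 := by
  have h0 : (0 : ℝ) ∈ Ioo (-δ₂) δ₂ := ⟨by linarith, hδ₂⟩
  have hIoo : ∀ ε ∈ Ioo (-δ₂) δ₂, ε ∈ Ioo (-δ) δ := fun ε hε =>
    ⟨by linarith [hε.1], by linarith [hε.2]⟩
  have hM := h.contDiffOn_max hδ hρ hm hmb
  have hM' := h.contDiffOn_max_deriv hδ hρ hm hmb
  have hA := h.contDiffOn_area
  have hIM := contDiffOn_integral_unit (convex_Ioo (-δ₂) δ₂) isOpen_Ioo.uniqueDiffOn hM
  have hIA := contDiffOn_integral_unit (convex_Ioo (-δ) δ) isOpen_Ioo.uniqueDiffOn hA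
  have hhbs : 𝒞 hb (Ioo (-δ) δ) := by
    have h1 : ContDiffOn ℝ (∞ + 1) hb (Ioo (-δ) δ) := by
      rw [contDiffOn_succ_iff_deriv_of_isOpen isOpen_Ioo]
      refine ⟨fun ε hε => (hhb ε hε).differentiableAt.differentiableWithinAt, by simp, ?_⟩
      exact hIA.neg.congr fun ε hε => (hhb ε hε).deriv
    exact h1.of_le (by simp)
  have hls : 𝒞 l (Ioo (-δ₂) δ₂) := (hIM.add (hhbs.mono hIoo)).congr hl
  have hd : ∀ ε ∈ Ioo (-δ₂) δ₂, HasDerivAt l ((∫ t in 0..1, 𝐝[δ, ρ, z] H (ε, t, m (ε, t)) (dirE n))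
      + -∫ t in 0..1, h.area ε t) ε := by
    intro ε hε
    have h1 := hasDerivAt_integral_unit isOpen_Ioo (hM.of_le (by simp)) hε
      fun t ht => h.hasDerivAt_max hδ hρ hm hmb hmc hε ht
    refine (h1.add (hhb ε (hIoo ε hε))).congr_of_eventuallyEq ?_
    filter_upwards [isOpen_Ioo.mem_nhds hε] with ε' hε'
    exact hl ε' hε'
  have hev : deriv l =ᶠ[𝓝 0] fun ε => (∫ t in 0..1, 𝐝[δ, ρ, z] H (ε, t, m (ε, t)) (dirE n)) + -∫ t
      in 0..1, h.area ε t := by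
    filter_upwards [isOpen_Ioo.mem_nhds h0] with ε hε
    exact (hd ε hε).deriv
  have hS := h.contDiffOn_locLin
  have hC : ContinuousOn (fun t => (flowOp (locLin δ ρ z G) t).inverse) 𝕀 := by
    have h1 : 𝒞 (flowOp (locLin δ ρ z G)) 𝕀 := (contDiffOn_derivWithin_unit hS).clm_comp
      (contDiffOn_inverse hS fun t ht => h.isInvertible_locLin ht)
    exact (contDiffOn_inverse h1 fun t ht => isInvertible_flowOp (h.isInvertible_locLin ht)
      (h.isInvertible_derivWithin_locLin ht)).continuousOn
  have hv := h.contDiffOn_locVar.continuousOn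
  have hv' := (contDiffOn_derivWithin_unit h.contDiffOn_locVar).continuousOn
  refine ⟨hls.contDiffAt (isOpen_Ioo.mem_nhds h0), ?_, ?_⟩
  · have e1 : ∫ t in 0..1, 𝐝[δ, ρ, z] H (0, t, m (0, t)) (dirE n) = 0 :=
      (intervalIntegral.integral_congr (g := fun _ => (0 : ℝ)) fun t ht => by
        rw [uIcc_unit] at ht
        simp only [hm0 t ht]
        exact h.ham_dirE_center (hIoo 0 h0) ht).trans (by simp)
    have e2 : ∫ t in 0..1, h.area 0 t = 0 :=
      (intervalIntegral.integral_congr (g := fun _ => (0 : ℝ)) fun t ht => by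
        rw [uIcc_unit] at ht
        simp only [area]
        rw [h.fderivWithin_dirT_base ht, map_zero, zero_apply]).trans (by simp)
    rw [hev.self_of_nhds]
    simp only [e1, e2, neg_zero, add_zero]
  · have h1 := hasDerivAt_integral_unit isOpen_Ioo (hM'.of_le (by simp)) h0
      fun t ht => h.hasDerivAt_max_deriv hδ₂ hδ hρ hm hmb hmc hm0 ht
    have h2 := hasDerivAt_integral_unit isOpen_Ioo (hA.of_le (by simp)) (hIoo 0 h0)
      fun t ht => h.hasDerivAt_area ht
    refine ((h1.add h2.neg).congr_of_eventuallyEq hev).congr_deriv ?_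
    rw [quadForm, intervalIntegral.integral_add, intervalIntegral.integral_neg, neg_add]
    · exact intervalIntegrable_unit <| (continuousOn_const.clm_apply (hC.clm_apply hv')).clm_apply hv'
    · exact intervalIntegrable_unit <| (continuousOn_const.clm_apply hv').clm_apply hv

end Maximizer

end LocalFamily

theorem hasFDerivAt_comp_affine {F : Type*} [NormedAddCommGroup F] [NormedSpace ℝ F]
    {g : E n → F} {L : E n →L[ℝ] F} {z y : E n} {s : ℝ} (hg : HasFDerivAt g L (z + s • (y - z))) :
    HasFDerivAt (fun y => g (z + s • (y - z))) (s • L) y := by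
  have h0 : HasFDerivAt (fun y => z + s • (y - z)) (s • ContinuousLinearMap.id ℝ (E n)) y :=
    (((hasFDerivAt_id y).sub_const z).const_smul s).const_add z
  refine (hg.comp y h0).congr_fderiv ?_
  ext u
  simp

theorem hasDerivAt_comp_affine {F : Type*} [NormedAddCommGroup F] [NormedSpace ℝ F]
    {g : E n → F} {L : E n →L[ℝ] F} {z u : E n} {s : ℝ} (hg : HasFDerivAt g L (z + s • u)) :
    HasDerivAt (fun s : ℝ => g (z + s • u)) (L u) s := by
  have h0 : HasDerivAt (fun s : ℝ => z + s • u) u s := by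
    simpa using ((hasDerivAt_id s).smul_const u).const_add z
  exact hg.comp_hasDerivAt s h0

/-- Closed two-forms on a ball are exact. -/
theorem exists_primitive {ϖ : E n → 𝓑} {z : E n} {r : ℝ} (hr : 0 < r) (hϖ : 𝒞 ϖ (ball z r)) (hskew :
    ∀ y u w, ϖ y u w = -ϖ y w u) (hclosed : ∀ y ∈ ball z r, ∀ a b c, fderiv ℝ ϖ y a b c - fderiv ℝ ϖ
    y b a c + fderiv ℝ ϖ y c a b = 0) : ∃ l : E n → E n →L[ℝ] ℝ, 𝒞 l (ball z r) ∧ l z = 0 ∧ (∀ y ∈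
    ball z r, ∀ a b, fderiv ℝ l y a b - fderiv ℝ l y b a = ϖ y a b) ∧ ∀ a b, fderiv ℝ l z a b = 1 /
    2 * ϖ z a b := by
  set B := ball z r with hB
  have hBo : IsOpen B := isOpen_ball
  have hzB : z ∈ B := mem_ball_self hr
  have hseg : ∀ y ∈ B, ∀ s ∈ 𝕀, z + s • (y - z) ∈ B := fun y hy s hs =>
    (convex_ball z r).add_smul_sub_mem hzB hy hs
  let g : E n × ℝ → E n →L[ℝ] ℝ := fun k => k.2 • ϖ (z + k.2 • (k.1 - z)) (k.1 - z)
  have hcomp : 𝒞 (fun k : E n × ℝ => ϖ (z + k.2 • (k.1 - z))) (B ×ˢ 𝕀) := hϖ.comp (f := fun k : E n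
    × ℝ => z + k.2 • (k.1 - z)) (by fun_prop) fun k hk => hseg _ hk.1 _ hk.2
  have hg : 𝒞 g (B ×ˢ 𝕀) := contDiffOn_snd.smul (hcomp.clm_apply (by fun_prop))
  let l : E n → E n →L[ℝ] ℝ := fun y => ∫ s in 0..1, g (y, s)
  have hl : 𝒞 l B := contDiffOn_integral_unit (convex_ball z r) hBo.uniqueDiffOn hg
  have hlb : ∀ y ∈ B, ∀ b, l y b = ∫ s in 0..1, g (y, s) b := by
    intro y hy b
    refine ContinuousLinearMap.intervalIntegral_apply ?_ b
    exact intervalIntegrable_unit <| hg.continuousOn.comp (f := fun s => (y, s)) (by fun_prop) fun s hs => ⟨hy, hs⟩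
  have hdϖ : ∀ y ∈ B, HasFDerivAt ϖ (fderiv ℝ ϖ y) y := fun y hy =>
    ((hϖ.differentiableOn (by simp)).differentiableAt (hBo.mem_nhds hy)).hasFDerivAt
  have hfd : ∀ y ∈ B, ∀ a b, fderiv ℝ l y a b = ∫ s in 0..1,
      s * (s * fderiv ℝ ϖ (z + s • (y - z)) a (y - z) b + ϖ (z + s • (y - z)) a b) := by
    intro y hy a b
    have hslice : ∀ s ∈ 𝕀, ∃ L : E n →L[ℝ] ℝ, HasFDerivAt (fun y => g (y, s) b) L y ∧ ∀ a, L a = s *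
        (s * fderiv ℝ ϖ (z + s • (y - z)) a (y - z) b + ϖ (z + s • (y - z)) a b) := by
      intro s hs
      have h1 := hasFDerivAt_comp_affine (F := 𝓑) (hdϖ _ (hseg y hy s hs))
      have h2 := ((h1.clm_apply ((hasFDerivAt_id y).sub_const z)).clm_apply
        (hasFDerivAt_const b y)).const_mul s
      refine ⟨_, h2, fun a => ?_⟩
      simp
      ring
    choose! L hL hL' using hslice
    obtain ⟨L0, hL0, hL0'⟩ := exists_hasFDerivAt_integral_unit hBo
      (G := fun k => g k b) ((hg.clm_apply contDiffOn_const).of_le (by simp)) hy hL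
    have h3 : HasFDerivAt (fun y => l y b) L0 y := by
      refine hL0.congr_of_eventuallyEq ?_
      filter_upwards [hBo.mem_nhds hy] with y' hy'
      exact hlb y' hy' b
    have h4 := (((hl.differentiableOn (by simp)).differentiableAt
      (hBo.mem_nhds hy)).hasFDerivAt).clm_apply (hasFDerivAt_const b y)
    have h5 := congrArg (fun L : E n →L[ℝ] ℝ => L a) (h4.unique h3)
    simp only [add_apply, ContinuousLinearMap.comp_apply, ContinuousLinearMap.flip_apply,
      zero_apply, map_zero, zero_add] at h5
    rw [h5, hL0']
    refine intervalIntegral.integral_congr fun s hs => ?_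
    rw [uIcc_unit] at hs
    exact hL' s hs a
  have hcont : ∀ y ∈ B, ∀ a b, ContinuousOn (fun s : ℝ =>
      s * (s * fderiv ℝ ϖ (z + s • (y - z)) a (y - z) b + ϖ (z + s • (y - z)) a b))
      𝕀 := by
    intro y hy a b
    have h1 : ContinuousOn (fun s : ℝ => fderiv ℝ ϖ (z + s • (y - z)) a (y - z) b)
        𝕀 := by
      have hs : 𝒞 (fun y' => ϖ y' (y - z) b) B :=
        (hϖ.clm_apply contDiffOn_const).clm_apply contDiffOn_const
      have hs' := ((hs.fderiv_of_isOpen hBo (m := ∞) (by simp)).clm_apply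
        (contDiffOn_const (c := a))).continuousOn
      refine ContinuousOn.congr (hs'.comp (f := fun s : ℝ => z + s • (y - z))
        (by fun_prop) fun s hs => hseg y hy s hs) fun s hs => ?_
      have e1 := ((hdϖ _ (hseg y hy s hs)).clm_apply (hasFDerivAt_const (y - z) _)).clm_apply
          (hasFDerivAt_const b _)
      have e2 := congrArg (fun L : E n →L[ℝ] ℝ => L a) e1.fderiv
      simpa using e2.symm
    have h2 : ContinuousOn (fun s : ℝ => ϖ (z + s • (y - z))) 𝕀 := hϖ.continuousOn.comp (f := fun s
      : ℝ => z + s • (y - z)) (by fun_prop) fun s hs => hseg y hy s hs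
    exact continuousOn_id.mul ((continuousOn_id.mul h1).add
      ((h2.clm_apply continuousOn_const).clm_apply continuousOn_const))
  have hii : ∀ y ∈ B, ∀ a b, IntervalIntegrable (fun s : ℝ =>
      s * (s * fderiv ℝ ϖ (z + s • (y - z)) a (y - z) b + ϖ (z + s • (y - z)) a b)) volume 0 1 := by
    intro y hy a b
    exact intervalIntegrable_unit <| hcont y hy a b
  refine ⟨l, hl, ?_, fun y hy a b => ?_, fun a b => ?_⟩
  · simp [l, g]
  · rw [hfd y hy, hfd y hy, ← intervalIntegral.integral_sub (hii y hy a b) (hii y hy b a)]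
    have hd : ∀ s ∈ uIcc (0 : ℝ) 1, HasDerivAt (fun s : ℝ => s ^ 2 * ϖ (z + s • (y - z)) a b)
        (s * (s * fderiv ℝ ϖ (z + s • (y - z)) a (y - z) b + ϖ (z + s • (y - z)) a b)
        - s * (s * fderiv ℝ ϖ (z + s • (y - z)) b (y - z) a + ϖ (z + s • (y - z)) b a)) s := by
      intro s hs
      rw [uIcc_unit] at hs
      have hys := hseg y hy s hs
      have h1 := hasDerivAt_comp_affine (F := 𝓑) (hdϖ _ hys)
      have h2 := (hasDerivAt_pow 2 s).mul ((h1.clm_apply (hasDerivAt_const s a)).clm_apply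
        (hasDerivAt_const s b))
      refine h2.congr_deriv ?_
      have hc := hclosed _ hys a b (y - z)
      have hsk : ∀ u w, fderiv ℝ ϖ (z + s • (y - z)) u w (y - z)
          = -fderiv ℝ ϖ (z + s • (y - z)) u (y - z) w := by
        intro u w
        have e1 := ((hdϖ _ hys).clm_apply (hasFDerivAt_const w _)).clm_apply
          (hasFDerivAt_const (y - z) _)
        have e2 := (((hdϖ _ hys).clm_apply (hasFDerivAt_const (y - z) _)).clm_apply
          (hasFDerivAt_const w _)).neg
        have e3 : (fun x => ϖ x w (y - z)) = fun x => -ϖ x (y - z) w :=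
          funext fun x => hskew x w (y - z)
        rw [e3] at e1
        have e4 := congrArg (fun L : E n →L[ℝ] ℝ => L u) (e1.unique e2)
        simpa using e4
      rw [hsk, hsk] at hc
      have hs2 := hskew (z + s • (y - z)) b a
      simp only [map_zero, zero_apply, add_zero]
      rw [hs2]
      push_cast
      linear_combination s ^ 2 * hc
    rw [intervalIntegral.integral_eq_sub_of_hasDerivAt hd ((hii y hy a b).sub (hii y hy b a))]
    simp
  · rw [hfd z hzB]
    simp only [sub_self, smul_zero, add_zero, map_zero, zero_apply, mul_zero, zero_add]
    rw [intervalIntegral.integral_mul_const]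
    simp

theorem integral_sq_le {a : ℝ → ℝ} (ha : ContinuousOn a 𝕀) :
    (∫ t in 0..1, a t) ^ 2 ≤ ∫ t in 0..1, a t ^ 2 := by
  set c := ∫ t in 0..1, a t with hc
  have hi : ∀ {b : ℝ → ℝ}, ContinuousOn b 𝕀 → IntervalIntegrable b volume 0 1 := by
    intro b hb
    exact intervalIntegrable_unit ‹_›
  have h1 : 0 ≤ ∫ t in 0..1, (a t - c) ^ 2 :=
    intervalIntegral.integral_nonneg zero_le_one fun t _ => sq_nonneg _
  have h2 : ∫ t in 0..1, (a t - c) ^ 2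
      = (∫ t in 0..1, a t ^ 2) - 2 * c * (∫ t in 0..1, a t) + c ^ 2 := by
    rw [← intervalIntegral.integral_const_mul, ← intervalIntegral.integral_sub (f := fun t => a t ^
      2) (g := fun t => 2 * c * a t) (hi (ha.pow 2)) (hi (ha.const_smul (2 * c)))]
    have h3 : ∫ t in 0..1, (a t - c) ^ 2 = ∫ t in 0..1, ((a t ^ 2 - 2 * c * a t) + c ^ 2) :=
      integral_congr_unit fun t _ => by ring
    rw [h3, intervalIntegral.integral_add (f := fun t => a t ^ 2 - 2 * c * a t)
      (g := fun _ => c ^ 2) (hi ((ha.pow 2).sub (ha.const_smul (2 * c)))) (by simp)]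
    simp
  rw [h2, ← hc] at h1
  nlinarith

theorem norm_le_integral_norm_deriv {v : ℝ → E n} (hv : 𝒞 v 𝕀) (h0 : v 0 = 0) (ht : t ∈ 𝕀) : ‖v t‖ ≤
    ∫ s in 0..1, ‖derivWithin v 𝕀 s‖ := by
  have hv' := (contDiffOn_derivWithin_unit hv).continuousOn
  have hii : IntervalIntegrable (derivWithin v 𝕀) volume 0 t := by
    apply ContinuousOn.intervalIntegrable
    rw [uIcc_of_le ht.1]
    exact hv'.mono (Icc_subset_Icc_right ht.2)
  have h1 := intervalIntegral.integral_eq_sub_of_hasDerivAt_of_le ht.1 (hv.continuousOn.mono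
    (Icc_subset_Icc_right ht.2)) (fun s hs => ((hv.differentiableOn (by simp) s ⟨hs.1.le,
    hs.2.le.trans ht.2⟩).hasDerivWithinAt).hasDerivAt (Icc_mem_nhds hs.1 (hs.2.trans_le ht.2))) hii
  rw [h0, sub_zero] at h1
  rw [← h1]
  refine (intervalIntegral.norm_integral_le_integral_norm ht.1).trans ?_
  refine intervalIntegral.integral_mono_interval le_rfl ht.1 ht.2
    (Eventually.of_forall fun s => norm_nonneg _) ?_
  exact intervalIntegrable_unit <| hv'.norm

theorem integral_norm_mul_le {v : ℝ → E n} (hv : 𝒞 v 𝕀) (h0 : v 0 = 0) : ∫ t in 0..1, ‖v t‖ *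
    ‖derivWithin v 𝕀 t‖ ≤ ∫ t in 0..1, ‖derivWithin v 𝕀 t‖ ^ 2 := by
  have hv' := (contDiffOn_derivWithin_unit hv).continuousOn
  refine le_trans ?_ (integral_sq_le hv'.norm)
  rw [sq, ← intervalIntegral.integral_const_mul]
  refine intervalIntegral.integral_mono_on zero_le_one ?_ ?_ fun t ht =>
    mul_le_mul_of_nonneg_right (norm_le_integral_norm_deriv hv h0 ht) (norm_nonneg _)
  · exact intervalIntegrable_unit <| hv.continuousOn.norm.mul hv'.norm
  · exact intervalIntegrable_unit <| continuousOn_const.mul hv'.norm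

theorem taylor_lower {f f' f'' : ℝ → ℝ} {a : ℝ} (h : ∀ s ∈ 𝕀, HasDerivAt f (f' s) s) (h' : ∀ s ∈ 𝕀,
    HasDerivAt f' (f'' s) s) (ha : ∀ s ∈ 𝕀, a ≤ f'' s) : f 0 + f' 0 + a / 2 ≤ f 1 := by
  have hg : ∀ s ∈ 𝕀, HasDerivAt (fun s => f s - f' 0 * s - a / 2 * s ^ 2)
      (f' s - f' 0 - a * s) s := by
    intro s hs
    have := ((h s hs).sub ((hasDerivAt_id s).const_mul (f' 0))).sub
      ((hasDerivAt_pow 2 s).const_mul (a / 2))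
    refine this.congr_deriv ?_
    push_cast
    ring
  obtain ⟨c, hc, hc'⟩ := exists_hasDerivAt_eq_slope _ _ zero_lt_one (fun s hs => (hg s
    hs).continuousAt.continuousWithinAt) (fun s hs => hg s (Ioo_subset_Icc_self hs))
  have hsub : Icc 0 c ⊆ 𝕀 := Icc_subset_Icc_right hc.2.le
  obtain ⟨d, hd, hd'⟩ := exists_hasDerivAt_eq_slope f' f'' hc.1 (fun s hs => (h' s (hsub
    hs)).continuousAt.continuousWithinAt) (fun s hs => h' s (hsub (Ioo_subset_Icc_self hs)))
  have h1 := ha d (hsub (Ioo_subset_Icc_self hd))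
  rw [hd', sub_zero, le_div_iff₀ hc.1] at h1
  have h2 : 0 ≤ f' c - f' 0 - a * c := by linarith
  rw [hc'] at h2
  norm_num at h2
  linarith

namespace LocalFamily

variable {δ ρ : ℝ} {z : E n} {G : 𝔓 n → E n} {H : 𝔓 n → ℝ}
  {ϖ : E n → E n →L[ℝ] E n →L[ℝ] ℝ} {U : Set (E n)} (h : LocalFamily δ ρ z G H ϖ U)
include h

/-- The orbit of the center, relative to the center. -/
theorem contDiffOn_orbit (hε : ε ∈ Ioo (-δ) δ) : 𝒞 (fun t => G (ε, t, z) - z) 𝕀 := (h.smooth.comp (f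
  := fun t : ℝ => ((ε, t, z) : 𝔓 n)) (by fun_prop) fun _ ht => h.mem_center hε ht).sub
  contDiffOn_const

theorem derivWithin_orbit (hε : ε ∈ Ioo (-δ) δ) (ht : t ∈ 𝕀) : derivWithin (fun t => G (ε, t, z) -
    z) 𝕀 t = 𝐝[δ, ρ, z] G (ε, t, z) (dirT n) := by
  have hq := h.mem_center hε ht
  exact ((hasDerivWithinAt_sliceT_of_locDom ((h.smooth.differentiableOn (by simp) _
    hq).hasFDerivWithinAt) hq).sub_const z).derivWithin (uniqueDiffOn_unit t ht)

/-- The action of the orbit of the center. -/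
theorem exists_eventually_action {hb : ℝ → ℝ} (hhb : ∀ ε ∈ Ioo (-δ) δ, HasDerivAt hb (-∫ t in 0..1,
    h.area ε t) ε) : ∃ l : E n → E n →L[ℝ] ℝ, HasFDerivAt l ((1 / 2 : ℝ) • ϖ z) z ∧ l z = 0 ∧ ∀ᶠ ε
    in 𝓝 (0 : ℝ), ContinuousOn (fun t => l (G (ε, t, z)) (𝐝[δ, ρ, z] G (ε, t, z) (dirT n))) 𝕀 ∧ hb ε
    - hb 0 = ∫ t in 0..1, l (G (ε, t, z)) (𝐝[δ, ρ, z] G (ε, t, z) (dirT n)) := by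
  have hzU : z ∈ U := by
    have := h.maps (h.mem_base (t := 0) (by simp))
    rwa [h.base 0 (by simp)] at this
  obtain ⟨r, hr, hrU⟩ := Metric.isOpen_iff.1 h.isOpen z hzU
  obtain ⟨l, hl, hl0, hcl, hlz⟩ := exists_primitive hr (h.form.mono hrU) h.skew
    fun y hy => h.closed y (hrU hy)
  have hdl : ∀ y ∈ ball z r, HasFDerivAt l (fderiv ℝ l y) y := fun y hy => ((hl.differentiableOn (by
    simp)).differentiableAt (Metric.isOpen_ball.mem_nhds hy)).hasFDerivAt
  refine ⟨l, ?_, hl0, ?_⟩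
  · have h1 := hdl z (mem_ball_self hr)
    have h2 : fderiv ℝ l z = (1 / 2 : ℝ) • ϖ z := by
      ext a b
      simp [hlz]
    rwa [h2] at h1
  have hGc := h.smooth.continuousOn.comp (f := fun k : ℝ × ℝ => ((k.1, k.2, z) : 𝔓 n)) (s := Ioo
    (-δ) δ ×ˢ 𝕀) (by fun_prop) fun k hk => h.mem_center hk.1 hk.2
  have hball : ∀ᶠ ε in 𝓝 (0 : ℝ), ∀ t ∈ 𝕀, ‖G (ε, t, z) - z‖ < r := eventually_lt_of_isCompact
    isCompact_Icc (isOpen_Ioo.mem_nhds h.zero_mem) (g := fun k : ℝ × ℝ => ‖G (k.1, k.2, z) - z‖)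
    (hGc.sub continuousOn_const).norm fun t ht => by simp [h.base t ht, hr]
  obtain ⟨δ', hδ', hδ'b⟩ := Metric.eventually_nhds_iff.1
    (hball.and (isOpen_Ioo.mem_nhds h.zero_mem))
  have hI : ∀ ε ∈ Ioo (-δ') δ', ε ∈ Ioo (-δ) δ ∧ ∀ t ∈ 𝕀, G (ε, t, z) ∈ ball z r := fun ε hε => by
    have := hδ'b (y := ε) (by rw [Real.dist_eq, sub_zero]; exact abs_lt.2 hε)
    exact ⟨this.2, fun t ht => by simpa [dist_eq_norm] using this.1 t ht⟩
  have hud := uniqueDiffOn_locDom δ ρ z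
  set D := locDom δ ρ z with hD
  have hj : 𝒞 (fun k : ℝ × ℝ => ((k.1, k.2, z) : 𝔓 n)) (Ioo (-δ') δ' ×ˢ 𝕀) := by fun_prop
  have hjm : MapsTo (fun k : ℝ × ℝ => ((k.1, k.2, z) : 𝔓 n))
    (Ioo (-δ') δ' ×ˢ 𝕀) D := fun k hk => h.mem_center (hI _ hk.1).1 hk.2
  have hDG := (h.smooth.fderivWithin hud (m := ∞) (by simp)).comp hj hjm
  have hlG : 𝒞 (fun k : ℝ × ℝ => l (G (k.1, k.2, z))) (Ioo (-δ') δ' ×ˢ 𝕀) := hl.comp (h.smooth.comp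
    hj hjm) fun k hk => (hI _ hk.1).2 _ hk.2
  have hB : ∀ a, 𝒞 (fun k : ℝ × ℝ => l (G (k.1, k.2, z)) (fderivWithin ℝ G D (k.1, k.2, z) a)) (Ioo
    (-δ') δ' ×ˢ 𝕀) := fun a => hlG.clm_apply (hDG.clm_apply contDiffOn_const)
  -- the derivative of the integrand in an arbitrary direction
  have hdir : ∀ ε ∈ Ioo (-δ') δ', ∀ t ∈ 𝕀, ∀ a, ∃ L : 𝔓 n →L[ℝ] ℝ, HasFDerivWithinAt (fun q => l (G
      q) (fderivWithin ℝ G D q a)) L (D ∩ G ⁻¹' ball z r) (ε, t, z) ∧ ∀ b, L b = fderiv ℝ l (G (ε,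
      t, z)) (fderivWithin ℝ G D (ε, t, z) b) (fderivWithin ℝ G D (ε, t, z) a) + l (G (ε, t, z))
      (fderivWithin ℝ (fderivWithin ℝ G D) D (ε, t, z) b a) := by
    intro ε hε t ht a
    have hq := h.mem_center (hI ε hε).1 ht
    have h1 : HasFDerivWithinAt (fun q => l (G q)) ((fderiv ℝ l (G (ε, t, z))).comp (fderivWithin ℝ
      G D (ε, t, z))) (D ∩ G ⁻¹' ball z r) (ε, t, z) := HasFDerivAt.comp_hasFDerivWithinAt _ (hdl _
      ((hI ε hε).2 t ht)) ((h.smooth.differentiableOn (by simp) _ hq).hasFDerivWithinAt.mono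
      inter_subset_left)
    refine ⟨_, h1.clm_apply ((hasFDerivWithinAt_fderivWithin_apply h.smooth hud hq a).mono
      inter_subset_left), fun b => ?_⟩
    simp [add_comm]
    rfl
  have hder : ∀ ε ∈ Ioo (-δ') δ', HasDerivAt (fun ε => ∫ t in 0..1, l (G (ε, t, z))
      (fderivWithin ℝ G D (ε, t, z) (dirT n))) (-∫ t in 0..1, h.area ε t) ε := by
    intro ε hε
    have hsl : ∀ t ∈ 𝕀, HasDerivAt (fun ε => l (G (ε, t, z)) (fderivWithin ℝ G D (ε, t, z) (dirT
        n))) (fderiv ℝ l (G (ε, t, z)) (fderivWithin ℝ G D (ε, t, z) (dirE n)) (fderivWithin ℝ G D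
        (ε, t, z) (dirT n)) + l (G (ε, t, z)) (fderivWithin ℝ (fderivWithin ℝ G D) D (ε, t, z) (dirE
        n) (dirT n))) ε := by
      intro t ht
      obtain ⟨L, hL, hLb⟩ := hdir ε hε t ht (dirT n)
      have h1 := (HasFDerivWithinAt.comp (f := fun ε => (ε, t, z)) ε hL (hasFDerivAt_sliceE ε t
        z).hasFDerivWithinAt (s := Ioo (-δ') δ') fun ε' hε' => ⟨h.mem_center (hI ε' hε').1 ht, (hI
        ε' hε').2 t ht⟩).hasFDerivAt (isOpen_Ioo.mem_nhds hε)
      refine h1.hasDerivAt.congr_deriv ?_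
      rw [← hLb]
      simp
    have hT : ∀ t ∈ 𝕀, HasDerivWithinAt (fun t => l (G (ε, t, z)) (fderivWithin ℝ G D (ε, t, z)
        (dirE n))) (fderiv ℝ l (G (ε, t, z)) (fderivWithin ℝ G D (ε, t, z) (dirT n)) (fderivWithin ℝ
        G D (ε, t, z) (dirE n)) + l (G (ε, t, z)) (fderivWithin ℝ (fderivWithin ℝ G D) D (ε, t, z)
        (dirT n) (dirE n))) 𝕀 t := by
      intro t ht
      obtain ⟨L, hL, hLb⟩ := hdir ε hε t ht (dirE n)
      have h1 := HasFDerivWithinAt.comp (f := fun t => (ε, t, z)) t hL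
        (hasFDerivAt_sliceT ε t z).hasFDerivWithinAt (s := 𝕀)
        fun t' ht' => ⟨h.mem_center (hI ε hε).1 ht', (hI ε hε).2 t' ht'⟩
      refine h1.hasDerivWithinAt.congr_deriv ?_
      rw [← hLb]
      simp
    refine (hasDerivAt_integral_unit isOpen_Ioo ((hB (dirT n)).of_le (by simp)) hε
      hsl).congr_deriv ?_
    have hi : 𝒞 (fun t => l (G (ε, t, z)) (fderivWithin ℝ G D (ε, t, z) (dirE n)))
        𝕀 :=
      (hB (dirE n)).comp (f := fun t : ℝ => ((ε, t) : ℝ × ℝ)) (by fun_prop) fun t ht => ⟨hε, ht⟩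
    have hic := (contDiffOn_derivWithin_unit hi).continuousOn
    have hFTC := intervalIntegral.integral_eq_sub_of_hasDerivAt_of_le zero_le_one hi.continuousOn
      (fun t ht => (hT t (Ioo_subset_Icc_self ht)).hasDerivAt (Icc_mem_nhds ht.1 ht.2)) (by
        exact intervalIntegrable_unit <| hic.congr fun t ht =>
          ((hT t ht).derivWithin (uniqueDiffOn_unit t ht)).symm)
    rw [h.start ε (hI ε hε).1, h.finish ε (hI ε hε).1, hl0, zero_apply, zero_apply,
      sub_zero] at hFTC
    have hareac : ContinuousOn (fun t => h.area ε t) 𝕀 := h.contDiffOn_area.continuousOn.comp (f :=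
      fun t : ℝ => ((ε, t) : ℝ × ℝ)) (by fun_prop) fun t ht => ⟨(hI ε hε).1, ht⟩
    have hadd := congrArg (fun c : ℝ => (∫ t in 0..1, -h.area ε t) + c) hFTC
    simp only [add_zero] at hadd
    rw [← intervalIntegral.integral_neg]
    refine Eq.trans ?_ hadd
    rw [← intervalIntegral.integral_add]
    · refine integral_congr_unit fun t ht => ?_
      have hq := h.mem_center (hI ε hε).1 ht
      simp only [area]
      rw [fderivWithin_fderivWithin_symm h.smooth hud (locDom_subset_closure_interior δ ρ z) hq
        (dirE n) (dirT n), h.skew, ← hcl _ ((hI ε hε).2 t ht)]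
      ring
    · exact intervalIntegrable_unit <| hareac.neg
    · exact intervalIntegrable_unit <| hic.congr fun t ht =>
        ((hT t ht).derivWithin (uniqueDiffOn_unit t ht)).symm
  have h00 : (0 : ℝ) ∈ Ioo (-δ') δ' := ⟨by linarith, hδ'⟩
  filter_upwards [isOpen_Ioo.mem_nhds h00] with ε hε
  refine ⟨(hB (dirT n)).continuousOn.comp (f := fun t : ℝ => ((ε, t) : ℝ × ℝ)) (by fun_prop)
    fun t ht => ⟨hε, ht⟩, ?_⟩
  have hconst := (convex_Ioo (-δ') δ').is_const_of_fderivWithin_eq_zero (𝕜 := ℝ) (f := fun ε => hb ε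
    - ∫ t in 0..1, l (G (ε, t, z)) (fderivWithin ℝ G D (ε, t, z) (dirT n))) (fun ε hε => ((hhb ε (hI
    ε hε).1).sub (hder ε hε)).differentiableAt.differentiableWithinAt) (fun ε hε => by
      have h1 := ((hhb ε (hI ε hε).1).sub (hder ε hε)).hasFDerivAt.hasFDerivWithinAt.fderivWithin
        (isOpen_Ioo.uniqueDiffOn (𝕜 := ℝ) ε hε)
      refine h1.trans ?_
      ext
      simp) hε h00
  have hzero : ∫ t in 0..1, l (G (0, t, z)) (fderivWithin ℝ G D (0, t, z) (dirT n)) = 0 := by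
    rw [intervalIntegral.integral_congr (g := fun _ => (0 : ℝ))]
    · simp
    · intro t ht
      rw [uIcc_unit] at ht
      simp only [h.base t ht, hl0, zero_apply]
  simp only [hzero, sub_zero] at hconst
  linarith

theorem continuousOn_flowOp_inverse :
    ContinuousOn (fun t => (flowOp (locLin δ ρ z G) t).inverse) 𝕀 := by
  have h1 : 𝒞 (flowOp (locLin δ ρ z G)) 𝕀 := (contDiffOn_derivWithin_unit
    h.contDiffOn_locLin).clm_comp (contDiffOn_inverse h.contDiffOn_locLin fun t ht =>
    h.isInvertible_locLin ht)
  exact (contDiffOn_inverse h1 fun t ht => isInvertible_flowOp (h.isInvertible_locLin ht)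
    (h.isInvertible_derivWithin_locLin ht)).continuousOn

theorem eventually_ham_second_close {η : ℝ} (hη : 0 < η) : ∀ᶠ x : ℝ × E n in 𝓝 (0, z), ∀ t ∈ 𝕀, ∀ u
    : E n, 𝐝[δ, ρ, z] (𝐝[δ, ρ, z] H) (0, t, z) (dirX n u) (dirX n u) - η * ‖u‖ ^ 2 ≤ 𝐝[δ, ρ, z]
    (𝐝[δ, ρ, z] H) (x.1, t, x.2) (dirX n u) (dirX n u) := by
  set B := 𝐝[δ, ρ, z] (𝐝[δ, ρ, z] H) with hB
  have hP : Ioo (-δ) δ ×ˢ ball z ρ ∈ 𝓝 ((0 : ℝ), z) :=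
    prod_mem_nhds (isOpen_Ioo.mem_nhds h.zero_mem) (ball_mem_nhds z h.radius)
  have hBc : ContinuousOn B (locDom δ ρ z) := ((h.ham.fderivWithin (uniqueDiffOn_locDom δ ρ z)
    (m := ∞) (by simp)).fderivWithin (uniqueDiffOn_locDom δ ρ z) (m := ∞) (by simp)).continuousOn
  have hc : ContinuousOn (fun k : (ℝ × E n) × ℝ × E n => B (0, k.2.1, z) (dirX n k.2.2) (dirX n
      k.2.2) - B (k.1.1, k.2.1, k.1.2) (dirX n k.2.2) (dirX n k.2.2)) ((Ioo (-δ) δ ×ˢ ball z ρ) ×ˢ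
      (𝕀 ×ˢ sphere (0 : E n) 1)) := by
    have h1 := hBc.comp (f := fun k : (ℝ × E n) × ℝ × E n => ((0, k.2.1, z) : 𝔓 n)) (s := (Ioo (-δ)
      δ ×ˢ ball z ρ) ×ˢ (𝕀 ×ˢ sphere (0 : E n) 1)) (by fun_prop) fun k hk => h.mem_base hk.2.1
    have h2 := hBc.comp (f := fun k : (ℝ × E n) × ℝ × E n => ((k.1.1, k.2.1, k.1.2) : 𝔓 n)) (s :=
      (Ioo (-δ) δ ×ˢ ball z ρ) ×ˢ (𝕀 ×ˢ sphere (0 : E n) 1)) (by fun_prop) fun k hk => ⟨hk.1.1,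
      hk.2.1, hk.1.2⟩
    have h3 : Continuous (fun k : (ℝ × E n) × ℝ × E n => dirX n k.2.2) :=
      (dirX n).continuous.comp (by fun_prop)
    exact ((h1.clm_apply h3.continuousOn).clm_apply h3.continuousOn).sub
      ((h2.clm_apply h3.continuousOn).clm_apply h3.continuousOn)
  filter_upwards [eventually_lt_of_isCompact (isCompact_Icc.prod (isCompact_sphere (0 : E n) 1))
    hP hc (a := η) fun k _ => by simpa using hη] with x hx t ht u
  by_cases hu : u = 0
  · subst hu
    rw [(dirX n).map_zero, map_zero, map_zero]
    simp
  · have hn : 0 < ‖u‖ := norm_pos_iff.2 hu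
    have h1 := hx (t, ‖u‖⁻¹ • u) ⟨ht, by simp [norm_smul, hn.ne']⟩
    simp only [map_smul, smul_apply, smul_eq_mul] at h1
    have h2 : ∀ q, ‖u‖ ^ 2 * (‖u‖⁻¹ * (‖u‖⁻¹ * B q (dirX n u) (dirX n u)))
        = B q (dirX n u) (dirX n u) := fun q => by field_simp
    rw [← h2, ← h2 (x.1, t, x.2)]
    nlinarith [sq_nonneg ‖u‖, mul_pos hn hn]

theorem eventually_form_close {η : ℝ} (hη : 0 < η) : ∀ᶠ ε in 𝓝 (0 : ℝ), ∀ t ∈ 𝕀, ∀ u w : E n, |ϖ (G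
    (ε, t, z)) u (𝐝[δ, ρ, z] G (ε, t, z) (dirX n w)) - ϖ z u (locLin δ ρ z G t w)| ≤ η * ‖u‖ * ‖w‖
    := by
  let K : Set (ℝ × E n × E n) := 𝕀 ×ˢ sphere (0 : E n) 1 ×ˢ sphere (0 : E n) 1
  have hK : IsCompact K :=
    isCompact_Icc.prod ((isCompact_sphere (0 : E n) 1).prod (isCompact_sphere (0 : E n) 1))
  have hDG : ContinuousOn (𝐝[δ, ρ, z] G) (locDom δ ρ z) :=
    (h.smooth.fderivWithin (uniqueDiffOn_locDom δ ρ z) (m := ∞) (by simp)).continuousOn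
  have hX : Continuous (fun k : ℝ × ℝ × E n × E n => dirX n k.2.2.2) :=
    (dirX n).continuous.comp (by fun_prop)
  have hu : Continuous (fun k : ℝ × ℝ × E n × E n => k.2.2.1) := by fun_prop
  have hj : MapsTo (fun k : ℝ × ℝ × E n × E n => ((k.1, k.2.1, z) : 𝔓 n))
    (Ioo (-δ) δ ×ˢ K) (locDom δ ρ z) := fun k hk => h.mem_center hk.1 hk.2.1
  have hj0 : MapsTo (fun k : ℝ × ℝ × E n × E n => ((0, k.2.1, z) : 𝔓 n))
    (Ioo (-δ) δ ×ˢ K) (locDom δ ρ z) := fun k hk => h.mem_base hk.2.1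
  have hc : ContinuousOn (fun k : ℝ × ℝ × E n × E n => |ϖ (G (k.1, k.2.1, z)) k.2.2.1 (𝐝[δ, ρ, z] G
      (k.1, k.2.1, z) (dirX n k.2.2.2)) - ϖ z k.2.2.1 (𝐝[δ, ρ, z] G (0, k.2.1, z) (dirX n
      k.2.2.2))|) (Ioo (-δ) δ ×ˢ K) := by
    have h1 := (hDG.comp (f := fun k : ℝ × ℝ × E n × E n => ((k.1, k.2.1, z) : 𝔓 n))
      (by fun_prop) hj).clm_apply hX.continuousOn
    have h2 := (hDG.comp (f := fun k : ℝ × ℝ × E n × E n => ((0, k.2.1, z) : 𝔓 n))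
      (by fun_prop) hj0).clm_apply hX.continuousOn
    have h3 : ContinuousOn (fun k : ℝ × ℝ × E n × E n => ϖ (G (k.1, k.2.1, z))) (Ioo (-δ) δ ×ˢ K) :=
      (h.form.comp h.smooth h.maps).continuousOn.comp (f := fun k : ℝ × ℝ × E n × E n => ((k.1,
      k.2.1, z) : 𝔓 n)) (by fun_prop) hj
    exact (((h3.clm_apply hu.continuousOn).clm_apply h1).sub
      ((continuousOn_const.clm_apply hu.continuousOn).clm_apply h2)).abs
  filter_upwards [eventually_lt_of_isCompact hK (isOpen_Ioo.mem_nhds h.zero_mem)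
    hc (a := η) fun k hk => by simpa [h.base k.1 hk.1] using hη] with ε hε t ht u w
  rcases eq_or_ne u 0 with rfl | hu0
  · simp
  rcases eq_or_ne w 0 with rfl | hw0
  · rw [(dirX n).map_zero]
    simp
  have hun : 0 < ‖u‖ := norm_pos_iff.2 hu0
  have hwn : 0 < ‖w‖ := norm_pos_iff.2 hw0
  have h1 := hε (t, ‖u‖⁻¹ • u, ‖w‖⁻¹ • w)
    ⟨ht, by simp [norm_smul, hun.ne'], by simp [norm_smul, hwn.ne']⟩
  simp only [map_smul, smul_apply, smul_eq_mul, ← mul_sub] at h1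
  rw [abs_mul, abs_mul, abs_inv, abs_inv, abs_norm, abs_norm, inv_mul_lt_iff₀ hwn,
    inv_mul_lt_iff₀ hun] at h1
  refine h1.le.trans (le_of_eq ?_)
  ring

/-- A lower bound for the values of the Hamiltonian near its maximum. -/
theorem eventually_exists_ham_ge {η r : ℝ} (hη : 0 < η) (hr : 0 < r) : ∀ᶠ ε in 𝓝 (0 : ℝ), ∀ t ∈ 𝕀, ∃
    y ∈ ball z r, -(1 / 2) * ϖ z ((flowOp (locLin δ ρ z G) t).inverse (𝐝[δ, ρ, z] G (ε, t, z) (dirT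
    n))) (𝐝[δ, ρ, z] G (ε, t, z) (dirT n)) - η * ‖𝐝[δ, ρ, z] G (ε, t, z) (dirT n)‖ ^ 2 ≤ H (ε, t, y)
    := by
  have hinvc : ContinuousOn (fun t => (derivWithin (locLin δ ρ z G) 𝕀 t).inverse)
      𝕀 :=
    (contDiffOn_inverse (contDiffOn_derivWithin_unit h.contDiffOn_locLin)
      fun t ht => h.isInvertible_derivWithin_locLin ht).continuousOn
  obtain ⟨b, hb⟩ := isCompact_Icc.exists_bound_of_continuousOn hinvc
  obtain ⟨B, hB0, hB⟩ : ∃ B > 0, ∀ t ∈ 𝕀, ‖(derivWithin (locLin δ ρ z G) 𝕀 t).inverse‖ ≤ B :=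
    ⟨Max.max b 1, by positivity, fun t ht => (hb t ht).trans (le_max_left _ _)⟩
  set η₁ := η / (B + B ^ 2) with hη₁
  have hη₁0 : 0 < η₁ := by positivity
  obtain ⟨r₁, hr₁, hr₁b⟩ := Metric.eventually_nhds_iff_ball.1 (h.eventually_ham_second_close hη₁0)
  set r₂ := min r (min r₁ ρ) with hr₂
  have hr₂0 : 0 < r₂ := lt_min hr (lt_min hr₁ h.radius)
  have hsmall : ∀ᶠ ε in 𝓝 (0 : ℝ), ∀ t ∈ 𝕀, ‖𝐝[δ, ρ, z] G (ε, t, z) (dirT n)‖ < r₂ / B := by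
    refine eventually_lt_of_isCompact isCompact_Icc (isOpen_Ioo.mem_nhds h.zero_mem) (g := fun k : ℝ
      × ℝ => ‖𝐝[δ, ρ, z] G (k.1, k.2, z) (dirT n)‖) ?_ fun t ht => ?_
    · exact (((h.smooth.fderivWithin (uniqueDiffOn_locDom δ ρ z) (m := ∞)
        (by simp)).continuousOn.comp (f := fun k : ℝ × ℝ => ((k.1, k.2, z) : 𝔓 n))
        (by fun_prop) fun k hk => h.mem_center hk.1 hk.2).clm_apply continuousOn_const).norm
    · simp only [h.fderivWithin_dirT_base ht, norm_zero]
      positivity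
  filter_upwards [hsmall, h.eventually_form_close hη₁0, isOpen_Ioo.mem_nhds h.zero_mem,
    ball_mem_nhds (0 : ℝ) hr₁] with ε hεs hεf hεδ hεr t ht
  set ξ := 𝐝[δ, ρ, z] G (ε, t, z) (dirT n) with hξ
  set w := -(derivWithin (locLin δ ρ z G) 𝕀 t).inverse ξ with hw
  have hSw : derivWithin (locLin δ ρ z G) 𝕀 t w = -ξ := by
    rw [hw, map_neg]
    obtain ⟨L, hL⟩ := h.isInvertible_derivWithin_locLin ht
    rw [← hL, ContinuousLinearMap.inverse_equiv]
    simp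
  have hCw : (flowOp (locLin δ ρ z G) t).inverse ξ = -locLin δ ρ z G t w := by
    have h2 := flowOp_inverse_apply (h.isInvertible_locLin ht)
      (h.isInvertible_derivWithin_locLin ht) w
    rw [hSw, map_neg] at h2
    rw [← h2, neg_neg]
  have hwn : ‖w‖ ≤ B * ‖ξ‖ := by
    rw [hw, norm_neg]
    exact (ContinuousLinearMap.le_opNorm _ _).trans
      (mul_le_mul_of_nonneg_right (hB t ht) (norm_nonneg _))
  have hwr : ‖w‖ < r₂ := by
    have := hεs t ht
    rw [lt_div_iff₀ hB0] at this
    linarith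
  have hline : ∀ s ∈ 𝕀, ‖s • w‖ < r₂ := fun s hs => by
    rw [norm_smul, Real.norm_of_nonneg hs.1]
    exact lt_of_le_of_lt (mul_le_of_le_one_left (norm_nonneg _) hs.2) hwr
  have hmem : ∀ s ∈ 𝕀, (ε, t, z + s • w) ∈ locDom δ ρ z := fun s hs => ⟨hεδ, ht, by
      simpa using (hline s hs).trans_le ((min_le_right _ _).trans (min_le_right _ _))⟩
  refine ⟨z + w, by simpa using hwr.trans_le (min_le_left _ _), ?_⟩
  have hT := taylor_lower (a := 𝐝[δ, ρ, z] (𝐝[δ, ρ, z] H) (0, t, z) (dirX n w) (dirX n w) - η₁ * ‖w‖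
    ^ 2) (fun s hs => h.hasDerivAt_line (hmem s hs)) (fun s hs => h.hasDerivAt_line_apply (hmem s
    hs) (dirX n w)) fun s hs => by
      refine hr₁b (ε, z + s • w) ?_ t ht w
      rw [mem_ball, Prod.dist_eq, max_lt_iff]
      refine ⟨hεr, ?_⟩
      simpa using (hline s hs).trans_le ((min_le_right _ _).trans (min_le_left _ _))
  simp only [zero_smul, add_zero, one_smul] at hT
  have hneg : ϖ z (-ξ) (locLin δ ρ z G t w) = -ϖ z ξ (locLin δ ρ z G t w) := by simp
  rw [h.ham_center ε hεδ t ht, h.ham_deriv _ (h.mem_center hεδ ht), h.ham_second_XX ht, hSw,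
    hneg, neg_neg, ← hξ] at hT
  have h1 := (abs_le.1 (hεf t ht ξ w)).2
  refine le_trans ?_ hT
  rw [hCw, map_neg, neg_apply, h.skew z _ ξ]
  have h2 : η₁ * ‖ξ‖ * ‖w‖ + η₁ * ‖w‖ ^ 2 / 2 ≤ η * ‖ξ‖ ^ 2 := by
    have e1 : η₁ * ‖ξ‖ * ‖w‖ ≤ η₁ * ‖ξ‖ * (B * ‖ξ‖) := by gcongr
    have e2 : η₁ * ‖w‖ ^ 2 ≤ η₁ * (B * ‖ξ‖) ^ 2 := by gcongr
    have e3 : η = η₁ * (B + B ^ 2) := by rw [hη₁]; field_simp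
    have e4 : 0 ≤ η₁ * (B * ‖ξ‖) ^ 2 := by positivity
    rw [e3]
    nlinarith
  linarith

/-- If the quadratic functional is coercive then the length functional has a local minimum. -/
theorem eventually_le_of_coercive {c : ℝ} (hc : 0 < c) (hQ : ∀ v : ℝ → E n, 𝒞 v 𝕀 → v 0 = 0 → v 1 =
    0 → c * ∫ t in 0..1, ‖derivWithin v 𝕀 t‖ ^ 2 ≤ quadForm (ϖ z) (locLin δ ρ z G) v) {hb : ℝ → ℝ}
    (hhb : ∀ ε ∈ Ioo (-δ) δ, HasDerivAt hb (-∫ t in 0..1, h.area ε t) ε) {δ₂ ρ₂ : ℝ} {m : ℝ × ℝ → E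
    n} (hδ₂ : 0 < δ₂) (hδ : δ₂ ≤ δ) (hρ : ρ₂ < ρ) (hρ₂ : 0 < ρ₂) (hm : 𝒞 m (Ioo (-δ₂) δ₂ ×ˢ 𝕀)) (hmb
    : ∀ q ∈ Ioo (-δ₂) δ₂ ×ˢ 𝕀, m q ∈ ball z ρ₂) (hmax : ∀ q ∈ Ioo (-δ₂) δ₂ ×ˢ 𝕀, ∀ y ∈ closedBall z
    ρ₂, H (q.1, q.2, y) ≤ H (q.1, q.2, m q)) : ∀ᶠ ε in 𝓝 (0 : ℝ), hb 0 ≤ (∫ t in 0..1, H (ε, t, m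
    (ε, t))) + hb ε := by
  obtain ⟨l, hl, hl0, hA⟩ := h.exists_eventually_action hhb
  have hη : 0 < c / 4 := by linarith
  have hlz : ∀ᶠ y in 𝓝 z, ‖l y - l z - (1 / 2 : ℝ) • ϖ z (y - z)‖ ≤ c / 4 * ‖y - z‖ := by
    have h1 := hl.isLittleO.bound hη
    filter_upwards [h1] with y hy
    simpa using hy
  obtain ⟨r, hr, hlr⟩ := Metric.eventually_nhds_iff_ball.1 hlz
  have hGc := h.smooth.continuousOn.comp (f := fun k : ℝ × ℝ => ((k.1, k.2, z) : 𝔓 n)) (s := Ioo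
    (-δ) δ ×ˢ 𝕀) (by fun_prop) fun k hk => h.mem_center hk.1 hk.2
  have hball : ∀ᶠ ε in 𝓝 (0 : ℝ), ∀ t ∈ 𝕀, ‖G (ε, t, z) - z‖ < r := eventually_lt_of_isCompact
    isCompact_Icc (isOpen_Ioo.mem_nhds h.zero_mem) (g := fun k : ℝ × ℝ => ‖G (k.1, k.2, z) - z‖)
    (hGc.sub continuousOn_const).norm fun t ht => by simp [h.base t ht, hr]
  have h0 : (0 : ℝ) ∈ Ioo (-δ₂) δ₂ := ⟨by linarith, hδ₂⟩
  filter_upwards [hA, hball, h.eventually_exists_ham_ge hη hρ₂, isOpen_Ioo.mem_nhds h0] with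
    ε hεA hεb hεH hε
  have hεδ : ε ∈ Ioo (-δ) δ := ⟨by linarith [hε.1], by linarith [hε.2]⟩
  set ξ : ℝ → E n := fun t => G (ε, t, z) - z with hξ
  have hξs := h.contDiffOn_orbit hεδ
  have hξ0 : ξ 0 = 0 := by simp [hξ, h.start ε hεδ]
  have hξ1 : ξ 1 = 0 := by simp [hξ, h.finish ε hεδ]
  have hξ' : ∀ t ∈ 𝕀, 𝐝[δ, ρ, z] G (ε, t, z) (dirT n)
      = derivWithin ξ 𝕀 t := fun t ht => (h.derivWithin_orbit hεδ ht).symm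
  have hξc := (contDiffOn_derivWithin_unit hξs).continuousOn
  have hCc := h.continuousOn_flowOp_inverse
  have hii : ∀ {g : ℝ → ℝ}, ContinuousOn g 𝕀 → IntervalIntegrable g volume 0 1 := by
    intro g hg
    exact intervalIntegrable_unit ‹_›
  have hlin : ∀ (a b : ℝ) {f g : ℝ → ℝ}, ContinuousOn f 𝕀 → ContinuousOn g 𝕀 → ∫ t in 0..1, (a * f t
      - b * g t) = a * (∫ t in 0..1, f t) - b * ∫ t in 0..1, g t := by
    intro a b f g hf hg
    rw [intervalIntegral.integral_sub (f := fun t => a * f t) (g := fun t => b * g t)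
      ((hii hf).const_mul a) ((hii hg).const_mul b), intervalIntegral.integral_const_mul,
      intervalIntegral.integral_const_mul]
  have hHm : ContinuousOn (fun t => H (ε, t, m (ε, t))) 𝕀 := (h.contDiffOn_max hδ hρ hm
    hmb).continuousOn.comp (f := fun t : ℝ => ((ε, t) : ℝ × ℝ)) (by fun_prop) fun t ht => ⟨hε, ht⟩
  have hc1 : ContinuousOn (fun t => ϖ z ((flowOp (locLin δ ρ z G) t).inverse (derivWithin ξ 𝕀 t))
    (derivWithin ξ 𝕀 t)) 𝕀 := (continuousOn_const.clm_apply (hCc.clm_apply hξc)).clm_apply hξc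
  have hc2 : ContinuousOn (fun t => ϖ z (derivWithin ξ 𝕀 t) (ξ t))
      𝕀 :=
    (continuousOn_const.clm_apply hξc).clm_apply hξs.continuousOn
  have hc3 : ContinuousOn (fun t => ‖derivWithin ξ 𝕀 t‖ ^ 2) 𝕀 := hξc.norm.pow 2
  have hc4 : ContinuousOn (fun t => ‖ξ t‖ * ‖derivWithin ξ 𝕀 t‖) 𝕀 :=
    hξs.continuousOn.norm.mul hξc.norm
  have hI1 : ∫ t in 0..1, (-(1 / 2) * ϖ z ((flowOp (locLin δ ρ z G) t).inverse (derivWithin ξ 𝕀 t))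
      (derivWithin ξ 𝕀 t) - c / 4 * ‖derivWithin ξ 𝕀 t‖ ^ 2) ≤ ∫ t in 0..1, H (ε, t, m (ε, t)) := by
    refine intervalIntegral.integral_mono_on zero_le_one
      (hii ((continuousOn_const.mul hc1).sub (continuousOn_const.mul hc3))) (hii hHm) fun t ht => ?_
    obtain ⟨y, hy, hyH⟩ := hεH t ht
    rw [← hξ' t ht]
    exact hyH.trans (hmax (ε, t) ⟨hε, ht⟩ y (ball_subset_closedBall hy))
  have hI2 : ∫ t in 0..1, (-(1 / 2) * ϖ z (derivWithin ξ 𝕀 t) (ξ t)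
      - c / 4 * (‖ξ t‖ * ‖derivWithin ξ 𝕀 t‖)) ≤ hb ε - hb 0 := by
    rw [hεA.2]
    refine intervalIntegral.integral_mono_on zero_le_one (hii ((continuousOn_const.mul hc2).sub
      (continuousOn_const.mul hc4))) (hii hεA.1) fun t ht => ?_
    rw [hξ' t ht]
    have h1 := hlr (G (ε, t, z)) (by simpa [dist_eq_norm] using hεb t ht)
    rw [hl0, sub_zero] at h1
    have h2 := (l (G (ε, t, z)) - (1 / 2 : ℝ) • ϖ z (G (ε, t, z) - z)).le_of_opNorm_le h1
      (derivWithin ξ 𝕀 t)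
    have h3 := (abs_le.1 h2).1
    simp only [sub_apply, smul_apply, smul_eq_mul] at h3
    rw [h.skew z _ (ξ t)]
    simp only [hξ] at h3 ⊢
    linarith
  have hI3 : ∫ t in 0..1, ‖ξ t‖ * ‖derivWithin ξ 𝕀 t‖
      ≤ ∫ t in 0..1, ‖derivWithin ξ 𝕀 t‖ ^ 2 := integral_norm_mul_le hξs hξ0
  have hQξ := hQ ξ hξs hξ0 hξ1
  rw [quadForm, intervalIntegral.integral_add (hii hc1) (hii hc2)] at hQξ
  rw [hlin _ _ hc1 hc3] at hI1
  rw [hlin _ _ hc2 hc4] at hI2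
  nlinarith

end LocalFamily

section Level

variable [IsManifold (𝓡 (2 * n)) ∞ M]

theorem isOpen_level {g : M → ℝ} (hg : MDifferentiable 𝓜 𝓘₁ g) {W : Set M} (hW : IsOpen W) (h0 : ∀ x
    ∈ W, ∀ u, (mfderiv 𝓜 𝓘₁ g x u : ℝ) = 0) (a : ℝ) : IsOpen {x ∈ W | g x = a} := by
  rw [isOpen_iff_mem_nhds]
  rintro x ⟨hxW, hxa⟩
  set e := 𝓔 x with he
  have hopen : IsOpen (e.target ∩ e.symm ⁻¹' W) := (continuousOn_extChartAt_symm (I := 𝓜)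
    x).isOpen_inter_preimage (isOpen_extChartAt_target x) hW
  have hxe : e.symm (e x) = x := extChartAt_to_inv (I := 𝓜) x
  obtain ⟨r, hr, hball⟩ := Metric.isOpen_iff.1 hopen (e x)
    ⟨mem_extChartAt_target (I := 𝓜) x, by rw [mem_preimage, hxe]; exact hxW⟩
  have hd : ∀ y ∈ ball (e x) r, HasFDerivAt (fun y => g (e.symm y)) (0 : E n →L[ℝ] ℝ) y := by
    intro y hy
    have h1 := ((hg (e.symm y)).hasMFDerivAt.comp y
      (mdifferentiableAt_extChartAt_symm (hball hy).1).hasMFDerivAt).hasFDerivAt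
    refine h1.congr_fderiv ?_
    ext u
    exact h0 _ (hball hy).2 _
  have hconst : ∀ y ∈ ball (e x) r, g (e.symm y) = a := by
    intro y hy
    have h1 := Metric.isOpen_ball.is_const_of_fderiv_eq_zero (convex_ball (e x) r).isPreconnected
      (fun y hy => (hd y hy).differentiableAt.differentiableWithinAt) (fun y hy => (hd y hy).fderiv)
      hy (mem_ball_self hr)
    exact h1.trans (by rw [hxe, hxa])
  filter_upwards [extChartAt_source_mem_nhds (I := 𝓜) x,
    (continuousAt_extChartAt (I := 𝓜) x) (ball_mem_nhds _ hr)] with x' hx' hxb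
  have h1 : e.symm (e x') = x' := e.left_inv hx'
  have h2 := (hball hxb).2
  rw [mem_preimage, h1] at h2
  exact ⟨h2, by rw [← hconst _ hxb, h1]⟩

theorem eq_of_mfderiv_eq_zero [ConnectedSpace M] {g : M → ℝ} (hg : MDifferentiable 𝓜 𝓘₁ g) (h0 : ∀ x
    u, (mfderiv 𝓜 𝓘₁ g x u : ℝ) = 0) (x y : M) : g x = g y := by
  have h1 := isOpen_level hg isOpen_univ (fun x _ => h0 x) (g x)
  simp only [mem_univ, true_and] at h1
  have h2 : IsClopen {z | g z = g x} := ⟨isClosed_eq hg.continuous continuous_const, h1⟩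
  have h3 : y ∈ {z | g z = g x} := by rw [h2.eq_univ ⟨x, rfl⟩]; exact mem_univ y
  exact h3.symm

/-- A function locally constant off a compact set takes all its values near that set. -/
theorem exists_mem_eq_of_mfderiv_eq_zero [ConnectedSpace M] [T2Space M] {g : M → ℝ} (hg :
    MDifferentiable 𝓜 𝓘₁ g) {K K' : Set M} (hK : IsCompact K) (hKK' : K ⊆ interior K') (hne :
    K'.Nonempty) (h0 : ∀ x ∉ K, ∀ u, (mfderiv 𝓜 𝓘₁ g x u : ℝ) = 0) (x : M) : ∃ x' ∈ K', g x' = g x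
    := by
  by_cases hx : x ∈ K'
  · exact ⟨x, hx, rfl⟩
  by_contra hcon
  push Not at hcon
  have hxK : x ∉ K := fun h => hx (interior_subset (hKK' h))
  have hopen := isOpen_level hg hK.isClosed.isOpen_compl (fun x hx => h0 x hx) (g x)
  have hcl : IsClosed {z ∈ Kᶜ | g z = g x} := by
    have h1 : {z ∈ Kᶜ | g z = g x} = {z ∈ (interior K')ᶜ | g z = g x} := by
      ext z
      refine ⟨fun h => ⟨fun hz => hcon z (interior_subset hz) h.2, h.2⟩,
        fun h => ⟨fun hz => h.1 (hKK' hz), h.2⟩⟩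
    rw [h1]
    exact isOpen_interior.isClosed_compl.inter (isClosed_eq hg.continuous continuous_const)
  obtain ⟨p, hp⟩ := hne
  have h3 : p ∈ {z ∈ Kᶜ | g z = g x} := by
    rw [IsClopen.eq_univ ⟨hcl, hopen⟩ ⟨x, hxK, rfl⟩]; exact mem_univ p
  exact hcon p hp h3.2

theorem mfderiv_extChartAt_symm_center (x : M) (u : E n) : (mfderiv 𝓘(ℝ, E n) 𝓜 (𝓔 x).symm (𝓔 x x) u
    : E n) = u := by
  have hy := mem_extChartAt_target (I := 𝓜) x
  have h1 : fderivWithin ℝ (writtenInExtChartAt 𝓘(ℝ, E n) 𝓜 (𝓔 x x) (𝓔 x).symm) (range 𝓘(ℝ, E n)) (𝓔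
      x x) = ContinuousLinearMap.id ℝ (E n) := by
    rw [modelWithCornersSelf_coe, range_id, fderivWithin_univ]
    refine (Filter.EventuallyEq.fderiv_eq ?_).trans fderiv_id
    filter_upwards [(isOpen_extChartAt_target (I := 𝓜) x).mem_nhds hy] with y hy
    simp only [writtenInExtChartAt, Function.comp_apply, extChartAt_to_inv]
    exact (𝓔 x).right_inv hy
  exact congrArg (fun L : 𝓛 => L u) ((mdifferentiableAt_extChartAt_symm hy).mfderiv.trans h1)

theorem pairing_eq_chartForm (Ω : SymplecticForm n M) (x : M) (u w : E n) :
    pairing Ω x u w = chartForm Ω.form x (𝓔 x x) ![u, w] := by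
  rw [chartForm_apply, pairing]
  refine (form_congr_point Ω (extChartAt_to_inv (I := 𝓜) x).symm u w).trans ?_
  refine congrArg (Ω.form _) ?_
  funext i; fin_cases i
  · exact (mfderiv_extChartAt_symm_center x u).symm
  · exact (mfderiv_extChartAt_symm_center x w).symm

end Level

theorem hasFDerivAt_fderiv_of_contDiffOn {V : Type*} [NormedAddCommGroup V] [NormedSpace ℝ V] {k : V
  → ℝ} {U : Set V} (hk : 𝒞 k U) (hU : IsOpen U) {z : V} (hz : z ∈ U) : HasFDerivAt (fderiv ℝ k)
  (fderiv ℝ (fderiv ℝ k) z) z := (((hk.fderiv_of_isOpen hU (m := 1) (by norm_cast)).differentiableOn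
  (by norm_num)).differentiableAt (hU.mem_nhds hz)).hasFDerivAt

/-- A nondegenerate critical point stays nondegenerate after a change of coordinates. -/
theorem eq_zero_of_hessian {δ ρ c : ℝ} {z : E n} {G : 𝔓 n → E n} {H : 𝔓 n → ℝ} {k : E n → ℝ} {U :
    Set (E n)} {u : E n} (hδ : 0 < δ) (hρ : 0 < ρ) (hG : 𝒞 G (locDom δ ρ z)) (hH : 𝒞 H (locDom δ ρ
    z)) (hU : IsOpen U) (hk : 𝒞 k U) (hz : z ∈ U) (ht : t ∈ 𝕀) (hGU : ∀ y ∈ ball z ρ, G (0, t, y) ∈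
    U) (hHk : ∀ y ∈ ball z ρ, H (0, t, y) = k (G (0, t, y)) - c) (hGz : G (0, t, z) = z) (hkz :
    fderiv ℝ k z = 0) (hinj : ∀ w, 𝐝[δ, ρ, z] G (0, t, z) (dirX n w) = 0 → w = 0) (hnd : ∀ w, (∀ v,
    fderiv ℝ (fderiv ℝ k) z w v = 0) → w = 0) (hu : ∀ w, 𝐝[δ, ρ, z] (𝐝[δ, ρ, z] H) (0, t, z) (dirX n
    u) (dirX n w) = 0) : u = 0 := by
  have h0 : (0 : ℝ) ∈ Ioo (-δ) δ := ⟨by linarith, hδ⟩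
  have hq : ∀ y ∈ ball z ρ, ((0 : ℝ), t, y) ∈ locDom δ ρ z := fun y hy => ⟨h0, ht, hy⟩
  have hzb : z ∈ ball z ρ := mem_ball_self hρ
  have hGy : ∀ y ∈ ball z ρ, HasFDerivAt (fun y => G (0, t, y)) ((𝐝[δ, ρ, z] G (0, t, y)).comp (dirX
    n)) y := fun y hy => hasFDerivAt_sliceX_of_locDom (hG.differentiableOn (by simp) (0, t, y) (hq y
    hy)).hasFDerivWithinAt (hq y hy)
  have hid : ∀ y ∈ ball z ρ, ∀ w, fderiv ℝ k (G (0, t, y)) (𝐝[δ, ρ, z] G (0, t, y) (dirX n w)) =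
      𝐝[δ, ρ, z] H (0, t, y) (dirX n w) := by
    intro y hy w
    have h1 := (((hk.differentiableOn (by simp)).differentiableAt
      (hU.mem_nhds (hGU y hy))).hasFDerivAt.comp y (hGy y hy)).sub_const c
    have h2 := hasFDerivAt_sliceX_of_locDom
      (hH.differentiableOn (by simp) (0, t, y) (hq y hy)).hasFDerivWithinAt (hq y hy)
    have h3 : (fun y => H (0, t, y)) =ᶠ[𝓝 y] fun y => (k ∘ fun y => G (0, t, y)) y - c := by
      filter_upwards [Metric.isOpen_ball.mem_nhds hy] with y' hy' using hHk y' hy'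
    exact congrArg (fun L : E n →L[ℝ] ℝ => L w) ((h1.congr_of_eventuallyEq h3).unique h2)
  have hkk := hasFDerivAt_fderiv_of_contDiffOn hk hU hz
  obtain ⟨L, hL⟩ := isInvertible_of_injective (A := (𝐝[δ, ρ, z] G (0, t, z)).comp (dirX n)) hinj
  have hSu : (𝐝[δ, ρ, z] G (0, t, z)).comp (dirX n) u = 0 := by
    refine hnd _ fun v => ?_
    have e1 : HasFDerivAt (fun y => fderiv ℝ k (G (0, t, y))) ((fderiv ℝ (fderiv ℝ k) z).comp ((𝐝[δ,
      ρ, z] G (0, t, z)).comp (dirX n))) z := HasFDerivAt.comp (g := fderiv ℝ k) (f := fun y => G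
      (0, t, y)) z (by rw [hGz]; exact hkk) (hGy z hzb)
    have e2 := hasFDerivAt_sliceX_of_locDom (g := fun q => 𝐝[δ, ρ, z] G q
      (dirX n (L.symm v))) (hasFDerivWithinAt_fderivWithin_apply hG
      (uniqueDiffOn_locDom δ ρ z) (hq z hzb) (dirX n (L.symm v))) (hq z hzb)
    have e3 := hasFDerivAt_sliceX_of_locDom (g := fun q => 𝐝[δ, ρ, z] H q
      (dirX n (L.symm v))) (hasFDerivWithinAt_fderivWithin_apply hH
      (uniqueDiffOn_locDom δ ρ z) (hq z hzb) (dirX n (L.symm v))) (hq z hzb)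
    have e4 := (e1.clm_apply e2).congr_of_eventuallyEq (f₁ := fun y =>
      𝐝[δ, ρ, z] H (0, t, y) (dirX n (L.symm v))) (by
        filter_upwards [ball_mem_nhds z hρ] with y hy
        exact (hid y hy _).symm)
    have e5 := congrArg (fun A : E n →L[ℝ] ℝ => A u) (e4.unique e3)
    have e6 : 𝐝[δ, ρ, z] G (0, t, z) (dirX n (L.symm v)) = v := by
      have : (𝐝[δ, ρ, z] G (0, t, z)).comp (dirX n) (L.symm v) = v := by
        rw [← hL]; simp
      exact this
    simp only [add_apply, ContinuousLinearMap.comp_apply, ContinuousLinearMap.flip_apply] at e5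
    rw [hu (L.symm v), hGz, hkz, e6, zero_apply, zero_add] at e5
    exact e5
  rw [← hL] at hSu
  exact L.map_eq_zero_iff.1 hSu

namespace IsFamily

variable [IsManifold (𝓡 (2 * n)) ∞ M]

/-- A family of diffeomorphisms in the chart around a fixed point. -/
def locMap (φ : ℝ → ℝ → Diffeo n M) (p : M) (q : 𝔓 n) : E n :=
  𝓔 p (famMap φ p q)

/-- The relative Hamiltonian in the chart around a fixed point. -/
def locHam (φ : ℝ → ℝ → Diffeo n M) (Φ : ℝ → ℝ → M → ℝ) (p : M)
    (q : 𝔓 n) : ℝ :=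
  relHam φ Φ p q.1 q.2.1 ((𝓔 p).symm q.2.2)

/-- A symplectic form in the chart around a point. -/
def locForm (Ω : SymplecticForm n M) (p : M) (y : E n) : 𝓑 :=
  toBilin (E n) (chartForm Ω.form p y)

theorem locDom_eq_inter {δ ρ : ℝ} (hδ : δ ≤ ε₀) (hρ : ball (𝓔 p p) ρ ⊆ (𝓔 p).target) : locDom δ ρ (𝓔
    p p) = famDom n ε₀ p ∩ (Ioo (-δ) δ ×ˢ univ ×ˢ ball (𝓔 p p) ρ) := by
  ext q
  exact ⟨fun hq => ⟨⟨⟨by linarith [hq.1.1], by linarith [hq.1.2]⟩, hq.2.1, hρ hq.2.2⟩,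
    hq.1, mem_univ _, hq.2.2⟩, fun hq => ⟨hq.2.1, hq.1.2.1, hq.2.2.2⟩⟩

variable (h : IsFamily Ω ε₀ φ Φ)
include h

theorem exists_locDom (hb : ∀ t ∈ 𝕀, φ 0 t p = p) : ∃ δ ρ : ℝ, 0 < δ ∧ δ ≤ ε₀ ∧ 0 < ρ ∧ ball (𝓔 p p)
    ρ ⊆ (𝓔 p).target ∧ ∀ q ∈ locDom δ ρ (𝓔 p p), famMap φ p q ∈ (𝓔 p).source := by
  set z := 𝓔 p p with hz
  have hzt : z ∈ (𝓔 p).target := mem_extChartAt_target (I := 𝓜) p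
  have h0 : (0 : ℝ) ∈ Ioo (-ε₀) ε₀ := ⟨by linarith [h.pos], h.pos⟩
  have h1 : ∀ᶠ x : ℝ × E n in 𝓝 (0, z), ∀ t ∈ 𝕀, (x.1, t, x.2) ∈ famDom n ε₀ p → famMap φ p (x.1, t,
      x.2) ∈ (𝓔 p).source := by
    refine isCompact_Icc.eventually_forall_of_forall_eventually fun t ht => ?_
    have hc := (contMDiffOn_famMap h.smooth p (0, t, z) ⟨h0, ht, hzt⟩).continuousWithinAt
    have hp : famMap φ p (0, t, z) = p := (famMap_extChartAt φ (mem_extChartAt_source p) 0 t).trans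
      (hb t ht)
    have h2 := hc.eventually (p := fun x => x ∈ (𝓔 p).source)
      (by rw [hp]; exact extChartAt_source_mem_nhds p)
    have hcont : Tendsto (fun k : (ℝ × E n) × ℝ => ((k.1.1, k.2, k.1.2) : 𝔓 n)) (𝓝 ((0, z), t)) (𝓝
      (0, t, z)) := Continuous.tendsto (f := fun k : (ℝ × E n) × ℝ => ((k.1.1, k.2, k.1.2) : 𝔓 n))
      (by fun_prop) ((0, z), t)
    exact hcont.eventually (eventually_nhdsWithin_iff.1 h2)
  obtain ⟨r, hr, hball⟩ := Metric.eventually_nhds_iff_ball.1 h1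
  obtain ⟨r', hr', hball'⟩ := Metric.isOpen_iff.1 (isOpen_extChartAt_target (I := 𝓜) p) z hzt
  refine ⟨min r ε₀, min r r', lt_min hr h.pos, min_le_right _ _, lt_min hr hr',
    (ball_subset_ball (min_le_right _ _)).trans hball', ?_⟩
  rintro ⟨ε, t, y⟩ ⟨hε, ht, hy⟩
  refine hball (ε, y) ?_ t ht ⟨?_, ht, hball' (ball_subset_ball (min_le_right _ _) hy)⟩
  · rw [mem_ball, Prod.dist_eq, max_lt_iff]
    refine ⟨?_, lt_of_lt_of_le hy (min_le_left _ _)⟩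
    rw [Real.dist_eq, sub_zero]
    exact lt_of_lt_of_le (abs_lt.2 hε) (min_le_left _ _)
  · have := min_le_right r ε₀
    exact ⟨by linarith [hε.1], by linarith [hε.2]⟩

variable {δ ρ : ℝ} (hδ : 0 < δ) (hδ' : δ ≤ ε₀) (hρ : 0 < ρ) (hρ' : ball (extChartAt (𝓡 (2 * n)) p p)
  ρ ⊆ (extChartAt (𝓡 (2 * n)) p).target) (hs : ∀ q ∈ locDom δ ρ (extChartAt (𝓡 (2 * n)) p p), famMap
  φ p q ∈ (extChartAt (𝓡 (2 * n)) p).source)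
include hδ' hρ'

omit h in
theorem fderivWithin_locDom_eq {F : Type} [NormedAddCommGroup F] [NormedSpace ℝ F] (g : 𝔓 n → F) {q
    : 𝔓 n} (hq : q ∈ locDom δ ρ (𝓔 p p)) : fderivWithin ℝ g (locDom δ ρ (𝓔 p p)) q = fderivWithin ℝ
    g (famDom n ε₀ p) q := by
  rw [locDom_eq_inter hδ' hρ'] at hq ⊢
  exact fderivWithin_inter ((isOpen_Ioo.prod (isOpen_univ.prod isOpen_ball)).mem_nhds hq.2)

include hs

theorem famForm_eq_locForm {q : 𝔓 n} (hq : q ∈ locDom δ ρ (𝓔 p p)) (a b : 𝔓 n) : famForm Ω ε₀ φ p q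
    a b = locForm Ω p (locMap φ p q) (fderivWithin ℝ (locMap φ p) (locDom δ ρ (𝓔 p p)) q a)
    (fderivWithin ℝ (locMap φ p) (locDom δ ρ (𝓔 p p)) q b) := by
  have hq' : q ∈ famDom n ε₀ p := by
    rw [locDom_eq_inter hδ' hρ'] at hq
    exact hq.1
  rw [fderivWithin_locDom_eq hδ' hρ' _ hq, famForm, pull_eq_chart Ω (h.mdiff hq')
    (uniqueDiffOn_famDom ε₀ p q hq') (hs q hq) hq', toBilin_apply, locForm, toBilin_apply,
    ContinuousAlternatingMap.compContinuousLinearMap_apply]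
  refine congrArg (chartForm Ω.form p (locMap φ p q)) ?_
  funext i; fin_cases i <;> rfl

theorem contDiffOn_locMap : 𝒞 (locMap φ p) (locDom δ ρ (𝓔 p p)) := by
  rw [locDom_eq_inter hδ' hρ'] at hs ⊢
  exact contDiffOn_chart_comp (contMDiffOn_famMap h.smooth p) hs

theorem locMap_dirX_eq_zero {q : 𝔓 n} (hq : q ∈ locDom δ ρ (𝓔 p p)) {u : E n} (hu : fderivWithin ℝ
    (locMap φ p) (locDom δ ρ (𝓔 p p)) q (dirX n u) = 0) : u = 0 := by
  have hq' : q ∈ famDom n ε₀ p := by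
    rw [locDom_eq_inter hδ' hρ'] at hq
    exact hq.1
  refine chartForm_nondegenerate Ω hq'.2.2 fun w => ?_
  have h1 := h.famForm_eq_locForm hδ' hρ' hs hq (dirX n u) (dirX n w)
  rw [hu, map_zero, zero_apply] at h1
  exact (h.form_dirX (ε := q.1) (t := q.2.1) (y := q.2.2) hq' u w).symm.trans h1

include hδ hρ

/-- A family near a fixed nondegenerate maximum point, in a chart. -/
theorem localFamily [ConnectedSpace M] (hb : ∀ t ∈ 𝕀, φ 0 t p = p) (hfin : ∀ ε ∈ Ioo (-ε₀) ε₀, ∀ x,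
    φ ε 1 x = φ 0 1 x) (hmax : ∀ t ∈ 𝕀, IsUniqueMax (Φ 0 t) p) (hnd : ∀ t ∈ 𝕀, HessianNondegenerate
    (n := n) (Φ 0 t) p) : LocalFamily δ ρ (𝓔 p p) (locMap φ p) (locHam φ Φ p) (locForm Ω p) (𝓔
    p).target := by
  have hG := h.contDiffOn_locMap hδ' hρ' hs
  have hmap := fun q hq => h.famForm_eq_locForm (q := q) hδ' hρ' hs hq
  have hinj := fun q hq u => h.locMap_dirX_eq_zero (q := q) hδ' hρ' hs hq (u := u)
  have hfd := fun (F : Type) [NormedAddCommGroup F] [NormedSpace ℝ F] (g : 𝔓 n → F) q hq =>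
    fderivWithin_locDom_eq (n := n) (p := p) (ε₀ := ε₀) hδ' hρ' g (q := q) hq
  have hle : locDom δ ρ (𝓔 p p) ⊆ famDom n ε₀ p := by
    rw [locDom_eq_inter hδ' hρ']; exact inter_subset_left
  have hI : ∀ ε ∈ Ioo (-δ) δ, ε ∈ Ioo (-ε₀) ε₀ := fun ε hε =>
    ⟨by linarith [hε.1], by linarith [hε.2]⟩
  have h0δ : (0 : ℝ) ∈ Ioo (-δ) δ := ⟨by linarith, hδ⟩
  set e := 𝓔 p with he
  set z := e p with hz
  set D := locDom δ ρ z with hD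
  have hze : e.symm z = p := extChartAt_to_inv (I := 𝓜) p
  have hzt : z ∈ e.target := mem_extChartAt_target (I := 𝓜) p
  have hcen : ∀ ε t, φ ε t p = p → locMap φ p (ε, t, z) = z := by
    intro ε t hp
    rw [locMap, famMap_extChartAt φ (mem_extChartAt_source p), hp]
  have hham : 𝒞 (locHam φ Φ p) D := (h.contDiffOn_relHam p p).mono hle
  have hform : 𝒞 (locForm Ω p) e.target := contDiff_toBilin.comp_contDiffOn (Ω.smooth p)
  have hhd : ∀ q ∈ D, ∀ w : E n, fderivWithin ℝ (locHam φ Φ p) D q (dirX n w)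
      = -famForm Ω ε₀ φ p q (dirT n) (dirX n w) := by
    intro q hq w
    rw [hfd ℝ _ q hq]
    exact h.relHam_fderivWithin_dirX p (hle hq) w
  have hcm : ∀ t ∈ 𝕀, (0, t, z) ∈ D := fun t ht => ⟨h0δ, ht, mem_ball_self hρ⟩
  refine ⟨hδ, hρ, isOpen_extChartAt_target p, hG, hham, hform, fun q hq => e.map_source (hs q hq),
    fun ε hε t ht => ?_, fun q hq w => ?_, fun t ht => hcen 0 t (hb t ht), fun ε hε => ?_,
    fun ε hε => ?_, fun y u w => alternating_swap (chartForm Ω.form p y) u w, fun y hy a b c => ?_, fun u hu => ?_,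
    fun t ht y hy hyz => ?_, fun t ht u hu => hinj _ (hcm t ht) u hu, fun t ht u hu => ?_⟩
  · simp only [locHam, ← he, hze, relHam, sub_self]
  · rw [hhd q hq w, hmap q hq]
  · exact hcen ε 0 (h.start ε (hI ε hε) p)
  · exact hcen ε 1 ((hfin ε (hI ε hε) p).trans (hb 1 (by simp)))
  · have hd : DifferentiableAt ℝ (chartForm Ω.form p) y := ((Ω.smooth p).differentiableOn (by
      simp)).differentiableAt ((isOpen_extChartAt_target p).mem_nhds hy)
    have h1 := extDerivWithin_eq_zero_iff_cyclic hd.differentiableWithinAt uniqueDiffWithinAt_univ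
      (by rw [extDerivWithin_univ]; exact Ω.closed p y hy) a b c
    rwa [fderivWithin_univ] at h1
  · exact chartForm_nondegenerate Ω hzt hu
  · have hyt : y ∈ e.target := hρ' hy
    simp only [locHam, relHam, ← he]
    rw [hb t ht]
    refine sub_neg.2 (hmax t ht _ fun hcon => hyz ?_)
    have h1 : e.symm y = p := (φ 0 t).injective (hcon.trans (hb t ht).symm)
    rw [hz, ← h1, e.right_inv hyt]
  · set k : E n → ℝ := Φ 0 t ∘ e.symm with hk
    have hkd : 𝒞 k e.target := contMDiffOn_iff_contDiffOn.1 ((h.contMDiff_ham (hI 0 h0δ)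
      ht).comp_contMDiffOn (contMDiffOn_extChartAt_symm p))
    have hko := isOpen_extChartAt_target (I := 𝓜) p
    have hkz : fderiv ℝ k z = 0 := by
      refine IsLocalMax.fderiv_eq_zero (Eventually.of_forall fun y => ?_)
      simp only [hk, Function.comp_apply, hze]
      by_cases hy : e.symm y = p
      · rw [hy]
      · exact (hmax t ht _ hy).le
    refine eq_zero_of_hessian hδ hρ hG hham hko hkd hzt ht
      (fun y hy => e.map_source (hs (0, t, y) ⟨h0δ, ht, hy⟩)) (c := Φ 0 t (φ 0 t p))
      (fun y hy => ?_) (hcen 0 t (hb t ht)) hkz (fun u hu => hinj _ (hcm t ht) u hu) (hnd t ht) hu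
    have h4 : e.symm (locMap φ p (0, t, y)) = famMap φ p (0, t, y) :=
      e.left_inv (hs (0, t, y) ⟨h0δ, ht, hy⟩)
    simp only [locHam, relHam, hk, Function.comp_apply, h4]
    rfl

end IsFamily

namespace IsFamily

variable [IsManifold (𝓡 (2 * n)) ∞ M] (h : IsFamily Ω ε₀ φ Φ)
include h

section Center

variable {δ ρ : ℝ} {H : 𝔓 n → ℝ} {ϖ : E n → E n →L[ℝ] E n →L[ℝ] ℝ} {U : Set (E n)}
  (L : LocalFamily δ ρ (extChartAt (𝓡 (2 * n)) p p) (locMap φ p) H ϖ U)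
include L

omit h in
theorem locLin_eq_linFlow (ht : t ∈ 𝕀) (hb : φ 0 t p = p) :
    locLin δ ρ (𝓔 p p) (locMap φ p) t = linFlow (φ 0) p t := by
  have h1 := hasFDerivAt_sliceX_of_locDom ((L.smooth.differentiableOn (by simp) _
    (L.mem_base ht)).hasFDerivWithinAt) (L.mem_base ht)
  have h2 : MDifferentiableAt 𝓜 𝓜 (φ 0 t) p := (φ 0 t).contMDiff.mdifferentiableAt (by simp)
  have h3 : writtenInExtChartAt 𝓜 𝓜 p (φ 0 t) = fun y => locMap φ p (0, t, y) := by
    rw [writtenInExtChartAt, hb]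
    rfl
  have h4 := h2.mfderiv
  rw [h3, ModelWithCorners.range_eq_univ, fderivWithin_univ] at h4
  exact (h4.trans h1.fderiv).symm

theorem locVar_eq_varField (ht : t ∈ 𝕀) (hb : φ 0 t p = p) :
    locVar δ ρ (𝓔 p p) (locMap φ p) t = varField φ p t := by
  have h1 := hasDerivAt_sliceE_of_locDom ((L.smooth.differentiableOn (by simp) _
    (L.mem_base ht)).hasFDerivWithinAt) (L.mem_base ht)
  have h0 : (0 : ℝ) ∈ Ioo (-ε₀) ε₀ := ⟨by linarith [h.pos], h.pos⟩
  have h2 : MDifferentiableAt 𝓘₁ 𝓜 (fun ε => φ ε t p) 0 := by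
    have h5 : ContMDiffOn 𝓘₁ 𝓜 ∞ (fun ε => φ ε t p) (Ioo (-ε₀) ε₀) := h.smooth.comp (f := fun ε : ℝ
      => (ε, t, p)) (contMDiffOn_id.prodMk (contMDiffOn_const.prodMk contMDiffOn_const)) fun ε hε =>
      ⟨hε, ht, mem_univ _⟩
    exact (h5.contMDiffAt (isOpen_Ioo.mem_nhds h0)).mdifferentiableAt (by simp)
  have h3 : writtenInExtChartAt 𝓘₁ 𝓜 0 (fun ε => φ ε t p) = fun ε => locMap φ p (ε, t, 𝓔 p p) := by
    funext ε
    rw [writtenInExtChartAt, hb, locMap, famMap_extChartAt φ (mem_extChartAt_source p)]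
    rfl
  have h4 := h2.mfderiv
  rw [h3, modelWithCornersSelf_coe, range_id, fderivWithin_univ] at h4
  have h5 := congrArg (fun A : ℝ →L[ℝ] E n => A 1) (h4.trans h1.hasFDerivAt.fderiv)
  refine Eq.trans ?_ h5.symm
  simp [locVar]

omit h in
theorem quadForm_eq_Q (hb : ∀ t ∈ 𝕀, φ 0 t p = p) (v : ℝ → E n) : quadForm (locForm Ω p (𝓔 p p))
    (locLin δ ρ (𝓔 p p) (locMap φ p)) v = Q Ω (φ 0) p v := by
  have h1 : EqOn (locLin δ ρ (𝓔 p p) (locMap φ p)) (linFlow (φ 0) p)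
    𝕀 := fun t ht => locLin_eq_linFlow L ht (hb t ht)
  rw [quadForm, Q]
  refine congrArg Neg.neg (integral_congr_unit fun t ht => ?_)
  simp only [pairing_eq_chartForm, flowOp, linOp, h1 ht, derivWithin_congr h1 (h1 ht)]
  rfl

end Center

variable [ConnectedSpace M] [T2Space M]

/-- Near the unperturbed path the maximum is attained near the maximum point. -/
theorem eventually_iSup_ham_eq (hb : ∀ t ∈ 𝕀, φ 0 t p = p) (hK : ∃ K : Set M, IsCompact K ∧ ∀ ε ∈
    Ioo (-ε₀) ε₀, ∀ t ∈ 𝕀, ∀ x ∉ K, φ ε t x = x) (hmax : ∀ t ∈ 𝕀, IsUniqueMax (Φ 0 t) p) {δ₂ ρ₂ : ℝ}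
    {m : ℝ × ℝ → E n} (hδ₂ : 0 < δ₂) (hρ₂ : 0 < ρ₂) (ht' : closedBall (𝓔 p p) ρ₂ ⊆ (𝓔 p).target) (hm
    : ∀ q ∈ Ioo (-δ₂) δ₂ ×ˢ 𝕀, ∀ y ∈ closedBall (𝓔 p p) ρ₂, locHam φ Φ p (q.1, q.2, y) ≤ locHam φ Φ
    p (q.1, q.2, m q)) : ∀ᶠ ε in 𝓝 (0 : ℝ), ∀ t ∈ 𝕀, ⨆ x, Φ ε t x = locHam φ Φ p (ε, t, m (ε, t)) +
    Φ ε t (φ ε t p) := by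
  have : LocallyCompactSpace M := ChartedSpace.locallyCompactSpace (E n) M
  obtain ⟨K, hKc, hK⟩ := hK
  obtain ⟨K', hK'c, hK'⟩ := exists_compact_superset (hKc.union (isCompact_singleton (x := p)))
  have h0 : (0 : ℝ) ∈ Ioo (-ε₀) ε₀ := ⟨by linarith [h.pos], h.pos⟩
  have h02 : (0 : ℝ) ∈ Ioo (-δ₂) δ₂ := ⟨by linarith, hδ₂⟩
  set e := 𝓔 p with he
  set z := e p with hz
  set N : Set M := e.source ∩ e ⁻¹' ball z ρ₂ with hN
  have hNo : IsOpen N := (continuousOn_extChartAt (I := 𝓜) p).isOpen_inter_preimage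
    (isOpen_extChartAt_source p) isOpen_ball
  have hev : ∀ᶠ ε in 𝓝 (0 : ℝ), ∀ k ∈ 𝕀 ×ˢ (K' \ N), relHam φ Φ p ε k.1 k.2 < 0 := by
    refine eventually_lt_of_isCompact (isCompact_Icc.prod (hK'c.diff hNo)) (isOpen_Ioo.mem_nhds h0)
      (g := fun q : ℝ × ℝ × M => relHam φ Φ p q.1 q.2.1 q.2.2) ((h.continuousOn_relHam p).mono
      (prod_mono subset_rfl (prod_mono subset_rfl (subset_univ _)))) fun k hk => ?_
    simp only [relHam]
    rw [hb k.1 hk.1]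
    refine sub_neg.2 (hmax k.1 hk.1 _ fun hcon => hk.2.2 ?_)
    have h1 : k.2 = p := (φ 0 k.1).injective (hcon.trans (hb k.1 hk.1).symm)
    rw [h1]
    exact ⟨mem_extChartAt_source p, mem_ball_self hρ₂⟩
  filter_upwards [hev, isOpen_Ioo.mem_nhds h0, isOpen_Ioo.mem_nhds h02] with ε hε hε0 hε2 t ht
  have hcenter : locHam φ Φ p (ε, t, z) = 0 := by
    simp only [locHam, ← he]
    rw [show e.symm z = p from extChartAt_to_inv (I := 𝓜) p, relHam, sub_self]
  have hm0 : 0 ≤ locHam φ Φ p (ε, t, m (ε, t)) := by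
    rw [← hcenter]
    exact hm (ε, t) ⟨hε2, ht⟩ z (mem_closedBall_self hρ₂.le)
  have hbound' : ∀ x ∈ K', relHam φ Φ p ε t x ≤ locHam φ Φ p (ε, t, m (ε, t)) := by
    intro x hx
    by_cases hxN : x ∈ N
    · have h1 := hm (ε, t) ⟨hε2, ht⟩ (e x) (ball_subset_closedBall hxN.2)
      simp only [locHam, ← he] at h1 ⊢
      rwa [show e.symm (e x) = x from e.left_inv hxN.1] at h1
    · exact (hε (t, x) ⟨ht, hx, hxN⟩).le.trans hm0
  have hsm : ContMDiff 𝓜 𝓘₁ ∞ (Φ ε t) := h.contMDiff_ham hε0 ht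
  have hbound : ∀ x, relHam φ Φ p ε t x ≤ locHam φ Φ p (ε, t, m (ε, t)) := by
    intro x
    by_cases hx : x ∈ K'
    · exact hbound' x hx
    obtain ⟨x', hx', hxx'⟩ := exists_mem_eq_of_mfderiv_eq_zero (hsm.mdifferentiable (by simp)) hKc
      (subset_union_left.trans hK') ⟨p, interior_subset (hK' (Or.inr rfl))⟩ (fun x hx u => by
        have h1 := h.gen ε hε0 t ht x
        have h2 : (mfderivWithin 𝓘₁ 𝓜 (fun s : ℝ => φ ε s x) 𝕀 t (1 : ℝ) : E n) = 0 := by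
          have h3 := mfderivWithin_congr (I := 𝓘₁) (I' := 𝓜) (f := fun _ : ℝ => x)
            (f₁ := fun s : ℝ => φ ε s x) (fun s hs => hK ε hε0 s hs x hx) (hK ε hε0 t ht x hx)
          rw [mfderivWithin_const] at h3
          exact congrArg (fun A : ℝ →L[ℝ] E n => A 1) h3
        have h4 : ∀ y, y = x → ∀ ξ : E n, ξ = 0 → IsSgradAt Ω (Φ ε t) y ξ → ∀ u,
            (mfderiv 𝓜 𝓘₁ (Φ ε t) x u : ℝ) = 0 := by
          rintro y rfl ξ rfl hs u
          have h5 := hs u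
          have h6 : Ω.form y ![(0 : E n), u] = 0 :=
            (Ω.form y).toAlternatingMap.map_coord_zero (m := ![(0 : E n), u]) 0 rfl
          have h7 := h6.symm.trans h5
          exact neg_eq_zero.1 h7.symm
        exact h4 _ (hK ε hε0 t ht x hx) _ h2 h1 u) (φ ε t x)
    have hfix : φ ε t x = x := hK ε hε0 t ht x fun hc => hx (interior_subset (hK' (Or.inl hc)))
    obtain ⟨x'', rfl⟩ : ∃ y, φ ε t y = x' := (φ ε t).surjective x'
    by_cases hx'' : x'' ∈ K'
    · rw [relHam, ← hxx']
      exact hbound' x'' hx''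
    · exfalso
      have : φ ε t x'' = x'' := hK ε hε0 t ht x'' fun hc => hx'' (interior_subset (hK' (Or.inl hc)))
      rw [this] at hx'
      exact hx'' hx'
  have hle : ∀ x, Φ ε t x ≤ locHam φ Φ p (ε, t, m (ε, t)) + Φ ε t (φ ε t p) := by
    intro x
    obtain ⟨x', rfl⟩ : ∃ y, φ ε t y = x := (φ ε t).surjective x
    have := hbound x'
    rw [relHam] at this
    linarith
  refine le_antisymm (ciSup_le hle) ?_
  have h1 := le_ciSup (f := Φ ε t) ⟨_, forall_mem_range.2 hle⟩ (φ ε t (e.symm (m (ε, t))))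
  refine le_trans (le_of_eq ?_) h1
  simp only [locHam, relHam, sub_add_cancel, he]

/-- The second variation formula, and the local minimality under coercivity. -/
theorem second_variation [SecondCountableTopology M] [MeasurableSpace M] [BorelSpace M] (hb : ∀ t ∈
    𝕀, φ 0 t p = p) (hfin : ∀ ε ∈ Ioo (-ε₀) ε₀, ∀ x, φ ε 1 x = φ 0 1 x) (hK : ∃ K : Set M, IsCompact
    K ∧ ∀ ε ∈ Ioo (-ε₀) ε₀, ∀ t ∈ 𝕀, ∀ x ∉ K, φ ε t x = x) (hn : ∀ ε ∈ Ioo (-ε₀) ε₀, IsNormalized Ω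
    (Φ ε)) (hmax : ∀ t ∈ 𝕀, IsUniqueMax (Φ 0 t) p) (hnd : ∀ t ∈ 𝕀, HessianNondegenerate (n := n) (Φ
    0 t) p) : IsLoopField (varField φ p) ∧ (𝒞 (linFlow (φ 0) p) 𝕀 ∧ ∀ t ∈ 𝕀, (linFlow (φ 0) p
    t).IsInvertible ∧ (derivWithin (linFlow (φ 0) p) 𝕀 t).IsInvertible ∧ (∀ u w, pairing Ω p
    (linFlow (φ 0) p t u) (linFlow (φ 0) p t w) = pairing Ω p u w) ∧ ∀ u, u ≠ 0 → 0 < pairing Ω p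
    (derivWithin (linFlow (φ 0) p) 𝕀 t u) (linFlow (φ 0) p t u)) ∧ ContDiffAt ℝ ∞ (lengthPlus Φ) 0 ∧
    deriv (lengthPlus Φ) 0 = 0 ∧ HasDerivAt (deriv (lengthPlus Φ)) (Q Ω (φ 0) p (varField φ p)) 0 ∧
    ((∃ c > 0, ∀ v, IsLoopField v → c * ∫ t in 0..1, ‖derivWithin v 𝕀 t‖ ^ 2 ≤ Q Ω (φ 0) p v) → ∀ᶠ ε
    in 𝓝 (0 : ℝ), lengthPlus Φ 0 ≤ lengthPlus Φ ε) := by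
  obtain ⟨δ, ρ, hδ, hδ', hρ, hρ', hs⟩ := h.exists_locDom hb
  have L := h.localFamily hδ hδ' hρ hρ' hs hb hfin hmax hnd
  obtain ⟨δ₁, ρ₂, m, hδ₁, hδ₁', hρ₂, hρ₂', hm, hmm, hm0⟩ := L.exists_maximizer
  have hsup := h.eventually_iSup_ham_eq hb hK hmax hδ₁ hρ₂
    ((Metric.closedBall_subset_ball hρ₂').trans hρ') fun q hq => (hmm q hq).2.2
  obtain ⟨r, hr, hrs⟩ := Metric.eventually_nhds_iff_ball.1 hsup
  set δ₂ := min r δ₁ with hδ₂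
  have hδ₂0 : 0 < δ₂ := lt_min hr hδ₁
  have hsub : Ioo (-δ₂) δ₂ ×ˢ 𝕀 ⊆ Ioo (-δ₁) δ₁ ×ˢ 𝕀 :=
    prod_mono (Ioo_subset_Ioo (neg_le_neg (min_le_right _ _)) (min_le_right _ _)) subset_rfl
  have hδ₂δ : δ₂ ≤ δ := (min_le_right _ _).trans hδ₁'
  have hI : ∀ ε ∈ Ioo (-δ) δ, ε ∈ Ioo (-ε₀) ε₀ := fun ε hε =>
    ⟨by linarith [hε.1], by linarith [hε.2]⟩
  have hmS := hm.mono hsub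
  have hmb := fun q hq => (hmm q (hsub hq)).1
  have hmc := fun q hq => (hmm q (hsub hq)).2.1
  have hl : ∀ ε ∈ Ioo (-δ₂) δ₂, lengthPlus Φ ε = (∫ t in 0..1, locHam φ Φ p (ε, t, m (ε, t))) + ∫ t
      in 0..1, Φ ε t (φ ε t p) := by
    intro ε hε
    have hεδ : ε ∈ Ioo (-δ) δ := ⟨by linarith [hε.1], by linarith [hε.2]⟩
    rw [lengthPlus, ← intervalIntegral.integral_add]
    · refine integral_congr_unit fun t ht => ?_
      refine hrs ε ?_ t ht
      rw [mem_ball, Real.dist_eq, sub_zero]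
      exact (abs_lt.2 hε).trans_le (min_le_left _ _)
    · exact intervalIntegrable_unit <| (L.contDiffOn_max hδ₂δ hρ₂' hmS hmb).continuousOn.comp
        (f := fun t : ℝ => ((ε, t) : ℝ × ℝ)) (by fun_prop) fun t ht => ⟨hε, ht⟩
    · apply intervalIntegrable_unit
      have hφ : ContinuousOn (fun t : ℝ => φ ε t p) 𝕀 := h.smooth.continuousOn.comp (f := fun t : ℝ
        => (ε, t, p)) (by fun_prop) fun t ht => ⟨hI ε hεδ, ht, mem_univ _⟩
      exact (h.ham ε (hI ε hεδ)).continuousOn.comp (f := fun t : ℝ => (t, φ ε t p))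
        (continuousOn_id.prodMk hφ) fun t ht => ⟨ht, mem_univ _⟩
  have hhb : ∀ ε ∈ Ioo (-δ) δ, HasDerivAt (fun ε => ∫ t in 0..1, Φ ε t (φ ε t p))
      (-∫ t in 0..1, L.area ε t) ε := by
    intro ε hε
    refine (h.hasDerivAt_integral_ham hfin hK hn p (hI ε hε)).congr_deriv ?_
    refine congrArg Neg.neg (integral_congr_unit fun t ht => ?_)
    have hq := L.mem_center hε ht
    have h1 := h.form_dirT_dirE (x₀ := p) (ε := ε) (t := t)
      (y := 𝓔 p p) ⟨hI ε hε, ht, mem_extChartAt_target (I := 𝓜) p⟩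
    rw [extChartAt_to_inv, h.famForm_eq_locForm hδ' hρ' hs hq] at h1
    exact h1.symm
  have hlin : EqOn (linFlow (φ 0) p) (locLin δ ρ (𝓔 p p) (locMap φ p))
    𝕀 := fun t ht => (locLin_eq_linFlow L ht (hb t ht)).symm
  have hvar : EqOn (varField φ p) (locVar δ ρ (𝓔 p p) (locMap φ p))
    𝕀 := fun t ht => (h.locVar_eq_varField L ht (hb t ht)).symm
  have hQ := fun v => quadForm_eq_Q (Ω := Ω) L hb v
  have hQv : quadForm (locForm Ω p (𝓔 p p)) (locLin δ ρ (𝓔 p p) (locMap φ p)) (locVar δ ρ (𝓔 p p)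
      (locMap φ p)) = Q Ω (φ 0) p (varField φ p) := by
    rw [← hQ, quadForm, quadForm]
    refine congrArg Neg.neg (integral_congr_unit fun t ht => ?_)
    simp only [derivWithin_congr hvar (hvar ht), hvar ht]
  obtain ⟨hs1, hs2, hs3⟩ := L.second_variation hδ₂0 hδ₂δ hρ₂' hmS hmb hmc hm0 hhb hl
  refine ⟨⟨L.contDiffOn_locVar.congr hvar, (hvar (by simp)).trans L.locVar_zero, (hvar (by
    simp)).trans L.locVar_one⟩, ⟨L.contDiffOn_locLin.congr hlin, fun t ht => ?_⟩, hs1, hs2, ?_, ?_⟩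
  · rw [derivWithin_congr hlin (hlin ht), hlin ht]
    refine ⟨L.isInvertible_locLin ht, L.isInvertible_derivWithin_locLin ht, fun u w => ?_,
      fun u hu => ?_⟩
    · have h1 := h.form_dirX (hδ' |> fun _ => ⟨hI 0 L.zero_mem, ht, mem_extChartAt_target (I := 𝓜)
        p⟩ : ((0 : ℝ), t, 𝓔 p p) ∈ famDom n ε₀ p) u w
      rw [h.famForm_eq_locForm hδ' hρ' hs (L.mem_base ht), L.base t ht] at h1
      rw [pairing_eq_chartForm, pairing_eq_chartForm]
      exact h1
    · have h1 := L.ham_second_neg ht hu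
      rw [L.ham_second_XX ht] at h1
      rw [pairing_eq_chartForm]
      exact neg_lt_zero.1 h1
  · rwa [hQv] at hs3
  · rintro ⟨c, hc, hcQ⟩
    have h1 := L.eventually_le_of_coercive hc (fun v hv h0 h1 => by
      rw [hQ]; exact hcQ v ⟨hv, h0, h1⟩) hhb hδ₂0 hδ₂δ hρ₂' hρ₂ hmS hmb
      fun q hq => (hmm q (hsub hq)).2.2
    have h0 : (0 : ℝ) ∈ Ioo (-δ₂) δ₂ := ⟨by linarith, hδ₂0⟩
    filter_upwards [h1, isOpen_Ioo.mem_nhds h0] with ε hε hε2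
    rw [hl ε hε2, hl 0 h0]
    refine le_trans (le_of_eq ?_) hε
    rw [add_eq_right, intervalIntegral.integral_congr (g := fun _ => (0 : ℝ))]
    · simp
    · intro t ht
      rw [uIcc_unit] at ht
      simp only [hm0 t ht]
      exact L.ham_center 0 L.zero_mem t ht

end IsFamily

section

variable [MeasurableSpace M]

/-- A nondegenerate maximum point of all `F t`, fixed by the flow. -/
structure IsFixedMax (f : ℝ → Diffeo n M) (F : ℝ → M → ℝ) (p : M) : Prop where
  max : ∀ t ∈ 𝕀, IsUniqueMax (F t) p
  nondegenerate : ∀ t ∈ 𝕀, HessianNondegenerate (n := n) (F t) p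
  fixed : ∀ t ∈ 𝕀, f t p = p

theorem isFamily_of_isVariation (hf : IsHamiltonianFlow Ω f F) (hv : IsVariation Ω f ε₀ φ) (hΦ :
  IsHamiltonianOfVariation Ω ε₀ φ Φ) : IsFamily Ω ε₀ φ Φ := ⟨hv.pos, hv.smooth, fun ε hε => (hΦ ε
  hε).1.smooth, fun ε hε => (hΦ ε hε).2, fun ε hε x => (hv.start ε hε x).trans (hf.zero x)⟩

/-- The constant variation. -/
theorem IsHamiltonianFlow.isVariation (hf : IsHamiltonianFlow Ω f F) :
    IsVariation Ω f 1 (fun _ => f) ∧ IsHamiltonianOfVariation Ω 1 (fun _ => f) (fun _ => F) := by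
  obtain ⟨K, hK, hKf⟩ := hf.path.compact_support
  exact ⟨⟨one_pos, hf.path.smooth.comp (f := fun q : ℝ × ℝ × M => q.2) contMDiffOn_snd
    fun q hq => hq.2, ⟨K, hK, fun _ _ => hKf⟩, fun _ _ t ht => ⟨f, F, hf, t, ht, rfl⟩,
    fun _ _ _ => rfl, fun _ _ _ => rfl, fun _ _ _ => rfl⟩, fun _ _ => ⟨hf.normalized, hf.generates⟩⟩

theorem isSgradAt_congr {H H' : M → ℝ} {x x' : M} {u v : E n} (hx : x = x') (huv : u = v)
    (h : IsSgradAt Ω H x u) (h' : IsSgradAt Ω H' x' v) (w : E n) :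
    (mfderiv 𝓜 𝓘₁ H x w : ℝ) = (mfderiv 𝓜 𝓘₁ H' x w : ℝ) := by
  subst hx huv
  exact neg_injective ((h w).symm.trans (h' w))

variable [IsManifold (𝓡 (2 * n)) ∞ M] [ConnectedSpace M]

/-- The Hamiltonians of a path are determined up to constants. -/
theorem exists_ham_eq_add (hf : IsHamiltonianFlow Ω f F) (hv : IsVariation Ω f ε₀ φ) (hΦ :
    IsHamiltonianOfVariation Ω ε₀ φ Φ) (ht : t ∈ 𝕀) : ∃ c : ℝ, Φ 0 t = fun x => F t x + c := by
  have h0 : (0 : ℝ) ∈ Ioo (-ε₀) ε₀ := ⟨by linarith [hv.pos], hv.pos⟩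
  have hs : MDifferentiable 𝓜 𝓘₁ (Φ 0 t) :=
    ((isFamily_of_isVariation hf hv hΦ).contMDiff_ham h0 ht).mdifferentiable (by simp)
  have hc := hf.isVariation
  have hs' : MDifferentiable 𝓜 𝓘₁ (F t) := ((isFamily_of_isVariation hf hc.1 hc.2).contMDiff_ham (ε
    := 0) (by simp) ht).mdifferentiable (by simp)
  obtain ⟨x₀⟩ := (inferInstance : Nonempty M)
  refine ⟨Φ 0 t x₀ - F t x₀, funext fun x => ?_⟩
  have h1 := eq_of_mfderiv_eq_zero (g := Φ 0 t - F t) (fun x => (hs x).sub (hs' x)) (fun x u => by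
    rw [mfderiv_sub (hs x) (hs' x)]
    obtain ⟨y, rfl⟩ : ∃ y, φ 0 t y = x := (φ 0 t).surjective x
    have h3 := isSgradAt_congr (hv.base t ht y) (congrArg (fun A : ℝ →L[ℝ] E n => A 1)
      (mfderivWithin_congr (I := 𝓘₁) (I' := 𝓜) (fun s hs => hv.base s hs y) (hv.base t ht y))) ((hΦ
      0 h0).2 t ht y) (hf.generates t ht y) u
    exact sub_eq_zero.2 h3) x x₀
  simp only [Pi.sub_apply] at h1
  linarith

theorem IsFixedMax.ham (hp : IsFixedMax f F p) (hf : IsHamiltonianFlow Ω f F) (hv : IsVariation Ω f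
    ε₀ φ) (hΦ : IsHamiltonianOfVariation Ω ε₀ φ Φ) : IsFixedMax (φ 0) (Φ 0) p := by
  refine ⟨fun t ht => ?_, fun t ht => ?_, fun t ht => (hv.base t ht p).trans (hp.fixed t ht)⟩ <;>
  obtain ⟨c, hc⟩ := exists_ham_eq_add hf hv hΦ ht
  · intro y hy
    rw [hc]
    exact add_lt_add_left (hp.max t ht y hy) c
  · intro u hu
    refine hp.nondegenerate t ht u fun v => ?_
    rw [← hu v, hc]
    have h1 : fderiv ℝ ((fun x => F t x + c) ∘ (𝓔 p).symm) = fderiv ℝ (F t ∘ (𝓔 p).symm) := by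
      funext y
      exact fderiv_add_const c
    rw [h1]

theorem linFlow_eqOn (hv : IsVariation Ω f ε₀ φ) (p : M) :
    EqOn (linFlow (φ 0) p) (linFlow f p) 𝕀 := by
  intro t ht
  have h1 : (φ 0 t : M → M) = f t := funext (hv.base t ht)
  simp only [linFlow]
  congr 1

theorem linOp_eq (hv : IsVariation Ω f ε₀ φ) (p : M) (ht : t ∈ 𝕀) :
    linOp (φ 0) p t = linOp f p t := by
  rw [linOp, linOp, derivWithin_congr (linFlow_eqOn hv p) (linFlow_eqOn hv p ht),
    linFlow_eqOn hv p ht]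

theorem Q_eq_of_isVariation (hv : IsVariation Ω f ε₀ φ) (p : M) (v : ℝ → E n) :
    Q Ω (φ 0) p v = Q Ω f p v := by
  refine congrArg Neg.neg (integral_congr_unit fun t ht => ?_)
  simp only [linOp_eq hv p ht]

variable [T2Space M] [SecondCountableTopology M] [BorelSpace M]

/-- The second variation at the maximum. -/
theorem IsFixedMax.second_variation (hp : IsFixedMax f F p) (hf : IsHamiltonianFlow Ω f F) (hv :
    IsVariation Ω f ε₀ φ) (hΦ : IsHamiltonianOfVariation Ω ε₀ φ Φ) : IsLoopField (varField φ p) ∧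
    ContDiffAt ℝ ∞ (lengthPlus Φ) 0 ∧ deriv (lengthPlus Φ) 0 = 0 ∧ HasDerivAt (deriv (lengthPlus Φ))
    (Q Ω f p (varField φ p)) 0 ∧ ((∃ c > 0, ∀ v, IsLoopField v → c * ∫ t in 0..1, ‖derivWithin v 𝕀
    t‖ ^ 2 ≤ Q Ω f p v) → ∀ᶠ ε in 𝓝 (0 : ℝ), lengthPlus Φ 0 ≤ lengthPlus Φ ε) := by
  have h0 : (0 : ℝ) ∈ Ioo (-ε₀) ε₀ := ⟨by linarith [hv.pos], hv.pos⟩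
  have hp' := hp.ham hf hv hΦ
  have := (isFamily_of_isVariation hf hv hΦ).second_variation hp'.fixed (fun ε hε x =>
    (hv.finish ε hε x).trans (hv.finish 0 h0 x).symm) hv.compact_support (fun ε hε => (hΦ ε hε).1)
    hp'.max hp'.nondegenerate
  simp only [Q_eq_of_isVariation hv] at this
  exact ⟨this.1, this.2.2⟩

/-- The linearized flow at the maximum. -/
theorem IsFixedMax.linFlow_spec (hp : IsFixedMax f F p) (hf : IsHamiltonianFlow Ω f F) : 𝒞 (linFlow
    f p) 𝕀 ∧ ∀ t ∈ 𝕀, (linFlow f p t).IsInvertible ∧ (derivWithin (linFlow f p) 𝕀 t).IsInvertible ∧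
    (∀ u w, pairing Ω p (linFlow f p t u) (linFlow f p t w) = pairing Ω p u w) ∧ ∀ u, u ≠ 0 → 0 <
    pairing Ω p (derivWithin (linFlow f p) 𝕀 t u) (linFlow f p t u) := by
  have hc := hf.isVariation
  exact ((isFamily_of_isVariation hf hc.1 hc.2).second_variation hp.fixed (fun _ _ _ => rfl)
    hc.1.compact_support (fun ε hε => (hc.2 ε hε).1) hp.max hp.nondegenerate).2.1

end

section Neg

theorem chartForm_neg (β : ∀ x : M, TangentSpace 𝓜 x [⋀^Fin 2]→L[ℝ] ℝ) (x₀ : M) :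
    chartForm (fun x => -β x) x₀ = fun y => -chartForm β x₀ y := rfl

/-- The opposite symplectic form. -/
def SymplecticForm.neg (Ω : SymplecticForm n M) : SymplecticForm n M where
  form x := -Ω.form x
  smooth x₀ := (Ω.smooth x₀).neg
  closed x₀ y hy := by
    have h1 : extDeriv (fun y => -chartForm Ω.form x₀ y) y = -extDeriv (chartForm Ω.form x₀) y := by
      simp only [extDeriv]
      rw [show fderiv ℝ (fun y => -chartForm Ω.form x₀ y) y = -fderiv ℝ (chartForm Ω.form x₀) y from
        fderiv_neg]
      exact map_neg (ContinuousAlternatingMap.alternatizeUncurryFinCLM ℝ (E n) ℝ) _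
    rw [chartForm_neg, h1, Ω.closed x₀ y hy, neg_zero]
  nondegenerate x u h := Ω.nondegenerate x u fun v => neg_eq_zero.1 (h v)

theorem SymplecticForm.neg_neg (Ω : SymplecticForm n M) : Ω.neg.neg = Ω := by
  cases Ω
  simp [SymplecticForm.neg]

theorem liouville_neg [MeasurableSpace M] (Ω : SymplecticForm n M) :
    liouville Ω.neg = liouville Ω := by
  have h1 : ∀ x₀ y, liouvilleDensity Ω.neg x₀ y = liouvilleDensity Ω x₀ y := by
    intro x₀ y
    rw [liouvilleDensity, liouvilleDensity]
    refine congrArg Real.sqrt ?_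
    have h2 : (Matrix.of fun i j : Fin (2 * n) => chartForm Ω.neg.form x₀ y ![EuclideanSpace.single
        i (1 : ℝ), EuclideanSpace.single j (1 : ℝ)]) = -Matrix.of fun i j : Fin (2 * n) => chartForm
        Ω.form x₀ y ![EuclideanSpace.single i (1 : ℝ), EuclideanSpace.single j (1 : ℝ)] := by
      ext i j; rfl
    rw [h2, Matrix.det_neg, Fintype.card_fin, pow_mul]
    simp
  simp only [liouville, chartLiouville, h1]

theorem IsSgradAt.neg {H : M → ℝ} {x : M} {ξ : E n} (h : IsSgradAt Ω H x ξ) :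
    IsSgradAt Ω.neg (fun x => -H x) x ξ := by
  intro η
  have h1 := h η
  have h2 : (mfderiv 𝓜 𝓘₁ (fun x => -H x) x η : ℝ) = -(mfderiv 𝓜 𝓘₁ H x η : ℝ) := congrArg (fun A :
      E n →L[ℝ] ℝ => A η) (mfderiv_neg (f := H) (x := x))
  rw [h2]
  exact congrArg Neg.neg h1

variable [MeasurableSpace M]

theorem IsNormalized.neg (h : IsNormalized Ω F) : IsNormalized Ω.neg (fun t x => -F t x) where
  smooth := h.smooth.neg
  mean_zero hM t ht := by rw [liouville_neg, integral_neg, h.mean_zero hM t ht, neg_zero]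
  compact_support hM := by
    obtain ⟨K, hK, hF⟩ := h.compact_support hM
    exact ⟨K, hK, fun t ht x hx => by rw [hF t ht x hx, neg_zero]⟩

theorem IsHamiltonianFlow.neg (h : IsHamiltonianFlow Ω f F) : IsHamiltonianFlow Ω.neg f (fun t x =>
  -F t x) := ⟨h.path, h.zero, h.normalized.neg, fun t ht x => (h.generates t ht x).neg⟩

theorem IsVariation.neg (h : IsVariation Ω f ε₀ φ) : IsVariation Ω.neg f ε₀ φ :=
  { h with
    mem_ham := fun ε hε t ht => by
      obtain ⟨g, G, hg, a⟩ := h.mem_ham ε hε t ht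
      exact ⟨g, _, hg.neg, a⟩ }

theorem IsHamiltonianOfVariation.neg (h : IsHamiltonianOfVariation Ω ε₀ φ Φ) :
  IsHamiltonianOfVariation Ω.neg ε₀ φ (fun ε t x => -Φ ε t x) := fun ε hε => ⟨(h ε hε).1.neg, fun t
  ht x => ((h ε hε).2 t ht x).neg⟩

omit [MeasurableSpace M] in
theorem iSup_neg_eq (g : M → ℝ) : ⨆ x, -g x = -⨅ x, g x := by
  rw [iInf, Real.sInf_def, neg_neg, iSup]
  refine congrArg sSup ?_
  rw [← image_neg_eq_neg, ← range_comp]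
  rfl

omit [MeasurableSpace M] in
theorem lengthPlus_neg (Φ : ℝ → ℝ → M → ℝ) (ε : ℝ) :
    lengthPlus (fun ε t x => -Φ ε t x) ε = -lengthMinus Φ ε := by
  rw [lengthPlus, lengthMinus, ← intervalIntegral.integral_neg]
  simp only [iSup_neg_eq]

omit [MeasurableSpace M] in
theorem length_neg (Φ : ℝ → ℝ → M → ℝ) : length (fun ε t x => -Φ ε t x) = length Φ := by
  funext ε
  refine integral_congr_unit fun t _ => ?_
  have h1 : ⨆ x, -Φ ε t x = -⨅ x, Φ ε t x := iSup_neg_eq _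
  have h2 : ⨅ x, -Φ ε t x = -⨆ x, Φ ε t x := by
    rw [eq_neg_iff_add_eq_zero, add_comm, ← eq_neg_iff_add_eq_zero, ← iSup_neg_eq]
    simp only [neg_neg]
  simp only [osc]
  rw [h1, h2]
  ring

theorem IsStable.neg (h : IsStable Ω f) : IsStable Ω.neg f := by
  intro ε₀ φ Φ hv hΦ
  have h1 := hv.neg
  have h2 := hΦ.neg
  rw [SymplecticForm.neg_neg] at h1 h2
  have := h ε₀ φ _ h1 h2
  rwa [length_neg] at this

omit [MeasurableSpace M] in
theorem Q_neg (Ω : SymplecticForm n M) (f : ℝ → Diffeo n M) (x : M) (v : ℝ → E n) :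
    Q Ω.neg f x v = -Q Ω f x v := by
  have h1 : ∀ u w, pairing Ω.neg x u w = -pairing Ω x u w := fun _ _ => rfl
  rw [Q, Q, ← intervalIntegral.integral_neg, ← intervalIntegral.integral_neg,
    ← intervalIntegral.integral_neg]
  refine integral_congr_unit fun t _ => ?_
  simp only [h1]
  ring

omit [MeasurableSpace M] in
theorem HessianNondegenerate.neg {H : M → ℝ} {x : M} (h : HessianNondegenerate (n := n) H x) :
    HessianNondegenerate (n := n) (fun x => -H x) x := by
  intro u hu
  refine h u fun v => ?_
  have h1 : fderiv ℝ ((fun x => -H x) ∘ (𝓔 x).symm) = fun y => -fderiv ℝ (H ∘ (𝓔 x).symm) y := by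
    funext y
    exact fderiv_neg
  have h2 := hu v
  rw [h1, show fderiv ℝ (fun y => -fderiv ℝ (H ∘ (𝓔 x).symm) y) _ = -_ from fderiv_neg] at h2
  exact neg_eq_zero.1 h2

end Neg

section Calculus

variable {F : Type} [NormedAddCommGroup F] [NormedSpace ℝ F]

theorem hasDerivWithinAt_unit {g : ℝ → F} (hg : 𝒞 g 𝕀) (ht : t ∈ 𝕀) : HasDerivWithinAt g
  (derivWithin g 𝕀 t) 𝕀 t := (hg.differentiableOn (by simp) t ht).hasDerivWithinAt

theorem integral_of_hasDerivWithinAt_unit [CompleteSpace F] {g g' : ℝ → F} (hg : ∀ t ∈ 𝕀,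
    HasDerivWithinAt g (g' t) 𝕀 t) (hc : ContinuousOn g' 𝕀) : ∫ t in 0..1, g' t = g 1 - g 0 := by
  refine intervalIntegral.integral_eq_sub_of_hasDerivAt_of_le zero_le_one (fun t ht => (hg t
    ht).continuousWithinAt) (fun t ht => (hg t (Ioo_subset_Icc_self ht)).hasDerivAt (Icc_mem_nhds
    ht.1 ht.2)) ?_
  exact intervalIntegrable_unit ‹_›

/-- Hadamard's lemma on the unit interval. -/
theorem exists_eq_add_smul [CompleteSpace F] {g : ℝ → F} (hg : 𝒞 g 𝕀) : ∃ y : ℝ → F, 𝒞 y 𝕀 ∧ y 0 =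
    derivWithin g 𝕀 0 ∧ ∀ t ∈ 𝕀, g t = g 0 + t • y t := by
  have hmul : ∀ t ∈ 𝕀, ∀ r ∈ 𝕀, t * r ∈ 𝕀 := fun t ht r hr =>
    ⟨mul_nonneg ht.1 hr.1, mul_le_one₀ ht.2 hr.1 hr.2⟩
  have hg' := contDiffOn_derivWithin_unit hg
  refine ⟨fun t => ∫ r in 0..1, derivWithin g 𝕀 (t * r),
    contDiffOn_integral_unit (convex_Icc 0 1) uniqueDiffOn_unit
      (G := fun q : ℝ × ℝ => derivWithin g 𝕀 (q.1 * q.2)) (hg'.comp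
      (contDiff_fst.mul contDiff_snd).contDiffOn fun q hq => hmul _ hq.1 _ hq.2), by simp,
    fun t ht => ?_⟩
  have h1 : ∀ r ∈ 𝕀, HasDerivWithinAt (fun r => g (t * r)) (t • derivWithin g 𝕀 (t * r)) 𝕀 r := by
    intro r hr
    have h2 : HasDerivWithinAt (fun r : ℝ => t * r) t 𝕀 r := by
      simpa using ((hasDerivAt_id r).const_mul t).hasDerivWithinAt
    exact HasDerivWithinAt.scomp r (hasDerivWithinAt_unit hg (hmul t ht r hr)) h2
      fun r hr => hmul t ht r hr
  have h3 := integral_of_hasDerivWithinAt_unit h1 (continuousOn_const.smul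
    (hg'.continuousOn.comp (by fun_prop) fun r hr => hmul t ht r hr))
  rw [intervalIntegral.integral_smul] at h3
  rw [h3, mul_one, mul_zero, add_sub_cancel]

end Calculus

/-- Linear symplectic flows generated by positive definite quadratic Hamiltonians. -/
structure IsPositiveFlow (β : 𝓑) (S : ℝ → 𝓛) : Prop where
  skew : ∀ u w, β u w = -β w u
  smooth : 𝒞 S 𝕀
  zero : ∀ u, S 0 u = u
  inv : ∀ t ∈ 𝕀, (S t).IsInvertible
  inv' : ∀ t ∈ 𝕀, (derivWithin S 𝕀 t).IsInvertible
  symp : ∀ t ∈ 𝕀, ∀ u w, β (S t u) (S t w) = β u w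
  pos : ∀ t ∈ 𝕀, ∀ u, u ≠ 0 → 0 < β (derivWithin S 𝕀 t u) (S t u)

/-- The quadratic form on velocities. -/
def velForm (β : 𝓑) (S : ℝ → 𝓛) (t : ℝ) :
    𝓑 := -β.comp (flowOp S t).inverse

theorem quadForm_integrand {β P : 𝓑} {S D : 𝓛} {y a b w x : E n} (hβ : ∀ u w, β u w = -β w u) (hP :
    ∀ u w, P (D u) w = -β (S u) w) (hP' : ∀ u w, P u w = P w u) (hS : ∀ u w, β (S u) (S w) = β u w)
    (hy : y = b - S b) : P (-D a + y + x) (-D a + y + x) - β (-D a + y + x) (a - S a + w) = P y y +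
    (β b (a - S a) + β a (-D a + y)) + (β (D a + S b + b) w + β (S a + a) x) - 2 * β b w + 2 * P y x
    + (P x x - β x w) := by
  have h1 := hP' y (D a)
  have h2 := hP' x (D a)
  have h3 := hP' x y
  subst hy
  simp only [map_add, map_sub, map_neg, add_apply, sub_apply, neg_apply, hP] at h1 h2 h3 ⊢
  linarith [hβ b (S a), hβ (D a) a, hβ (D a) (S a), hβ x a, hβ x (S a), hβ (S b) w, hβ w b, hβ b a,
    hβ (S b) a, hS a b, hS b a, hβ (S a) (D a)]

namespace IsPositiveFlow

variable {β : E n →L[ℝ] E n →L[ℝ] ℝ} {S : ℝ → E n →L[ℝ] E n} (h : IsPositiveFlow β S)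
include h

theorem velForm_deriv (ht : t ∈ 𝕀) (u w : E n) :
    velForm β S t (derivWithin S 𝕀 t u) w = -β (S t u) w := by
  simp only [velForm, neg_apply, ContinuousLinearMap.comp_apply]
  rw [flowOp_inverse_apply (h.inv t ht) (h.inv' t ht)]

theorem exists_deriv_eq (ht : t ∈ 𝕀) (x : E n) : ∃ u, derivWithin S 𝕀 t u = x := by
  obtain ⟨L, hL⟩ := h.inv' t ht
  exact ⟨L.symm x, by rw [← hL]; simp⟩

theorem velForm_symm (ht : t ∈ 𝕀) (x y : E n) : velForm β S t x y = velForm β S t y x := by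
  obtain ⟨u, rfl⟩ := h.exists_deriv_eq ht x
  obtain ⟨w, rfl⟩ := h.exists_deriv_eq ht y
  rw [h.velForm_deriv ht, h.velForm_deriv ht]
  have hS := hasDerivWithinAt_unit h.smooth ht
  have h1 := ((hasDerivWithinAt_const t 𝕀 β).clm_apply (hS.clm_apply (hasDerivWithinAt_const t _
    u))).clm_apply (hS.clm_apply (hasDerivWithinAt_const t _ w))
  have h2 := h1.congr (fun s hs => (h.symp s hs u w).symm) (h.symp t ht u w).symm
  have h3 := (uniqueDiffOn_unit t ht).eq_deriv _ h2 (hasDerivWithinAt_const t 𝕀 (β u w))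
  simp only [zero_apply, map_zero, add_zero, zero_add] at h3
  rw [h.skew (S t w)]
  linarith

theorem velForm_pos (ht : t ∈ 𝕀) {x : E n} (hx : x ≠ 0) : 0 < velForm β S t x x := by
  obtain ⟨u, rfl⟩ := h.exists_deriv_eq ht x
  rw [h.velForm_deriv ht, ← h.skew]
  exact h.pos t ht u fun hu => hx (by rw [hu, map_zero])

theorem contDiffOn_flowOp_inverse : 𝒞 (fun t => (flowOp S t).inverse) 𝕀 := by
  have h1 : 𝒞 (flowOp S) 𝕀 :=
    (contDiffOn_derivWithin_unit h.smooth).clm_comp (contDiffOn_inverse h.smooth h.inv)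
  exact contDiffOn_inverse h1 fun t ht => isInvertible_flowOp (h.inv t ht) (h.inv' t ht)

theorem contDiffOn_velForm : 𝒞 (velForm β S) 𝕀 :=
  (contDiffOn_const.clm_comp h.contDiffOn_flowOp_inverse).neg

theorem exists_le_velForm : ∃ c > 0, ∀ t ∈ 𝕀, ∀ x, c * ‖x‖ ^ 2 ≤ velForm β S t x x := by
  have hc : ContinuousOn (fun k : ℝ × E n => velForm β S k.1 k.2 k.2) (𝕀 ×ˢ sphere (0 : E n) 1) :=
    ((h.contDiffOn_velForm.continuousOn.comp continuousOn_fst fun k hk => hk.1).clm_apply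
    continuousOn_snd).clm_apply continuousOn_snd
  obtain ⟨c, hc0, hcb⟩ := (isCompact_Icc.prod (isCompact_sphere (0 : E n) 1)).exists_forall_le' hc
    (a := 0) fun k hk => h.velForm_pos hk.1 (ne_zero_of_mem_unit_sphere ⟨k.2, hk.2⟩)
  refine ⟨c, hc0, fun t ht x => ?_⟩
  by_cases hx : x = 0
  · simp [hx]
  have hx0 : ‖x‖ ≠ 0 := norm_ne_zero_iff.2 hx
  have h1 := hcb (t, ‖x‖⁻¹ • x) ⟨ht, by simp [norm_smul, hx0]⟩
  simp only [map_smul, smul_apply, smul_eq_mul] at h1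
  have h2 : velForm β S t x x = ‖x‖ ^ 2 * (‖x‖⁻¹ * (‖x‖⁻¹ * velForm β S t x x)) := by field_simp
  rw [h2, mul_comm]
  exact mul_le_mul_of_nonneg_left h1 (sq_nonneg _)

omit h in
theorem quadForm_eq (v : ℝ → E n) : quadForm β S v = ∫ t in 0..1, (velForm β S t (derivWithin v 𝕀 t)
    (derivWithin v 𝕀 t) - β (derivWithin v 𝕀 t) (v t)) := by
  rw [quadForm, ← intervalIntegral.integral_neg]
  refine integral_congr_unit fun t _ => ?_
  simp only [velForm, neg_apply, ContinuousLinearMap.comp_apply]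
  ring

theorem continuousOn_integrand {v : ℝ → E n} (hv : 𝒞 v 𝕀) :
    ContinuousOn (fun t => velForm β S t (derivWithin v 𝕀 t)
      (derivWithin v 𝕀 t) - β (derivWithin v 𝕀 t) (v t))
      𝕀 := by
  have h1 := (contDiffOn_derivWithin_unit hv).continuousOn
  exact ((h.contDiffOn_velForm.continuousOn.clm_apply h1).clm_apply h1).sub
    ((continuousOn_const.clm_apply h1).clm_apply hv.continuousOn)

theorem hasDerivWithinAt_sub {a : ℝ → E n} (ha : 𝒞 a 𝕀) (ht : t ∈ 𝕀) : HasDerivWithinAt (fun t => a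
    t - S t (a t)) (-derivWithin S 𝕀 t (a t) + (derivWithin a 𝕀 t - S t (derivWithin a 𝕀 t))) 𝕀 t :=
    by
  have h1 := hasDerivWithinAt_unit ha ht
  refine (h1.sub ((hasDerivWithinAt_unit h.smooth ht).clm_apply h1)).congr_deriv ?_
  abel

/-- Coercivity of the second variation in the absence of periodic orbits. -/
theorem coercive (hper : ∀ t ∈ Ioc (0 : ℝ) 1, ∀ u, S t u = u → u = 0) : ∃ c > 0, ∀ v, IsLoopField v
    → c * ∫ t in 0..1, ‖derivWithin v 𝕀 t‖ ^ 2 ≤ quadForm β S v := by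
  obtain ⟨W, hW, hW0, hSW⟩ := exists_eq_add_smul h.smooth
  have hS0 : S 0 = ContinuousLinearMap.id ℝ (E n) := ContinuousLinearMap.ext h.zero
  have hSu : ∀ t ∈ 𝕀, ∀ u, u - S t u = -(t • W t u) := by
    intro t ht u
    rw [hSW t ht, hS0]
    simp
  have hWi : ∀ t ∈ 𝕀, (W t).IsInvertible := by
    intro t ht
    rcases ht.1.eq_or_lt with rfl | h0
    · rw [hW0]; exact h.inv' 0 ht
    · refine isInvertible_of_injective fun u hu => hper t ⟨h0, ht.2⟩ u ?_
      have h1 := hSu t ht u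
      rw [hu, smul_zero, neg_zero] at h1
      exact (sub_eq_zero.1 h1).symm
  have hWs := contDiffOn_inverse hW hWi
  obtain ⟨c₀, hc₀, hP⟩ := h.exists_le_velForm
  obtain ⟨C₁, hC₁⟩ := isCompact_Icc.exists_bound_of_continuousOn hWs.continuousOn
  have hDs := contDiffOn_derivWithin_unit h.smooth
  obtain ⟨C₂, hC₂⟩ := isCompact_Icc.exists_bound_of_continuousOn hDs.continuousOn
  set l := c₀ / (4 * C₁ ^ 2 + 1) with hl
  have hl0 : 0 < l := by positivity
  have hlC : 2 * l * C₁ ^ 2 ≤ c₀ / 2 := by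
    rw [hl, mul_div_assoc', div_mul_eq_mul_div, div_le_div_iff₀ (by positivity) two_pos]
    nlinarith
  set c := Min.min (c₀ / 4) (l / (4 * (C₂ ^ 2 + 1))) with hc
  have hc0 : 0 < c := lt_min (by positivity) (by positivity)
  have hcc : 2 * c ≤ c₀ / 2 := by linarith [min_le_left (c₀ / 4) (l / (4 * (C₂ ^ 2 + 1)))]
  have hcC : 2 * c * C₂ ^ 2 ≤ l / 2 := by
    have h1 : c * (4 * (C₂ ^ 2 + 1)) ≤ l := (le_div_iff₀ (by positivity)).1 (min_le_right _ _)
    nlinarith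
  refine ⟨c, hc0, fun v hv => ?_⟩
  obtain ⟨y, hy, -, hvy⟩ := exists_eq_add_smul hv.1
  set a : ℝ → E n := fun t => -(W t).inverse (y t) with ha
  have has : 𝒞 a 𝕀 := (hWs.clm_apply hy).neg
  have hva : ∀ t ∈ 𝕀, v t = a t - S t (a t) := by
    intro t ht
    obtain ⟨L, hL⟩ := hWi t ht
    rw [hSu t ht, hvy t ht, hv.2.1]
    simp [ha, ← hL]
  have ha1 : a 1 = 0 := by
    have h1 : v 1 = v 0 + (1 : ℝ) • y 1 := hvy 1 (by simp)
    rw [hv.2.1, hv.2.2, one_smul, zero_add] at h1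
    simp [ha, ← h1]
  have has' := contDiffOn_derivWithin_unit has
  set b := derivWithin a 𝕀 with hb
  have hder : ∀ t ∈ 𝕀, derivWithin v 𝕀 t = -derivWithin S 𝕀 t (a t) + (b t - S t (b t)) := fun t ht
    => ((h.hasDerivWithinAt_sub has ht).congr (fun s hs => hva s hs) (hva t ht)).derivWithin
    (uniqueDiffOn_unit t ht)
  have hvs := contDiffOn_derivWithin_unit hv.1
  set g : ℝ → ℝ := fun t => l * (t * inner ℝ (a t) (a t)) - β (a t) (v t) with hg
  set g' : ℝ → ℝ := fun t => l * (inner ℝ (a t) (a t) + t * (inner ℝ (a t) (b t)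
    + inner ℝ (b t) (a t))) - (β (b t) (v t) + β (a t) (derivWithin v 𝕀 t)) with hg'
  have hgd : ∀ t ∈ 𝕀, HasDerivWithinAt g (g' t) 𝕀 t := by
    intro t ht
    have h1 := hasDerivWithinAt_unit has ht
    refine (((((hasDerivWithinAt_id t _).mul (h1.inner ℝ h1)).const_mul l).sub
      (((hasDerivWithinAt_const t _ β).clm_apply h1).clm_apply (hasDerivWithinAt_unit hv.1
      ht)))).congr_deriv ?_
    simp [hb, hg']
  have hgc : ContinuousOn g' 𝕀 := continuousOn_const (c := l) |>.mul ((has.continuousOn.inner (𝕜 :=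
    ℝ) has.continuousOn).add (continuousOn_id.mul ((has.continuousOn.inner (𝕜 := ℝ)
    has'.continuousOn).add (has'.continuousOn.inner (𝕜 := ℝ) has.continuousOn)))) |>.sub
    (((continuousOn_const (c := β)).clm_apply has'.continuousOn).clm_apply hv.1.continuousOn |>.add
    (((continuousOn_const (c := β)).clm_apply has.continuousOn).clm_apply hvs.continuousOn))
  have hint := integral_of_hasDerivWithinAt_unit hgd hgc
  have hg0 : g 1 - g 0 = 0 := by simp [hg, ha1, hv.2.1]
  have hii : ∀ {g : ℝ → ℝ}, ContinuousOn g 𝕀 → IntervalIntegrable g volume 0 1 := by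
    intro g hg
    exact intervalIntegrable_unit ‹_›
  have hQ : quadForm β S v = ∫ t in 0..1, ((velForm β S t (derivWithin v 𝕀 t)
      (derivWithin v 𝕀 t) - β (derivWithin v 𝕀 t) (v t)) + g' t) := by
    rw [intervalIntegral.integral_add (hii (h.continuousOn_integrand hv.1)) (hii hgc), hint, hg0,
      add_zero, quadForm_eq]
  rw [hQ, ← intervalIntegral.integral_const_mul]
  refine intervalIntegral.integral_mono_on zero_le_one (hii (continuousOn_const.mul
    (hvs.continuousOn.norm.pow 2))) (hii ((h.continuousOn_integrand hv.1).add hgc)) fun t ht => ?_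
  have hid := quadForm_integrand (y := b t - S t (b t)) (a := a t) (b := b t) (w := 0) (x := 0)
    h.skew (h.velForm_deriv ht) (h.velForm_symm ht) (h.symp t ht) rfl
  simp only [add_zero, map_zero, mul_zero, sub_zero, ← hder t ht, ← hva t ht] at hid
  simp only [hid, hg']
  set u := b t - S t (b t) with hu
  have h1 : ‖t • b t‖ ≤ C₁ * ‖u‖ := by
    have h2 : t • b t = -(W t).inverse u := by
      obtain ⟨L, hL⟩ := hWi t ht
      rw [hu, hSu t ht, ← hL]
      simp
    rw [h2, norm_neg]
    exact (ContinuousLinearMap.le_opNorm _ _).trans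
      (mul_le_mul_of_nonneg_right (hC₁ t ht) (norm_nonneg _))
  have h3 : ‖derivWithin v 𝕀 t‖ ≤ C₂ * ‖a t‖ + ‖u‖ := by
    rw [hder t ht]
    refine (norm_add_le _ _).trans (add_le_add_left ?_ _)
    rw [norm_neg]
    exact (ContinuousLinearMap.le_opNorm _ _).trans
      (mul_le_mul_of_nonneg_right (hC₂ t ht) (norm_nonneg _))
  have h4 : ‖derivWithin v 𝕀 t‖ ^ 2 ≤ 2 * C₂ ^ 2 * ‖a t‖ ^ 2 + 2 * ‖u‖ ^ 2 := by
    nlinarith [pow_le_pow_left₀ (norm_nonneg _) h3 2, sq_nonneg (C₂ * ‖a t‖ - ‖u‖)]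
  have h5 : |t * inner ℝ (a t) (b t)| ≤ ‖a t‖ * (C₁ * ‖u‖) := by
    rw [← real_inner_smul_right]
    exact (abs_real_inner_le_norm _ _).trans (mul_le_mul_of_nonneg_left h1 (norm_nonneg _))
  have h6 := (abs_le.1 h5).1
  have h7 := hP t ht u
  rw [real_inner_comm (a t) (b t), real_inner_self_eq_norm_sq]
  have h8 : 0 ≤ (‖a t‖ - 2 * C₁ * ‖u‖) ^ 2 := sq_nonneg _
  have h9 := mul_le_mul_of_nonneg_left h4 hc0.le
  have h10 := mul_le_mul_of_nonneg_right hlC (sq_nonneg ‖u‖)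
  have h11 := mul_le_mul_of_nonneg_right hcC (sq_nonneg ‖a t‖)
  have h12 := mul_le_mul_of_nonneg_right hcc (sq_nonneg ‖u‖)
  have h13 := mul_nonneg hl0.le h8
  have h14 := mul_le_mul_of_nonneg_left h6 hl0.le
  nlinarith

end IsPositiveFlow

/-- Smooth steps of width `δ`. -/
theorem exists_step : ∃ K : ℝ, ∀ T δ : ℝ, 0 < δ → ∃ χ χ' : ℝ → ℝ, ContDiff ℝ ∞ χ ∧
    (∀ t, HasDerivAt χ (χ' t) t) ∧ Continuous χ' ∧ (∀ t, χ' t ≤ 0) ∧ (∀ t, -χ' t * δ ≤ K) ∧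
    (∀ t ∉ Icc T (T + δ), χ' t = 0) ∧ (∀ t, t ≤ T → χ t = 1) ∧ ∀ t, T + δ ≤ t → χ t = 0 := by
  have hs : ContDiff ℝ ∞ Real.smoothTransition := Real.smoothTransition.contDiff
  have hsc : Continuous (deriv Real.smoothTransition) := hs.continuous_deriv (by simp)
  obtain ⟨K, hK⟩ := isCompact_Icc.exists_bound_of_continuousOn (s := 𝕀) hsc.continuousOn
  have hz : ∀ x ∉ 𝕀, deriv Real.smoothTransition x = 0 := by
    intro x hx
    rcases not_and_or.1 hx with h | h
    · have : Real.smoothTransition =ᶠ[𝓝 x] fun _ => 0 := by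
        filter_upwards [gt_mem_nhds (not_le.1 h)] with y hy
        exact Real.smoothTransition.zero_of_nonpos hy.le
      rw [this.deriv_eq, deriv_const]
    · have : Real.smoothTransition =ᶠ[𝓝 x] fun _ => 1 := by
        filter_upwards [lt_mem_nhds (not_le.1 h)] with y hy
        exact Real.smoothTransition.one_of_one_le hy.le
      rw [this.deriv_eq, deriv_const]
  have hK0 : 0 ≤ K := (norm_nonneg _).trans (hK 0 (by simp))
  refine ⟨K, fun T δ hδ => ⟨fun t => 1 - Real.smoothTransition ((t - T) / δ),
    fun t => -(deriv Real.smoothTransition ((t - T) / δ) / δ), ?_, fun t => ?_, ?_, fun t => ?_,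
    fun t => ?_, fun t ht => ?_, fun t ht => ?_, fun t ht => ?_⟩⟩
  · exact contDiff_const.sub (hs.comp ((contDiff_id.sub contDiff_const).div_const δ))
  · have h1 : HasDerivAt (fun t : ℝ => (t - T) / δ) (1 / δ) t :=
      ((hasDerivAt_id t).sub_const T).div_const δ
    have h2 := ((hs.differentiable (by simp)) ((t - T) / δ)).hasDerivAt.comp t h1
    refine (h2.const_sub 1).congr_deriv ?_
    ring
  · exact ((hsc.comp (by fun_prop)).div_const δ).neg
  · exact neg_nonpos.2 (div_nonneg Real.smoothTransition.monotone.deriv_nonneg hδ.le)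
  · rw [neg_neg, div_mul_cancel₀ _ hδ.ne']
    by_cases hx : (t - T) / δ ∈ 𝕀
    · exact (le_abs_self _).trans (hK _ hx)
    · rw [hz _ hx]; exact hK0
  · simp only
    rw [hz, zero_div, neg_zero]
    refine fun hx => ht ⟨?_, ?_⟩
    · have := mul_nonneg hx.1 hδ.le
      rw [div_mul_cancel₀ _ hδ.ne'] at this
      linarith
    · have := (div_le_one hδ).1 hx.2
      linarith
  · simp only
    rw [Real.smoothTransition.zero_of_nonpos, sub_zero]
    exact div_nonpos_of_nonpos_of_nonneg (by linarith) hδ.le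
  · simp only
    rw [Real.smoothTransition.one_of_one_le, sub_self]
    rw [le_div_iff₀ hδ]; linarith

namespace IsPositiveFlow

variable {β : E n →L[ℝ] E n →L[ℝ] ℝ} {S : ℝ → E n →L[ℝ] E n} (h : IsPositiveFlow β S)
include h

set_option maxHeartbeats 800000 in
/-- Periodic orbits before time one make the second variation indefinite. -/
theorem exists_quadForm_neg (hβ : ∀ u, (∀ w, β u w = 0) → u = 0) {T : ℝ} (hT : T ∈ Ioo (0 : ℝ) 1)
    {ξ : E n} (hξ : ξ ≠ 0) (hper : S T ξ = ξ) : ∃ v, IsLoopField v ∧ quadForm β S v < 0 := by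
  obtain ⟨ζ, hζ⟩ : ∃ ζ, β ξ ζ = -1 := by
    by_contra hcon
    refine hξ (hβ ξ fun w => ?_)
    by_contra hw
    exact hcon ⟨-(β ξ w)⁻¹ • w, by simp [hw]⟩
  obtain ⟨r, hr, hrT⟩ : ∃ r : ℝ, 0 < r ∧ 2 * r < T ∧ 2 * r < 1 - T := by
    refine ⟨Min.min T (1 - T) / 4, by have := lt_min hT.1 (sub_pos.2 hT.2); linarith, ?_, ?_⟩
    · have := min_le_left T (1 - T); linarith [hT.1]
    · have := min_le_right T (1 - T); linarith [hT.2]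
  let b : ContDiffBump T := ⟨r, 2 * r, hr, by linarith⟩
  have hbs : ContDiff ℝ ∞ b := b.contDiff
  have hb0 : b 0 = 0 := b.zero_of_le_dist (by
    rw [Real.dist_eq, zero_sub, abs_neg, abs_of_pos hT.1]; exact hrT.1.le)
  have hb1 : b 1 = 0 := b.zero_of_le_dist (by
    rw [Real.dist_eq, abs_of_pos (sub_pos.2 hT.2)]; exact hrT.2.le)
  have hwl : ∀ s : ℝ, 𝒞 (fun t => (s * b t) • ζ) 𝕀 := fun s =>
    ((contDiff_const.mul hbs).smul contDiff_const).contDiffOn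
  have hDs := contDiffOn_derivWithin_unit h.smooth
  obtain ⟨L, hL⟩ := isCompact_Icc.exists_bound_of_continuousOn hDs.continuousOn
  obtain ⟨C₀, hC₀⟩ := isCompact_Icc.exists_bound_of_continuousOn
    h.contDiffOn_flowOp_inverse.continuousOn
  have hC00 : 0 ≤ C₀ := (norm_nonneg _).trans (hC₀ 0 (by simp))
  set C := ‖β‖ * C₀ with hCdef
  have hC : ∀ t ∈ 𝕀, ∀ x, velForm β S t x x ≤ C * ‖x‖ ^ 2 := by
    intro t ht x
    refine (le_abs_self _).trans ?_
    simp only [velForm, neg_apply, ContinuousLinearMap.comp_apply, abs_neg]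
    refine (ContinuousLinearMap.le_opNorm₂ β _ _).trans ?_
    have h1 : ‖(flowOp S t).inverse x‖ ≤ C₀ * ‖x‖ := (ContinuousLinearMap.le_opNorm _ _).trans
      (mul_le_mul_of_nonneg_right (hC₀ t ht) (norm_nonneg _))
    have h2 := mul_le_mul_of_nonneg_left (mul_le_mul_of_nonneg_right h1 (norm_nonneg x))
      (norm_nonneg β)
    rw [hCdef]
    linarith
  have hL0 : 0 ≤ L := (norm_nonneg _).trans (hL 0 (by simp))
  have hC0 : 0 ≤ C := by positivity
  have hTI : T ∈ 𝕀 := Ioo_subset_Icc_self hT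
  have hη : ∀ t ∈ 𝕀, ‖ξ - S t ξ‖ ≤ L * ‖ξ‖ * |t - T| := by
    intro t ht
    have h1 := (convex_Icc (0 : ℝ) 1).norm_image_sub_le_of_norm_hasDerivWithin_le (f := fun t => S t
      ξ) (f' := fun t => derivWithin S 𝕀 t ξ) (C := L * ‖ξ‖) (fun s hs => ((hasDerivWithinAt_unit
      h.smooth hs).clm_apply (hasDerivWithinAt_const s _ ξ)).congr_deriv (by simp)) (fun s hs =>
      (ContinuousLinearMap.le_opNorm _ _).trans (mul_le_mul_of_nonneg_right (hL s hs) (norm_nonneg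
      _))) hTI ht
    rwa [hper, norm_sub_rev, Real.norm_eq_abs] at h1
  obtain ⟨K, hstep⟩ := exists_step
  set N := K * C * (L * ‖ξ‖) ^ 2 with hN
  set w₁ : ℝ → E n := fun t => b t • ζ with hw₁
  obtain ⟨s, hs0, hsQ⟩ : ∃ s : ℝ, 0 < s ∧ s * |quadForm β S w₁| ≤ 1 := by
    refine ⟨(|quadForm β S w₁| + 1)⁻¹, by positivity, ?_⟩
    rw [inv_mul_le_one₀ (by positivity)]
    linarith
  obtain ⟨δ, hδ, hδr, hδN⟩ : ∃ δ : ℝ, 0 < δ ∧ δ < r ∧ N * δ < s := by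
    refine ⟨Min.min (r / 2) (s / (2 * (|N| + 1))), by positivity,
      (min_le_left _ _).trans_lt (by linarith), ?_⟩
    have h1 := min_le_right (r / 2) (s / (2 * (|N| + 1)))
    have h2 : 0 < Min.min (r / 2) (s / (2 * (|N| + 1))) := by positivity
    rw [le_div_iff₀ (by positivity)] at h1
    nlinarith [le_abs_self N, abs_nonneg N]
  obtain ⟨χ, χ', hχs, hχd, hχc, hχ0, hχK, hχz, hχ1, hχ2⟩ := hstep T δ hδ
  have hNδ : ∀ t ∈ 𝕀, velForm β S t (χ' t • (ξ - S t ξ)) (χ' t • (ξ - S t ξ))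
      ≤ -χ' t * (N * δ) := by
    intro t ht
    by_cases htT : t ∈ Icc T (T + δ)
    · have h1 : ‖ξ - S t ξ‖ ≤ L * ‖ξ‖ * δ := (hη t ht).trans (mul_le_mul_of_nonneg_left
        (abs_le.2 ⟨by linarith [htT.1], by linarith [htT.2]⟩) (by positivity))
      have h2 : velForm β S t (ξ - S t ξ) (ξ - S t ξ) ≤ C * (L * ‖ξ‖ * δ) ^ 2 := by
        exact (hC t ht _).trans
          (mul_le_mul_of_nonneg_left (pow_le_pow_left₀ (norm_nonneg _) h1 2) hC0)
      simp only [map_smul, smul_apply, smul_eq_mul]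
      have h3 := mul_le_mul_of_nonneg_left h2 (sq_nonneg (χ' t))
      have h4 := mul_le_mul_of_nonneg_left (hχK t) (mul_nonneg (neg_nonneg.2 (hχ0 t))
        (mul_nonneg (mul_nonneg hC0 (sq_nonneg (L * ‖ξ‖))) hδ.le))
      rw [hN]
      nlinarith
    · simp [hχz t htT]
  have hχb : ∀ t, χ' t * b t = χ' t := by
    intro t
    by_cases htT : t ∈ Icc T (T + δ)
    · rw [b.one_of_mem_closedBall, mul_one]
      rw [Metric.mem_closedBall, Real.dist_eq, abs_of_nonneg (by linarith [htT.1])]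
      exact (by linarith [htT.2] : t - T ≤ r)
    · rw [hχz t htT, zero_mul]
  have hχb' : ∀ t, χ' t * deriv b t = 0 := by
    intro t
    by_cases htT : t ∈ Icc T (T + δ)
    · have h1 : b =ᶠ[𝓝 t] fun _ => 1 := by
        filter_upwards [Metric.isOpen_ball.mem_nhds (x := t) (s := ball T r) (by
          rw [mem_ball, Real.dist_eq, abs_of_nonneg (by linarith [htT.1])]
          linarith [htT.2])] with y hy
        exact b.one_of_mem_closedBall (ball_subset_closedBall hy)
      rw [h1.deriv_eq, deriv_const, mul_zero]
    · rw [hχz t htT, zero_mul]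
  set a : ℝ → E n := fun t => χ t • ξ with ha
  have has : 𝒞 a 𝕀 := (hχs.smul contDiff_const).contDiffOn
  have had : ∀ t ∈ 𝕀, derivWithin a 𝕀 t = χ' t • ξ := fun t ht =>
    ((hχd t).smul_const ξ).hasDerivWithinAt.derivWithin (uniqueDiffOn_unit t ht)
  set w : ℝ → E n := fun t => (s * b t) • ζ with hw
  set x : ℝ → E n := fun t => (s * deriv b t) • ζ with hx
  have hwd : ∀ t, HasDerivAt w (x t) t := fun t =>
    (((hbs.differentiable (by simp)) t).hasDerivAt.const_mul s).smul_const ζ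
  have hxc : Continuous x := (continuous_const.mul (hbs.continuous_deriv (by simp))).smul
    continuous_const
  set v : ℝ → E n := fun t => a t - S t (a t) + w t with hv
  have hvs : 𝒞 v 𝕀 := (has.sub (h.smooth.clm_apply has)).add (hwl s)
  set y : ℝ → E n := fun t => χ' t • (ξ - S t ξ) with hy
  have hvd : ∀ t ∈ 𝕀, derivWithin v 𝕀 t = -derivWithin S 𝕀 t (a t) + y t + x t := by
    intro t ht
    have h1 : HasDerivWithinAt v _ 𝕀 t :=
      (h.hasDerivWithinAt_sub has ht).add (hwd t).hasDerivWithinAt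
    rw [h1.derivWithin (uniqueDiffOn_unit t ht), had t ht]
    simp [hy, smul_sub]
  have ha1 : a 1 = 0 := by simp only [ha]; rw [hχ2 1 (by linarith), zero_smul]
  have hw0 : w 0 = 0 := by simp [hw, hb0]
  have hw1 : w 1 = 0 := by simp [hw, hb1]
  have hv0 : v 0 = 0 := by simp [hv, h.zero, hw0]
  have hv1 : v 1 = 0 := by simp [hv, ha1, hw1]
  refine ⟨v, ⟨hvs, hv0, hv1⟩, ?_⟩
  set q₁ : ℝ → ℝ := fun t => velForm β S t (deriv b t • ζ) (deriv b t • ζ)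
    - β (deriv b t • ζ) (b t • ζ) with hq₁
  have hq₁Q : quadForm β S w₁ = ∫ t in 0..1, q₁ t := by
    rw [quadForm_eq]
    refine integral_congr_unit fun t ht => ?_
    have h1 : derivWithin w₁ 𝕀 t = deriv b t • ζ := (((hbs.differentiable (by simp))
      t).hasDerivAt.smul_const ζ).hasDerivWithinAt.derivWithin (uniqueDiffOn_unit t ht)
    rw [h1]
  have hDc := hDs.continuousOn
  have hSc := h.smooth.continuousOn
  have hac := has.continuousOn
  have hwc := (hwl s).continuousOn
  have hyc : ContinuousOn y 𝕀 := hχc.continuousOn.smul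
    (continuousOn_const.sub (hSc.clm_apply continuousOn_const))
  have hcc : ∀ {f g : ℝ → E n}, ContinuousOn f 𝕀 → ContinuousOn g 𝕀 → ContinuousOn (fun t => β (f t)
    (g t)) 𝕀 := fun hf hg => (continuousOn_const.clm_apply hf).clm_apply hg
  have hq₁c : ContinuousOn q₁ 𝕀 := by
    have h1 : ContinuousOn (fun t => deriv b t • ζ) 𝕀 :=
      ((hbs.continuous_deriv (by simp)).smul continuous_const).continuousOn
    exact ((h.contDiffOn_velForm.continuousOn.clm_apply h1).clm_apply h1).sub
      (hcc h1 (hbs.continuous.smul continuous_const).continuousOn)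
  set g : ℝ → ℝ := fun t => β (a t) (a t - S t (a t)) + β (S t (a t) + a t) (w t)
    + (2 * s - N * δ) * χ t with hg
  set g' : ℝ → ℝ := fun t => (β (χ' t • ξ) (a t - S t (a t)) + β (a t) (-derivWithin S 𝕀 t (a t) + y
    t)) + (β (derivWithin S 𝕀 t (a t) + S t (χ' t • ξ) + χ' t • ξ) (w t) + β (S t (a t) + a t) (x
    t)) + (2 * s - N * δ) * χ' t with hg'
  have hgd : ∀ t ∈ 𝕀, HasDerivWithinAt g (g' t) 𝕀 t := by
    intro t ht
    have h1 := hasDerivWithinAt_unit has ht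
    have h2 := h.hasDerivWithinAt_sub has ht
    have h3 := (hasDerivWithinAt_unit h.smooth ht).clm_apply h1
    have hcβ := hasDerivWithinAt_const t 𝕀 β
    rw [had t ht] at h1 h2 h3
    refine ((((hcβ.clm_apply h1).clm_apply h2).add ((hcβ.clm_apply (h3.add h1)).clm_apply
      (hwd t).hasDerivWithinAt)).add ((hχd t).hasDerivWithinAt.const_mul _)).congr_deriv ?_
    simp [hg', hy, smul_sub]
  have hχξ : ContinuousOn (fun t => χ' t • ξ) 𝕀 := (hχc.smul continuous_const).continuousOn
  have hgc : ContinuousOn g' 𝕀 := (((hcc hχξ (hac.sub (hSc.clm_apply hac))).add (hcc hac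
    ((hDc.clm_apply hac).neg.add hyc))).add ((hcc (((hDc.clm_apply hac).add (hSc.clm_apply hχξ)).add
    hχξ) hwc).add (hcc ((hSc.clm_apply hac).add hac) hxc.continuousOn))).add (continuousOn_const.mul
    hχc.continuousOn)
  have hint := integral_of_hasDerivWithinAt_unit hgd hgc
  have hg01 : g 1 - g 0 = N * δ - 2 * s := by
    simp [hg, ha1, hw0, hw1, h.zero, hχ1 0 hT.1.le, hχ2 1 (by linarith)]
  have hii : ∀ {g : ℝ → ℝ}, ContinuousOn g 𝕀 → IntervalIntegrable g volume 0 1 := by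
    intro g hg
    exact intervalIntegrable_unit ‹_›
  have hle : quadForm β S v ≤ ∫ t in 0..1, (g' t + s ^ 2 * q₁ t) := by
    rw [quadForm_eq]
    refine intervalIntegral.integral_mono_on zero_le_one (hii (h.continuousOn_integrand hvs))
      (hii (hgc.add (continuousOn_const.mul hq₁c))) fun t ht => ?_
    have hid := quadForm_integrand (y := y t) (a := a t) (b := χ' t • ξ) (w := w t) (x := x t)
      h.skew (h.velForm_deriv ht) (h.velForm_symm ht) (h.symp t ht) (by simp [hy, smul_sub])
    rw [hvd t ht, hid]
    have h1 := hNδ t ht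
    have h2 : β (χ' t • ξ) (w t) = -(s * χ' t) := by
      simp only [hw, map_smul, smul_apply, smul_eq_mul, hζ]
      linear_combination -s * hχb t
    have h3 : velForm β S t (y t) (x t) = 0 := by
      simp only [hy, hx, map_smul, smul_apply, smul_eq_mul]
      linear_combination s * velForm β S t (ξ - S t ξ) ζ * hχb' t
    have h4 : velForm β S t (x t) (x t) - β (x t) (w t) = s ^ 2 * q₁ t := by
      simp only [hq₁, hx, hw, map_smul, smul_apply, smul_eq_mul]
      ring
    rw [h2, h3, h4]
    simp only [hg']
    linarith
  rw [intervalIntegral.integral_add (f := g') (g := fun t => s ^ 2 * q₁ t) (hii hgc) (hii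
    (continuousOn_const.mul hq₁c)), hint, hg01, intervalIntegral.integral_const_mul, ← hq₁Q] at hle
  have h1 : s ^ 2 * quadForm β S w₁ ≤ s := by
    nlinarith [le_abs_self (quadForm β S w₁)]
  linarith

end IsPositiveFlow

section Link

variable [MeasurableSpace M]

omit [MeasurableSpace M] in
theorem Q_eq_quadForm [IsManifold 𝓜 ∞ M] (p : M) (v : ℝ → E n) :
    Q Ω f p v = quadForm (IsFamily.locForm Ω p (𝓔 p p)) (linFlow f p) v := by
  refine congrArg Neg.neg (integral_congr_unit fun t _ => ?_)
  simp only [pairing_eq_chartForm]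
  rfl

variable [IsManifold (𝓡 (2 * n)) ∞ M] [ConnectedSpace M] [T2Space M] [SecondCountableTopology M]
  [BorelSpace M]

theorem IsFixedMax.isPositiveFlow (hp : IsFixedMax f F p) (hf : IsHamiltonianFlow Ω f F) :
    IsPositiveFlow (IsFamily.locForm Ω p (𝓔 p p)) (linFlow f p) := by
  obtain ⟨h1, h2⟩ := hp.linFlow_spec hf
  simp only [pairing_eq_chartForm] at h2
  refine ⟨fun u w => alternating_swap (chartForm Ω.form p _) u w, h1, fun u => ?_, fun t ht => (h2 t
    ht).1, fun t ht => (h2 t ht).2.1, fun t ht => (h2 t ht).2.2.1, fun t ht => (h2 t ht).2.2.2⟩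
  have h3 : (f 0 : M → M) = id := funext hf.zero
  rw [linFlow, h3, mfderiv_id]
  rfl

theorem IsFixedMax.coercive (hp : IsFixedMax f F p) (hf : IsHamiltonianFlow Ω f F) (hper : ∀ T ∈ Ioc
    (0 : ℝ) 1, ¬ HasPeriodicOrbit f p T) : ∃ c > 0, ∀ v, IsLoopField v → c * ∫ t in 0..1,
    ‖derivWithin v 𝕀 t‖ ^ 2 ≤ Q Ω f p v := by
  simp only [Q_eq_quadForm]
  refine (hp.isPositiveFlow hf).coercive fun t ht u hu => ?_
  by_contra hcon
  exact hper t ht ⟨u, hcon, hu⟩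

theorem IsFixedMax.exists_Q_neg (hp : IsFixedMax f F p) (hf : IsHamiltonianFlow Ω f F) {T : ℝ} (hT :
    T ∈ Ioo (0 : ℝ) 1) (hper : HasPeriodicOrbit f p T) : ∃ v, IsLoopField v ∧ Q Ω f p v < 0 := by
  obtain ⟨ξ, hξ, hTξ⟩ := hper
  simp only [Q_eq_quadForm]
  exact (hp.isPositiveFlow hf).exists_quadForm_neg (fun u hu => chartForm_nondegenerate Ω
    (mem_extChartAt_target (I := 𝓜) p) hu) hT hξ hTξ

/-- The operators of the linearized equation. -/
theorem IsFixedMax.linOp_spec (hp : IsFixedMax f F p) (hf : IsHamiltonianFlow Ω f F) (ht : t ∈ 𝕀) :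
    HasDerivWithinAt (linFlow f p) (linOp f p t ∘L linFlow f p t) 𝕀 t ∧ (linOp f p t).IsInvertible
    := by
  have h := hp.isPositiveFlow hf
  refine ⟨?_, isInvertible_flowOp (h.inv t ht) (h.inv' t ht)⟩
  rw [show linOp f p t ∘L linFlow f p t = _ from flowOp_comp (h.inv t ht)]
  exact hasDerivWithinAt_unit h.smooth ht

end Link

section Sgrad

variable [IsManifold (𝓡 (2 * n)) ∞ M] (Ω : SymplecticForm n M)

/-- The symplectic gradient in a chart, as a function of the point and the differential. -/
def chartSgrad (x₀ : M) (y : E n) (d : E n →L[ℝ] ℝ) : E n :=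
  -(IsFamily.locForm Ω x₀ y).inverse d

theorem isInvertible_locForm (hy : y ∈ (𝓔 x₀).target) : (IsFamily.locForm Ω x₀ y).IsInvertible := by
  have hinj : Function.Injective (IsFamily.locForm Ω x₀ y : E n →ₗ[ℝ] E n →L[ℝ] ℝ) :=
    (injective_iff_map_eq_zero _).2 fun u hu => chartForm_nondegenerate Ω hy fun w => congrArg (fun
    A : E n →L[ℝ] ℝ => A w) hu
  have hdim : Module.finrank ℝ (E n) = Module.finrank ℝ (E n →L[ℝ] ℝ) := by
    rw [← (LinearMap.toContinuousLinearMap (𝕜 := ℝ) (E := E n) (F' := ℝ)).finrank_eq]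
    exact (Subspace.dual_finrank_eq (K := ℝ) (V := E n)).symm
  refine ⟨(LinearEquiv.ofInjectiveOfFinrankEq (IsFamily.locForm Ω x₀ y : E n →ₗ[ℝ] E n →L[ℝ] ℝ) hinj
    hdim).toContinuousLinearEquiv, ?_⟩
  ext1 u
  rfl

theorem locForm_chartSgrad (hy : y ∈ (𝓔 x₀).target)
    (d : E n →L[ℝ] ℝ) (w : E n) : chartForm Ω.form x₀ y ![chartSgrad Ω x₀ y d, w] = -d w := by
  obtain ⟨L, hL⟩ := isInvertible_locForm Ω hy
  have h1 : IsFamily.locForm Ω x₀ y (chartSgrad Ω x₀ y d) = -d := by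
    rw [chartSgrad, ← hL]
    simp
  exact congrArg (fun A : E n →L[ℝ] ℝ => A w) h1

theorem contDiffOn_chartSgrad {N : Type} [NormedAddCommGroup N] [NormedSpace ℝ N] (x₀ : M) {s : Set
    N} {γ : N → E n} {d : N → E n →L[ℝ] ℝ} (hγ : 𝒞 γ s) (hs : MapsTo γ s (𝓔 x₀).target) (hd : 𝒞 d s)
    : 𝒞 (fun q => chartSgrad Ω x₀ (γ q) (d q)) s := by
  have hform : 𝒞 (fun q => IsFamily.locForm Ω x₀ (γ q)) s :=
    (contDiff_toBilin.comp_contDiffOn (Ω.smooth x₀)).comp hγ hs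
  refine ContDiffOn.neg (ContDiffOn.clm_apply (fun q hq => ?_) hd)
  obtain ⟨L, hL⟩ := isInvertible_locForm Ω (hs hq)
  have h1 : ContDiffAt ℝ ∞ ContinuousLinearMap.inverse (IsFamily.locForm Ω x₀ (γ q)) := by
    rw [← hL]; exact contDiffAt_map_inverse L
  exact h1.comp_contDiffWithinAt q (hform q hq)

/-- Symplectic gradients in a chart. -/
theorem isSgradAt_symm_iff (hy : y ∈ (𝓔 x₀).target) {H : M → ℝ} (hH : MDifferentiableAt 𝓜 𝓘₁ H ((𝓔
    x₀).symm y)) (v : E n) : IsSgradAt Ω H ((𝓔 x₀).symm y) (mfderiv 𝓘(ℝ, E n) 𝓜 (𝓔 x₀).symm y v) ↔ v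
    = chartSgrad Ω x₀ y (fderiv ℝ (H ∘ (𝓔 x₀).symm) y) := by
  set e := 𝓔 x₀ with he
  have h1 : ∀ w : E n, fderiv ℝ (H ∘ e.symm) y w = (mfderiv 𝓜 𝓘₁ H (e.symm y)
      (mfderiv 𝓘(ℝ, E n) 𝓜 e.symm y w) : ℝ) := by
    intro w
    have h2 := mfderiv_comp y hH (mdifferentiableAt_extChartAt_symm hy)
    rw [mfderiv_eq_fderiv] at h2
    exact congrArg (fun A : E n →L[ℝ] ℝ => A w) h2
  have h3 : IsSgradAt Ω H (e.symm y) (mfderiv 𝓘(ℝ, E n) 𝓜 e.symm y v) ↔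
      ∀ w, chartForm Ω.form x₀ y ![v, w] = -fderiv ℝ (H ∘ e.symm) y w := by
    refine ⟨fun h w => ?_, fun h η => ?_⟩
    · rw [chartForm_apply, h1]
      exact h _
    · obtain ⟨w, rfl⟩ := (mfderiv_symm_injective hy).2 η
      exact (chartForm_apply Ω x₀ y v w).symm.trans ((h w).trans (congrArg Neg.neg (h1 w)))
  rw [h3]
  refine ⟨fun h => ?_, fun h w => by rw [h, locForm_chartSgrad Ω hy]⟩
  refine sub_eq_zero.1 (chartForm_nondegenerate Ω hy fun w => ?_)
  have h4 : ∀ v', IsFamily.locForm Ω x₀ y (v - v') w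
      = IsFamily.locForm Ω x₀ y v w - IsFamily.locForm Ω x₀ y v' w := fun v' => by
    rw [map_sub]; rfl
  exact (h4 _).trans (sub_eq_zero.2 ((h w).trans (locForm_chartSgrad Ω hy _ w).symm))

end Sgrad

section HamFlow

/-- Flows, for times in `(-1, 1)`, of compactly supported autonomous Hamiltonian vector fields. -/
structure IsHamFlow (Ω : SymplecticForm n M) (k : M → ℝ) (ψ : ℝ → Diffeo n M) : Prop where
  ham : ContMDiff 𝓜 𝓘₁ ∞ k
  smooth : ContMDiffOn 𝓣 𝓜 ∞ (fun q : ℝ × M => ψ q.1 q.2) (Ioo (-1 : ℝ) 1 ×ˢ univ)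
  zero : ∀ x, ψ 0 x = x
  inv : ∀ s ∈ Ioo (-1 : ℝ) 1, ∀ x, ψ (-s) (ψ s x) = x
  support : ∃ K, IsCompact K ∧ ∀ s ∈ Ioo (-1 : ℝ) 1, ∀ x ∉ K, ψ s x = x
  gen : ∀ s ∈ Ioo (-1 : ℝ) 1, ∀ x, IsSgradAt Ω k (ψ s x) (mfderiv 𝓘₁ 𝓜 (fun s => ψ s x) s (1 : ℝ))

theorem isSgradAt_zero (Ω : SymplecticForm n M) {H : M → ℝ} {x : M}
    (h : mfderiv 𝓜 𝓘₁ H x = 0) : IsSgradAt Ω H x 0 := by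
  intro η
  rw [h]
  exact ((Ω.form x).toAlternatingMap.map_coord_zero (m := ![0, η]) 0 rfl).trans neg_zero.symm

theorem IsSgradAt.congr_point {H : M → ℝ} {x x' : M} {u v : E n}
    (h : IsSgradAt Ω H x u) (hx : x' = x) (hv : v = u) : IsSgradAt Ω H x' v := by
  subst hx hv
  exact h

theorem neg_mem_Ioo_one {s : ℝ} (hs : s ∈ Ioo (-1 : ℝ) 1) : -s ∈ Ioo (-1 : ℝ) 1 :=
  ⟨by linarith [hs.2], by linarith [hs.1]⟩

variable [IsManifold (𝓡 (2 * n)) ∞ M]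

open Classical in
/-- Functions supported in a chart generate Hamiltonian flows for a definite time. -/
theorem exists_isHamFlow [T2Space M] (Ω : SymplecticForm n M) {k : M → ℝ} (hk : ContMDiff 𝓜 𝓘₁ ∞ k)
    {K : Set M} (hK : IsCompact K) (hKs : K ⊆ (𝓔 x₀).source) (hk0 : ∀ x ∉ K, k x = 0) : ∃ c > 0, ∃ ψ
    : ℝ → Diffeo n M, IsHamFlow Ω (fun x => c * k x) ψ ∧ ∀ x, mfderiv 𝓜 𝓘₁ k x = 0 → ∀ s ∈ Ioo (-1 :
    ℝ) 1, ψ s x = x := by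
  set e := 𝓔 x₀ with he
  have hto : IsOpen e.target := isOpen_extChartAt_target x₀
  have hso : IsOpen e.source := isOpen_extChartAt_source x₀
  have hec : ContMDiffOn 𝓜 𝓘(ℝ, E n) ∞ e e.source := by
    rw [he, extChartAt_source]; exact contMDiffOn_extChartAt
  have hes : ContMDiffOn 𝓘(ℝ, E n) 𝓜 ∞ e.symm e.target := contMDiffOn_extChartAt_symm x₀
  have hks : 𝒞 (k ∘ e.symm) e.target := contMDiffOn_iff_contDiffOn.1 (hk.comp_contMDiffOn hes)
  set X : E n → E n := e.target.indicator fun y => chartSgrad Ω x₀ y (fderiv ℝ (k ∘ e.symm) y)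
    with hX
  have hXt : ∀ y ∈ e.target, X y = chartSgrad Ω x₀ y (fderiv ℝ (k ∘ e.symm) y) := fun y hy =>
    indicator_of_mem hy _
  have heK : IsCompact (e '' K) := hK.image_of_continuousOn (hec.continuousOn.mono hKs)
  have hk0' : ∀ x ∉ K, k =ᶠ[𝓝 x] fun _ => 0 := fun x hx => by
    filter_upwards [hK.isClosed.isOpen_compl.mem_nhds hx] with y hy using hk0 y hy
  have hX0 : ∀ y ∉ e '' K, X y = 0 := by
    intro y hy
    by_cases hyt : y ∈ e.target
    · have h1 : k ∘ e.symm =ᶠ[𝓝 y] fun _ => 0 := (hes.continuousOn.continuousAt (hto.mem_nhds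
        hyt)).eventually (hk0' _ fun hc => hy ⟨_, hc, e.right_inv hyt⟩)
      rw [hXt y hyt, h1.fderiv_eq, fderiv_const_apply, chartSgrad, map_zero, neg_zero]
    · exact indicator_of_notMem hyt _
  have hXs : ContDiff ℝ ∞ X := by
    refine contDiff_iff_contDiffAt.2 fun y => ?_
    by_cases hy : y ∈ e '' K
    · have hyt : y ∈ e.target := by
        obtain ⟨x, hx, rfl⟩ := hy
        exact e.map_source (hKs hx)
      exact ((contDiffOn_chartSgrad Ω x₀ contDiffOn_id (fun _ h => h)
        (hks.fderiv_of_isOpen hto (m := ∞) (by norm_cast))).congr hXt).contDiffAt (hto.mem_nhds hyt)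
    · refine (contDiffAt_const (c := (0 : E n))).congr_of_eventuallyEq ?_
      filter_upwards [heK.isClosed.isOpen_compl.mem_nhds hy] with z hz using hX0 z hz
  obtain ⟨c, θ, hc, hθs, hθ0, hθd, hθi, hθf⟩ := exists_smooth_flow hXs
    (HasCompactSupport.of_support_subset_isCompact heK fun y hy => by
      by_contra hcon; exact hy (hX0 y hcon))
  have hmap : ∀ s ∈ Ioo (-1 : ℝ) 1, ∀ y ∈ e.target, θ s y ∈ e.target := by
    intro s hs y hy
    by_contra hcon
    have h1 := hθf (-s) (neg_mem_Ioo_one hs) _ (indicator_of_notMem hcon _)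
    rw [hθi s hs] at h1
    exact hcon (h1 ▸ hy)
  set m : ℝ → M → M := fun s x => if x ∈ e.source then e.symm (θ s (e x)) else x with hm
  have hms : ∀ s, ∀ x ∈ e.source, m s x = e.symm (θ s (e x)) := fun s x hx => if_pos hx
  have hmn : ∀ s, ∀ x ∉ e.source, m s x = x := fun s x hx => if_neg hx
  have hfix : ∀ s ∈ Ioo (-1 : ℝ) 1, ∀ x, (x ∈ e.source → X (e x) = 0) → m s x = x := by
    intro s hs x hx
    by_cases hxs : x ∈ e.source
    · rw [hms s x hxs, hθf s hs _ (hx hxs), e.left_inv hxs]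
    · exact hmn s x hxs
  have hfixK : ∀ s ∈ Ioo (-1 : ℝ) 1, ∀ x ∉ K, m s x = x := fun s hs x hx =>
    hfix s hs x fun hxs => hX0 _ fun ⟨z, hz, hzx⟩ => hx (by rwa [← e.injOn (hKs hz) hxs hzx])
  have hinv : ∀ s ∈ Ioo (-1 : ℝ) 1, ∀ x, m (-s) (m s x) = x := by
    intro s hs x
    by_cases hxs : x ∈ e.source
    · have h1 := hmap s hs _ (e.map_source hxs)
      rw [hms s x hxs, hms _ _ (e.map_target h1), e.right_inv h1, hθi s hs, e.left_inv hxs]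
    · rw [hmn s x hxs, hmn _ x hxs]
  have hsm : ContMDiffOn 𝓣 𝓜 ∞ (fun q : ℝ × M => m q.1 q.2) (Ioo (-1 : ℝ) 1 ×ˢ univ) := by
    rintro ⟨s, x⟩ ⟨hs, -⟩
    by_cases hxs : x ∈ e.source
    · have h1 : ContMDiffOn 𝓣 𝓜 ∞ (fun q : ℝ × M => e.symm (θ q.1 (e q.2))) (Ioo (-1 : ℝ) 1 ×ˢ
        e.source) := hes.comp (hθs.contMDiff.comp_contMDiffOn (f := fun q : ℝ × M => (q.1, e q.2))
        (contMDiffOn_fst.prodMk_space (hec.comp contMDiffOn_snd fun q hq => hq.2))) fun q hq => hmap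
        _ hq.1 _ (e.map_source hq.2)
      exact ((h1.congr fun q hq => hms _ _ hq.2).contMDiffAt
        ((isOpen_Ioo.prod hso).mem_nhds ⟨hs, hxs⟩)).contMDiffWithinAt
    · have h1 : ContMDiffOn 𝓣 𝓜 ∞ (fun q : ℝ × M => m q.1 q.2) (Ioo (-1 : ℝ) 1 ×ˢ Kᶜ) :=
        contMDiffOn_snd.congr fun q hq => hfixK _ hq.1 _ hq.2
      exact (h1.contMDiffAt ((isOpen_Ioo.prod hK.isClosed.isOpen_compl).mem_nhds
        ⟨hs, fun hx => hxs (hKs hx)⟩)).contMDiffWithinAt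
  have hsl : ∀ s ∈ Ioo (-1 : ℝ) 1, ContMDiff 𝓜 𝓜 ∞ (m s) := fun s hs => contMDiffOn_univ.1 (hsm.comp
    (f := fun x : M => (s, x)) (contMDiffOn_const.prodMk contMDiffOn_id) fun x _ => ⟨hs, mem_univ
    x⟩)
  set ψ : ℝ → Diffeo n M := fun s => if hs : s ∈ Ioo (-1 : ℝ) 1 then
    ⟨⟨m s, m (-s), hinv s hs, fun x => by simpa using hinv (-s) (neg_mem_Ioo_one hs) x⟩,
      hsl s hs, hsl (-s) (neg_mem_Ioo_one hs)⟩ else Diffeomorph.refl _ M ∞ with hψ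
  have hψm : ∀ s ∈ Ioo (-1 : ℝ) 1, ∀ x, ψ s x = m s x := by
    intro s hs x
    simp only [hψ, dif_pos hs]
    rfl
  have h0 : (0 : ℝ) ∈ Ioo (-1 : ℝ) 1 := by norm_num
  refine ⟨c, hc, ψ, ⟨contMDiff_const.mul hk, hsm.congr fun q hq => hψm _ hq.1 _, fun x => ?_,
    fun s hs x => ?_, ⟨K, hK, fun s hs x hx => (hψm s hs x).trans (hfixK s hs x hx)⟩,
    fun s hs x => ?_⟩, fun x hx s hs => ?_⟩
  · rw [hψm 0 h0]
    by_cases hxs : x ∈ e.source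
    · rw [hms _ _ hxs, hθ0, e.left_inv hxs]
    · exact hmn _ _ hxs
  · rw [hψm s hs, hψm _ (neg_mem_Ioo_one hs), hinv s hs]
  · have hev : (fun s => ψ s x) =ᶠ[𝓝 s] fun s => m s x := by
      filter_upwards [isOpen_Ioo.mem_nhds hs] with r hr using hψm r hr x
    rw [hev.mfderiv_eq, hψm s hs]
    by_cases hxs : x ∈ e.source
    · have hy := hmap s hs _ (e.map_source hxs)
      have h1 : (fun s => m s x) = fun s => e.symm (θ s (e x)) := funext fun s => hms s x hxs
      have h2 : (mfderiv 𝓘₁ 𝓜 (fun s => e.symm (θ s (e x))) s (1 : ℝ) : E n)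
          = mfderiv 𝓘(ℝ, E n) 𝓜 e.symm (θ s (e x)) (c • X (θ s (e x))) := by
        have h3 := mfderiv_comp s (mdifferentiableAt_extChartAt_symm hy)
          (hθd s hs (e x)).differentiableAt.mdifferentiableAt
        rw [mfderiv_eq_fderiv, (hθd s hs (e x)).hasFDerivAt.fderiv] at h3
        refine (congrArg (fun A : ℝ →L[ℝ] E n => A 1) h3).trans ?_
        exact congrArg (mfderiv 𝓘(ℝ, E n) 𝓜 e.symm (θ s (e x))) (one_smul ℝ _)
      rw [h1]
      refine ((isSgradAt_symm_iff Ω hy (H := fun x => c * k x) ((contMDiff_const.mul hk).mdifferentiable (by simp) _)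
        _).2 ?_).congr_point (hms s x hxs) h2
      rw [hXt _ hy]
      have h4 : fderiv ℝ ((fun x => c * k x) ∘ e.symm) (θ s (e x)) = c • fderiv ℝ (k ∘ e.symm) (θ s
        (e x)) := fderiv_const_mul ((hks.differentiableOn (by simp)).differentiableAt (hto.mem_nhds
        hy)) c
      rw [h4, chartSgrad, chartSgrad, map_smul, smul_neg]
    · have h1 : (fun s => m s x) = fun _ => x := funext fun s => hmn s x hxs
      rw [h1, hmn s x hxs, mfderiv_const]
      refine isSgradAt_zero Ω ?_
      have h2 : (fun x => c * k x) =ᶠ[𝓝 x] fun _ => 0 := by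
        filter_upwards [hk0' x fun hx => hxs (hKs hx)] with z hz
        rw [hz, mul_zero]
      rw [h2.mfderiv_eq, mfderiv_const]
      rfl
  · rw [hψm s hs]
    refine hfix s hs x fun hxs => ?_
    have h3 := mfderiv_comp (e x) (g := k) (f := e.symm) (I' := 𝓜) (hk.mdifferentiable (by simp) _)
      (mdifferentiableAt_extChartAt_symm (e.map_source hxs))
    rw [mfderiv_eq_fderiv, e.left_inv hxs, hx] at h3
    rw [hXt _ (e.map_source hxs), h3]
    exact neg_eq_zero.2 (map_zero _)

end HamFlow

section FlowVariation

variable [IsManifold (𝓡 (2 * n)) ∞ M]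

/-- The tangent map of a diffeomorphism. -/
def tanMap (ψ : Diffeo n M) (x : M) : 𝓛 :=
  mfderiv 𝓜 𝓜 ψ x

/-- The velocity of the curve `r ↦ ψ r x`. -/
def velocity (ψ : ℝ → Diffeo n M) (s : ℝ) (x : M) : E n :=
  mfderiv 𝓘₁ 𝓜 (fun r => ψ r x) s (1 : ℝ)

theorem pairing_add_left (x : M) (u v w : E n) :
    pairing Ω x (u + v) w = pairing Ω x u w + pairing Ω x v w := by
  simp only [pairing_eq_chartForm, ← toBilin_apply, map_add, add_apply]

theorem pairing_smul_left (x : M) (c : ℝ) (u w : E n) :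
    pairing Ω x (c • u) w = c * pairing Ω x u w := by
  simp only [pairing_eq_chartForm, ← toBilin_apply, map_smul, smul_apply, smul_eq_mul]

theorem IsSgradAt.add {H₁ H₂ : M → ℝ} {x : M} {u v : E n} (h₁ : IsSgradAt Ω H₁ x u) (h₂ : IsSgradAt
    Ω H₂ x v) (d₁ : MDifferentiableAt 𝓜 𝓘₁ H₁ x) (d₂ : MDifferentiableAt 𝓜 𝓘₁ H₂ x) : IsSgradAt Ω
    (fun x => H₁ x + H₂ x) x (u + v : E n) := by
  intro η
  have h3 := congrArg (fun A : E n →L[ℝ] ℝ => -A η) (mfderiv_add d₁ d₂)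
  exact (pairing_add_left x u v η).trans ((congrArg₂ (fun a b : ℝ => a + b) (h₁ η) (h₂ η)).trans
    ((neg_add _ _).symm.trans h3.symm))

theorem IsSgradAt.const_mul {H : M → ℝ} {x : M} {u : E n} (h : IsSgradAt Ω H x u) (d :
    MDifferentiableAt 𝓜 𝓘₁ H x) (c : ℝ) : IsSgradAt Ω (fun x => c * H x) x (c • u : E n) := by
  intro η
  have h3 := congrArg (fun A : E n →L[ℝ] ℝ => -A η) (d.hasMFDerivAt.const_smul c).mfderiv
  exact (pairing_smul_left x c u η).trans ((congrArg (fun a : ℝ => c * a) (h η)).trans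
    ((mul_neg _ _).trans h3.symm))

theorem IsSymplectic.pairing_tanMap {ψ : Diffeo n M} (hψ : IsSymplectic Ω ψ) (x : M) (u w : E n) :
    pairing Ω (ψ x) (tanMap ψ x u) (tanMap ψ x w) = pairing Ω x u w := by
  set y := 𝓔 x x with hy
  have hyt : y ∈ (𝓔 x).target := mem_extChartAt_target (I := 𝓜) x
  have h1 := hψ x y hyt u w
  have hyx := extChartAt_to_inv (I := 𝓜) x
  have h2 : ∀ u : E n, (mfderivWithin 𝓘(ℝ, E n) 𝓜 (fun y => ψ ((𝓔 x).symm y)) (𝓔 x).target y u : E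
      n) = tanMap ψ x u := by
    intro u
    have h3 := mfderiv_comp_of_eq (x := y) (g := ψ) (f := (𝓔 x).symm) (I' := 𝓜) (I'' := 𝓜)
      (ψ.contMDiff.mdifferentiable (by simp) x) (mdifferentiableAt_extChartAt_symm hyt) hyx
    have h4 := mfderivWithin_of_isOpen (I := 𝓘(ℝ, E n)) (I' := 𝓜)
      (f := fun y => ψ ((𝓔 x).symm y)) (isOpen_extChartAt_target x) hyt
    refine (congrArg (fun A : 𝓛 => A u) (h4.trans h3)).trans ?_
    have h5 : ∀ z, z = x → ∀ v : E n, v = u → tanMap ψ z v = tanMap ψ x u := by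
      rintro z rfl v rfl; rfl
    exact h5 _ hyx _ (mfderiv_extChartAt_symm_center x u)
  rw [pairing_eq_chartForm Ω x, ← h1, pull_apply]
  refine (form_congr_point Ω (congrArg ψ hyx).symm _ _).trans (congrArg (Ω.form _) ?_)
  funext i; fin_cases i
  · exact (h2 u).symm
  · exact (h2 w).symm

theorem tanMap_surjective (ψ : Diffeo n M) (x : M) : Function.Surjective (tanMap ψ x) :=
  (ψ.mfderivToContinuousLinearEquiv (by simp) x).surjective

/-- Hamiltonian vector fields are natural under symplectic diffeomorphisms. -/
theorem IsSgradAt.push {ψ : Diffeo n M} (hψ : IsSymplectic Ω ψ) {H H' : M → ℝ} {x : M} {u : E n} (h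
    : IsSgradAt Ω H x u) (hH : ∀ x, H' (ψ x) = H x) (d : MDifferentiableAt 𝓜 𝓘₁ H' (ψ x)) :
    IsSgradAt Ω H' (ψ x) (tanMap ψ x u) := by
  intro η
  obtain ⟨w, rfl⟩ := tanMap_surjective ψ x η
  have h1 := mfderiv_comp x d (ψ.contMDiff.mdifferentiable (by simp) x)
  rw [show H' ∘ ψ = H from funext hH] at h1
  exact (hψ.pairing_tanMap x u w).trans ((h w).trans (congrArg (fun A : E n →L[ℝ] ℝ => -A w) h1))

namespace IsHamFlow

variable {k : M → ℝ} {ψ : ℝ → Diffeo n M} (h : IsHamFlow Ω k ψ)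
include h

theorem mdiff_ham (x : M) : MDifferentiableAt 𝓜 𝓘₁ k x := h.ham.mdifferentiable (by simp) x

theorem add_const (c : ℝ) : IsHamFlow Ω (fun x => k x + c) ψ :=
  { h with
    ham := h.ham.add contMDiff_const
    gen := fun s hs x => ((h.gen s hs x).add (isSgradAt_zero Ω mfderiv_const) (h.mdiff_ham _)
      mdifferentiableAt_const).congr_point rfl (add_zero (M := E n) _).symm }

theorem mdiff {s : ℝ} (hs : s ∈ Ioo (-1 : ℝ) 1) (x : M) : MDifferentiableAt 𝓣 𝓜 (fun q : ℝ × M => ψ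
  q.1 q.2) (s, x) := (h.smooth.contMDiffAt ((isOpen_Ioo.prod isOpen_univ).mem_nhds ⟨hs, mem_univ
  x⟩)).mdifferentiableAt (by simp)

theorem mfderivWithin_comp {γ : ℝ → M} {σ : ℝ → ℝ} {σ' t : ℝ} {s : Set ℝ} {w : E n} (hσ :
    HasDerivWithinAt σ σ' s t) (hσt : σ t ∈ Ioo (-1 : ℝ) 1) (hγ : MDifferentiableWithinAt 𝓘₁ 𝓜 γ s
    t) (hs : UniqueDiffWithinAt ℝ s t) (hw : (mfderivWithin 𝓘₁ 𝓜 γ s t (1 : ℝ) : E n) = w) :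
    (mfderivWithin 𝓘₁ 𝓜 (fun t => ψ (σ t) (γ t)) s t (1 : ℝ) : E n) = σ' • velocity ψ (σ t) (γ t) +
    tanMap (ψ (σ t)) (γ t) w := by
  have hσm : MDifferentiableWithinAt 𝓘₁ 𝓘₁ σ s t :=
    hσ.differentiableWithinAt.mdifferentiableWithinAt
  have h1 := mfderiv_comp_mfderivWithin t (g := fun q : ℝ × M => ψ q.1 q.2)
    (f := fun t => (σ t, γ t)) (h.mdiff hσt (γ t)) (hσm.prodMk hγ) hs.uniqueMDiffWithinAt
  rw [mfderivWithin_prodMk hσm hγ hs.uniqueMDiffWithinAt] at h1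
  refine (congrArg (fun A : ℝ →L[ℝ] E n => A 1) h1).trans ?_
  refine (mfderiv_prod_eq_add_apply (h.mdiff hσt (γ t))).trans ?_
  refine congrArg₂ (fun a b : E n => a + b) ?_ (congrArg (tanMap (ψ (σ t)) (γ t)) hw)
  have h2 : (mfderivWithin 𝓘₁ 𝓘₁ σ s t (1 : ℝ) : ℝ) = σ' • (1 : ℝ) := by
    rw [mfderivWithin_eq_fderivWithin, hσ.hasFDerivWithinAt.fderivWithin hs]
    exact (one_smul ℝ σ').trans (mul_one σ').symm
  refine (congrArg (mfderiv 𝓘₁ 𝓜 (fun r => ψ r (γ t)) (σ t)) h2).trans ?_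
  exact ContinuousLinearMap.map_smul (M₁ := ℝ) (M₂ := E n) _ σ' (1 : ℝ)

theorem isSymplectic {s : ℝ} (hs : s ∈ Ioo (-1 : ℝ) 1) : IsSymplectic Ω (ψ s) := by
  have hst : ∀ t ∈ 𝕀, t * s ∈ Ioo (-1 : ℝ) 1 := fun t ht => abs_lt.1 ((abs_mul t s).le.trans_lt
    ((mul_le_of_le_one_left (abs_nonneg s) (abs_le.2 ⟨by linarith [ht.1], ht.2⟩)).trans_lt (abs_lt.2
    hs)))
  have hF : IsFamily Ω 1 (fun _ t => ψ (t * s)) (fun _ _ x => s * k x) := by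
    refine ⟨one_pos, h.smooth.comp (f := fun q : ℝ × ℝ × M => (q.2.1 * s, q.2.2)) ?_ fun q hq =>
      ⟨hst _ hq.2.1, mem_univ _⟩, fun _ _ => (contMDiffOn_const.mul (h.ham.comp_contMDiffOn
      contMDiffOn_snd)), fun _ _ t ht x => ?_, fun _ _ x => ?_⟩
    · have h1 : ContMDiff (𝓘(ℝ, ℝ).prod 𝓣) 𝓘₁ ∞ (fun q : ℝ × ℝ × M => q.2.1 * s) := (contDiff_id.mul
        contDiff_const).contMDiff.comp (contMDiff_fst.comp contMDiff_snd)
      exact (h1.prodMk (contMDiff_snd.comp contMDiff_snd)).contMDiffOn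
    · have h1 := h.mfderivWithin_comp (γ := fun _ => x) (σ := fun t => t * s) (w := 0)
        (((hasDerivAt_id t).mul_const s).congr_deriv (one_mul s)).hasDerivWithinAt (hst t ht)
        mdifferentiableWithinAt_const (uniqueDiffOn_unit t ht) (by rw [mfderivWithin_const]; rfl)
      rw [ContinuousLinearMap.map_zero (tanMap (ψ (t * s)) x), add_zero] at h1
      exact ((h.gen _ (hst t ht) x).const_mul (h.mdiff_ham _) s).congr_point rfl h1
    · rw [zero_mul]; exact h.zero x
  simpa using hF.isSymplectic (ε := 0) (t := 1) (by simp) (by simp)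

theorem ham_apply {s : ℝ} (hs : s ∈ Ioo (-1 : ℝ) 1) (x : M) : k (ψ s x) = k x := by
  have h1 : ∀ r ∈ Ioo (-1 : ℝ) 1, HasDerivAt (fun r => k (ψ r x)) 0 r := by
    intro r hr
    have h2 : MDifferentiableAt 𝓘₁ 𝓜 (fun r => ψ r x) r :=
      (h.mdiff hr x).comp r (mdifferentiableAt_id.prodMk mdifferentiableAt_const)
    have h3 : HasFDerivAt (fun r => k (ψ r x)) (_ : ℝ →L[ℝ] ℝ) r :=
      ((h.mdiff_ham _).hasMFDerivAt.comp r h2.hasMFDerivAt).hasFDerivAt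
    refine (HasFDerivAt.hasDerivAt h3).congr_deriv ?_
    have h4 := h.gen r hr x (mfderiv 𝓘₁ 𝓜 (fun r => ψ r x) r (1 : ℝ))
    exact neg_eq_zero.1 (h4.symm.trans ((Ω.form (ψ r x)).map_eq_zero_of_eq _ (i := 0) (j := 1)
      rfl (by decide)))
  have h2 := isOpen_Ioo.is_const_of_deriv_eq_zero isPreconnected_Ioo
    (fun r hr => (h1 r hr).differentiableAt.differentiableWithinAt) (fun r hr => (h1 r hr).deriv)
    hs (by norm_num : (0 : ℝ) ∈ Ioo (-1 : ℝ) 1)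
  simpa only [h.zero] using h2

end IsHamFlow

section Composition

variable [MeasurableSpace M] [ConnectedSpace M] [T2Space M] [SecondCountableTopology M]
  [BorelSpace M] {k : M → ℝ} {ψ : ℝ → Diffeo n M} {a : ℝ → ℝ}

/-- Variations composed with an autonomous Hamiltonian flow. -/
theorem IsVariation.comp_flow (hf : IsHamiltonianFlow Ω f F) (hv : IsVariation Ω f ε₀ φ) (hΦ :
    IsHamiltonianOfVariation Ω ε₀ φ Φ) (hψ : IsHamFlow Ω k ψ) (hkm : CompactSpace M → ∫ x, k x
    ∂(liouville Ω) = 0) (hkc : ¬ CompactSpace M → ∃ K : Set M, IsCompact K ∧ ∀ x ∉ K, k x = 0) (ha :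
    𝒞 a 𝕀) (ha0 : a 0 = 0) (ha1 : a 1 = 0) : ∃ ε₁ ≤ ε₀, (∀ ε ∈ Ioo (-ε₁) ε₁, ∀ t ∈ 𝕀, ε * a t ∈ Ioo
    (-1 : ℝ) 1) ∧ IsVariation Ω f ε₁ (fun ε t => (φ ε t).trans (ψ (ε * a t))) ∧
    IsHamiltonianOfVariation Ω ε₁ (fun ε t => (φ ε t).trans (ψ (ε * a t))) (fun ε t x => ε *
    derivWithin a 𝕀 t * k x + Φ ε t (ψ (-(ε * a t)) x)) := by
  obtain ⟨A, hA⟩ := isCompact_Icc.exists_bound_of_continuousOn ha.continuousOn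
  have hA0 : 0 ≤ A := (norm_nonneg _).trans (hA 0 (by simp))
  set ε₁ := Min.min ε₀ (A + 1)⁻¹ with hε₁
  have hε₁0 : 0 < ε₁ := lt_min hv.pos (by positivity)
  have hsub : ∀ ε ∈ Ioo (-ε₁) ε₁, ε ∈ Ioo (-ε₀) ε₀ := fun ε hε =>
    ⟨(neg_le_neg (min_le_left _ _)).trans_lt hε.1, hε.2.trans_le (min_le_left _ _)⟩
  have hεa : ∀ ε ∈ Ioo (-ε₁) ε₁, ∀ t ∈ 𝕀, ε * a t ∈ Ioo (-1 : ℝ) 1 := by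
    intro ε hε t ht
    refine abs_lt.1 ?_
    have h1 : |ε| < (A + 1)⁻¹ := (abs_lt.2 hε).trans_le (min_le_right _ _)
    have h2 : |ε| * (A + 1) < 1 := by
      rwa [← one_div, lt_div_iff₀ (by positivity)] at h1
    rw [abs_mul]
    nlinarith [hA t ht, abs_nonneg ε, Real.norm_eq_abs (a t)]
  have has : ContMDiffOn 𝓘₁ 𝓘₁ ∞ a 𝕀 := ha.contMDiffOn
  have hsm : ContMDiffOn (𝓘(ℝ, ℝ).prod 𝓣) 𝓜 ∞ (fun q : ℝ × ℝ × M => ψ (q.1 * a q.2.1) (φ q.1 q.2.1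
    q.2.2)) (Ioo (-ε₁) ε₁ ×ˢ 𝕀 ×ˢ univ) := hψ.smooth.comp (f := fun q : ℝ × ℝ × M => (q.1 * a q.2.1,
    φ q.1 q.2.1 q.2.2)) ((contMDiffOn_fst.mul (has.comp (contMDiff_fst.comp
    contMDiff_snd).contMDiffOn fun q hq => hq.2.1)).prodMk (hv.smooth.mono fun q hq => ⟨hsub _ hq.1,
    hq.2⟩)) fun q hq => ⟨hεa _ hq.1 _ hq.2.1, mem_univ _⟩
  obtain ⟨K₁, hK₁, hK₁φ⟩ := hv.compact_support
  obtain ⟨K₂, hK₂, hK₂ψ⟩ := hψ.support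
  have hsupp : ∀ ε ∈ Ioo (-ε₁) ε₁, ∀ t ∈ 𝕀, ∀ x ∉ K₁ ∪ K₂,
      (φ ε t).trans (ψ (ε * a t)) x = x := fun ε hε t ht x hx => by
    simp only [Diffeomorph.coe_trans, Function.comp_apply]
    rw [hK₁φ ε (hsub ε hε) t ht x fun h => hx (Or.inl h),
      hK₂ψ _ (hεa ε hε t ht) x fun h => hx (Or.inr h)]
  have hham : IsHamiltonianOfVariation Ω ε₁ (fun ε t => (φ ε t).trans (ψ (ε * a t)))
      (fun ε t x => ε * derivWithin a 𝕀 t * k x + Φ ε t (ψ (-(ε * a t)) x)) := by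
    intro ε hε
    obtain ⟨hn, hg⟩ := hΦ ε (hsub ε hε)
    have hHs : ContMDiffOn 𝓣 𝓘₁ ∞ (fun q : ℝ × M => ε * derivWithin a 𝕀 q.1 * k q.2) (𝕀 ×ˢ univ) :=
      (contMDiffOn_const.mul ((contDiffOn_derivWithin_unit ha).contMDiffOn.comp contMDiffOn_fst fun
      q hq => hq.1)).mul (hψ.ham.comp_contMDiffOn contMDiffOn_snd)
    have hψs : ContMDiffOn 𝓣 𝓜 ∞ (fun q : ℝ × M => ψ (-(ε * a q.1)) q.2) (𝕀 ×ˢ univ) :=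
      hψ.smooth.comp (f := fun q : ℝ × M => (-(ε * a q.1), q.2)) (((contMDiffOn_const.mul (has.comp
      contMDiffOn_fst fun q hq => hq.1)).neg).prodMk contMDiffOn_snd) fun q hq => ⟨neg_mem_Ioo_one
      (hεa ε hε _ hq.1), mem_univ _⟩
    have hGs := hn.smooth.comp (f := fun q : ℝ × M => (q.1, ψ (-(ε * a q.1)) q.2))
      (contMDiffOn_fst.prodMk hψs) fun q hq => ⟨hq.1, mem_univ _⟩
    have hslice : ∀ {G : ℝ × M → ℝ}, ContMDiffOn 𝓣 𝓘₁ ∞ G (𝕀 ×ˢ univ) → ∀ t ∈ 𝕀, ContMDiff 𝓜 𝓘₁ ∞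
      (fun x => G (t, x)) := fun hG t ht => contMDiffOn_univ.1 (hG.comp (f := fun x : M => (t, x))
      (contMDiffOn_const.prodMk contMDiffOn_id) fun x _ => ⟨ht, mem_univ x⟩)
    refine ⟨⟨hHs.add hGs, fun hM t ht => ?_, fun hM => ?_⟩, fun t ht x => ?_⟩
    · have := isFiniteMeasure_liouville Ω
      change ∫ x, (ε * derivWithin a 𝕀 t * k x + Φ ε t (ψ (-(ε * a t)) x)) ∂_ = 0
      rw [integral_add (f := fun x => ε * derivWithin a 𝕀 t * k x) (g := fun x => Φ ε t (ψ (-(ε * a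
        t)) x)) ((hslice hHs t ht).continuous.integrable_of_hasCompactSupport
        (HasCompactSupport.of_compactSpace _)) ((hslice hGs t
        ht).continuous.integrable_of_hasCompactSupport (HasCompactSupport.of_compactSpace _)),
        integral_const_mul, hkm hM, mul_zero, zero_add]
      exact ((measurePreserving_liouville Ω (hψ.isSymplectic
        (neg_mem_Ioo_one (hεa ε hε t ht)))).integral_comp
        (ψ (-(ε * a t))).toHomeomorph.measurableEmbedding (Φ ε t)).trans (hn.mean_zero hM t ht)
    · obtain ⟨K₃, hK₃, hK₃k⟩ := hkc hM
      obtain ⟨K₄, hK₄, hK₄Φ⟩ := hn.compact_support hM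
      refine ⟨K₃ ∪ (K₂ ∪ K₄), hK₃.union (hK₂.union hK₄), fun t ht x hx => ?_⟩
      simp only
      rw [hK₃k x fun h => hx (Or.inl h), hK₂ψ _ (neg_mem_Ioo_one (hεa ε hε t ht)) x
        fun h => hx (Or.inr (Or.inl h)), hK₄Φ t ht x fun h => hx (Or.inr (Or.inr h))]
      simp
    · have hσ := hεa ε hε t ht
      have h1 : MDifferentiableWithinAt 𝓘₁ 𝓜 (fun s => φ ε s x) 𝕀 t := (hv.smooth.comp (f := fun s :
        ℝ => (ε, s, x)) (contMDiffOn_const.prodMk (contMDiffOn_id.prodMk contMDiffOn_const)) (fun s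
        hs => ⟨hsub ε hε, hs, mem_univ _⟩) t ht).mdifferentiableWithinAt (by simp)
      have h2 := hψ.mfderivWithin_comp (σ := fun t => ε * a t) (γ := fun s => φ ε s x)
        ((hasDerivWithinAt_unit ha ht).const_mul ε) hσ h1 (uniqueDiffOn_unit t ht) rfl
      refine IsSgradAt.congr_point (IsSgradAt.add
        (H₁ := fun x => ε * derivWithin a 𝕀 t * k x)
        (H₂ := fun x => Φ ε t (ψ (-(ε * a t)) x))
        ((hψ.gen _ hσ (φ ε t x)).const_mul (hψ.mdiff_ham _) (ε * derivWithin a 𝕀 t))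
        (IsSgradAt.push (hψ.isSymplectic hσ) (hg t ht x) (fun y => by rw [hψ.inv _ hσ])
          ((hslice hGs t ht).mdifferentiable (by simp) _))
        ((hslice hHs t ht).mdifferentiable (by simp) _)
        ((hslice hGs t ht).mdifferentiable (by simp) _)) rfl h2
  refine ⟨ε₁, min_le_left _ _, hεa, ⟨hε₁0, hsm, ⟨K₁ ∪ K₂, hK₁.union hK₂, hsupp⟩, fun ε hε t ht =>
    ⟨_, _, ⟨⟨?_, ⟨K₁ ∪ K₂, hK₁.union hK₂, hsupp ε hε⟩⟩, fun x => ?_, (hham ε hε).1, (hham ε hε).2⟩,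
    t, ht, rfl⟩, fun ε hε x => ?_, fun ε hε x => ?_, fun t ht x => ?_⟩, hham⟩
  · exact hsm.comp (f := fun q : ℝ × M => (ε, q)) (contMDiffOn_const.prodMk contMDiffOn_id)
      fun q hq => ⟨hε, hq⟩
  · simp only [Diffeomorph.coe_trans, Function.comp_apply, ha0, mul_zero, hψ.zero]
    exact (hv.start ε (hsub ε hε) x).trans (hf.zero x)
  · simp only [Diffeomorph.coe_trans, Function.comp_apply, ha0, mul_zero, hψ.zero]
    exact hv.start ε (hsub ε hε) x
  · simp only [Diffeomorph.coe_trans, Function.comp_apply, ha1, mul_zero, hψ.zero]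
    exact hv.finish ε (hsub ε hε) x
  · simp only [Diffeomorph.coe_trans, Function.comp_apply, zero_mul, hψ.zero]
    exact hv.base t ht x

end Composition

end FlowVariation

section Envelope

variable {M : Type*} [TopologicalSpace M] {h : ℝ → M → ℝ} {k : M → ℝ} {S : Set M} {X : ℝ → M}

theorem IsUniqueMax.le {H : M → ℝ} {p : M} (hp : IsUniqueMax H p) (x : M) : H x ≤ H p := by
  by_cases hx : x = p
  · rw [hx]
  · exact (hp x hx).le

theorem IsUniqueMax.eq {H : M → ℝ} {p q : M} (hp : IsUniqueMax H p) (hq : H p ≤ H q) : q = p :=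
  by_contra fun hne => (hp q hne).not_ge hq

theorem IsUniqueMax.iSup_eq {H : M → ℝ} {p : M} (hp : IsUniqueMax H p) : ⨆ x, H x = H p :=
  have : Nonempty M := ⟨p⟩
  le_antisymm (ciSup_le hp.le) (le_ciSup ⟨H p, forall_mem_range.2 hp.le⟩ p)

theorem IsUniqueMin.neg {H : M → ℝ} {p : M} (hp : IsUniqueMin H p) :
    IsUniqueMax (fun x => -H x) p := fun y hy => neg_lt_neg (hp y hy)

theorem osc_eq_sub {H : M → ℝ} {p q : M} (hp : IsUniqueMax H p) (hq : IsUniqueMin H q) :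
    osc H = H p - H q := by
  rw [osc, hp.iSup_eq, ← neg_neg (⨅ x, H x), ← iSup_neg_eq, hq.neg.iSup_eq, neg_neg]

theorem continuous_iSup_of_isCompact (hc : Continuous fun q : ℝ × M => h q.1 q.2) (hS : IsCompact S)
    (hSM : ∀ x, ∃ y ∈ S, ∀ t, h t y = h t x) : Continuous fun t => ⨆ x, h t x := by
  have h1 : ∀ t, h t '' S = range (h t) := fun t =>
    (image_subset_range _ _).antisymm (range_subset_iff.2 fun x => by
      obtain ⟨y, hy, hyx⟩ := hSM x
      exact ⟨y, hy, hyx t⟩)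
  have h2 := hS.continuous_sSup (f := h) hc
  simpa only [h1, sSup_range] using h2

theorem continuous_argmax (hc : Continuous fun q : ℝ × M => h q.1 q.2) (hS : IsCompact S) (hSM : ∀
    x, ∃ y ∈ S, ∀ t, h t y = h t x) (hX : ∀ t, IsUniqueMax (h t) (X t)) : Continuous X := by
  have hXS : ∀ t, X t ∈ S := fun t => by
    obtain ⟨y, hy, hyx⟩ := hSM (X t)
    rwa [(hX t).eq (hyx t).ge] at hy
  refine continuous_iff_continuousAt.2 fun t₀ U hU => mem_map.2 ?_
  obtain ⟨V, hVU, hV, hVX⟩ := mem_nhds_iff.1 hU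
  have h1 := eventually_lt_of_isCompact (hS.diff hV) (x₀ := t₀) univ_mem (g := fun q => h q.1 q.2 -
    h q.1 (X t₀)) (a := 0) (by fun_prop) fun x hx => sub_neg.2 (hX t₀ x fun hxe => hx.2 (hxe ▸ hVX))
  filter_upwards [h1] with t ht
  by_contra hn
  exact absurd (ht (X t) ⟨hXS t, fun hv => hn (hVU hv)⟩) (sub_nonneg.2 ((hX t).le _)).not_gt

/-- A uniform envelope estimate for the maximum of `h t + s k`. -/
theorem exists_add_mul_le (hc : Continuous fun q : ℝ × M => h q.1 q.2) (hk : Continuous k) (hS :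
    IsCompact S) (hSM : ∀ x, ∃ y ∈ S, (∀ t, h t y = h t x) ∧ k y = k x) (hX : ∀ t, IsUniqueMax (h t)
    (X t)) {η : ℝ} (hη : 0 < η) : ∃ s₀ > 0, ∀ t ∈ 𝕀, ∀ s, |s| < s₀ → ∀ x, h t x + s * k x ≤ h t (X
    t) + s * k (X t) + |s| * η := by
  have hXc : Continuous X := continuous_argmax hc hS (fun x => by
    obtain ⟨y, hy, h1, -⟩ := hSM x
    exact ⟨y, hy, h1⟩) hX
  obtain ⟨B, hB⟩ := hS.exists_bound_of_continuousOn hk.continuousOn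
  have hkB : ∀ x, |k x| ≤ B := fun x => by
    obtain ⟨y, hy, -, h1⟩ := hSM x
    exact h1 ▸ hB y hy
  have hB0 : 0 ≤ B := (abs_nonneg _).trans (hkB (X 0))
  have hZ : IsCompact ((𝕀 ×ˢ S) ∩ {q : ℝ × M | η ≤ |k q.2 - k (X q.1)|}) :=
    (isCompact_Icc.prod hS).inter_right (isClosed_le (by fun_prop) (by fun_prop))
  have hcX : Continuous fun q : ℝ × M => h q.1 (X q.1) - h q.1 q.2 :=
    (hc.comp (continuous_fst.prodMk (hXc.comp continuous_fst))).sub hc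
  obtain ⟨c, hc0, hcZ⟩ := hZ.exists_forall_le' hcX.continuousOn (a := 0) (by
    rintro ⟨t, x⟩ ⟨-, hq⟩
    refine sub_pos.2 (hX t x fun hx => ?_)
    simp only [mem_ofPred_eq, hx, sub_self, abs_zero] at hq
    linarith)
  refine ⟨c / (2 * B + 1), by positivity, fun t ht s hs x => ?_⟩
  rw [lt_div_iff₀ (by positivity)] at hs
  have h3 : s * k x - s * k (X t) ≤ |s| * |k x - k (X t)| := by
    rw [← mul_sub, ← abs_mul]; exact le_abs_self _
  obtain ⟨y, hy, hyx, hky⟩ := hSM x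
  by_cases hq : η ≤ |k x - k (X t)|
  · have h1 := hcZ (t, y) ⟨⟨ht, hy⟩, by simpa only [mem_ofPred_eq, hky] using hq⟩
    simp only [hyx] at h1
    have h4 : |k x - k (X t)| ≤ 2 * B := (abs_sub _ _).trans (by linarith [hkB x, hkB (X t)])
    nlinarith [abs_nonneg s]
  · nlinarith [(hX t).le x, abs_nonneg s]

end Envelope

/-- The lemma of du Bois-Reymond. -/
theorem eq_of_forall_integral_deriv_mul {κ : ℝ → ℝ} (hκ : Continuous κ)
    (h : ∀ a : ℝ → ℝ, ContDiff ℝ ∞ a → a 0 = 0 → a 1 = 0 → ∫ t in 0..1, deriv a t * κ t = 0)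
    {s t : ℝ} (hs : s ∈ 𝕀) (ht : t ∈ 𝕀) : κ s = κ t := by
  set m := ∫ t in 0..1, κ t with hm
  have h1 : ∀ᵐ t ∂volume, t ∈ Ioo (0 : ℝ) 1 → κ t - m = 0 := by
    refine isOpen_Ioo.ae_eq_zero_of_integral_contDiff_smul_eq_zero
      ((hκ.sub continuous_const).locallyIntegrable.locallyIntegrableOn _) fun g hg _ hgs => ?_
    set c := ∫ t in 0..1, g t with hc
    have hd : ∀ t, HasDerivAt (fun t => (∫ r in 0..t, g r) - t * c) (g t - c) t := fun t =>
      ((intervalIntegral.integral_hasDerivAt_right (hg.continuous.intervalIntegrable _ _)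
      (hg.continuous.stronglyMeasurableAtFilter _ _) hg.continuous.continuousAt).sub ((hasDerivAt_id
      t).mul_const c)).congr_deriv (by ring)
    have h2 := h (fun t => (∫ r in 0..t, g r) - t * c)
      (contDiff_infty_iff_deriv.2 ⟨fun t => (hd t).differentiableAt, by
        rw [show deriv _ = _ from funext fun t => (hd t).deriv]; exact hg.sub contDiff_const⟩)
      (by simp) (by simp [hc])
    simp only [fun t => (hd t).deriv] at h2
    have hi : ∀ {u : ℝ → ℝ}, Continuous u → IntervalIntegrable u volume 0 1 := fun hu =>
      hu.intervalIntegrable _ _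
    have h3 : ∫ t in 0..1, g t * (κ t - m) = 0 := by
      simp only [sub_mul] at h2
      rw [intervalIntegral.integral_sub (f := fun t => g t * κ t) (hi (hg.continuous.mul hκ)) (hi
        (hκ.const_mul c)), intervalIntegral.integral_const_mul] at h2
      simp only [mul_sub]
      rw [intervalIntegral.integral_sub (f := fun t => g t * κ t) (hi (hg.continuous.mul hκ))
        (hi (hg.continuous.mul_const m)), intervalIntegral.integral_mul_const]
      exact h2
    rw [← h3, intervalIntegral.integral_of_le zero_le_one]
    refine (setIntegral_eq_integral_of_forall_compl_eq_zero fun t ht => ?_).symm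
    rw [image_eq_zero_of_notMem_tsupport fun h => ht (Ioo_subset_Ioc_self (hgs h)), zero_smul]
  have h2 : EqOn κ (fun _ => m) 𝕀 := by
    refine Measure.eqOn_Icc_of_ae_eq volume zero_ne_one ?_ hκ.continuousOn continuousOn_const
    rw [← Measure.restrict_congr_set Ioo_ae_eq_Icc, EventuallyEq, ae_restrict_iff' measurableSet_Ioo]
    filter_upwards [h1] with t ht hti using sub_eq_zero.1 (ht hti)
  rw [h2 hs, h2 ht]

section Geodesic

variable [IsManifold (𝓡 (2 * n)) ∞ M] [MeasurableSpace M] [ConnectedSpace M] [T2Space M]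
  [SecondCountableTopology M] [BorelSpace M] {k : M → ℝ} {ψ : ℝ → Diffeo n M} {X Y : ℝ → M}

/-- Compactly supported functions are normalized up to a constant. -/
theorem exists_normalized_add (Ω : SymplecticForm n M) (hk : Continuous k) {K : Set M} (hK :
    IsCompact K) (hk0 : ∀ x ∉ K, k x = 0) : ∃ C : ℝ, (CompactSpace M → ∫ x, (k x + C) ∂(liouville Ω)
    = 0) ∧ (¬ CompactSpace M → ∃ K : Set M, IsCompact K ∧ ∀ x ∉ K, k x + C = 0) := by
  by_cases hM : CompactSpace M
  · have := isFiniteMeasure_liouville Ω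
    have hi : Integrable k (liouville Ω) :=
      hk.integrable_of_hasCompactSupport (HasCompactSupport.of_compactSpace _)
    have hne : (liouville Ω).real univ ≠ 0 := by
      rw [Measure.real, ENNReal.toReal_ne_zero]
      exact ⟨liouville_univ_ne_zero Ω, measure_ne_top _ _⟩
    refine ⟨-(∫ x, k x ∂(liouville Ω)) / (liouville Ω).real univ, fun _ => ?_, fun h => (h hM).elim⟩
    rw [integral_add hi (integrable_const _), integral_const, smul_eq_mul, mul_div_cancel₀ _ hne,
      add_neg_cancel]
  · exact ⟨0, fun h => (hM h).elim, fun _ => ⟨K, hK, fun x hx => by rw [hk0 x hx, add_zero]⟩⟩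

theorem exists_isCompact_forall_eq {h : ℝ → M → ℝ} (hh : ¬ CompactSpace M → ∃ K : Set M, IsCompact K
    ∧ ∀ t, ∀ x ∉ K, h t x = 0) (hk : ¬ CompactSpace M → ∃ K : Set M, IsCompact K ∧ ∀ x ∉ K, k x = 0)
    : ∃ S : Set M, IsCompact S ∧ ∀ x, ∃ y ∈ S, (∀ t, h t y = h t x) ∧ k y = k x := by
  by_cases hM : CompactSpace M
  · exact ⟨univ, isCompact_univ, fun x => ⟨x, mem_univ x, fun _ => rfl, rfl⟩⟩
  · obtain ⟨K, hK, hK0⟩ := hh hM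
    obtain ⟨L, hL, hL0⟩ := hk hM
    obtain ⟨z, hz⟩ : ∃ z, z ∉ K ∪ L := by
      by_contra! hn
      exact hM ⟨(eq_univ_of_forall hn) ▸ hK.union hL⟩
    refine ⟨insert z (K ∪ L), (hK.union hL).insert z, fun x => ?_⟩
    by_cases hx : x ∈ K ∪ L
    · exact ⟨x, mem_insert_of_mem z hx, fun _ => rfl, rfl⟩
    · simp only [mem_union, not_or] at hx hz
      exact ⟨z, mem_insert _ _, fun t => by rw [hK0 t z hz.1, hK0 t x hx.1],
        by rw [hL0 z hz.2, hL0 x hx.2]⟩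

theorem osc_comp (ψ : Diffeo n M) (H : M → ℝ) : osc (fun x => H (ψ x)) = osc H :=
  congrArg₂ (fun a b : ℝ => a - b) (ψ.toEquiv.iSup_comp (g := H)) (ψ.toEquiv.iInf_comp (g := H))

theorem IsGeodesic.integral_eq_zero (hgeo : IsGeodesic Ω f F) (hf : IsHamiltonianFlow Ω f F) (hψ :
    IsHamFlow Ω k ψ) (hkm : CompactSpace M → ∫ x, k x ∂(liouville Ω) = 0) (hkc : ¬ CompactSpace M →
    ∃ K : Set M, IsCompact K ∧ ∀ x ∉ K, k x = 0) {h : ℝ → M → ℝ} (hh : ∀ t ∈ 𝕀, h t = F t) (hc :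
    Continuous fun q : ℝ × M => h q.1 q.2) {S : Set M} (hS : IsCompact S) (hSM : ∀ x, ∃ y ∈ S, (∀ t,
    h t y = h t x) ∧ k y = k x) (hX : ∀ t, IsUniqueMax (h t) (X t)) (hY : ∀ t, IsUniqueMin (h t) (Y
    t)) {a : ℝ → ℝ} (ha : ContDiff ℝ ∞ a) (ha0 : a 0 = 0) (ha1 : a 1 = 0) : ∫ t in 0..1, deriv a t *
    (k (X t) - k (Y t)) = 0 := by
  have hSM' : ∀ x, ∃ y ∈ S, ∀ t, h t y = h t x := fun x => by
    obtain ⟨y, hy, h1, -⟩ := hSM x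
    exact ⟨y, hy, h1⟩
  have hk : Continuous k := hψ.ham.continuous
  have hXc := continuous_argmax hc hS hSM' hX
  have hYc := continuous_argmax (h := fun t x => -h t x) hc.neg hS
    (fun x => by simpa only [neg_inj] using hSM' x) fun t => (hY t).neg
  obtain ⟨ε₁, -, hεa, hv, hΦ⟩ := hf.isVariation.1.comp_flow hf hf.isVariation.2 hψ hkm hkc
    ha.contDiffOn ha0 ha1
  obtain ⟨u, δ, C, hδ, hC, -, hu, hu0⟩ := hgeo.critical _ _ _ hv hΦ
  have hb : Continuous (deriv a) := ha.continuous_deriv (by simp)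
  obtain ⟨B, hB⟩ := isCompact_Icc.exists_bound_of_continuousOn (s := 𝕀) hb.continuousOn
  have hB0 : 0 ≤ B := (norm_nonneg _).trans (hB 0 (by simp))
  have hI : ∀ {u : ℝ → ℝ}, Continuous u → IntervalIntegrable u volume 0 1 := fun hu =>
    hu.intervalIntegrable _ _
  have hosc : ∀ ε, Continuous fun t => osc (fun x => h t x + ε * deriv a t * k x) := fun ε => by
    have h1 : Continuous fun q : ℝ × M => h q.1 q.2 + ε * deriv a q.1 * k q.2 := by fun_prop
    have h2 : ∀ x, ∃ y ∈ S, ∀ t, h t y + ε * deriv a t * k y = h t x + ε * deriv a t * k x :=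
      fun x => by
        obtain ⟨y, hy, h1, h2⟩ := hSM x
        exact ⟨y, hy, fun t => by rw [h1, h2]⟩
    have h3 := continuous_iSup_of_isCompact (h := fun t x => -(h t x + ε * deriv a t * k x))
      h1.neg hS fun x => by simpa only [neg_inj] using h2 x
    simp only [iSup_neg_eq] at h3
    refine ((continuous_iSup_of_isCompact (h := fun t x => h t x + ε * deriv a t * k x) h1 hS
      h2).add h3).congr fun t => (sub_eq_add_neg _ _).symm
  have hlen : ∀ ε ∈ Ioo (-ε₁) ε₁, length (fun ε t x => ε * derivWithin a 𝕀 t * k x +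
      F t (ψ (-(ε * a t)) x)) ε = ∫ t in 0..1, osc (fun x => h t x + ε * deriv a t * k x) := by
    intro ε hε
    refine integral_congr_unit fun t ht => ?_
    rw [← osc_comp (ψ (-(ε * a t))) (fun x => h t x + ε * deriv a t * k x)]
    refine congrArg osc (funext fun x => ?_)
    simp only
    rw [hψ.ham_apply (neg_mem_Ioo_one (hεa ε hε t ht)), hh t ht,
      (ha.differentiable (by simp) t).derivWithin (uniqueDiffOn_unit t ht), add_comm]
  set J := ∫ t in 0..1, deriv a t * (k (X t) - k (Y t)) with hJ
  have hD : Continuous fun t => deriv a t * (k (X t) - k (Y t)) := by fun_prop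
  set ℓ := length (fun ε t x => ε * derivWithin a 𝕀 t * k x + F t (ψ (-(ε * a t)) x)) with hℓ
  have hlow : ∀ ε ∈ Ioo (-δ) δ, ℓ 0 - C * ε ^ 2 ≤ ℓ ε := by
    intro ε hε
    have h1 := hu 0 ⟨neg_lt_zero.2 hδ, hδ⟩
    have h2 := abs_le.1 (hu ε hε)
    rw [zero_pow two_ne_zero, mul_zero] at h1
    have h3 := abs_le.1 h1
    linarith [hu0 ε hε]
  have hup : ∀ η > 0, ∃ r > 0, ∀ ε, |ε| < r → ε ∈ Ioo (-ε₁) ε₁ →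
      ℓ ε ≤ ℓ 0 + ε * J + 2 * |ε| * B * η := by
    intro η hη
    obtain ⟨r₁, hr₁, h1⟩ := exists_add_mul_le hc hk hS hSM hX hη
    obtain ⟨r₂, hr₂, h2⟩ := exists_add_mul_le (h := fun t x => -h t x) hc.neg hk hS
      (fun x => by simpa only [neg_inj] using hSM x) (fun t => (hY t).neg) hη
    refine ⟨Min.min r₁ r₂ / (B + 1), by positivity, fun ε hε hε₁ => ?_⟩
    rw [lt_div_iff₀ (by positivity)] at hε
    have h0 : ℓ 0 = ∫ t in 0..1, osc (h t) := by
      rw [hlen 0 ⟨by linarith [hv.pos], hv.pos⟩]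
      simp
    have hosc0 : Continuous fun t => osc (h t) := by simpa using hosc 0
    rw [hlen ε hε₁, h0, hJ, ← intervalIntegral.integral_const_mul,
      show 2 * |ε| * B * η = ∫ t in 0..1, 2 * |ε| * B * η by simp,
      ← intervalIntegral.integral_add (hI hosc0) (hI (hD.const_mul ε)),
      ← intervalIntegral.integral_add
        (f := fun t => osc (h t) + ε * (deriv a t * (k (X t) - k (Y t))))
        (hI (hosc0.add (hD.const_mul ε))) (hI continuous_const)]
    refine intervalIntegral.integral_mono_on zero_le_one (hI (hosc ε))
      (hI ((hosc0.add (hD.const_mul ε)).add continuous_const)) fun t ht => ?_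
    have hs : |ε * deriv a t| ≤ |ε| * B := by
      rw [abs_mul]; exact mul_le_mul_of_nonneg_left (hB t ht) (abs_nonneg ε)
    have hs' : |ε * deriv a t| < Min.min r₁ r₂ := by nlinarith [abs_nonneg ε]
    have h3 := h1 t ht _ (hs'.trans_le (min_le_left _ _))
    have h4 := h2 t ht (-(ε * deriv a t)) (by rw [abs_neg]; exact hs'.trans_le (min_le_right _ _))
    rw [abs_neg] at h4
    rw [osc_eq_sub (hX t) (hY t), osc]
    have h5 : ⨆ x, (h t x + ε * deriv a t * k x) ≤ _ := ciSup_le h3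
    have h6 : _ ≤ ⨅ x, (h t x + ε * deriv a t * k x) := le_ciInf fun x =>
      show h t (Y t) + ε * deriv a t * k (Y t) - |ε * deriv a t| * η ≤ _ by linarith [h4 x]
    nlinarith
  by_contra hne
  have hJ0 : 0 < |J| := abs_pos.2 hne
  obtain ⟨r, hr, hrJ⟩ := hup (|J| / (4 * (B + 1))) (by positivity)
  set s := Min.min (Min.min δ ε₁) (Min.min r (|J| / (4 * C))) / 2 with hs
  have hε₁ := hv.pos
  have hs1 : 0 < Min.min (Min.min δ ε₁) (Min.min r (|J| / (4 * C))) := by positivity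
  have hsδ : s < δ := (half_lt_self hs1).trans_le ((min_le_left _ _).trans (min_le_left _ _))
  have hsε : s < ε₁ := (half_lt_self hs1).trans_le ((min_le_left _ _).trans (min_le_right _ _))
  have hsr : s < r := (half_lt_self hs1).trans_le ((min_le_right _ _).trans (min_le_left _ _))
  have hsC : s < |J| / (4 * C) :=
    (half_lt_self hs1).trans_le ((min_le_right _ _).trans (min_le_right _ _))
  rw [lt_div_iff₀ (by positivity)] at hsC
  have hs0 : 0 < s := half_pos hs1
  obtain ⟨σ, hσ, hσJ⟩ : ∃ σ : ℝ, |σ| = 1 ∧ σ * J = -|J| := by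
    rcases abs_cases J with ⟨h1, -⟩ | ⟨h1, -⟩
    · exact ⟨-1, by simp, by rw [h1]; ring⟩
    · exact ⟨1, by simp, by rw [h1]; ring⟩
  have hsσ : |s * σ| = s := by rw [abs_mul, hσ, mul_one, abs_of_pos hs0]
  have h1 := hlow (s * σ) (abs_lt.1 (hsσ.trans_lt hsδ))
  have h2 := hrJ (s * σ) (hsσ.trans_lt hsr) (abs_lt.1 (hsσ.trans_lt hsε))
  rw [hsσ, mul_assoc s, hσJ] at h2
  rw [← sq_abs, hsσ] at h1
  have h3 : 2 * s * B * (|J| / (4 * (B + 1))) ≤ s * |J| / 2 := by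
    rw [mul_div_assoc', div_le_div_iff₀ (by positivity) two_pos]
    nlinarith [mul_pos hs0 hJ0]
  nlinarith [mul_pos hs0 hJ0]

end Geodesic

section Fixed

variable [IsManifold (𝓡 (2 * n)) ∞ M] [T2Space M]

omit [IsManifold 𝓜 ∞ M] [T2Space M] in
theorem IsUniqueMax.fderiv_eq_zero {H : M → ℝ} (hp : IsUniqueMax H p) :
    fderiv ℝ (H ∘ (𝓔 p).symm) (𝓔 p p) = 0 := by
  refine IsLocalMax.fderiv_eq_zero (Eventually.of_forall fun y => ?_)
  simpa only [Function.comp_apply, extChartAt_to_inv] using hp.le _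

/-- Hamilton's equation in a chart. -/
theorem Generates.hasDerivWithinAt (hf : IsPath f) (hg : Generates Ω F f) {x₀ p : M} {s : ℝ} (hs : s
    ∈ 𝕀) (hF : ContMDiff 𝓜 𝓘₁ ∞ (F s)) (hp : f s p ∈ (𝓔 x₀).source) : HasDerivWithinAt (fun r => 𝓔
    x₀ (f r p)) (chartSgrad Ω x₀ (𝓔 x₀ (f s p)) (fderiv ℝ (F s ∘ (𝓔 x₀).symm) (𝓔 x₀ (f s p)))) 𝕀 s
    := by
  set e := 𝓔 x₀ with he
  have hγ : MDifferentiableWithinAt 𝓘₁ 𝓜 (fun r => f r p) 𝕀 s := (hf.smooth.comp (f := fun r : ℝ =>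
    (r, p)) (contMDiffOn_id.prodMk contMDiffOn_const) (fun r hr => ⟨hr, mem_univ _⟩) s
    hs).mdifferentiableWithinAt (by simp)
  have hem : MDifferentiableAt 𝓜 𝓘(ℝ, E n) e (f s p) :=
    (contMDiffAt_extChartAt' (by rwa [he, extChartAt_source] at hp)).mdifferentiableAt
      (by simp : (∞ : WithTop ℕ∞) ≠ 0)
  have hc : DifferentiableWithinAt ℝ (fun r => e (f r p)) 𝕀 s :=
    (hem.comp_mdifferentiableWithinAt s hγ).differentiableWithinAt
  have hyt : e (f s p) ∈ e.target := e.map_source hp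
  have hu : UniqueMDiffWithinAt 𝓘₁ 𝕀 s := (uniqueDiffOn_unit s hs).uniqueMDiffWithinAt
  have h1 := mfderiv_comp_mfderivWithin s (mdifferentiableAt_extChartAt_symm hyt)
    hc.mdifferentiableWithinAt hu
  have h2 : (fun r => f r p) =ᶠ[𝓝[𝕀] s] e.symm ∘ fun r => e (f r p) := by
    filter_upwards [hγ.continuousWithinAt ((isOpen_extChartAt_source x₀).mem_nhds hp)] with r hr
    exact (e.left_inv hr).symm
  have h3 := (h2.mfderivWithin_eq (I := 𝓘₁) (I' := 𝓜) (e.left_inv hp).symm)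
  have h4 : (mfderivWithin 𝓘₁ 𝓜 (fun r => f r p) 𝕀 s (1 : ℝ) : E n) = mfderiv 𝓘(ℝ, E n) 𝓜 e.symm (e
      (f s p)) (derivWithin (fun r => e (f r p)) 𝕀 s) := by
    refine congrArg (fun A : ℝ →L[ℝ] E n => A 1) (h3.trans h1) |>.trans ?_
    exact congrArg (mfderiv 𝓘(ℝ, E n) 𝓜 e.symm (e (f s p)) : 𝓛)
      (congrArg (fun A : ℝ →L[ℝ] E n => A 1) (mfderivWithin_eq_fderivWithin))
  have h5 := (isSgradAt_symm_iff Ω hyt (hF.mdifferentiable (by simp) _) _).1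
    ((hg s hs p).congr_point (e.left_inv hp) h4.symm)
  rw [← h5]
  exact hc.hasDerivWithinAt

/-- Hamiltonian flows fix common critical points of their Hamiltonians. -/
theorem IsPath.eq_self_of_fderiv_eq_zero (hf : IsPath f) (h0 : ∀ x, f 0 x = x) (hg : Generates Ω F
    f) (hF : ContMDiffOn 𝓣 𝓘₁ ∞ (fun q : ℝ × M => F q.1 q.2) (𝕀 ×ˢ univ)) (hp : ∀ t ∈ 𝕀, fderiv ℝ (F
    t ∘ (𝓔 p).symm) (𝓔 p p) = 0) : ∀ t ∈ 𝕀, f t p = p := by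
  set e := 𝓔 p with he
  have hto : IsOpen e.target := isOpen_extChartAt_target p
  have hze : e p ∈ e.target := mem_extChartAt_target (I := 𝓜) p
  have hFt : ∀ t ∈ 𝕀, ContMDiff 𝓜 𝓘₁ ∞ (F t) := fun t ht => contMDiffOn_univ.1 (hF.comp (f := fun x
    : M => (t, x)) (contMDiffOn_const.prodMk contMDiffOn_id) fun x _ => ⟨ht, mem_univ x⟩)
  set V : ℝ × E n → E n := fun q => chartSgrad Ω p q.2 (fderiv ℝ (F q.1 ∘ e.symm) q.2) with hV
  have hVs : 𝒞 V (𝕀 ×ˢ e.target) := by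
    refine contDiffOn_chartSgrad Ω p contDiffOn_snd (fun q hq => hq.2) fun q hq => ?_
    have h1 : 𝒞 (fun q : (ℝ × E n) × E n => F q.1.1 (e.symm q.2))
        ((𝕀 ×ˢ e.target) ×ˢ e.target) := by
      refine contMDiffOn_iff_contDiffOn.1 ?_
      have h2 : ContMDiffOn 𝓘(ℝ, (ℝ × E n) × E n) 𝓜 ∞ (fun q => e.symm q.2) ((𝕀 ×ˢ e.target) ×ˢ
        e.target) := (contMDiffOn_extChartAt_symm p).comp contDiff_snd.contMDiff.contMDiffOn fun q
        hq => hq.2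
      exact hF.comp ((contDiff_fst.comp contDiff_fst).contMDiff.contMDiffOn.prodMk h2)
        fun q hq => ⟨hq.1.1, mem_univ _⟩
    refine (ContDiffWithinAt.fderivWithin (n := ∞) (m := ∞)
      (f := fun (q : ℝ × E n) y => F q.1 (e.symm y)) (g := Prod.snd) (h1 (q, q.2) ⟨hq, hq.2⟩)
      contDiffWithinAt_snd hto.uniqueDiffOn (by simp) hq fun q hq => hq.2).congr_of_mem
      (fun q hq => (fderivWithin_of_isOpen hto hq.2).symm) hq
  obtain ⟨ρ, hρ, hρt⟩ := Metric.isOpen_iff.1 hto _ hze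
  have hγ : ContinuousOn (fun t => f t p) 𝕀 :=
    hf.smooth.continuousOn.comp (f := fun t : ℝ => (t, p)) (by fun_prop) fun t ht => ⟨ht, mem_univ _⟩
  have hcl : IsClosed ({t | f t p = p} ∩ 𝕀) := by
    rw [inter_comm]; exact hγ.preimage_isClosed_of_isClosed isClosed_Icc isClosed_singleton
  refine fun t ht => hcl.Icc_subset_of_forall_exists_gt (h0 p) ?_ ht
  rintro t ⟨htp, ht⟩ y hy
  have htp' : f t p = p := htp
  have htI := Ico_subset_Icc_self ht
  have hcv : Convex ℝ (𝕀 ×ˢ ball (e p) ρ) := (convex_Icc _ _).prod (convex_ball _ _)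
  obtain ⟨L, W, hW, hL⟩ := (((hVs.mono (prod_mono_right hρt)) (t, e p)
    ⟨htI, mem_ball_self hρ⟩).of_le (by simp : (1 : WithTop ℕ∞) ≤ ∞)).exists_lipschitzOnWith hcv
  rw [nhdsWithin_prod_eq, Metric.isOpen_ball.nhdsWithin_eq (mem_ball_self hρ)] at hW
  obtain ⟨A, hA, B, hB, hAB⟩ := mem_prod_iff.1 hW
  have hec : ContinuousAt e (f t p) := by rw [htp']; exact continuousAt_extChartAt p
  have h1 : ∀ᶠ s in 𝓝[𝕀] t, s ∈ A ∧ f s p ∈ e.source ∧ e (f s p) ∈ B := by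
    refine inter_mem hA (inter_mem (hγ t htI ?_) (ContinuousAt.comp_continuousWithinAt
      (f := fun t => f t p) hec (hγ t htI) ?_))
    · exact (isOpen_extChartAt_source p).mem_nhds (by simp only [htp', mem_extChartAt_source])
    · rwa [Function.comp_apply, htp']
  obtain ⟨r, hr, hrA⟩ := Metric.mem_nhdsWithin_iff.1 h1
  set b := Min.min (Min.min y 1) (t + r / 2) with hb
  have htb : t < b := lt_min (lt_min hy ht.2) (by linarith)
  have hb1 : b ≤ 1 := (min_le_left _ _).trans (min_le_right _ _)
  have hsA : ∀ s ∈ Icc t b, s ∈ A ∧ f s p ∈ e.source ∧ e (f s p) ∈ B := fun s hs => hrA ⟨by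
      rw [mem_ball, Real.dist_eq, abs_of_nonneg (by linarith [hs.1])]
      linarith [hs.2, min_le_right (Min.min y 1) (t + r / 2)], ht.1.trans hs.1, hs.2.trans hb1⟩
  have hd : ∀ s ∈ Icc t b, HasDerivWithinAt (fun s => e (f s p)) (V (s, e (f s p))) 𝕀 s := fun s hs
    => hg.hasDerivWithinAt hf ⟨ht.1.trans hs.1, hs.2.trans hb1⟩ (hFt s ⟨ht.1.trans hs.1, hs.2.trans
    hb1⟩) (hsA s hs).2.1
  have huniq := ODE_solution_unique_of_mem_Icc_right (v := fun s x => V (s, x)) (s := fun _ => B)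
    (K := L) (f := fun s => e (f s p)) (g := fun _ => e p) (a := t) (b := b)
    (fun s hs x hx x' hx' => by
      have hm : ∀ x ∈ B, (s, x) ∈ W := fun x hx => hAB ⟨(hsA s (Ico_subset_Icc_self hs)).1, hx⟩
      have h2 := hL (hm x hx) (hm x' hx')
      rwa [Prod.edist_eq, edist_self, max_eq_right (zero_le)] at h2)
    (fun s hs => (hd s hs).continuousWithinAt.mono (Icc_subset_Icc ht.1 hb1))
    (fun s hs => (hd s (Ico_subset_Icc_self hs)).mono_of_mem_nhdsWithin
      (mem_of_superset (Icc_mem_nhdsGE (hs.2.trans_le hb1)) (Icc_subset_Icc_left (ht.1.trans hs.1))))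
    (fun s hs => (hsA s (Ico_subset_Icc_self hs)).2.2)
    continuousOn_const
    (fun s hs => by
      have h3 : V (s, e p) = 0 := by
        simp only [hV, chartSgrad]
        rw [hp s ⟨ht.1.trans hs.1, hs.2.le.trans hb1⟩, map_zero, neg_zero]
      rw [h3]; exact hasDerivWithinAt_const _ _ _)
    (fun s _ => mem_of_mem_nhds hB) (congrArg e htp')
  refine ⟨b, ?_, htb, (min_le_left _ _).trans (min_le_left _ _)⟩
  have h4 := huniq (right_mem_Icc.2 htb.le)
  exact e.injOn (hsA b (right_mem_Icc.2 htb.le)).2.1 (mem_extChartAt_source p) h4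

end Fixed

section Extrema

variable [IsManifold (𝓡 (2 * n)) ∞ M] [T2Space M]

theorem eq_of_bump_sub_eq {X Y : ℝ → M} {s t : ℝ} (hXY : X s ≠ Y s) (h : ∀ χ : SmoothBumpFunction 𝓜
    (X s), χ (X s) - χ (Y s) = χ (X t) - χ (Y t)) : X t = X s := by
  by_contra hne
  obtain ⟨χ, -, hχ⟩ := (SmoothBumpFunction.nhds_basis_tsupport (I := 𝓜) (X s)).mem_iff.1
    (((isClosed_singleton (x := X t)).union (isClosed_singleton (x := Y s))).isOpen_compl.mem_nhds
    (x := X s) (by simp [hXY, Ne.symm hne]))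
  have h1 := h χ
  have h0 : ∀ y, y = X t ∨ y = Y s → χ y = 0 := fun y hy =>
    image_eq_zero_of_notMem_tsupport fun hs => hχ hs (by simpa using hy.symm)
  have h2 : χ (X s) = 1 := χ.eventuallyEq_one.eq_of_nhds
  rw [h0 _ (Or.inl rfl), h0 _ (Or.inr rfl), h2] at h1
  linarith [χ.nonneg (x := Y t)]

variable [MeasurableSpace M] [ConnectedSpace M] [SecondCountableTopology M] [BorelSpace M]

/-- The extremum points of a nondegenerate geodesic are fixed. -/
theorem IsGeodesic.exists_isFixedMax (hgeo : IsGeodesic Ω f F) (hf : IsHamiltonianFlow Ω f F)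
    (hnd : HasNondegenerateExtrema n F) :
    ∃ xp xm : M, IsFixedMax f F xp ∧ IsFixedMax f (fun t x => -F t x) xm := by
  have hX : ∀ t, ∃ x, t ∈ 𝕀 → IsUniqueMax (F t) x ∧
      HessianNondegenerate (n := n) (F t) x := fun t => by
    by_cases ht : t ∈ 𝕀
    · obtain ⟨x, hx⟩ := (hnd t ht).1
      exact ⟨x, fun _ => hx⟩
    · exact ⟨Classical.arbitrary M, fun h => (ht h).elim⟩
  have hY : ∀ t, ∃ x, t ∈ 𝕀 → IsUniqueMin (F t) x ∧
      HessianNondegenerate (n := n) (F t) x := fun t => by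
    by_cases ht : t ∈ 𝕀
    · obtain ⟨x, hx⟩ := (hnd t ht).2
      exact ⟨x, fun _ => hx⟩
    · exact ⟨Classical.arbitrary M, fun h => (ht h).elim⟩
  choose X hX using hX
  choose Y hY using hY
  set π : ℝ → ℝ := fun t => projIcc (0 : ℝ) 1 zero_le_one t with hπ
  have hπI : ∀ t, π t ∈ 𝕀 := fun t => (projIcc (0 : ℝ) 1 zero_le_one t).2
  have hπt : ∀ t ∈ 𝕀, π t = t := fun t ht => by
    simp only [hπ, projIcc_of_mem zero_le_one ht]
  have hπc : Continuous π := continuous_subtype_val.comp continuous_projIcc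
  have hc : Continuous fun q : ℝ × M => F (π q.1) q.2 :=
    hf.normalized.smooth.continuousOn.comp_continuous (f := fun q : ℝ × M => (π q.1, q.2)) (by
    fun_prop) fun q => ⟨hπI _, mem_univ _⟩
  have hbump : ∀ (x₀ : M) (χ : SmoothBumpFunction 𝓜 x₀), ∀ s ∈ 𝕀,
      ∀ t ∈ 𝕀, χ (X s) - χ (Y s) = χ (X t) - χ (Y t) := by
    intro x₀ χ s hs t ht
    have hχ0 : ∀ x ∉ tsupport χ, χ x = 0 := fun y hy => image_eq_zero_of_notMem_tsupport hy
    obtain ⟨c, hc0, ψ, hψ, -⟩ := exists_isHamFlow Ω χ.contMDiff χ.hasCompactSupport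
      χ.tsupport_subset_extChartAt_source hχ0
    obtain ⟨C, hC, hC'⟩ := exists_normalized_add Ω hψ.ham.continuous χ.hasCompactSupport
      fun x hx => by rw [hχ0 x hx, mul_zero]
    obtain ⟨S, hS, hSM⟩ := exists_isCompact_forall_eq (h := fun t => F (π t)) (fun hM => by
      obtain ⟨K, hK, hK0⟩ := hf.normalized.compact_support hM
      exact ⟨K, hK, fun t x hx => hK0 _ (hπI t) x hx⟩) hC'
    have hSM' : ∀ x, ∃ y ∈ S, ∀ t, F (π t) y = F (π t) x := fun x => by
      obtain ⟨y, hy, h1, -⟩ := hSM x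
      exact ⟨y, hy, h1⟩
    have hX' : ∀ t, IsUniqueMax (F (π t)) (X (π t)) := fun t => (hX _ (hπI t)).1
    have hY' : ∀ t, IsUniqueMin (F (π t)) (Y (π t)) := fun t => (hY _ (hπI t)).1
    have hXc := continuous_argmax (h := fun t => F (π t)) hc hS hSM' hX'
    have hYc := continuous_argmax (h := fun t x => -F (π t) x) hc.neg hS
      (fun x => by simpa only [neg_inj] using hSM' x) fun t => (hY' t).neg
    have hk := (hψ.add_const C).ham.continuous
    have h1 := eq_of_forall_integral_deriv_mul ((hk.comp hXc).sub (hk.comp hYc)) (fun a ha ha0 ha1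
      => hgeo.integral_eq_zero hf (hψ.add_const C) hC hC' (h := fun t => F (π t)) (fun t ht =>
      congrArg F (hπt t ht)) hc hS hSM hX' hY' ha ha0 ha1) hs ht
    simp only [Pi.sub_apply, Function.comp_apply, hπt s hs, hπt t ht, add_sub_add_right_eq_sub, ← mul_sub] at h1
    exact mul_left_cancel₀ hc0.ne' h1
  have h0 : (0 : ℝ) ∈ 𝕀 := by simp
  have hconst : ∀ t ∈ 𝕀, X t = X 0 ∧ Y t = Y 0 := by
    intro t ht
    by_cases hXY : X 0 = Y 0
    · have hsub : ∀ y, y = X 0 := fun y => by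
        by_contra hy
        exact lt_asymm ((hX 0 h0).1 y hy) (by simpa [hXY] using (hY 0 h0).1 y (hXY ▸ hy))
      exact ⟨hsub _, (hsub _).trans (hsub _).symm⟩
    · exact ⟨eq_of_bump_sub_eq hXY fun χ => hbump _ χ 0 h0 t ht,
        eq_of_bump_sub_eq (Ne.symm hXY) fun χ => by linarith [hbump _ χ 0 h0 t ht]⟩
  have hfix : ∀ p, (∀ t ∈ 𝕀, fderiv ℝ (F t ∘ (𝓔 p).symm) (𝓔 p p) = 0) → ∀ t ∈ 𝕀, f t p = p := fun p
    => hf.path.eq_self_of_fderiv_eq_zero hf.zero hf.generates hf.normalized.smooth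
  refine ⟨X 0, Y 0, ⟨fun t ht => ?_, fun t ht => ?_, hfix _ fun t ht => ?_⟩,
    ⟨fun t ht => ?_, fun t ht => ?_, hfix _ fun t ht => ?_⟩⟩
  · exact (hconst t ht).1 ▸ (hX t ht).1
  · exact (hconst t ht).1 ▸ (hX t ht).2
  · exact IsUniqueMax.fderiv_eq_zero (n := n) ((hconst t ht).1 ▸ (hX t ht).1)
  · exact (hconst t ht).2 ▸ (hY t ht).1.neg
  · exact (hconst t ht).2 ▸ (hY t ht).2.neg
  · have h1 := IsUniqueMax.fderiv_eq_zero (n := n) (p := Y 0) ((hconst t ht).2 ▸ (hY t ht).1.neg)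
    have h2 : (fun x => -F t x) ∘ (𝓔 (Y 0)).symm = -(F t ∘ (𝓔 (Y 0)).symm) := rfl
    rw [h2, fderiv_neg, neg_eq_zero] at h1
    exact h1

end Extrema

section Realize

variable [IsManifold (𝓡 (2 * n)) ∞ M] {ψ : ℝ → Diffeo n M} {k : M → ℝ}

theorem IsHamFlow.varField_trans [MeasurableSpace M] (hψ : IsHamFlow Ω k ψ) (hv : IsVariation Ω f ε₀
    φ) (ht : t ∈ 𝕀) (hp : f t p = p) (a : ℝ → ℝ) : varField (fun ε t => (φ ε t).trans (ψ (ε * a t)))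
    p t = a t • velocity ψ 0 p + varField φ p t := by
  have h0 : (0 : ℝ) ∈ Ioo (-ε₀) ε₀ := ⟨by linarith [hv.pos], hv.pos⟩
  have hγ : MDifferentiableAt 𝓘₁ 𝓜 (fun ε => φ ε t p) 0 := ((hv.smooth.comp (f := fun ε : ℝ => (ε,
    t, p)) (contMDiffOn_id.prodMk contMDiffOn_const) fun ε hε => ⟨hε, ht, mem_univ _⟩).contMDiffAt
    (isOpen_Ioo.mem_nhds h0)).mdifferentiableAt (by simp)
  have hσ : HasDerivAt (fun ε => ε * a t) (a t) 0 := by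
    simpa using (hasDerivAt_id (0 : ℝ)).mul_const (a t)
  have h1 := hψ.mfderivWithin_comp (s := univ) (hσ.hasDerivWithinAt) (by simp)
    hγ.mdifferentiableWithinAt uniqueDiffWithinAt_univ (w := varField φ p t)
    (by rw [mfderivWithin_univ]; rfl)
  have h2 : ∀ s x, s = 0 → x = p → a t • velocity ψ s x + tanMap (ψ s) x (varField φ p t) =
      a t • velocity ψ 0 p + varField φ p t := by
    rintro s x rfl rfl
    have h3 : (ψ 0 : M → M) = id := funext hψ.zero
    have h4 : ∀ w : E n, tanMap (ψ 0) x w = w := fun w => by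
      rw [tanMap, h3, mfderiv_id]
      rfl
    rw [h4]
  rw [mfderivWithin_univ] at h1
  exact h1.trans (h2 _ _ (zero_mul _) ((hv.base t ht p).trans hp))

variable [T2Space M]

/-- Hamiltonian flows with prescribed velocity at one point, fixing another point. -/
theorem exists_isHamFlow_velocity (Ω : SymplecticForm n M) {p q : M} (hpq : p ≠ q) (u : E n) : ∃ c >
    (0 : ℝ), ∃ k : M → ℝ, ∃ ψ : ℝ → Diffeo n M, IsHamFlow Ω k ψ ∧ velocity ψ 0 p = c • u ∧ velocity
    ψ 0 q = 0 ∧ ∃ K, IsCompact K ∧ ∀ x ∉ K, k x = 0 := by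
  obtain ⟨χ, -, hχ⟩ := (SmoothBumpFunction.nhds_basis_tsupport (I := 𝓜) p).mem_iff.1
    ((isClosed_singleton (x := q)).isOpen_compl.mem_nhds (x := p) hpq)
  set e := 𝓔 p with he
  have hpt : e p ∈ e.target := mem_extChartAt_target (I := 𝓜) p
  have hpe : e.symm (e p) = p := extChartAt_to_inv (I := 𝓜) p
  set d : E n →L[ℝ] ℝ := -IsFamily.locForm Ω p (e p) u with hd
  set k : M → ℝ := fun x => χ x • d (e x) with hk
  have hks : ContMDiff 𝓜 𝓘₁ ∞ k :=
    χ.contMDiff_smul (d.contDiff.contMDiff.comp_contMDiffOn contMDiffOn_extChartAt)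
  have hk0 : ∀ x ∉ tsupport χ, k x = 0 := fun x hx => by
    simp only [hk, image_eq_zero_of_notMem_tsupport hx, zero_smul]
  obtain ⟨c, hc, ψ, hψ, hfix⟩ := exists_isHamFlow Ω hks χ.hasCompactSupport
    χ.tsupport_subset_extChartAt_source hk0
  refine ⟨c, hc, _, ψ, hψ, ?_, ?_, tsupport χ, χ.hasCompactSupport, fun x hx => by
    rw [hk0 x hx, mul_zero]⟩
  · have h1 : (fun x => c * k x) ∘ e.symm =ᶠ[𝓝 (e p)] fun y => c • d y := by
      have h2 : ∀ᶠ y in 𝓝 (e p), χ (e.symm y) = 1 :=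
        (show ContinuousAt e.symm (e p) from continuousAt_extChartAt_symm p).eventually (by
          rw [hpe]; exact χ.eventuallyEq_one)
      filter_upwards [h2, (isOpen_extChartAt_target p).mem_nhds hpt] with y hy hyt
      simp only [hk, Function.comp_apply, hy, e.right_inv hyt, smul_eq_mul, one_mul]
    have h3 : fderiv ℝ ((fun x => c * k x) ∘ e.symm) (e p) = c • d := by
      rw [h1.fderiv_eq]
      exact (d.hasFDerivAt.const_smul c).fderiv
    have h4 := (isSgradAt_symm_iff Ω hpt (hψ.mdiff_ham _) (velocity ψ 0 p)).1 ((hψ.gen 0 (by simp)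
      p).congr_point (hpe.trans (hψ.zero p).symm) (mfderiv_extChartAt_symm_center p _))
    rw [h4, h3, chartSgrad, map_smul, hd, map_neg]
    obtain ⟨L, hL⟩ := isInvertible_locForm Ω hpt
    rw [← hL]
    simp
  · have h1 : k =ᶠ[𝓝 q] fun _ => 0 := by
      filter_upwards [(isClosed_tsupport χ).isOpen_compl.mem_nhds fun hq => hχ hq rfl] with x hx
      exact hk0 x hx
    have h2 : (fun r => ψ r q) =ᶠ[𝓝 0] fun _ => q := by
      filter_upwards [Ioo_mem_nhds (by norm_num : (-1 : ℝ) < 0) one_pos] with r hr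
      exact hfix q (h1.mfderiv_eq.trans mfderiv_const) r hr
    have h3 := congrArg (fun A : ℝ →L[ℝ] E n => A 1) (h2.mfderiv_eq (I := 𝓘₁) (I' := 𝓜))
    refine h3.trans ?_
    rw [mfderiv_const]
    rfl

variable [MeasurableSpace M] [ConnectedSpace M] [SecondCountableTopology M] [BorelSpace M]

/-- Every loop field at `p` is the field of a variation that is stationary to first order at
another point. -/
theorem IsHamiltonianFlow.exists_isVariation_varField (hf : IsHamiltonianFlow Ω f F) {p q : M} (hpq
    : p ≠ q) (hp : ∀ t ∈ 𝕀, f t p = p) (hq : ∀ t ∈ 𝕀, f t q = q) {v : ℝ → E n} (hv : IsLoopField v)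
    : ∃ ε₀ φ Φ, IsVariation Ω f ε₀ φ ∧ IsHamiltonianOfVariation Ω ε₀ φ Φ ∧ ∀ t ∈ 𝕀, varField φ p t =
    v t ∧ varField φ q t = 0 := by
  have key : ∀ s : Finset (Fin (2 * n)), ∃ ε₀ φ Φ, IsVariation Ω f ε₀ φ ∧ IsHamiltonianOfVariation Ω
      ε₀ φ Φ ∧ ∀ t ∈ 𝕀, varField φ p t = ∑ i ∈ s, v t i • EuclideanSpace.single i (1 : ℝ) ∧ varField
      φ q t = 0 := by
    intro s
    induction s using Finset.induction_on with
    | empty =>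
      refine ⟨1, _, _, hf.isVariation.1, hf.isVariation.2, fun t ht => ?_⟩
      have h1 : ∀ x, varField (fun _ => f) x t = 0 := fun x => by
        rw [varField, mfderiv_const]
        rfl
      exact ⟨h1 p, h1 q⟩
    | insert i s hi ih =>
      obtain ⟨ε₀, φ, Φ, hφ, hΦ, hs⟩ := ih
      obtain ⟨c, hc, k, ψ, hψ, hψp, hψq, K, hK, hK0⟩ := exists_isHamFlow_velocity Ω hpq
        (EuclideanSpace.single i (1 : ℝ))
      obtain ⟨C, hC, hC'⟩ := exists_normalized_add Ω hψ.ham.continuous hK hK0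
      have ha : 𝒞 (fun t => v t i / c) 𝕀 := ((contDiffOn_euclidean.1 hv.1) i).div_const c
      obtain ⟨ε₁, -, -, h1, h2⟩ := hφ.comp_flow hf hΦ (hψ.add_const C) hC hC' ha
        (by simp [hv.2.1]) (by simp [hv.2.2])
      refine ⟨ε₁, _, _, h1, h2, fun t ht => ⟨?_, ?_⟩⟩
      · rw [hψ.varField_trans hφ ht (hp t ht) (fun t => v t i / c), hψp, (hs t ht).1,
          Finset.sum_insert hi, smul_smul, div_mul_cancel₀ _ hc.ne']
      · rw [hψ.varField_trans hφ ht (hq t ht) (fun t => v t i / c), hψq, (hs t ht).2, smul_zero,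
          add_zero]
  obtain ⟨ε₀, φ, Φ, hφ, hΦ, h⟩ := key Finset.univ
  refine ⟨ε₀, φ, Φ, hφ, hΦ, fun t ht => ⟨(h t ht).1.trans ?_, (h t ht).2⟩⟩
  ext j
  simp [Pi.single_apply]

end Realize

section Stability

variable [IsManifold (𝓡 (2 * n)) ∞ M] [T2Space M] [MeasurableSpace M] [ConnectedSpace M]
  [SecondCountableTopology M] [BorelSpace M] {p q : M}

theorem IsNormalized.continuousOn_iSup (hF : IsNormalized Ω F) :
    ContinuousOn (fun t => ⨆ x, F t x) 𝕀 := by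
  set π : ℝ → ℝ := fun t => projIcc (0 : ℝ) 1 zero_le_one t with hπ
  have hπI : ∀ t, π t ∈ 𝕀 := fun t => (projIcc (0 : ℝ) 1 zero_le_one t).2
  have hπc : Continuous π := continuous_subtype_val.comp continuous_projIcc
  have hc : Continuous fun q : ℝ × M => F (π q.1) q.2 := hF.smooth.continuousOn.comp_continuous (f
    := fun q : ℝ × M => (π q.1, q.2)) (by fun_prop) fun q => ⟨hπI _, mem_univ _⟩
  obtain ⟨S, hS, hSM⟩ := exists_isCompact_forall_eq (k := 0) (h := fun t => F (π t)) (fun hM => by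
    obtain ⟨K, hK, hK0⟩ := hF.compact_support hM
    exact ⟨K, hK, fun t x hx => hK0 _ (hπI t) x hx⟩) fun _ => ⟨∅, isCompact_empty, fun _ _ => rfl⟩
  refine (continuous_iSup_of_isCompact (h := fun t => F (π t)) hc hS fun x => by
    obtain ⟨y, hy, h1, -⟩ := hSM x
    exact ⟨y, hy, h1⟩).continuousOn.congr fun t ht => ?_
  simp only [hπ, projIcc_of_mem zero_le_one ht]

theorem IsHamiltonianOfVariation.length_eventuallyEq (hv : 0 < ε₀) (hΦ : IsHamiltonianOfVariation Ω
    ε₀ φ Φ) : length Φ =ᶠ[𝓝 0] lengthPlus Φ + lengthPlus fun ε t x => -Φ ε t x := by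
  filter_upwards [Ioo_mem_nhds (neg_lt_zero.2 hv) hv] with ε hε
  have h1 := (hΦ ε hε).1.continuousOn_iSup
  have h2 := (hΦ ε hε).1.neg.continuousOn_iSup
  rw [← uIcc_unit] at h1 h2
  rw [Pi.add_apply, lengthPlus, lengthPlus, ← intervalIntegral.integral_add h1.intervalIntegrable
    h2.intervalIntegrable]
  refine integral_congr_unit fun t _ => ?_
  simp only [osc, iSup_neg_eq, sub_eq_add_neg]

theorem IsFixedMax.second_variation_length (hp : IsFixedMax f F p) (hq : IsFixedMax f (fun t x => -F
    t x) q) (hf : IsHamiltonianFlow Ω f F) (hv : IsVariation Ω f ε₀ φ) (hΦ :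
    IsHamiltonianOfVariation Ω ε₀ φ Φ) : ContDiffAt ℝ ∞ (length Φ) 0 ∧ deriv (length Φ) 0 = 0 ∧
    deriv (deriv (length Φ)) 0 = Q Ω f p (varField φ p) - Q Ω f q (varField φ q) := by
  obtain ⟨-, h1, h2, h3, -⟩ := hp.second_variation hf hv hΦ
  obtain ⟨-, k1, k2, k3, -⟩ := hq.second_variation hf.neg hv.neg hΦ.neg
  have h4 := hΦ.length_eventuallyEq hv.pos
  have hd : ∀ {g : ℝ → ℝ}, ContDiffAt ℝ ∞ g 0 → ∀ᶠ ε in 𝓝 0, DifferentiableAt ℝ g ε :=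
    fun {g} hg => by
      filter_upwards [(hg.of_le (m := 1) (by simp)).eventually (by simp)] with ε hε
      exact hε.differentiableAt (by simp)
  have h5 : deriv (length Φ) =ᶠ[𝓝 0]
      deriv (lengthPlus Φ) + deriv (lengthPlus fun ε t x => -Φ ε t x) := by
    filter_upwards [h4.eventuallyEq_nhds, hd h1, hd k1] with ε hε hε1 hε2
    rw [hε.deriv_eq, deriv_add hε1 hε2, Pi.add_apply]
  refine ⟨(h1.add k1).congr_of_eventuallyEq h4, ?_, ?_⟩
  · rw [h5.eq_of_nhds, Pi.add_apply, h2, k2, add_zero]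
  · rw [h5.deriv_eq, (h3.add k3).deriv, Q_neg, sub_eq_add_neg]

theorem Q_eq_zero {v : ℝ → E n} (hv : EqOn v 0 𝕀) : Q Ω f p v = 0 := by
  rw [Q, neg_eq_zero]
  refine (intervalIntegral.integral_congr (g := fun _ => 0) fun t ht => ?_).trans (by simp)
  rw [uIcc_unit] at ht
  have h1 : derivWithin v 𝕀 t = 0 := by
    rw [derivWithin_congr hv (hv ht)]
    exact congrFun (derivWithin_const 𝕀 (0 : E n)) t
  have h2 : ∀ w : E n, pairing Ω p 0 w = 0 := fun w => by
    simpa using pairing_smul_left (Ω := Ω) p 0 0 w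
  simp only [h1, map_zero, h2, add_zero]

theorem IsStable.not_hasPeriodicOrbit (hst : IsStable Ω f) (hf : IsHamiltonianFlow Ω f F)
    (hp : IsFixedMax f F p) (hq : IsFixedMax f (fun t x => -F t x) q) {T : ℝ}
    (hT : T ∈ Ioo (0 : ℝ) 1) : ¬ HasPeriodicOrbit f p T := by
  intro hper
  have h0 : (0 : ℝ) ∈ 𝕀 := by simp
  have hpq : p ≠ q := by
    rintro rfl
    have h1 : ∀ x, x = p := fun x => by
      by_contra hx
      exact lt_asymm (hp.max 0 h0 x hx) (neg_lt_neg_iff.1 (hq.max 0 h0 x hx))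
    obtain ⟨ξ, hξ, -⟩ := hper
    refine hξ (hp.nondegenerate 0 h0 ξ fun w => ?_)
    rw [show F 0 ∘ (𝓔 p).symm = fun _ => F 0 p from
      funext fun y => congrArg (F 0) (h1 _), fderiv_fun_const]
    simp
  obtain ⟨v, hv, hQ⟩ := hp.exists_Q_neg hf hT hper
  obtain ⟨ε₀, φ, Φ, hφ, hΦ, hvar⟩ := hf.exists_isVariation_varField hpq hp.fixed hq.fixed hv
  obtain ⟨h1, h2, h3⟩ := hp.second_variation_length hq hf hφ hΦ
  have h4 : Q Ω f p (varField φ p) = Q Ω f p v := by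
    refine congrArg Neg.neg (integral_congr_unit fun t ht => ?_)
    simp only [derivWithin_congr (fun t ht => (hvar t ht).1) (hvar t ht).1, (hvar t ht).1]
  rw [h4, Q_eq_zero fun t ht => (hvar t ht).2, sub_zero] at h3
  have h5 := isLocalMax_of_deriv_deriv_neg (h3.trans_lt hQ) h2 h1.continuousAt
  have h6 : length Φ =ᶠ[𝓝 0] fun _ => length Φ 0 := by
    filter_upwards [h5, hst ε₀ φ Φ hφ hΦ] with ε hε hε' using le_antisymm hε hε'
  have h7 : deriv (length Φ) =ᶠ[𝓝 0] fun _ => 0 := by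
    filter_upwards [h6.eventuallyEq_nhds] with ε hε
    rw [hε.deriv_eq, deriv_const]
  rw [h7.deriv_eq, deriv_const] at h3
  exact hQ.ne h3.symm

theorem IsFixedMax.isStable (hp : IsFixedMax f F p) (hq : IsFixedMax f (fun t x => -F t x) q)
    (hf : IsHamiltonianFlow Ω f F) (hper : ∀ T ∈ Ioc (0 : ℝ) 1, ¬ HasPeriodicOrbit f p T)
    (hper' : ∀ T ∈ Ioc (0 : ℝ) 1, ¬ HasPeriodicOrbit f q T) : IsStable Ω f := by
  intro ε₀ φ Φ hv hΦ
  obtain ⟨-, -, -, -, h1⟩ := hp.second_variation hf hv hΦ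
  obtain ⟨-, -, -, -, h2⟩ := hq.second_variation hf.neg hv.neg hΦ.neg
  have h3 := hΦ.length_eventuallyEq hv.pos
  filter_upwards [h1 (hp.coercive hf hper), h2 (hq.coercive hf.neg hper'), h3] with ε hε hε' hε3
  rw [h3.eq_of_nhds, hε3]
  exact add_le_add hε hε'

end Stability

end

end Hofer

theorem mainTheorem9 {n : ℕ} {M : Type*} [TopologicalSpace M] [ChartedSpace (Hofer.E n) M]
    [IsManifold (𝓡 (2 * n)) ∞ M] [T2Space M] [SecondCountableTopology M] [ConnectedSpace M]
    [MeasurableSpace M] [BorelSpace M]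
    (Ω : Hofer.SymplecticForm n M) (f : ℝ → Hofer.Diffeo n M) (F : ℝ → M → ℝ)
    (hflow : Hofer.IsHamiltonianFlow Ω f F) (hgeo : Hofer.IsGeodesic Ω f F)
    (hnd : Hofer.HasNondegenerateExtrema n F) :
    ∃ xp xm : M,
      -- the extrema do not depend on time and are fixed by the flow
      (∀ t ∈ Icc (0 : ℝ) 1, Hofer.IsUniqueMax (F t) xp ∧ Hofer.IsUniqueMin (F t) xm ∧
        f t xp = xp ∧ f t xm = xm) ∧
      -- sufficient condition for stability
      ((∀ T ∈ Ioc (0 : ℝ) 1, ¬ Hofer.HasPeriodicOrbit f xp T ∧ ¬ Hofer.HasPeriodicOrbit f xm T) →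
        Hofer.IsStable Ω f) ∧
      -- necessary condition for stability
      (Hofer.IsStable Ω f →
        ∀ T ∈ Ioo (0 : ℝ) 1,
          ¬ Hofer.HasPeriodicOrbit f xp T ∧ ¬ Hofer.HasPeriodicOrbit f xm T) ∧
      -- the operators of the linearized equation are well defined and invertible
      (∀ x : M, x = xp ∨ x = xm → ∀ t ∈ Icc (0 : ℝ) 1,
        HasDerivWithinAt (Hofer.linFlow f x) (Hofer.linOp f x t ∘L Hofer.linFlow f x t)
          (Icc (0 : ℝ) 1) t ∧
        (Hofer.linOp f x t).IsInvertible) ∧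
      -- second variation formula
      (∀ (ε₀ : ℝ) (φ : ℝ → ℝ → Hofer.Diffeo n M) (Φ : ℝ → ℝ → M → ℝ),
        Hofer.IsVariation Ω f ε₀ φ → Hofer.IsHamiltonianOfVariation Ω ε₀ φ Φ →
        Hofer.IsLoopField (Hofer.varField φ xp) ∧
        Hofer.IsLoopField (Hofer.varField φ xm) ∧
        ContDiffAt ℝ 2 (Hofer.lengthPlus Φ) 0 ∧
        ContDiffAt ℝ 2 (Hofer.lengthMinus Φ) 0 ∧
        ContDiffAt ℝ 2 (Hofer.length Φ) 0 ∧
        iteratedDeriv 2 (Hofer.lengthPlus Φ) 0 = Hofer.Q Ω f xp (Hofer.varField φ xp) ∧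
        iteratedDeriv 2 (Hofer.lengthMinus Φ) 0 = Hofer.Q Ω f xm (Hofer.varField φ xm) ∧
        iteratedDeriv 2 (Hofer.length Φ) 0 =
          Hofer.Q Ω f xp (Hofer.varField φ xp) - Hofer.Q Ω f xm (Hofer.varField φ xm)) := by
  obtain ⟨xp, xm, hp, hm⟩ := hgeo.exists_isFixedMax hflow hnd
  have hiter : ∀ g : ℝ → ℝ, iteratedDeriv 2 g 0 = deriv (deriv g) 0 := fun g => by
    rw [iteratedDeriv_succ, iteratedDeriv_one]
  refine ⟨xp, xm, fun t ht => ⟨hp.max t ht, fun y hy => neg_lt_neg_iff.1 (hm.max t ht y hy),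
    hp.fixed t ht, hm.fixed t ht⟩, fun hper => hp.isStable hm hflow (fun T hT => (hper T hT).1)
    fun T hT => (hper T hT).2, fun hst T hT => ⟨hst.not_hasPeriodicOrbit hflow hp hm hT,
    hst.neg.not_hasPeriodicOrbit hflow.neg hm (by simpa only [neg_neg] using hp) hT⟩, ?_,
    fun ε₀ φ Φ hv hΦ => ?_⟩
  · rintro x (rfl | rfl) t ht
    · exact hp.linOp_spec hflow ht
    · exact hm.linOp_spec hflow.neg ht
  · have hle : (2 : WithTop ℕ∞) ≤ ∞ := ENat.LEInfty.out
    obtain ⟨h1, h2, -, h3, -⟩ := hp.second_variation hflow hv hΦ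
    obtain ⟨k1, k2, -, k3, -⟩ := hm.second_variation hflow.neg hv.neg hΦ.neg
    obtain ⟨l1, -, l2⟩ := hp.second_variation_length hm hflow hv hΦ
    have hB : Hofer.lengthMinus Φ = -Hofer.lengthPlus fun ε t x => -Φ ε t x := funext fun ε => by
      rw [Pi.neg_apply, Hofer.lengthPlus_neg, neg_neg]
    have hd : deriv (Hofer.lengthMinus Φ) = -deriv (Hofer.lengthPlus fun ε t x => -Φ ε t x) := by
      rw [hB]; exact funext fun ε => deriv.neg
    refine ⟨h1, k1, h2.of_le hle, hB ▸ (k2.of_le hle).neg, l1.of_le hle, ?_, ?_, ?_⟩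
    · rw [hiter, h3.deriv]
    · rw [hiter, hd, k3.neg.deriv, Hofer.Q_neg, neg_neg]
    · rw [hiter, l2]
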